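/- Let the complete tripartite graph $K_{3,3,1}$ be linearly embedded in $\mathbb{R}^3$, that is, embedded so that every edge is a straight line segment. A link in the embedded graph is the union of the images of two vertex-disjoint cycles of $K_{3,3,1}$; links are considered unoriented and up to ambient isotopy of $\mathbb{R}^3$, and a link is nontrivial if it is not ambient isotopic to the two-component unlink (two round circles bounding disjoint flat disks in a plane). Let $N$ be the number of unordered pairs of vertex-disjoint cycles of $K_{3,3,1}$ whose image is a nontrivial link. (1) If $N$ is odd, then every nontrivial link in the embedded graph is a Hopf link. (2) If $N$ is even, then exactly one nontrivial link in the embedded graph is a $(2,4)$-torus link, and all the other nontrivial links are Hopf links. (Here a $(2,4)$-torus link may have either handedness, i.e. it is ambient isotopic to the standard $(2,4)$-torus link or to its mirror image.) -/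

import Mathlib

/-- Euclidean three-space. -/
abbrev E3 : Type := EuclideanSpace ℝ (Fin 3)

/-! ## Links in three-space and ambient isotopy -/

/-- Two subsets of three-space are ambient isotopic: there is a continuous family of
homeomorphisms of three-space, indexed by the unit interval and starting at the identity,
whose final member carries one set onto the other. Links are regarded as unoriented subsets. -/
def AmbientIsotopic (K L : Set E3) : Prop :=
  ∃ Φ : unitInterval → (E3 ≃ₜ E3),
    Continuous (fun q : unitInterval × E3 => Φ q.1 q.2) ∧
    Φ 0 = Homeomorph.refl E3 ∧
    Φ 1 '' K = L

/-- The standard two-component unlink: two round circles in the plane `z = 0`, of radius `1`,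
centred at `(0,0,0)` and `(3,0,0)`. -/
def standardUnlink : Set E3 :=
  {x | x 2 = 0 ∧ x 0 ^ 2 + x 1 ^ 2 = 1} ∪ {x | x 2 = 0 ∧ (x 0 - 3) ^ 2 + x 1 ^ 2 = 1}

/-- The standard Hopf link: the unit circle of the plane `z = 0` centred at the origin, and the
unit circle of the plane `y = 0` centred at `(1,0,0)`. -/
def standardHopfLink : Set E3 :=
  {x | x 2 = 0 ∧ x 0 ^ 2 + x 1 ^ 2 = 1} ∪ {x | x 1 = 0 ∧ (x 0 - 1) ^ 2 + x 2 ^ 2 = 1}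

/-- The point with longitude `θ` and meridional angle `φ` on the standard torus of revolution
with radii `2` and `1`. -/
noncomputable def torusPoint (θ φ : ℝ) : E3 :=
  !₂[(2 + Real.cos φ) * Real.cos θ, (2 + Real.cos φ) * Real.sin θ, Real.sin φ]

/-- The standard `(p,q)`-torus link: the curve `p φ = q θ` (modulo `2π`) on the standard torus.
It winds `p` times in the longitudinal and `q` times in the meridional direction in total, and
has `gcd(p,q)` components. -/
noncomputable def standardTorusLink (p q : ℤ) : Set E3 :=
  {x | ∃ θ φ : ℝ, (∃ k : ℤ, (p : ℝ) * φ - (q : ℝ) * θ = 2 * Real.pi * (k : ℝ)) ∧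
    x = torusPoint θ φ}

/-- A trivial two-component link. -/
def IsTrivialLink (L : Set E3) : Prop := AmbientIsotopic L standardUnlink

/-- A Hopf link. -/
def IsHopfLink (L : Set E3) : Prop := AmbientIsotopic L standardHopfLink

/-- A `(p,q)`-torus link, of either handedness: the mirror image of the standard
`(p,q)`-torus link is the standard `(p,-q)`-torus link. -/
def IsTorusLink (p q : ℤ) (L : Set E3) : Prop :=
  AmbientIsotopic L (standardTorusLink p q) ∨ AmbientIsotopic L (standardTorusLink p (-q))

/-! ## Linearly embedded graphs and their two-component links -/

/-- The vertex positions `f` define a linear (straight-edge) embedding of the graph `G`: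
distinct vertices are at distinct points, no vertex lies in the interior of an edge, and the
interiors of distinct edges are disjoint. -/
structure IsLinearEmbedding {V : Type*} (G : SimpleGraph V) (f : V → E3) : Prop where
  injective : Function.Injective f
  vertex_edge : ∀ v a b : V, G.Adj a b → f v ∉ openSegment ℝ (f a) (f b)
  edge_edge : ∀ a b c d : V, G.Adj a b → G.Adj c d → s(a, b) ≠ s(c, d) →
    Disjoint (openSegment ℝ (f a) (f b)) (openSegment ℝ (f c) (f d))

/-- The subset of three-space formed by the straight edges of a subgraph. -/
def edgeImage {V : Type*} {G : SimpleGraph V} (f : V → E3) (H : G.Subgraph) : Set E3 :=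
  {x | ∃ a b : V, H.Adj a b ∧ x ∈ segment ℝ (f a) (f b)}

/-- A subgraph that is a cycle. -/
def IsCycleSubgraph {V : Type*} {G : SimpleGraph V} (C : G.Subgraph) : Prop :=
  ∃ (v : V) (w : G.Walk v v), w.IsCycle ∧ w.toSubgraph = C

/-- A subgraph that is the union of two vertex-disjoint cycles. Such subgraphs correspond
bijectively to the unordered pairs of disjoint cycles, that is, to the two-component links
contained in an embedding of the graph. -/
def IsDisjointCyclePair {V : Type*} {G : SimpleGraph V} (H : G.Subgraph) : Prop :=
  ∃ C D : G.Subgraph, IsCycleSubgraph C ∧ IsCycleSubgraph D ∧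
    Disjoint C.verts D.verts ∧ H = C ⊔ D

/-- The nontrivial two-component links of the straight-edge graph with vertex positions `f`. -/
def nontrivialLinks {V : Type*} (G : SimpleGraph V) (f : V → E3) : Set G.Subgraph :=
  {H | IsDisjointCyclePair H ∧ ¬ IsTrivialLink (edgeImage f H)}

/-- The vertices of the complete tripartite graph `K_{3,3,1}`: a part and an index in it. -/
abbrev K331Vertex : Type := Σ i : Fin 3, Fin (![3, 3, 1] i)

/-- The complete tripartite graph `K_{3,3,1}`. -/
abbrev K331 : SimpleGraph K331Vertex :=
  SimpleGraph.completeMultipartiteGraph (fun i : Fin 3 => Fin (![3, 3, 1] i))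

/-!
# Links in linear embeddings of `K_{3,3,1}`

Two disjoint cycles of `K_{3,3,1}` are a triangle through the apex and the complementary
quadrilateral, so there are exactly nine pairs, indexed by an edge of `K_{3,3}`
(`IsDisjointCyclePair.exists_eq`, `isDisjointCyclePair_pairSubgraph`). A sufficiently small
displacement of the vertices is realized by an ambient isotopy of the whole graph
(`IsLinearEmbedding.exists_isIsotopyEnd`), and displacing the vertices along the moment curve makes
any four of them affinely independent (`exists_vol_ne_zero`). Hence the seven vertices may be
assumed to be in general position.

**The type of one link.** In general position, the type of the link formed by a triangle and a
quadrilateral can be read off from the edges of the quadrilateral that cross the flat disk bounded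
by the triangle (`GenericPair.classification`): an odd number of crossing edges gives a Hopf link,
an even number gives a trivial link, except when exactly two opposite edges cross the disk and the
vertices of the quadrilateral alternate between the two sides of its plane, in which case the link
is a `(2,4)`-torus link. The ambient isotopies come from an extension principle: a
straight-line homotopy between two embeddings extends to an ambient isotopy if its members satisfy a
bi-Lipschitz condition (`exists_isIsotopyEnd_of_lineMap`), which applies to
linear motions of the vertices (`ambientIsotopic_comb`) and to linear interpolations of two curves
around an axis, given in cylindrical coordinates (`exists_isIsotopyEnd_cyl`). The link
types are invariant under affine bijections, and a triangle and a quadrilateral with a common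
interior point are brought by such a bijection to curves around an axis (`exists_affineEquiv_cyl`);
these are compared with the standard links by interpolation.

**The nine links together.** The crossings depend only on the orientations of the tetrahedra spanned
by the seven points, which are subject to the three-term Grassmann–Plücker relations
(`IsChirotope`). Two consequences of these relations suffice. The total number of crossings in the
nine links is odd (`IsChirotope.odd_sum_crossings`), by a local count for five and for six points.
The torus pattern occurs in at most one of the nine links (`not_patternAt`), which reduces by the
symmetries of the graph to six finite verifications. So the number of Hopf links is odd, and there
is at most one `(2,4)`-torus link (`link_classification`, `IsLinearEmbedding.link_types`).

**The three types are different.** For a link with components `A` and `B`, it is an invariant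
property that every continuous function without zeros off `B` has a continuous `n`-th root on `A`
(`RootsOff`, `HasRoots`). The unlink has this property for all `n`, the Hopf link does not have it
for `n = 2`, and the `(2,4)`-torus link has it for `n = 2` but not for `n = 4`.

The number of nontrivial links is therefore an odd number, the number of Hopf links, plus the
number of torus links, which is `0` or `1`; its parity decides between the two cases.
-/

open Set Filter Topology

/-! ### Ambient isotopies and small displacements -/

/-- A homeomorphism of three-space that is the final member of an ambient isotopy. -/
def IsIsotopyEnd (h : E3 ≃ₜ E3) : Prop :=
  ∃ Φ : unitInterval → (E3 ≃ₜ E3),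
    Continuous (fun q : unitInterval × E3 => Φ q.1 q.2) ∧ Φ 0 = Homeomorph.refl E3 ∧ Φ 1 = h

theorem ambientIsotopic_iff {K L : Set E3} :
    AmbientIsotopic K L ↔ ∃ h, IsIsotopyEnd h ∧ h '' K = L := by
  constructor
  · rintro ⟨Φ, h1, h2, h3⟩
    exact ⟨Φ 1, ⟨Φ, h1, h2, rfl⟩, h3⟩
  · rintro ⟨h, ⟨Φ, h1, h2, rfl⟩, h3⟩
    exact ⟨Φ, h1, h2, h3⟩

theorem isIsotopyEnd_refl : IsIsotopyEnd (Homeomorph.refl E3) :=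
  ⟨fun _ => Homeomorph.refl E3, continuous_snd, rfl, rfl⟩

theorem IsIsotopyEnd.trans {h k : E3 ≃ₜ E3} (hh : IsIsotopyEnd h) (hk : IsIsotopyEnd k) :
    IsIsotopyEnd (h.trans k) := by
  obtain ⟨Φ, c, z, rfl⟩ := hh
  obtain ⟨Ψ, c', z', rfl⟩ := hk
  refine ⟨fun t => (Φ t).trans (Ψ t), ?_, ?_, rfl⟩
  · exact c'.comp (continuous_fst.prodMk c)
  · simp only [z, z']
    rfl

theorem IsIsotopyEnd.symm {h : E3 ≃ₜ E3} (hh : IsIsotopyEnd h) : IsIsotopyEnd h.symm := by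
  obtain ⟨Φ, c, z, rfl⟩ := hh
  refine ⟨fun t => (Φ 1).symm.trans (Φ (unitInterval.symm t)), ?_, ?_, ?_⟩
  · exact c.comp ((unitInterval.continuous_symm.comp continuous_fst).prodMk
      ((Φ 1).symm.continuous.comp continuous_snd))
  · ext1 x; simp
  · ext1 x; simp [z]

/-- The class of isotopic-to-the-identity homeomorphisms is normal. -/
theorem IsIsotopyEnd.conj {h : E3 ≃ₜ E3} (hh : IsIsotopyEnd h) (r : E3 ≃ₜ E3) :
    IsIsotopyEnd ((r.symm.trans h).trans r) := by
  obtain ⟨Φ, c, z, rfl⟩ := hh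
  refine ⟨fun t => (r.symm.trans (Φ t)).trans r, ?_, ?_, rfl⟩
  · exact r.continuous.comp (c.comp (continuous_fst.prodMk (r.symm.continuous.comp continuous_snd)))
  · ext1 x; simp [z]

theorem AmbientIsotopic.refl (K : Set E3) : AmbientIsotopic K K :=
  ambientIsotopic_iff.2 ⟨_, isIsotopyEnd_refl, by simp⟩

theorem AmbientIsotopic.symm {K L : Set E3} (h : AmbientIsotopic K L) : AmbientIsotopic L K := by
  obtain ⟨h, hh, rfl⟩ := ambientIsotopic_iff.1 h
  exact ambientIsotopic_iff.2 ⟨_, hh.symm, by simp [← image_comp]⟩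

theorem AmbientIsotopic.trans {K L M : Set E3} (h : AmbientIsotopic K L)
    (h' : AmbientIsotopic L M) : AmbientIsotopic K M := by
  obtain ⟨h, hh, rfl⟩ := ambientIsotopic_iff.1 h
  obtain ⟨k, hk, rfl⟩ := ambientIsotopic_iff.1 h'
  exact ambientIsotopic_iff.2 ⟨_, hh.trans hk, by rw [← image_comp]; rfl⟩

/-- A contraction added to the identity is a homeomorphism isotopic to the identity. -/
theorem exists_isIsotopyEnd_add {v : E3 → E3} {K : NNReal} (hv : LipschitzWith K v) (hK : K < 1) :
    ∃ h : E3 ≃ₜ E3, IsIsotopyEnd h ∧ ∀ x, h x = x + v x := by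
  have key : ∀ t : unitInterval, ApproximatesLinearOn (fun x => x + (t : ℝ) • v x)
      ((ContinuousLinearEquiv.refl ℝ E3 : E3 ≃L[ℝ] E3) : E3 →L[ℝ] E3) univ K := by
    intro t
    rw [ApproximatesLinearOn.approximatesLinearOn_iff_lipschitzOnWith, lipschitzOnWith_univ]
    refine LipschitzWith.of_dist_le_mul fun x y => ?_
    have h1 := hv.dist_le_mul x y
    have h2 : dist ((t : ℝ) • v x) ((t : ℝ) • v y) = t * dist (v x) (v y) := by
      rw [dist_smul₀, Real.norm_of_nonneg t.2.1]
    have h3 : (t : ℝ) * dist (v x) (v y) ≤ 1 * dist (v x) (v y) :=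
      mul_le_mul_of_nonneg_right t.2.2 dist_nonneg
    simp only [Pi.sub_apply, ContinuousLinearEquiv.coe_coe, ContinuousLinearEquiv.coe_refl',
      id, add_sub_cancel_left]
    linarith
  have hc : Subsingleton E3 ∨ K <
      ‖((ContinuousLinearEquiv.refl ℝ E3 : E3 ≃L[ℝ] E3).symm : E3 →L[ℝ] E3)‖₊⁻¹ := by
    right
    have : ‖((ContinuousLinearEquiv.refl ℝ E3 : E3 ≃L[ℝ] E3).symm : E3 →L[ℝ] E3)‖₊ = 1 := by
      ext
      exact ContinuousLinearMap.norm_id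
    rw [this]; simpa using hK
  refine ⟨(key 1).toHomeomorph _ hc, ⟨fun t => (key t).toHomeomorph _ hc, ?_, ?_, rfl⟩, ?_⟩
  · change Continuous (fun q : unitInterval × E3 => q.2 + (q.1 : ℝ) • v q.2)
    have := hv.continuous
    fun_prop
  · ext1 x
    change x + ((0 : unitInterval) : ℝ) • v x = x
    simp
  · intro x
    change x + ((1 : unitInterval) : ℝ) • v x = x + v x
    simp

/-- The straight-line homotopy between two maps `γ₀, γ₁` into three-space extends to an ambient
isotopy as soon as each of its members is bounded below by a multiple of a gauge `d` that also
bounds the displacement `γ₁ - γ₀`. Typically `d` is a metric, and the condition says that the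
members are bi-Lipschitz embeddings. -/
theorem exists_isIsotopyEnd_of_lineMap {X : Type*} (d : X → X → ℝ) (γ₀ γ₁ : X → E3)
    {C : ℝ} (hC0 : 0 ≤ C) (hC : ∀ x y, ‖(γ₁ x - γ₀ x) - (γ₁ y - γ₀ y)‖ ≤ C * d x y)
    (hc : ∀ t ∈ Icc (0 : ℝ) 1, ∃ c > 0, ∀ x y,
      c * d x y ≤ ‖(γ₀ x + t • (γ₁ x - γ₀ x)) - (γ₀ y + t • (γ₁ y - γ₀ y))‖) :
    ∃ h : E3 ≃ₜ E3, IsIsotopyEnd h ∧ ∀ x, h (γ₀ x) = γ₁ x := by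
  rcases isEmpty_or_nonempty X with hX | hX
  · exact ⟨_, isIsotopyEnd_refl, fun x => isEmptyElim x⟩
  set γ : ℝ → X → E3 := fun t x => γ₀ x + t • (γ₁ x - γ₀ x) with hγ
  let P : ℝ → ℝ → Prop := fun s t => ∃ h : E3 ≃ₜ E3, IsIsotopyEnd h ∧ ∀ x, h (γ s x) = γ t x
  have hP : P 0 1 := by
    refine isPreconnected_Icc.induction₂ (s := Icc (0 : ℝ) 1) P ?_ ?_ ?_
      (left_mem_Icc.2 zero_le_one) (right_mem_Icc.2 zero_le_one)
    · intro t ht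
      obtain ⟨c, hc0, hct⟩ := hc t ht
      change ∀ x y, c * d x y ≤ ‖γ t x - γ t y‖ at hct
      -- the factor lost in extending a Lipschitz map from a subset to all of three-space
      set κ : NNReal := lipschitzExtensionConstant E3 with hκ
      have hev : ∀ᶠ s in 𝓝 t, κ * (|s - t| * (C / c)) < 1 := by
        have : Continuous fun s : ℝ => κ * (|s - t| * (C / c)) := by fun_prop
        refine this.continuousAt.eventually_lt continuousAt_const ?_
        simp
      have hbound : ∀ x y, ‖(γ₁ x - γ₀ x) - (γ₁ y - γ₀ y)‖ ≤ C / c * ‖γ t x - γ t y‖ := by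
        intro x y
        refine (hC x y).trans ?_
        rw [div_mul_eq_mul_div, le_div_iff₀ hc0, mul_assoc]
        exact mul_le_mul_of_nonneg_left (by linarith [hct x y]) hC0
      filter_upwards [mem_nhdsWithin_of_mem_nhds hev] with s hs
      -- the displacement, as a function of the point `γ t x` instead of `x`
      choose! w hw using (fun (p : E3) (hp : p ∈ range (γ t)) => hp)
      have hwx : ∀ x, γ₁ (w (γ t x)) - γ₀ (w (γ t x)) = γ₁ x - γ₀ x := by
        intro x
        have h1 := hbound (w (γ t x)) x
        rw [hw _ (mem_range_self x), sub_self, norm_zero, mul_zero] at h1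
        exact sub_eq_zero.1 (norm_eq_zero.1 (le_antisymm h1 (norm_nonneg _)))
      have hK0 : 0 ≤ |s - t| * (C / c) := by positivity
      have hlip : LipschitzOnWith (|s - t| * (C / c)).toNNReal (fun p => (s - t) • (γ₁ (w p) - γ₀ (w p)))
          (range (γ t)) := by
        refine LipschitzOnWith.of_dist_le_mul ?_
        rintro _ ⟨x, rfl⟩ _ ⟨y, rfl⟩
        simp only [hwx]
        rw [dist_smul₀, Real.norm_eq_abs, dist_eq_norm, dist_eq_norm, Real.coe_toNNReal _ hK0, mul_assoc]
        exact mul_le_mul_of_nonneg_left (hbound x y) (abs_nonneg _)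
      obtain ⟨v, hv, hvx⟩ := hlip.extend_finite_dimension
      obtain ⟨h, hh, hx⟩ := exists_isIsotopyEnd_add hv (by
        rw [← NNReal.coe_lt_coe, NNReal.coe_mul, Real.coe_toNNReal _ hK0]; exact hs)
      refine ⟨h, hh, fun x => ?_⟩
      have h1 := hvx (mem_range_self x)
      simp only [hwx] at h1
      rw [hx, ← h1]
      simp only [hγ]
      module
    · rintro a b c - - - ⟨h, hh, h1⟩ ⟨k, hk, k1⟩
      exact ⟨h.trans k, hh.trans hk, fun x => by simp [h1, k1]⟩
    · rintro a b - - ⟨h, hh, h1⟩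
      exact ⟨h.symm, hh.symm, fun x => by simp [← h1]⟩
  obtain ⟨h, hh, h1⟩ := hP
  exact ⟨h, hh, fun x => by simpa [hγ] using h1 x⟩

/-- The version of `exists_isIsotopyEnd_of_lineMap` for two disjoint pieces. -/
theorem exists_isIsotopyEnd_of_lineMap_pair {X Y : Type*} (d : X → X → ℝ) (e : Y → Y → ℝ)
    (α₀ α₁ : X → E3) (β₀ β₁ : Y → E3) {C : ℝ}
    (hα : ∀ x y, ‖(α₁ x - α₀ x) - (α₁ y - α₀ y)‖ ≤ C * d x y)
    (hβ : ∀ x y, ‖(β₁ x - β₀ x) - (β₁ y - β₀ y)‖ ≤ C * e x y)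
    (hαβ : ∀ x y, ‖(α₁ x - α₀ x) - (β₁ y - β₀ y)‖ ≤ C)
    (hα' : ∀ t ∈ Icc (0 : ℝ) 1, ∃ c > 0, ∀ x y,
      c * d x y ≤ ‖(α₀ x + t • (α₁ x - α₀ x)) - (α₀ y + t • (α₁ y - α₀ y))‖)
    (hβ' : ∀ t ∈ Icc (0 : ℝ) 1, ∃ c > 0, ∀ x y,
      c * e x y ≤ ‖(β₀ x + t • (β₁ x - β₀ x)) - (β₀ y + t • (β₁ y - β₀ y))‖)
    (hαβ' : ∀ t ∈ Icc (0 : ℝ) 1, ∃ c > 0, ∀ x y,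
      c ≤ ‖(α₀ x + t • (α₁ x - α₀ x)) - (β₀ y + t • (β₁ y - β₀ y))‖)
    (hd : ∀ x y, 0 ≤ d x y) (he : ∀ x y, 0 ≤ e x y) (hC0 : 0 ≤ C) :
    ∃ h : E3 ≃ₜ E3, IsIsotopyEnd h ∧ (∀ x, h (α₀ x) = α₁ x) ∧ ∀ y, h (β₀ y) = β₁ y := by
  let D : X ⊕ Y → X ⊕ Y → ℝ := fun p q =>
    Sum.elim (fun x => Sum.elim (fun x' => d x x') (fun _ => 1) q)
      (fun y => Sum.elim (fun _ => 1) (fun y' => e y y') q) p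
  obtain ⟨h, hh, hx⟩ := exists_isIsotopyEnd_of_lineMap D (Sum.elim α₀ β₀) (Sum.elim α₁ β₁) hC0
    (by
      rintro (x | x) (y | y)
      · simpa [D] using hα x y
      · simpa [D] using hαβ x y
      · simpa [D] using (norm_sub_rev _ _).trans_le (hαβ y x)
      · simpa [D] using hβ x y)
    (by
      intro t ht
      obtain ⟨a, ha, ha'⟩ := hα' t ht
      obtain ⟨b, hb, hb'⟩ := hβ' t ht
      obtain ⟨c, hc, hc'⟩ := hαβ' t ht
      refine ⟨min (min a b) c, by positivity, ?_⟩
      have h1 : min (min a b) c ≤ a := (min_le_left _ _).trans (min_le_left _ _)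
      have h2 : min (min a b) c ≤ b := (min_le_left _ _).trans (min_le_right _ _)
      have h3 : min (min a b) c ≤ c := min_le_right _ _
      rintro (x | x) (y | y)
      · exact (mul_le_mul_of_nonneg_right h1 (hd _ _)).trans (ha' x y)
      · simpa [D] using h3.trans (hc' x y)
      · simpa only [D, Sum.elim_inl, Sum.elim_inr, mul_one] using
          (h3.trans (hc' y x)).trans (norm_sub_rev _ _).le
      · exact (mul_le_mul_of_nonneg_right h2 (he _ _)).trans (hb' x y))
  exact ⟨h, hh, fun x => hx (Sum.inl x), fun y => hx (Sum.inr y)⟩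

/-! ### Invariance under affine bijections -/

/-- The reflection of three-space in the plane `z = 0`. -/
noncomputable def reflectZ (p : E3) : E3 := !₂[p 0, p 1, -p 2]

/-- The linear self-map of three-space given by a matrix. -/
noncomputable def matLin (M : Matrix (Fin 3) (Fin 3) ℝ) : E3 →ₗ[ℝ] E3 where
  toFun p := WithLp.toLp 2 (M.mulVec p.ofLp)
  map_add' p q := by ext i; simp [Matrix.mulVec_add]
  map_smul' c p := by ext i; simp [Matrix.mulVec_smul]

theorem matLin_mul (M N : Matrix (Fin 3) (Fin 3) ℝ) (p : E3) :
    matLin (M * N) p = matLin M (matLin N p) := by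
  ext i; simp [matLin, Matrix.mulVec_mulVec]

theorem matLin_one (p : E3) : matLin 1 p = p := by
  ext i; simp [matLin]

theorem exists_norm_le_mul (L : E3 →ₗ[ℝ] E3) : ∃ C > 0, ∀ p, ‖L p‖ ≤ C * ‖p‖ := by
  refine ⟨‖LinearMap.toContinuousLinearMap L‖ + 1, by positivity, fun p => ?_⟩
  have := (LinearMap.toContinuousLinearMap L).le_opNorm p
  have h : ‖L p‖ = ‖LinearMap.toContinuousLinearMap L p‖ := rfl
  rw [h]
  nlinarith [norm_nonneg p]

/-- The segment from the identity to `M` is an isotopy if it consists of invertible matrices. -/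
theorem exists_isIsotopyEnd_matLin {M : Matrix (Fin 3) (Fin 3) ℝ}
    (hM : ∀ t ∈ Icc (0 : ℝ) 1, (1 + t • (M - 1)).det ≠ 0) :
    ∃ h : E3 ≃ₜ E3, IsIsotopyEnd h ∧ ∀ p, h p = matLin M p := by
  obtain ⟨C, hC, hC'⟩ := exists_norm_le_mul (matLin M - LinearMap.id)
  refine exists_isIsotopyEnd_of_lineMap (fun p q => ‖p - q‖) id (matLin M) hC.le ?_ ?_
  · intro x y
    have := hC' (x - y)
    simp only [LinearMap.sub_apply, map_sub, LinearMap.id_apply] at this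
    refine le_trans (le_of_eq ?_) this
    congr 1
  · intro t ht
    set N := 1 + t • (M - 1) with hN
    obtain ⟨c, hc, hc'⟩ := exists_norm_le_mul (matLin N⁻¹)
    refine ⟨c⁻¹, inv_pos.2 hc, fun x y => ?_⟩
    have h1 : ∀ p, p + t • (matLin M p - p) = matLin N p := by
      intro p
      ext i
      simp [matLin, hN, Matrix.add_mulVec, Matrix.sub_mulVec, Matrix.smul_mulVec]
    simp only [id, h1, ← map_sub]
    rw [inv_mul_le_iff₀ hc]
    refine le_trans (le_of_eq ?_) (hc' _)
    rw [← matLin_mul, Matrix.nonsing_inv_mul _ (hM t ht).isUnit, matLin_one]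

theorem exists_isIsotopyEnd_translate (v : E3) :
    ∃ h : E3 ≃ₜ E3, IsIsotopyEnd h ∧ ∀ p, h p = p + v :=
  exists_isIsotopyEnd_add (v := fun _ => v) (K := 0) (LipschitzWith.const v) zero_lt_one

/-- A property of subsets of three-space that is invariant under ambient isotopy and under one
reflection is invariant under all affine bijections: an invertible matrix is a product of
transvections, which are isotopic to the identity, and a diagonal matrix. -/
theorem of_affine_image {G : Set E3 → Prop} (hiso : ∀ K L, AmbientIsotopic K L → G K → G L)
    (hrefl : ∀ K, G K → G (reflectZ '' K)) (Ψ : E3 ≃ᵃ[ℝ] E3) {K : Set E3} (hK : G (Ψ '' K)) :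
    G K := by
  have iso' : ∀ (h : E3 ≃ₜ E3) (K : Set E3), IsIsotopyEnd h → G K → G (h '' K) :=
    fun h K hh hK => hiso _ _ (ambientIsotopic_iff.2 ⟨h, hh, rfl⟩) hK
  let P : Matrix (Fin 3) (Fin 3) ℝ → Prop := fun M => ∀ K, G K → G (matLin M '' K)
  have hmul : ∀ A B, P A → P B → P (A * B) := by
    intro A B hA hB K hK
    have := hA _ (hB K hK)
    rw [← image_comp] at this
    rwa [show (matLin (A * B) : E3 → E3) = matLin A ∘ matLin B from
      funext fun p => matLin_mul A B p]
  have hlin : ∀ M : Matrix (Fin 3) (Fin 3) ℝ,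
      (∀ t ∈ Icc (0 : ℝ) 1, (1 + t • (M - 1)).det ≠ 0) → P M := by
    intro M hM K hK
    obtain ⟨h, hh, hx⟩ := exists_isIsotopyEnd_matLin hM
    have := iso' h K hh hK
    rwa [show (h : E3 → E3) = matLin M from funext hx] at this
  have htr : ∀ (i j : Fin 3) (c : ℝ), i ≠ j → P (Matrix.transvection i j c) := by
    intro i j c hij
    refine hlin _ fun t _ => ?_
    have : 1 + t • (Matrix.transvection i j c - 1) = Matrix.transvection i j (t * c) := by
      simp [Matrix.transvection, Matrix.smul_single]
    rw [this, Matrix.det_transvection_of_ne _ _ hij]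
    exact one_ne_zero
  have hpos : ∀ D : Fin 3 → ℝ, (∀ i, 0 < D i) → P (Matrix.diagonal D) := by
    intro D hD
    refine hlin _ fun t ht => ?_
    have : 1 + t • (Matrix.diagonal D - 1) = Matrix.diagonal (fun i => 1 + t * (D i - 1)) := by
      ext i j
      by_cases hij : i = j
      · subst hij; simp
      · simp [hij, Matrix.diagonal_apply_ne]
    rw [this, Matrix.det_diagonal]
    refine (Finset.prod_pos fun i _ => ?_).ne'
    rcases ht.1.eq_or_lt with rfl | h0
    · simp
    · nlinarith [hD i, ht.2, mul_pos h0 (hD i)]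
  have hz : P (Matrix.diagonal ![1, 1, -1]) := by
    intro K hK
    have : (matLin (Matrix.diagonal ![1, 1, -1]) : E3 → E3) = reflectZ := by
      funext p
      ext i
      fin_cases i <;> simp [matLin, reflectZ, Matrix.mulVec_diagonal]
    rw [this]
    exact hrefl K hK
  -- half-turns about the coordinate axes are products of six transvections
  have hxy : P (Matrix.diagonal ![-1, -1, 1]) := by
    have : Matrix.diagonal ![(-1 : ℝ), -1, 1] =
        Matrix.transvection 0 1 1 * (Matrix.transvection 1 0 (-1) * (Matrix.transvection 0 1 1 *
        (Matrix.transvection 0 1 1 * (Matrix.transvection 1 0 (-1) *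
          Matrix.transvection 0 1 1)))) := by
      ext i j
      fin_cases i <;> fin_cases j <;>
        simp [Matrix.transvection, Matrix.mul_apply, Fin.sum_univ_three, Matrix.single,
          Matrix.one_apply]
    rw [this]
    refine hmul _ _ ?_ (hmul _ _ ?_ (hmul _ _ ?_ (hmul _ _ ?_ (hmul _ _ ?_ ?_)))) <;>
      exact htr _ _ _ (by decide)
  have hyz : P (Matrix.diagonal ![1, -1, -1]) := by
    have : Matrix.diagonal ![(1 : ℝ), -1, -1] =
        Matrix.transvection 1 2 1 * (Matrix.transvection 2 1 (-1) * (Matrix.transvection 1 2 1 *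
        (Matrix.transvection 1 2 1 * (Matrix.transvection 2 1 (-1) *
          Matrix.transvection 1 2 1)))) := by
      ext i j
      fin_cases i <;> fin_cases j <;>
        simp [Matrix.transvection, Matrix.mul_apply, Fin.sum_univ_three, Matrix.single,
          Matrix.one_apply]
    rw [this]
    refine hmul _ _ ?_ (hmul _ _ ?_ (hmul _ _ ?_ (hmul _ _ ?_ (hmul _ _ ?_ ?_)))) <;>
      exact htr _ _ _ (by decide)
  have hflip : ∀ i : Fin 3, P (Matrix.diagonal (Function.update 1 i (-1))) := by
    have hy := hmul _ _ hyz hz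
    have hx := hmul _ _ hxy hy
    simp only [Matrix.diagonal_mul_diagonal] at hy hx
    have e : ∀ (D : Fin 3 → ℝ) (i : Fin 3), P (Matrix.diagonal D) →
        (∀ j, D j = Function.update (1 : Fin 3 → ℝ) i (-1) j) →
        P (Matrix.diagonal (Function.update 1 i (-1))) := by
      intro D i hD h
      rwa [← show D = Function.update (1 : Fin 3 → ℝ) i (-1) from funext h]
    intro i
    fin_cases i
    · refine e _ _ hx fun j => ?_
      fin_cases j <;> simp [Function.update]
    · refine e _ _ hy fun j => ?_
      fin_cases j <;> simp [Function.update]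
    · refine e _ _ hz fun j => ?_
      fin_cases j <;> simp [Function.update]
  have hall : ∀ M : Matrix (Fin 3) (Fin 3) ℝ, M.det ≠ 0 → P M := by
    intro M hM
    refine Matrix.diagonal_transvection_induction_of_det_ne_zero P M hM ?_ ?_
      (fun A B _ _ hA hB => hmul A B hA hB)
    · intro D hD
      rw [Matrix.det_diagonal, Finset.prod_ne_zero_iff] at hD
      have h1 : Matrix.diagonal D = Matrix.diagonal (fun i => |D i|) *
          (Matrix.diagonal (Function.update 1 0 (SignType.sign (D 0) : ℝ)) *
          (Matrix.diagonal (Function.update 1 1 (SignType.sign (D 1) : ℝ)) *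
          Matrix.diagonal (Function.update 1 2 (SignType.sign (D 2) : ℝ)))) := by
        simp only [Matrix.diagonal_mul_diagonal]
        congr 1
        ext i
        fin_cases i <;> simp [Function.update, abs_mul_sign]
      have hs : ∀ i, P (Matrix.diagonal (Function.update 1 i (SignType.sign (D i) : ℝ))) := by
        intro i
        rcases lt_or_gt_of_ne (hD i (Finset.mem_univ i)) with h | h
        · simpa [sign_neg h] using hflip i
        · rw [sign_pos h]
          refine hpos _ fun j => ?_
          by_cases hj : j = i
          · subst hj; simp
          · simp [hj]
      rw [h1]
      exact hmul _ _ (hpos _ fun i => abs_pos.2 (hD i (Finset.mem_univ i)))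
        (hmul _ _ (hs 0) (hmul _ _ (hs 1) (hs 2)))
    · rintro ⟨i, j, hij, c⟩
      exact htr i j c hij
  have haff : ∀ (Φ : E3 ≃ᵃ[ℝ] E3) (K : Set E3), G K → G (Φ '' K) := by
    intro Φ K hK
    set b := (EuclideanSpace.basisFun (Fin 3) ℝ).toBasis
    set M := LinearMap.toMatrix b b (Φ.linear : E3 →ₗ[ℝ] E3) with hM
    have hdet : M.det ≠ 0 := by
      rw [hM, LinearMap.det_toMatrix]
      exact (LinearEquiv.isUnit_det' Φ.linear).ne_zero
    have hMx : ∀ p, matLin M p = Φ.linear p := by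
      intro p
      have := LinearMap.toMatrix_mulVec_repr b b (Φ.linear : E3 →ₗ[ℝ] E3) p
      ext i
      have e : (b.repr p : Fin 3 → ℝ) = p.ofLp := by
        funext j
        simp [b]
      rw [e] at this
      simpa [b, matLin, hM] using congrFun this i
    obtain ⟨h, hh, hx⟩ := exists_isIsotopyEnd_translate (Φ 0)
    have := iso' h _ hh (hall M hdet K hK)
    rw [← image_comp] at this
    have e : (Φ : E3 → E3) = h ∘ matLin M := by
      funext p
      have h2 := Φ.map_vadd 0 p
      simp only [vadd_eq_add, add_zero] at h2
      simp [hx, hMx, h2]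
    rwa [e]
  have := haff Ψ.symm _ hK
  rwa [← image_comp, show (Ψ.symm ∘ Ψ : E3 → E3) = id from funext fun p => by simp, image_id]
    at this

/-! ### Curves given in cylindrical coordinates -/

/-- The closed curve with cylindrical coordinates: radius `ρ u` and height `ζ u` over the
direction `u`. -/
noncomputable def cyl (ρ ζ : Circle → ℝ) (u : Circle) : E3 :=
  !₂[ρ u * (u : ℂ).re, ρ u * (u : ℂ).im, ζ u]

/-- A real function on the circle that is Lipschitz with respect to some constant. -/
def IsLip (φ : Circle → ℝ) : Prop := ∃ K ≥ 0, ∀ u v : Circle, |φ u - φ v| ≤ K * ‖(u : ℂ) - v‖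

theorem norm_le_sum_abs (p : E3) : ‖p‖ ≤ |p 0| + |p 1| + |p 2| := by
  rw [EuclideanSpace.norm_eq, Fin.sum_univ_three]
  refine Real.sqrt_le_iff.2 ⟨by positivity, ?_⟩
  simp only [Real.norm_eq_abs]
  nlinarith [abs_nonneg (p 0), abs_nonneg (p 1), abs_nonneg (p 2),
    mul_nonneg (abs_nonneg (p 0)) (abs_nonneg (p 1)),
    mul_nonneg (abs_nonneg (p 0)) (abs_nonneg (p 2)),
    mul_nonneg (abs_nonneg (p 1)) (abs_nonneg (p 2))]

theorem continuous_circle_coe : Continuous (fun u : Circle => (u : ℂ)) := continuous_subtype_val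

theorem IsLip.continuous {φ : Circle → ℝ} (h : IsLip φ) : Continuous φ := by
  obtain ⟨K, hK, h⟩ := h
  refine continuous_iff_continuousAt.2 fun v => ?_
  have h1 : Continuous fun u : Circle => K * ‖(u : ℂ) - v‖ := by
    have := continuous_circle_coe
    fun_prop
  refine tendsto_iff_dist_tendsto_zero.2 (squeeze_zero (fun _ => dist_nonneg)
    (fun u => (Real.dist_eq _ _).trans_le (h u v)) ?_)
  simpa using h1.tendsto v

theorem isLip_const (c : ℝ) : IsLip fun _ => c := ⟨0, le_rfl, by simp⟩

theorem isLip_re : IsLip fun u => (u : ℂ).re :=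
  ⟨1, zero_le_one, fun u v => by simpa using Complex.abs_re_le_norm ((u : ℂ) - v)⟩

theorem isLip_im : IsLip fun u => (u : ℂ).im :=
  ⟨1, zero_le_one, fun u v => by simpa using Complex.abs_im_le_norm ((u : ℂ) - v)⟩

theorem IsLip.add {φ ψ : Circle → ℝ} (h : IsLip φ) (k : IsLip ψ) : IsLip fun u => φ u + ψ u := by
  obtain ⟨K, hK, h⟩ := h
  obtain ⟨L, hL, k⟩ := k
  refine ⟨K + L, by positivity, fun u v => ?_⟩
  rw [add_sub_add_comm, add_mul]
  exact (abs_add_le _ _).trans (add_le_add (h u v) (k u v))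

theorem IsLip.bdd {φ : Circle → ℝ} (h : IsLip φ) : ∃ B ≥ 0, ∀ u, |φ u| ≤ B := by
  obtain ⟨B, hB⟩ := isCompact_univ.exists_bound_of_continuousOn h.continuous.continuousOn
  exact ⟨|B|, abs_nonneg _, fun u => (hB u (mem_univ u)).trans (le_abs_self B)⟩

theorem IsLip.mul {φ ψ : Circle → ℝ} (h : IsLip φ) (k : IsLip ψ) : IsLip fun u => φ u * ψ u := by
  obtain ⟨A, hA, hA'⟩ := h.bdd
  obtain ⟨B, hB, hB'⟩ := k.bdd
  obtain ⟨K, hK, h⟩ := h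
  obtain ⟨L, hL, k⟩ := k
  refine ⟨A * L + B * K, by positivity, fun u v => ?_⟩
  have : φ u * ψ u - φ v * ψ v = φ u * (ψ u - ψ v) + ψ v * (φ u - φ v) := by ring
  rw [this, add_mul]
  refine (abs_add_le _ _).trans (add_le_add ?_ ?_)
  · rw [abs_mul, mul_assoc]
    exact mul_le_mul (hA' u) (k u v) (abs_nonneg _) hA
  · rw [abs_mul, mul_assoc]
    exact mul_le_mul (hB' v) (h u v) (abs_nonneg _) hB

theorem IsLip.const_mul {φ : Circle → ℝ} (h : IsLip φ) (c : ℝ) : IsLip fun u => c * φ u :=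
  (isLip_const c).mul h

theorem IsLip.sub {φ ψ : Circle → ℝ} (h : IsLip φ) (k : IsLip ψ) : IsLip fun u => φ u - ψ u := by
  simpa [sub_eq_add_neg] using h.add (k.const_mul (-1))

/-- A Lipschitz change of a Lipschitz function bounded away from the bad values. -/
theorem IsLip.comp {φ : Circle → ℝ} (h : IsLip φ) {F : ℝ → ℝ} {C : ℝ} (hC : 0 ≤ C)
    (hF : ∀ u v, |F (φ u) - F (φ v)| ≤ C * |φ u - φ v|) : IsLip fun u => F (φ u) := by
  obtain ⟨K, hK, h⟩ := h
  refine ⟨C * K, by positivity, fun u v => (hF u v).trans ?_⟩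
  rw [mul_assoc]
  exact mul_le_mul_of_nonneg_left (h u v) hC

theorem exists_pos_le {X : Type*} [TopologicalSpace X] [CompactSpace X] {φ : X → ℝ}
    (h : Continuous φ) (hpos : ∀ x, 0 < φ x) : ∃ c > 0, ∀ x, c ≤ φ x := by
  rcases isEmpty_or_nonempty X with hX | hX
  · exact ⟨1, one_pos, fun x => isEmptyElim x⟩
  · obtain ⟨x, -, hx⟩ := isCompact_univ.exists_isMinOn univ_nonempty h.continuousOn
    exact ⟨φ x, hpos x, fun y => hx (mem_univ y)⟩

theorem IsLip.inv {φ : Circle → ℝ} (h : IsLip φ) (hpos : ∀ u, 0 < φ u) :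
    IsLip fun u => (φ u)⁻¹ := by
  obtain ⟨c, hc, hc'⟩ := exists_pos_le h.continuous hpos
  refine h.comp (F := fun x => x⁻¹) (C := (c * c)⁻¹) (by positivity) fun u v => ?_
  have hu := hpos u
  have hv := hpos v
  rw [inv_sub_inv hu.ne' hv.ne', abs_div, abs_sub_comm, div_eq_inv_mul,
    abs_of_pos (mul_pos hu hv)]
  gcongr <;> exact hc' _

theorem IsLip.sqrt {φ : Circle → ℝ} (h : IsLip φ) {c : ℝ} (hc : 0 < c) (hφ : ∀ u, c ≤ φ u) :
    IsLip fun u => √(φ u) := by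
  refine h.comp (F := Real.sqrt) (C := (√c)⁻¹) (by positivity) fun u v => ?_
  have hcs := Real.sqrt_pos.2 hc
  have h1 := Real.sqrt_le_sqrt (hφ u)
  have h2 := Real.sqrt_nonneg (φ v)
  rw [← div_eq_inv_mul, le_div_iff₀ hcs]
  have : φ u - φ v = (√(φ u) - √(φ v)) * (√(φ u) + √(φ v)) := by
    have := Real.mul_self_sqrt (hc.le.trans (hφ u))
    have := Real.mul_self_sqrt (hc.le.trans (hφ v))
    ring_nf
    nlinarith
  rw [this, abs_mul]
  refine mul_le_mul_of_nonneg_left ?_ (abs_nonneg _)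
  rw [abs_of_nonneg (by linarith)]
  linarith

theorem continuous_cyl {ρ ζ : Circle → ℝ} (hρ : IsLip ρ) (hζ : IsLip ζ) :
    Continuous (cyl ρ ζ) := by
  have h1 := hρ.continuous
  have h2 := hζ.continuous
  have h3 := isLip_re.continuous
  have h4 := isLip_im.continuous
  refine (PiLp.continuous_toLp 2 _).comp (continuous_pi fun i => ?_)
  fin_cases i
  · exact h1.mul h3
  · exact h1.mul h4
  · exact h2

theorem cyl_lipschitz {ρ ζ : Circle → ℝ} (hρ : IsLip ρ) (hζ : IsLip ζ) :
    ∃ C ≥ 0, ∀ u v : Circle, ‖cyl ρ ζ u - cyl ρ ζ v‖ ≤ C * ‖(u : ℂ) - v‖ := by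
  obtain ⟨A, hA, hA'⟩ := hρ.mul isLip_re
  obtain ⟨B, hB, hB'⟩ := hρ.mul isLip_im
  obtain ⟨C, hC, hC'⟩ := hζ
  refine ⟨A + B + C, by positivity, fun u v => (norm_le_sum_abs _).trans ?_⟩
  rw [add_mul, add_mul]
  exact add_le_add (add_le_add (hA' u v) (hB' u v)) (hC' u v)

theorem normSq_circle (u : Circle) : (u : ℂ).re ^ 2 + (u : ℂ).im ^ 2 = 1 := by
  have := Circle.normSq_coe u
  rw [Complex.normSq_apply] at this
  linarith

theorem cyl_antilipschitz {ρ ζ : Circle → ℝ} {r : ℝ} (hr : 0 < r) (hρ : ∀ u, r ≤ ρ u)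
    (u v : Circle) : r * ‖(u : ℂ) - v‖ ≤ ‖cyl ρ ζ u - cyl ρ ζ v‖ := by
  have hu := normSq_circle u
  have hv := normSq_circle v
  have h1 := hρ u
  have h2 := hρ v
  refine abs_le_of_sq_le_sq' ?_ (norm_nonneg _) |>.2
  rw [mul_pow, ← Complex.normSq_eq_norm_sq, Complex.normSq_apply, EuclideanSpace.norm_sq_eq,
    Fin.sum_univ_three]
  simp only [cyl, Complex.sub_re, Complex.sub_im, Real.norm_eq_abs, sq_abs, PiLp.sub_apply]
  simp only [Matrix.cons_val_zero, Matrix.cons_val_one, Matrix.cons_val]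
  have h3 : 0 ≤ 1 - ((u : ℂ).re * (v : ℂ).re + (u : ℂ).im * (v : ℂ).im) := by
    nlinarith [sq_nonneg ((u : ℂ).re - (v : ℂ).re), sq_nonneg ((u : ℂ).im - (v : ℂ).im)]
  have h4 : r * r ≤ ρ u * ρ v := mul_le_mul h1 h2 hr.le (hr.le.trans h1)
  have h5 := mul_le_mul_of_nonneg_right h4 h3
  have e1 : r ^ 2 * (((u : ℂ).re - (v : ℂ).re) * ((u : ℂ).re - (v : ℂ).re) +
      ((u : ℂ).im - (v : ℂ).im) * ((u : ℂ).im - (v : ℂ).im)) =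
      2 * (r * r * (1 - ((u : ℂ).re * (v : ℂ).re + (u : ℂ).im * (v : ℂ).im))) := by
    linear_combination r ^ 2 * hu + r ^ 2 * hv
  have e2 : (ρ u * (u : ℂ).re - ρ v * (v : ℂ).re) ^ 2 + (ρ u * (u : ℂ).im - ρ v * (v : ℂ).im) ^ 2 =
      (ρ u - ρ v) ^ 2 +
        2 * (ρ u * ρ v * (1 - ((u : ℂ).re * (v : ℂ).re + (u : ℂ).im * (v : ℂ).im))) := by
    linear_combination ρ u ^ 2 * hu + ρ v ^ 2 * hv
  rw [e1, e2]
  linarith [sq_nonneg (ρ u - ρ v), sq_nonneg (ζ u - ζ v)]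

theorem eq_of_smul_circle {a b : ℝ} (ha : 0 < a) (hb : 0 < b) {u v : Circle}
    (h1 : a * (u : ℂ).re = b * (v : ℂ).re) (h2 : a * (u : ℂ).im = b * (v : ℂ).im) :
    a = b ∧ u = v := by
  have hu := normSq_circle u
  have hv := normSq_circle v
  have h : a ^ 2 = b ^ 2 := by
    calc a ^ 2 = (a * (u : ℂ).re) ^ 2 + (a * (u : ℂ).im) ^ 2 := by rw [mul_pow, mul_pow, ← mul_add, hu, mul_one]
      _ = b ^ 2 := by rw [h1, h2, mul_pow, mul_pow, ← mul_add, hv, mul_one]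
  have hab : a = b := (pow_left_inj₀ ha.le hb.le two_ne_zero).1 h
  subst hab
  refine ⟨rfl, Circle.ext (Complex.ext ?_ ?_)⟩
  · exact mul_left_cancel₀ ha.ne' h1
  · exact mul_left_cancel₀ ha.ne' h2

theorem exists_pos_le_norm_sub {X Y : Type*} [TopologicalSpace X] [TopologicalSpace Y]
    [CompactSpace X] [CompactSpace Y] {α : X → E3} {β : Y → E3} (hα : Continuous α)
    (hβ : Continuous β) (h : ∀ x y, α x ≠ β y) : ∃ c > 0, ∀ x y, c ≤ ‖α x - β y‖ := by
  obtain ⟨c, hc, hc'⟩ := exists_pos_le (X := X × Y) (φ := fun q => ‖α q.1 - β q.2‖)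
    (by fun_prop) (fun q => norm_pos_iff.2 (sub_ne_zero.2 (h _ _)))
  exact ⟨c, hc, fun x y => hc' (x, y)⟩

/-- Two disjoint cylindrical curves are carried by an ambient isotopy to two others as soon as the
pairs stay disjoint under linear interpolation of radii and heights. -/
theorem exists_isIsotopyEnd_cyl {ρ ζ ρ' ζ' σ η σ' η' : Circle → ℝ}
    (hρ : IsLip ρ) (hζ : IsLip ζ) (hρ' : IsLip ρ') (hζ' : IsLip ζ')
    (hσ : IsLip σ) (hη : IsLip η) (hσ' : IsLip σ') (hη' : IsLip η')
    (pρ : ∀ u, 0 < ρ u) (pρ' : ∀ u, 0 < ρ' u) (pσ : ∀ u, 0 < σ u) (pσ' : ∀ u, 0 < σ' u)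
    (hdisj : ∀ t ∈ Icc (0 : ℝ) 1, ∀ u,
      (1 - t) * (σ u - ρ u) + t * (σ' u - ρ' u) = 0 →
      (1 - t) * (η u - ζ u) + t * (η' u - ζ' u) ≠ 0) :
    ∃ h : E3 ≃ₜ E3, IsIsotopyEnd h ∧ (∀ u, h (cyl ρ ζ u) = cyl ρ' ζ' u) ∧
      ∀ u, h (cyl σ η u) = cyl σ' η' u := by
  have interp : ∀ (ρ ζ ρ' ζ' : Circle → ℝ) (t : ℝ) (u : Circle),
      cyl ρ ζ u + t • (cyl ρ' ζ' u - cyl ρ ζ u) =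
        cyl (fun u => ρ u + t * (ρ' u - ρ u)) (fun u => ζ u + t * (ζ' u - ζ u)) u := by
    intro ρ ζ ρ' ζ' t u
    ext i
    fin_cases i <;> simp [cyl] <;> ring
  have hlow : ∀ {ρ ρ' : Circle → ℝ}, IsLip ρ → IsLip ρ' → (∀ u, 0 < ρ u) → (∀ u, 0 < ρ' u) →
      ∃ r > 0, ∀ t ∈ Icc (0 : ℝ) 1, ∀ u, r ≤ ρ u + t * (ρ' u - ρ u) := by
    intro ρ ρ' hρ hρ' pρ pρ'
    obtain ⟨a, ha, ha'⟩ := exists_pos_le hρ.continuous pρ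
    obtain ⟨b, hb, hb'⟩ := exists_pos_le hρ'.continuous pρ'
    refine ⟨min a b, lt_min ha hb, fun t ht u => ?_⟩
    nlinarith [mul_le_mul_of_nonneg_left ((min_le_right a b).trans (hb' u)) ht.1,
      mul_le_mul_of_nonneg_left ((min_le_left a b).trans (ha' u)) (sub_nonneg.2 ht.2)]
  obtain ⟨r, hr, hr'⟩ := hlow hρ hρ' pρ pρ'
  obtain ⟨s, hs, hs'⟩ := hlow hσ hσ' pσ pσ'
  obtain ⟨A, hA, hA'⟩ := cyl_lipschitz (hρ'.sub hρ) (hζ'.sub hζ)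
  obtain ⟨B, hB, hB'⟩ := cyl_lipschitz (hσ'.sub hσ) (hη'.sub hη)
  have hsub : ∀ (ρ ζ ρ' ζ' : Circle → ℝ) (u : Circle), cyl ρ' ζ' u - cyl ρ ζ u =
      cyl (fun u => ρ' u - ρ u) (fun u => ζ' u - ζ u) u := by
    intro ρ ζ ρ' ζ' u
    ext i
    fin_cases i <;> simp [cyl] <;> ring
  obtain ⟨C, hC⟩ := isCompact_univ.exists_bound_of_continuousOn
    (f := fun q : Circle × Circle => (cyl ρ' ζ' q.1 - cyl ρ ζ q.1) - (cyl σ' η' q.2 - cyl σ η q.2))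
    (by
      have := continuous_cyl hρ hζ
      have := continuous_cyl hρ' hζ'
      have := continuous_cyl hσ hη
      have := continuous_cyl hσ' hη'
      fun_prop)
  refine exists_isIsotopyEnd_of_lineMap_pair (fun u v : Circle => ‖(u : ℂ) - v‖)
    (fun u v : Circle => ‖(u : ℂ) - v‖) (cyl ρ ζ) (cyl ρ' ζ') (cyl σ η) (cyl σ' η')
    (C := max (max A B) |C|) ?_ ?_ ?_ ?_ ?_ ?_ (fun _ _ => norm_nonneg _)
    (fun _ _ => norm_nonneg _) (by positivity)
  · intro u v
    rw [hsub, hsub]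
    exact (hA' u v).trans (mul_le_mul_of_nonneg_right (by simp) (norm_nonneg _))
  · intro u v
    rw [hsub, hsub]
    exact (hB' u v).trans (mul_le_mul_of_nonneg_right (by simp) (norm_nonneg _))
  · intro u v
    exact (hC (u, v) (mem_univ _)).trans ((le_abs_self _).trans (le_max_right _ _))
  · intro t ht
    refine ⟨r, hr, fun u v => ?_⟩
    rw [interp, interp]
    exact cyl_antilipschitz hr (hr' t ht) u v
  · intro t ht
    refine ⟨s, hs, fun u v => ?_⟩
    rw [interp, interp]
    exact cyl_antilipschitz hs (hs' t ht) u v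
  · intro t ht
    simp only [interp]
    refine exists_pos_le_norm_sub
      (continuous_cyl (hρ.add ((hρ'.sub hρ).const_mul t)) (hζ.add ((hζ'.sub hζ).const_mul t)))
      (continuous_cyl (hσ.add ((hσ'.sub hσ).const_mul t)) (hη.add ((hη'.sub hη).const_mul t))) ?_
    intro u v huv
    have e0 := congrArg (fun p : E3 => p 0) huv
    have e1 := congrArg (fun p : E3 => p 1) huv
    have e2 := congrArg (fun p : E3 => p 2) huv
    simp only [cyl, Matrix.cons_val_zero, Matrix.cons_val_one, Matrix.cons_val] at e0 e1 e2
    obtain ⟨e3, rfl⟩ := eq_of_smul_circle (hr.trans_le (hr' t ht u)) (hs.trans_le (hs' t ht v)) e0 e1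
    exact hdisj t ht u (by linarith) (by linarith)

/-! ### The three standard links in cylindrical coordinates -/

theorem exists_circle {x y : ℝ} (h : x ^ 2 + y ^ 2 = 1) :
    ∃ u : Circle, (u : ℂ).re = x ∧ (u : ℂ).im = y := by
  refine ⟨⟨⟨x, y⟩, ?_⟩, rfl, rfl⟩
  refine mem_sphere_zero_iff_norm.2 ?_
  rw [Complex.norm_def, Complex.normSq_mk, Real.sqrt_eq_one]
  linarith

theorem exists_polar {x y : ℝ} (h : 0 < x ^ 2 + y ^ 2) :
    ∃ r > 0, ∃ u : Circle, x = r * (u : ℂ).re ∧ y = r * (u : ℂ).im := by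
  have hr := Real.sqrt_pos.2 h
  have hr2 := Real.sq_sqrt h.le
  obtain ⟨u, hu, hv⟩ := exists_circle (x := x / √(x ^ 2 + y ^ 2)) (y := y / √(x ^ 2 + y ^ 2)) (by
    rw [div_pow, div_pow, ← add_div, hr2, div_self h.ne'])
  exact ⟨_, hr, u, by rw [hu]; field_simp, by rw [hv]; field_simp⟩

theorem range_cyl_one (c : ℝ) :
    range (cyl (fun _ => 1) (fun _ => c)) = {p : E3 | p 2 = c ∧ p 0 ^ 2 + p 1 ^ 2 = 1} := by
  ext p
  constructor
  · rintro ⟨u, rfl⟩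
    exact ⟨rfl, by simpa [cyl] using normSq_circle u⟩
  · rintro ⟨h1, h2⟩
    obtain ⟨u, hu, hv⟩ := exists_circle h2
    refine ⟨u, ?_⟩
    ext i
    fin_cases i <;> simp [cyl, hu, hv, h1]

theorem isCompact_range_cyl {ρ ζ : Circle → ℝ} (hρ : IsLip ρ) (hζ : IsLip ζ) :
    IsCompact (range (cyl ρ ζ)) := isCompact_range (continuous_cyl hρ hζ)

/-- A component that is translated without meeting the rest of the link. -/
theorem ambientIsotopic_translate {K L : Set E3} (hK : IsCompact K) (hL : IsCompact L) (v : E3)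
    (h : ∀ t ∈ Icc (0 : ℝ) 1, ∀ x ∈ K, ∀ y ∈ L, x ≠ y + t • v) :
    AmbientIsotopic (K ∪ L) (K ∪ (fun p => p + v) '' L) := by
  have := isCompact_iff_compactSpace.1 hK
  have := isCompact_iff_compactSpace.1 hL
  obtain ⟨g, hg, h1, h2⟩ := exists_isIsotopyEnd_of_lineMap_pair (X := K) (Y := L)
    (fun x y => ‖(x : E3) - y‖) (fun x y => ‖(x : E3) - y‖) (fun x => x) (fun x => x)
    (fun x => x) (fun x => x + v) (C := ‖v‖)
    (by intro x y; simpa using by positivity) (by intro x y; simpa using by positivity)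
    (by intro x y; simp)
    (fun t ht => ⟨1, one_pos, by simp⟩) (fun t ht => ⟨1, one_pos, by simp⟩)
    (fun t ht => by
      simp only [sub_self, smul_zero, add_zero, add_sub_cancel_left]
      exact exists_pos_le_norm_sub continuous_subtype_val
        (continuous_subtype_val.add continuous_const) (fun x y => h t ht x x.2 y y.2))
    (fun _ _ => norm_nonneg _) (fun _ _ => norm_nonneg _) (norm_nonneg _)
  refine ambientIsotopic_iff.2 ⟨g, hg, ?_⟩
  rw [image_union]
  congr 1
  · rw [show g '' K = (fun x => x) '' K from image_congr fun x hx => h1 ⟨x, hx⟩, image_id']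
  · exact image_congr fun x hx => h2 ⟨x, hx⟩

/-- Two curves around the axis can only meet over a common direction, where both their radii and
their heights agree. If this does not occur during a linear interpolation, the interpolation is an
ambient isotopy. -/
theorem ambientIsotopic_cyl {ρ ζ ρ' ζ' σ η σ' η' : Circle → ℝ}
    (hρ : IsLip ρ) (hζ : IsLip ζ) (hρ' : IsLip ρ') (hζ' : IsLip ζ')
    (hσ : IsLip σ) (hη : IsLip η) (hσ' : IsLip σ') (hη' : IsLip η')
    (pρ : ∀ u, 0 < ρ u) (pρ' : ∀ u, 0 < ρ' u) (pσ : ∀ u, 0 < σ u) (pσ' : ∀ u, 0 < σ' u)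
    (hdisj : ∀ t ∈ Icc (0 : ℝ) 1, ∀ u,
      (1 - t) * (σ u - ρ u) + t * (σ' u - ρ' u) = 0 →
      (1 - t) * (η u - ζ u) + t * (η' u - ζ' u) ≠ 0) :
    AmbientIsotopic (range (cyl ρ ζ) ∪ range (cyl σ η))
      (range (cyl ρ' ζ') ∪ range (cyl σ' η')) := by
  obtain ⟨h, hh, h1, h2⟩ :=
    exists_isIsotopyEnd_cyl hρ hζ hρ' hζ' hσ hη hσ' hη' pρ pρ' pσ pσ' hdisj
  refine ambientIsotopic_iff.2 ⟨h, hh, ?_⟩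
  rw [image_union, ← range_comp, ← range_comp, show h ∘ cyl ρ ζ = cyl ρ' ζ' from funext h1,
    show h ∘ cyl σ η = cyl σ' η' from funext h2]

/-- Coaxial circles at different heights form an unlink. -/
theorem isTrivialLink_coaxial :
    IsTrivialLink (range (cyl (fun _ => 1) (fun _ => 0)) ∪ range (cyl (fun _ => 1) fun _ => 1)) := by
  have hL := isLip_const
  refine (ambientIsotopic_translate (isCompact_range_cyl (hL 1) (hL 0))
    (isCompact_range_cyl (hL 1) (hL 1)) !₂[3, 0, 0] ?_).trans ?_
  · rintro t - _ ⟨u, rfl⟩ _ ⟨v, rfl⟩ h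
    have := congrArg (fun p : E3 => p 2) h
    simp [cyl] at this
  refine (ambientIsotopic_translate (isCompact_range_cyl (hL 1) (hL 0))
    ((isCompact_range_cyl (hL 1) (hL 1)).image (by fun_prop)) !₂[0, 0, -1] ?_).trans ?_
  · rintro t - _ ⟨u, rfl⟩ _ ⟨_, ⟨v, rfl⟩, rfl⟩ h
    have := congrArg (fun p : E3 => p 0) h
    simp [cyl] at this
    have h1 := abs_le.1 ((Complex.abs_re_le_norm (u : ℂ)).trans_eq (Circle.norm_coe u))
    have h2 := abs_le.1 ((Complex.abs_re_le_norm (v : ℂ)).trans_eq (Circle.norm_coe v))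
    linarith [h1.2, h2.1]
  · convert AmbientIsotopic.refl standardUnlink using 1
    rw [range_cyl_one, range_cyl_one]
    unfold standardUnlink
    congr 1
    ext p
    constructor
    · rintro ⟨_, ⟨p, ⟨h1, h2⟩, rfl⟩, rfl⟩
      refine ⟨by simp [h1], by simpa using h2⟩
    · rintro ⟨h1, h2⟩
      refine ⟨_, ⟨!₂[p 0 - 3, p 1, 1], ⟨by simp, by simpa using h2⟩, rfl⟩, ?_⟩
      ext i
      fin_cases i <;> simp [h1]

/-- Two curves around the axis form an unlink if the second one is outside the first one wherever
both have the same height. -/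
theorem isTrivialLink_cyl {ρ ζ σ η : Circle → ℝ} (hρ : IsLip ρ) (hζ : IsLip ζ) (hσ : IsLip σ)
    (hη : IsLip η) (pρ : ∀ u, 0 < ρ u) (pσ : ∀ u, 0 < σ u)
    (h : ∀ u, σ u ≤ ρ u → η u ≠ ζ u) :
    IsTrivialLink (range (cyl ρ ζ) ∪ range (cyl σ η)) := by
  have hL := isLip_const
  refine (ambientIsotopic_cyl hρ hζ (hL 1) (hL 0) hσ hη (hL 2) (hL 0) pρ (fun _ => one_pos) pσ
    (fun _ => two_pos) ?_).trans ((ambientIsotopic_cyl (hL 1) (hL 0) (hL 1) (hL 0) (hL 2) (hL 0)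
      (hL 1) (hL 1) (fun _ => one_pos) (fun _ => one_pos) (fun _ => two_pos) (fun _ => one_pos)
      ?_).trans isTrivialLink_coaxial)
  · intro t ht u h1 h2
    rcases ht.2.eq_or_lt with rfl | h3
    · norm_num at h1
    · have h4 : η u = ζ u := by
        have : (1 - t) * (η u - ζ u) = 0 := by linarith
        rcases mul_eq_zero.1 this with h | h <;> linarith
      refine h u ?_ h4
      by_contra! h5
      nlinarith [ht.1, mul_pos (sub_pos.2 h3) (sub_pos.2 h5)]
  · intro t ht u h1 h2
    linarith

/-- The radius, in the direction `u`, of the unit circle centred at `(a, 0)`. -/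
noncomputable def shiftedRadius (a : ℝ) (u : Circle) : ℝ :=
  a * (u : ℂ).re + √(1 - a ^ 2 * (u : ℂ).im ^ 2)

theorem shiftedRadius_pos {a : ℝ} (ha : a ^ 2 < 1) (u : Circle) : 0 < shiftedRadius a u := by
  have h1 := normSq_circle u
  unfold shiftedRadius
  have h2 : |a * (u : ℂ).re| < √(1 - a ^ 2 * (u : ℂ).im ^ 2) := by
    refine Real.lt_sqrt_of_sq_lt ?_
    rw [sq_abs]
    nlinarith
  linarith [neg_abs_le (a * (u : ℂ).re)]

theorem isLip_shiftedRadius {a : ℝ} (ha : a ^ 2 < 1) : IsLip (shiftedRadius a) := by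
  refine (isLip_re.const_mul a).add (IsLip.sqrt (φ := fun u : Circle => 1 - a ^ 2 * (u : ℂ).im ^ 2)
    ?_ (sub_pos.2 ha) fun u => ?_)
  · have := (isLip_const 1).sub ((isLip_im.mul isLip_im).const_mul (a ^ 2))
    simpa only [sq] using this
  · nlinarith [normSq_circle u, sq_nonneg (u : ℂ).re, sq_nonneg a, mul_nonneg (sq_nonneg a) (sq_nonneg (u : ℂ).re)]

theorem shiftedRadius_eq {a r : ℝ} (ha : a ^ 2 < 1) (hr : 0 < r) {u : Circle} :
    (r * (u : ℂ).re - a) ^ 2 + (r * (u : ℂ).im) ^ 2 = 1 ↔ r = shiftedRadius a u := by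
  have h1 := normSq_circle u
  have h0 : 0 ≤ 1 - a ^ 2 * (u : ℂ).im ^ 2 := by
    nlinarith [sq_nonneg (u : ℂ).re, mul_nonneg (sq_nonneg a) (sq_nonneg (u : ℂ).re)]
  constructor
  · intro h
    have h2 : (r - a * (u : ℂ).re) ^ 2 = 1 - a ^ 2 * (u : ℂ).im ^ 2 := by
      linear_combination h - (r ^ 2 - a ^ 2) * h1
    have h3 : 0 ≤ r - a * (u : ℂ).re := by
      by_contra! h3
      nlinarith
    unfold shiftedRadius
    rw [← h2, Real.sqrt_sq h3]
    ring
  · intro h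
    have h2 : (r - a * (u : ℂ).re) ^ 2 = 1 - a ^ 2 * (u : ℂ).im ^ 2 := by
      rw [h, shiftedRadius, add_sub_cancel_left, Real.sq_sqrt h0]
    linear_combination h2 + (r ^ 2 - a ^ 2) * h1

theorem range_cyl_shiftedRadius {a b : ℝ} (ha : a ^ 2 < 1) :
    range (cyl (shiftedRadius a) fun u => b * (shiftedRadius a u * (u : ℂ).im)) =
      {p : E3 | p 2 = b * p 1 ∧ (p 0 - a) ^ 2 + p 1 ^ 2 = 1} := by
  ext p
  constructor
  · rintro ⟨u, rfl⟩
    exact ⟨rfl, (shiftedRadius_eq ha (shiftedRadius_pos ha u)).2 rfl⟩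
  · rintro ⟨h1, h2⟩
    have h3 : 0 < p 0 ^ 2 + p 1 ^ 2 := by
      by_contra! h3
      have e0 : p 0 = 0 := by nlinarith [sq_nonneg (p 0), sq_nonneg (p 1)]
      have e1 : p 1 = 0 := by nlinarith [sq_nonneg (p 0), sq_nonneg (p 1)]
      rw [e0, e1] at h2
      nlinarith
    obtain ⟨r, hr, u, hx, hy⟩ := exists_polar h3
    rw [hx, hy] at h2
    have h4 := (shiftedRadius_eq ha hr).1 h2
    refine ⟨u, ?_⟩
    ext i
    fin_cases i <;> simp [cyl, ← h4, hx, hy, h1]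

/-- The Hopf link, sheared and translated so that both components become curves around the
vertical axis. -/
theorem isHopfLink_shifted :
    IsHopfLink ({p : E3 | p 2 = 0 * p 1 ∧ (p 0 - (-1 / 2)) ^ 2 + p 1 ^ 2 = 1} ∪
      {p : E3 | p 2 = 1 * p 1 ∧ (p 0 - 1 / 2) ^ 2 + p 1 ^ 2 = 1}) := by
  obtain ⟨s, hs, hs'⟩ := exists_isIsotopyEnd_matLin (M := Matrix.transvection 1 2 1) (by
    intro t _
    have : 1 + t • (Matrix.transvection 1 2 1 - 1) = Matrix.transvection (1 : Fin 3) 2 (t * 1) := by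
      simp [Matrix.transvection, Matrix.smul_single]
    rw [this, Matrix.det_transvection_of_ne _ _ (by decide)]
    exact one_ne_zero)
  obtain ⟨m, hm, hm'⟩ := exists_isIsotopyEnd_translate !₂[-1 / 2, 0, 0]
  refine AmbientIsotopic.symm (ambientIsotopic_iff.2 ⟨_, hs.trans hm, ?_⟩)
  have e : ∀ p : E3, (s.trans m) p = !₂[p 0 - 1 / 2, p 1 + p 2, p 2] := by
    intro p
    simp only [Homeomorph.trans_apply, hm', hs']
    ext i
    fin_cases i <;> simp [matLin, Matrix.transvection, Matrix.add_mulVec, Matrix.single_mulVec]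
    ring
  rw [standardHopfLink, image_union]
  congr 1
  · ext p
    constructor
    · rintro ⟨p, ⟨h1, h2⟩, rfl⟩
      rw [e]
      refine ⟨by simp [h1], ?_⟩
      simp [h1]; linarith
    · rintro ⟨h1, h2⟩
      rw [zero_mul] at h1
      refine ⟨!₂[p 0 + 1 / 2, p 1, 0], ⟨by simp, ?_⟩, ?_⟩
      · simp; linarith
      · rw [e]; ext i; fin_cases i <;> simp [h1]
  · ext p
    constructor
    · rintro ⟨p, ⟨h1, h2⟩, rfl⟩
      rw [e]
      refine ⟨by simp [h1], ?_⟩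
      simp [h1]; linarith
    · rintro ⟨h1, h2⟩
      rw [one_mul] at h1
      refine ⟨!₂[p 0 + 1 / 2, 0, p 2], ⟨by simp, ?_⟩, ?_⟩
      · simp [h1]; linarith
      · rw [e]; ext i; fin_cases i <;> simp [h1]

/-- A flat curve around the axis forms a Hopf link with a curve that passes through its plane twice,
once outside it and once inside it. -/
theorem isHopfLink_cyl {ρ σ η : Circle → ℝ} (hρ : IsLip ρ) (hσ : IsLip σ)
    (hη : IsLip η) (pρ : ∀ u, 0 < ρ u) (pσ : ∀ u, 0 < σ u)
    (h1 : ∀ u : Circle, 0 < (u : ℂ).im → 0 < η u) (h2 : ∀ u : Circle, (u : ℂ).im < 0 → η u < 0)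
    (h3 : ∀ u : Circle, (u : ℂ).im = 0 → 0 < (u : ℂ).re → ρ u < σ u)
    (h4 : ∀ u : Circle, (u : ℂ).im = 0 → (u : ℂ).re < 0 → σ u < ρ u) :
    IsHopfLink (range (cyl ρ fun _ => 0) ∪ range (cyl σ η)) := by
  have ha : (-1 / 2 : ℝ) ^ 2 < 1 := by norm_num
  have hb : (1 / 2 : ℝ) ^ 2 < 1 := by norm_num
  have key := isHopfLink_shifted
  rw [← range_cyl_shiftedRadius ha, ← range_cyl_shiftedRadius hb] at key
  have hl := isLip_shiftedRadius ha
  have hr := isLip_shiftedRadius hb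
  refine (ambientIsotopic_cyl hρ (isLip_const 0) hl ((hl.mul isLip_im).const_mul 0) hσ hη hr
    ((hr.mul isLip_im).const_mul 1) pρ (shiftedRadius_pos ha) pσ (shiftedRadius_pos hb) ?_).trans key
  intro t ht u e1 e2
  have hs := shiftedRadius_pos hb u
  have ht0 := ht.1
  have ht1 := sub_nonneg.2 ht.2
  -- a convex combination of two numbers of the same strict sign does not vanish
  have conv : ∀ {a b : ℝ}, 0 < a → 0 < b → 0 < (1 - t) * a + t * b := by
    intro a b ha hb
    rcases ht0.eq_or_lt with rfl | h0
    · simpa using ha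
    · have := mul_pos h0 hb
      have := mul_nonneg ht1 ha.le
      linarith
  rcases lt_trichotomy (u : ℂ).im 0 with hu | hu | hu
  · have := conv (neg_pos.2 (h2 u hu)) (mul_pos hs (neg_pos.2 hu))
    linarith
  · have hre : (u : ℂ).re ^ 2 = 1 := by
      have := normSq_circle u
      rw [hu] at this
      linarith
    have e : ∀ a, shiftedRadius a u = a * (u : ℂ).re + 1 := by
      intro a; simp [shiftedRadius, hu]
    rw [e, e] at e1
    rcases mul_self_eq_one_iff.1 ((sq _).symm.trans hre) with h | h
    · have := conv (sub_pos.2 (h3 u hu (by rw [h]; exact one_pos))) one_pos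
      rw [h] at e1
      linarith
    · have := conv (sub_pos.2 (h4 u hu (by rw [h]; norm_num))) one_pos
      rw [h] at e1
      linarith
  · have := conv (h1 u hu) (mul_pos hs hu)
    linarith

/-- The two components of the standard `(2,4)`-torus link. -/
theorem standardTorusLink_eq :
    standardTorusLink 2 4 =
      range (cyl (fun u => 2 - ((u : ℂ).re ^ 2 - (u : ℂ).im ^ 2))
        fun u => -(2 * ((u : ℂ).re * (u : ℂ).im))) ∪
      range (cyl (fun u => 2 + ((u : ℂ).re ^ 2 - (u : ℂ).im ^ 2))
        fun u => 2 * ((u : ℂ).re * (u : ℂ).im)) := by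
  have hc : ∀ θ : ℝ, Real.cos θ ^ 2 - Real.sin θ ^ 2 = Real.cos (2 * θ) := fun θ => by
    rw [Real.cos_two_mul']
  have hs : ∀ θ : ℝ, 2 * (Real.cos θ * Real.sin θ) = Real.sin (2 * θ) := fun θ => by
    rw [Real.sin_two_mul]; ring
  ext p
  constructor
  · rintro ⟨θ, φ, ⟨k, hk⟩, rfl⟩
    push_cast at hk
    rcases Int.even_or_odd' k with ⟨m, rfl | rfl⟩
    · right
      have hφ : φ = 2 * θ + m * (2 * Real.pi) := by push_cast at hk; linarith
      refine ⟨Circle.exp θ, ?_⟩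
      ext i
      fin_cases i <;>
        simp [cyl, torusPoint, hc, hs, hφ, Real.cos_add_int_mul_two_pi,
          Real.sin_add_int_mul_two_pi]
    · left
      have hφ : φ = 2 * θ + Real.pi + m * (2 * Real.pi) := by push_cast at hk; linarith
      refine ⟨Circle.exp θ, ?_⟩
      ext i
      fin_cases i <;>
        simp [cyl, torusPoint, hc, hs, hφ, Real.cos_add_int_mul_two_pi,
          Real.sin_add_int_mul_two_pi, Real.cos_add_pi, Real.sin_add_pi,
          sub_eq_add_neg]
  · rintro (⟨u, rfl⟩ | ⟨u, rfl⟩)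
    · obtain ⟨θ, rfl⟩ := Circle.exp_surjective u
      refine ⟨θ, 2 * θ + Real.pi, ⟨1, by push_cast; ring⟩, ?_⟩
      ext i
      fin_cases i <;>
        simp [cyl, torusPoint, hc, hs, Real.cos_add_pi, Real.sin_add_pi,
          sub_eq_add_neg]
    · obtain ⟨θ, rfl⟩ := Circle.exp_surjective u
      refine ⟨θ, 2 * θ, ⟨0, by push_cast; ring⟩, ?_⟩
      ext i
      fin_cases i <;> simp [cyl, torusPoint, hc, hs]

theorem isLip_torus : IsLip (fun u : Circle => (u : ℂ).re ^ 2 - (u : ℂ).im ^ 2) ∧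
    IsLip (fun u : Circle => 2 * ((u : ℂ).re * (u : ℂ).im)) := by
  refine ⟨?_, (isLip_re.mul isLip_im).const_mul 2⟩
  simpa only [sq] using (isLip_re.mul isLip_re).sub (isLip_im.mul isLip_im)

theorem torus_abs_le (u : Circle) : |(u : ℂ).re ^ 2 - (u : ℂ).im ^ 2| ≤ 1 := by
  have := normSq_circle u
  rw [abs_le]
  constructor <;> nlinarith [sq_nonneg (u : ℂ).re, sq_nonneg (u : ℂ).im]

/-- A flat curve around the axis forms a `(2,4)`-torus link with a curve that passes through its
plane four times, alternately outside it and inside it. -/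
theorem isTorusLink_cyl {ρ σ η : Circle → ℝ} (hρ : IsLip ρ) (hσ : IsLip σ)
    (hη : IsLip η) (pρ : ∀ u, 0 < ρ u) (pσ : ∀ u, 0 < σ u)
    (h1 : ∀ u : Circle, 0 < (u : ℂ).re * (u : ℂ).im → 0 < η u)
    (h2 : ∀ u : Circle, (u : ℂ).re * (u : ℂ).im < 0 → η u < 0)
    (h3 : ∀ u : Circle, (u : ℂ).im = 0 → ρ u < σ u)
    (h4 : ∀ u : Circle, (u : ℂ).re = 0 → σ u < ρ u) :
    AmbientIsotopic (range (cyl ρ fun _ => 0) ∪ range (cyl σ η)) (standardTorusLink 2 4) := by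
  rw [standardTorusLink_eq]
  obtain ⟨l1, l2⟩ := isLip_torus
  refine ambientIsotopic_cyl hρ (isLip_const 0) ((isLip_const 2).sub l1)
    (by simpa using l2.const_mul (-1)) hσ hη ((isLip_const 2).add l1) l2 pρ
    (fun u => by linarith [(abs_le.1 (torus_abs_le u)).2]) pσ
    (fun u => by linarith [(abs_le.1 (torus_abs_le u)).1]) ?_
  intro t ht u e1 e2
  have ht0 := ht.1
  have ht1 := sub_nonneg.2 ht.2
  -- a convex combination of two numbers of the same strict sign does not vanish
  have conv : ∀ {a b : ℝ}, 0 < a → 0 < b → 0 < (1 - t) * a + t * b := by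
    intro a b ha hb
    rcases ht0.eq_or_lt with rfl | h0
    · simpa using ha
    · have := mul_pos h0 hb
      have := mul_nonneg ht1 ha.le
      linarith
  have hu := normSq_circle u
  rcases lt_trichotomy ((u : ℂ).re * (u : ℂ).im) 0 with h | h | h
  · have := conv (neg_pos.2 (h2 u h)) (neg_pos.2 h)
    nlinarith
  · rcases mul_eq_zero.1 h with h | h
    · have := conv (sub_pos.2 (h4 u h)) one_pos
      have h5 : (u : ℂ).im ^ 2 = 1 := by rw [h] at hu; linarith
      rw [h5, h] at e1
      nlinarith
    · have := conv (sub_pos.2 (h3 u h)) one_pos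
      have h5 : (u : ℂ).re ^ 2 = 1 := by rw [h] at hu; linarith
      rw [h5, h] at e1
      nlinarith
  · have := conv (h1 u h) h
    nlinarith

/-! ### Invariance of the three link types under affine bijections -/

theorem reflectZ_reflectZ (p : E3) : reflectZ (reflectZ p) = p := by
  ext i; fin_cases i <;> simp [reflectZ]

/-- The reflection in the plane `z = 0` as a homeomorphism. -/
noncomputable def reflectZHomeo : E3 ≃ₜ E3 where
  toFun := reflectZ
  invFun := reflectZ
  left_inv := reflectZ_reflectZ
  right_inv := reflectZ_reflectZ
  continuous_toFun := by
    refine (PiLp.continuous_toLp 2 _).comp (continuous_pi fun i => ?_)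
    fin_cases i <;> simp <;> fun_prop
  continuous_invFun := by
    refine (PiLp.continuous_toLp 2 _).comp (continuous_pi fun i => ?_)
    fin_cases i <;> simp <;> fun_prop

theorem AmbientIsotopic.reflectZ {K L : Set E3} (h : AmbientIsotopic K L) :
    AmbientIsotopic (reflectZ '' K) (reflectZ '' L) := by
  obtain ⟨g, hg, rfl⟩ := ambientIsotopic_iff.1 h
  refine ambientIsotopic_iff.2 ⟨_, hg.conj reflectZHomeo, ?_⟩
  rw [← image_comp, ← image_comp]
  refine image_congr fun x _ => ?_
  change _root_.reflectZ (g (_root_.reflectZ (_root_.reflectZ x))) = _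
  rw [reflectZ_reflectZ]
  rfl

theorem reflectZ_image_eq {S T : Set E3} (h : ∀ p, p ∈ S → reflectZ p ∈ T)
    (h' : ∀ p, p ∈ T → reflectZ p ∈ S) : reflectZ '' S = T := by
  ext p
  constructor
  · rintro ⟨q, hq, rfl⟩
    exact h q hq
  · intro hp
    exact ⟨_, h' p hp, reflectZ_reflectZ p⟩

theorem isTrivialLink_of_affine (Ψ : E3 ≃ᵃ[ℝ] E3) {K : Set E3} (hK : IsTrivialLink (Ψ '' K)) :
    IsTrivialLink K := by
  refine of_affine_image (fun K L h h' => h.symm.trans h') (fun K h => ?_) Ψ hK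
  have := AmbientIsotopic.reflectZ h
  have e : reflectZ '' standardUnlink = standardUnlink :=
    reflectZ_image_eq (by simp [standardUnlink, reflectZ]) (by simp [standardUnlink, reflectZ])
  rwa [e] at this

theorem isHopfLink_of_affine (Ψ : E3 ≃ᵃ[ℝ] E3) {K : Set E3} (hK : IsHopfLink (Ψ '' K)) :
    IsHopfLink K := by
  refine of_affine_image (fun K L h h' => h.symm.trans h') (fun K h => ?_) Ψ hK
  have := AmbientIsotopic.reflectZ h
  have e : reflectZ '' standardHopfLink = standardHopfLink :=
    reflectZ_image_eq (by simp [standardHopfLink, reflectZ]) (by simp [standardHopfLink, reflectZ])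
  rwa [e] at this

theorem reflectZ_torusPoint (θ φ : ℝ) : reflectZ (torusPoint θ φ) = torusPoint θ (-φ) := by
  ext i; fin_cases i <;> simp [reflectZ, torusPoint]

theorem reflectZ_standardTorusLink (q : ℤ) :
    reflectZ '' standardTorusLink 2 q = standardTorusLink 2 (-q) := by
  have : ∀ (q : ℤ) (p : E3), p ∈ standardTorusLink 2 q → reflectZ p ∈ standardTorusLink 2 (-q) := by
    rintro q _ ⟨θ, φ, ⟨k, hk⟩, rfl⟩
    refine ⟨θ, -φ, ⟨-k, ?_⟩, reflectZ_torusPoint θ φ⟩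
    push_cast at hk ⊢
    linarith
  exact reflectZ_image_eq (this q) (fun p hp => by simpa using this _ p hp)

theorem isTorusLink_of_affine (Ψ : E3 ≃ᵃ[ℝ] E3) {K : Set E3} (hK : IsTorusLink 2 4 (Ψ '' K)) :
    IsTorusLink 2 4 K := by
  refine of_affine_image (fun K L h h' => h'.imp (fun h' => h.symm.trans h')
    (fun h' => h.symm.trans h')) (fun K h => ?_) Ψ hK
  rcases h with h | h
  · right
    have := AmbientIsotopic.reflectZ h
    rwa [reflectZ_standardTorusLink] at this
  · left
    have := AmbientIsotopic.reflectZ h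
    rwa [reflectZ_standardTorusLink, neg_neg] at this

/-! ### Barycentric coordinates and linear motions of simplices -/

/-- The combination of the points `p i` with coefficients `b i`. -/
noncomputable def comb {ι : Type*} [Fintype ι] (p : ι → E3) (b : ι → ℝ) : E3 := ∑ i, b i • p i

theorem comb_apply {ι : Type*} [Fintype ι] (p : ι → E3) (b : ι → ℝ) (j : Fin 3) :
    comb p b j = ∑ i, b i * p i j := by
  simp [comb]

theorem comb_add {ι : Type*} [Fintype ι] (p : ι → E3) (a b : ι → ℝ) :
    comb p (a + b) = comb p a + comb p b := by
  simp [comb, add_smul, Finset.sum_add_distrib]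

theorem comb_sub {ι : Type*} [Fintype ι] (p : ι → E3) (a b : ι → ℝ) :
    comb p (a - b) = comb p a - comb p b := by
  simp [comb, sub_smul, Finset.sum_sub_distrib]

theorem comb_smul {ι : Type*} [Fintype ι] (p : ι → E3) (c : ℝ) (b : ι → ℝ) :
    comb p (c • b) = c • comb p b := by
  simp [comb, mul_smul, Finset.smul_sum]

theorem continuous_comb {ι : Type*} [Fintype ι] (p : ι → E3) : Continuous (comb p) := by
  unfold comb
  fun_prop

theorem affineMap_comb {ι V : Type*} [Fintype ι] [AddCommGroup V] [Module ℝ V] (h : E3 →ᵃ[ℝ] V)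
    (p : ι → E3) {b : ι → ℝ} (hb : ∑ i, b i = 1) : h (comb p b) = ∑ i, b i • h (p i) := by
  have e : ∀ x, h x = h.linear x + h 0 := by
    intro x
    have := h.map_vadd 0 x
    simpa using this
  rw [e, comb, map_sum]
  simp only [map_smul, e (p _), smul_add, Finset.sum_add_distrib, ← Finset.sum_smul, hb, one_smul]

theorem affineIndependent_iff_comb {ι : Type*} [Fintype ι] {p : ι → E3} :
    AffineIndependent ℝ p ↔ ∀ w : ι → ℝ, ∑ i, w i = 0 → comb p w = 0 → w = 0 := by
  constructor
  · intro h w h1 h2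
    funext i
    exact h.eq_zero_of_sum_eq_zero h1 h2 i (Finset.mem_univ i)
  · intro h
    rw [affineIndependent_iff]
    classical
    intro s w h1 h2 i hi
    have := congrFun (h (fun j => if j ∈ s then w j else 0) (by simpa using h1)
      (by simpa [comb, ite_smul] using h2)) i
    simpa [hi] using this

theorem eq_of_comb_eq {ι : Type*} [Fintype ι] {p : ι → E3} (hp : AffineIndependent ℝ p)
    {a b : ι → ℝ} (hab : ∑ i, a i = ∑ i, b i) (h : comb p a = comb p b) : a = b :=
  sub_eq_zero.1 (affineIndependent_iff_comb.1 hp (a - b) (by simp [hab]) (by rw [comb_sub, h, sub_self]))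

/-- Barycentric coordinates with respect to affinely independent points are Lipschitz functions. -/
theorem exists_comb_antilipschitz {ι : Type*} [Fintype ι] {p : ι → E3}
    (hp : AffineIndependent ℝ p) : ∃ c > 0, ∀ a b : ι → ℝ, ∑ i, a i = ∑ i, b i →
      c * ‖a - b‖ ≤ ‖comb p a - comb p b‖ := by
  let L : (ι → ℝ) →ₗ[ℝ] E3 × ℝ :=
    { toFun := fun a => (comb p a, ∑ i, a i)
      map_add' := fun a b => by simp [comb_add, Finset.sum_add_distrib]
      map_smul' := fun c a => by simp [comb_smul, Finset.mul_sum] }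
  have hL : LinearMap.ker L = ⊥ := by
    rw [LinearMap.ker_eq_bot']
    intro w hw
    exact affineIndependent_iff_comb.1 hp w (congrArg Prod.snd hw) (congrArg Prod.fst hw)
  obtain ⟨K, hK, h⟩ := L.exists_antilipschitzWith hL
  have hK' : (0 : ℝ) < K := hK
  refine ⟨(K : ℝ)⁻¹, inv_pos.2 hK', fun a b hab => ?_⟩
  have h1 := h.le_mul_dist a b
  rw [inv_mul_le_iff₀ hK', ← dist_eq_norm]
  refine h1.trans (le_of_eq ?_)
  congr 1
  rw [dist_eq_norm, ← map_sub]
  change ‖(comb p (a - b), ∑ i, (a - b) i)‖ = _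
  have h2 : ∑ i, (a - b) i = 0 := by simp [hab]
  rw [h2, comb_sub, Prod.norm_mk, norm_zero, max_eq_left (norm_nonneg _)]

theorem comb_interp {ι : Type*} [Fintype ι] (v v' : ι → E3) (t : ℝ) (a : ι → ℝ) :
    comb v a + t • (comb v' a - comb v a) = comb (fun i => v i + t • (v' i - v i)) a := by
  simp only [comb, smul_add, Finset.sum_add_distrib, smul_sub, Finset.sum_sub_distrib,
    Finset.smul_sum, smul_comm t]

theorem exists_comb_sub_lipschitz {ι : Type*} [Fintype ι] (v v' : ι → E3) :
    ∃ C ≥ 0, ∀ a b : ι → ℝ,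
      ‖(comb v' a - comb v a) - (comb v' b - comb v b)‖ ≤ C * ‖a - b‖ := by
  refine ⟨∑ i, ‖v' i - v i‖, by positivity, fun a b => ?_⟩
  have : (comb v' a - comb v a) - (comb v' b - comb v b) = ∑ i, (a - b) i • (v' i - v i) := by
    simp [comb, smul_sub, sub_smul, Finset.sum_sub_distrib]
    abel
  rw [this, Finset.sum_mul]
  refine (norm_sum_le _ _).trans (Finset.sum_le_sum fun i _ => ?_)
  rw [norm_smul, mul_comm]
  exact mul_le_mul_of_nonneg_left (norm_le_pi_norm _ i) (norm_nonneg _)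

/-- Two polyhedral curves whose vertices move linearly, staying affinely independent and keeping
the curves disjoint, move by an ambient isotopy. The curves are given by compact sets `K, L` of
barycentric coordinates. -/
theorem ambientIsotopic_comb {ι κ : Type*} [Fintype ι] [Fintype κ] {K : Set (ι → ℝ)}
    {L : Set (κ → ℝ)} (hK : IsCompact K) (hL : IsCompact L) (hK1 : ∀ a ∈ K, ∑ i, a i = 1)
    (hL1 : ∀ a ∈ L, ∑ i, a i = 1) (v v' : ι → E3) (w w' : κ → E3)
    (hv : ∀ t ∈ Icc (0 : ℝ) 1, AffineIndependent ℝ fun i => v i + t • (v' i - v i))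
    (hw : ∀ t ∈ Icc (0 : ℝ) 1, AffineIndependent ℝ fun i => w i + t • (w' i - w i))
    (hdisj : ∀ t ∈ Icc (0 : ℝ) 1, Disjoint (comb (fun i => v i + t • (v' i - v i)) '' K)
      (comb (fun i => w i + t • (w' i - w i)) '' L)) :
    AmbientIsotopic (comb v '' K ∪ comb w '' L) (comb v' '' K ∪ comb w' '' L) := by
  have := isCompact_iff_compactSpace.1 hK
  have := isCompact_iff_compactSpace.1 hL
  obtain ⟨A, hA, hA'⟩ := exists_comb_sub_lipschitz v v'
  obtain ⟨B, hB, hB'⟩ := exists_comb_sub_lipschitz w w'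
  obtain ⟨C, hC⟩ := isCompact_univ.exists_bound_of_continuousOn
    (f := fun q : K × L => (comb v' q.1 - comb v q.1) - (comb w' q.2 - comb w q.2)) (by
      have := continuous_comb v
      have := continuous_comb v'
      have := continuous_comb w
      have := continuous_comb w'
      fun_prop)
  obtain ⟨g, hg, h1, h2⟩ := exists_isIsotopyEnd_of_lineMap_pair (X := K) (Y := L)
    (fun x y => ‖(x : ι → ℝ) - y‖) (fun x y => ‖(x : κ → ℝ) - y‖) (fun x => comb v x)
    (fun x => comb v' x) (fun x => comb w x) (fun x => comb w' x) (C := max (max A B) |C|)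
    (fun x y => (hA' x y).trans (mul_le_mul_of_nonneg_right (by simp) (norm_nonneg _)))
    (fun x y => (hB' x y).trans (mul_le_mul_of_nonneg_right (by simp) (norm_nonneg _)))
    (fun x y => (hC (x, y) (mem_univ _)).trans ((le_abs_self _).trans (le_max_right _ _)))
    (fun t ht => by
      obtain ⟨c, hc, hc'⟩ := exists_comb_antilipschitz (hv t ht)
      refine ⟨c, hc, fun x y => ?_⟩
      rw [comb_interp, comb_interp]
      exact hc' _ _ ((hK1 _ x.2).trans (hK1 _ y.2).symm))
    (fun t ht => by
      obtain ⟨c, hc, hc'⟩ := exists_comb_antilipschitz (hw t ht)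
      refine ⟨c, hc, fun x y => ?_⟩
      rw [comb_interp, comb_interp]
      exact hc' _ _ ((hL1 _ x.2).trans (hL1 _ y.2).symm))
    (fun t ht => by
      simp only [comb_interp]
      exact exists_pos_le_norm_sub ((continuous_comb _).comp continuous_subtype_val)
        ((continuous_comb _).comp continuous_subtype_val) (fun x y =>
          (hdisj t ht).ne_of_mem (mem_image_of_mem _ x.2) (mem_image_of_mem _ y.2)))
    (fun _ _ => norm_nonneg _) (fun _ _ => norm_nonneg _) (by positivity)
  refine ambientIsotopic_iff.2 ⟨g, hg, ?_⟩
  rw [image_union, ← image_comp, ← image_comp]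
  congr 1
  · exact image_congr fun x hx => h1 ⟨x, hx⟩
  · exact image_congr fun x hx => h2 ⟨x, hx⟩

/-- Barycentric coordinates with respect to four affinely independent points, as affine maps. -/
theorem exists_coord {p : Fin 4 → E3} (hp : AffineIndependent ℝ p) :
    ∃ c : Fin 4 → E3 →ᵃ[ℝ] ℝ, (∀ x, ∑ i, c i x = 1) ∧ (∀ x, comb p (fun i => c i x) = x) ∧
      ∀ b : Fin 4 → ℝ, ∑ i, b i = 1 → ∀ i, c i (comb p b) = b i := by
  have htop : affineSpan ℝ (range p) = ⊤ :=
    hp.affineSpan_eq_top_iff_card_eq_finrank_add_one.2 (by simp)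
  let B : AffineBasis (Fin 4) ℝ E3 := ⟨p, hp, htop⟩
  have h2 : ∀ x, comb p (fun i => B.coord i x) = x := fun x => B.linear_combination_coord_eq_self x
  refine ⟨B.coord, B.sum_coord_apply_eq_one, h2, fun b hb i => ?_⟩
  exact congrFun (eq_of_comb_eq hp ((B.sum_coord_apply_eq_one _).trans hb.symm) (h2 (comb p b))) i

theorem exists_affineMap_eq {p : Fin 4 → E3} (hp : AffineIndependent ℝ p) {V : Type*}
    [AddCommGroup V] [Module ℝ V] (q : Fin 4 → V) : ∃ h : E3 →ᵃ[ℝ] V, ∀ i, h (p i) = q i := by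
  classical
  obtain ⟨c, h1, h2, h3⟩ := exists_coord hp
  have hpi : ∀ i, comb p (Pi.single i 1) = p i := by
    intro i; simp [comb, Pi.single_apply, ite_smul]
  refine ⟨∑ i, (LinearMap.toSpanSingleton ℝ V (q i)).toAffineMap.comp (c i), fun i => ?_⟩
  have hc : ∀ j, c j (p i) = (Pi.single i (1 : ℝ) : Fin 4 → ℝ) j := by
    intro j
    have := h3 (Pi.single i 1) (by simp) j
    rwa [hpi] at this
  have hsum : ∀ x, (∑ i, (LinearMap.toSpanSingleton ℝ V (q i)).toAffineMap.comp (c i) : E3 →ᵃ[ℝ] V) x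
      = ∑ i, c i x • q i := by
    intro x
    simp [Fin.sum_univ_four]
  rw [hsum]
  simp [hc, Pi.single_apply, ite_smul]

theorem exists_affineEquiv_eq {p q : Fin 4 → E3} (hp : AffineIndependent ℝ p)
    (hq : AffineIndependent ℝ q) : ∃ Ψ : E3 ≃ᵃ[ℝ] E3, ∀ i, Ψ (p i) = q i := by
  obtain ⟨F, hF⟩ := exists_affineMap_eq hp q
  obtain ⟨c, h1, h2, h3⟩ := exists_coord hp
  obtain ⟨c', h1', h2', h3'⟩ := exists_coord hq
  have hFx : ∀ x, F x = comb q (fun i => c i x) := by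
    intro x
    conv_lhs => rw [← h2 x, affineMap_comb F p (h1 x)]
    simp [comb, hF]
  refine ⟨AffineEquiv.ofBijective (φ := F) ⟨fun x y hxy => ?_, fun y => ?_⟩, hF⟩
  · rw [hFx, hFx] at hxy
    have := eq_of_comb_eq hq ((h1 x).trans (h1 y).symm) hxy
    rw [← h2 x, ← h2 y, this]
  · refine ⟨comb p (fun i => c' i y), ?_⟩
    rw [hFx]
    simp only [h3 _ (h1' y), h2']

/-! ### Triangles and quadrilaterals as curves around an axis -/

/-- Barycentric coordinates of the boundary of a triangle. -/
def triangleCoords : Set (Fin 3 → ℝ) :=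
  {c | (∀ i, 0 ≤ c i) ∧ ∑ i, c i = 1 ∧ ∃ i, c i = 0}

/-- Barycentric coordinates of the closed quadrilateral with vertices `0, 1, 2, 3`, as a curve in
the boundary of the tetrahedron: no point has positive weight at two opposite vertices. -/
def quadCoords : Set (Fin 4 → ℝ) :=
  {b | (∀ i, 0 ≤ b i) ∧ ∑ i, b i = 1 ∧ b 0 * b 2 = 0 ∧ b 1 * b 3 = 0}

/-- The boundary curve of the triangle with vertices `d i`. -/
def triangle (d : Fin 3 → E3) : Set E3 := comb d '' triangleCoords

/-- The closed flat disk bounded by a triangle. -/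
def disk (d : Fin 3 → E3) : Set E3 := comb d '' {c | (∀ i, 0 ≤ c i) ∧ ∑ i, c i = 1}

/-- The relative interior of the flat disk bounded by a triangle. -/
def openDisk (d : Fin 3 → E3) : Set E3 := comb d '' {c | (∀ i, 0 < c i) ∧ ∑ i, c i = 1}

/-- The closed quadrilateral with vertices `p 0, p 1, p 2, p 3`. -/
def quad (p : Fin 4 → E3) : Set E3 := comb p '' quadCoords

theorem isCompact_triangleCoords : IsCompact triangleCoords := by
  refine (isCompact_stdSimplex ℝ (Fin 3)).of_isClosed_subset ?_ fun c hc => ⟨hc.1, hc.2.1⟩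
  have : triangleCoords = {c : Fin 3 → ℝ | ∀ i, 0 ≤ c i} ∩ ({c | ∑ i, c i = 1} ∩
      {c | c 0 * c 1 * c 2 = 0}) := by
    ext c
    simp [triangleCoords, Fin.exists_fin_succ, or_assoc]
  rw [this]
  refine IsClosed.inter ?_ (IsClosed.inter ?_ ?_)
  · simp only [ofPred_forall]
    exact isClosed_iInter fun i => isClosed_le continuous_const (continuous_apply i)
  · exact isClosed_eq (by fun_prop) continuous_const
  · exact isClosed_eq (by fun_prop) continuous_const

theorem isCompact_quadCoords : IsCompact quadCoords := by
  refine (isCompact_stdSimplex ℝ (Fin 4)).of_isClosed_subset ?_ fun c hc => ⟨hc.1, hc.2.1⟩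
  refine IsClosed.inter (s₁ := {c : Fin 4 → ℝ | ∀ i, 0 ≤ c i}) ?_
    (IsClosed.inter (s₁ := {c : Fin 4 → ℝ | ∑ i, c i = 1}) ?_
    (IsClosed.inter (s₁ := {c : Fin 4 → ℝ | c 0 * c 2 = 0}) (s₂ := {c | c 1 * c 3 = 0}) ?_ ?_))
  · simp only [ofPred_forall]
    exact isClosed_iInter fun i => isClosed_le continuous_const (continuous_apply i)
  · exact isClosed_eq (by fun_prop) continuous_const
  · exact isClosed_eq (by fun_prop) continuous_const
  · exact isClosed_eq (by fun_prop) continuous_const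

theorem IsLip.max {φ ψ : Circle → ℝ} (h : IsLip φ) (k : IsLip ψ) :
    IsLip fun u => max (φ u) (ψ u) := by
  obtain ⟨K, hK, h⟩ := h
  obtain ⟨L, hL, k⟩ := k
  refine ⟨Max.max K L, by positivity, fun u v => (abs_max_sub_max_le_max _ _ _ _).trans (max_le ?_ ?_)⟩
  · exact (h u v).trans (mul_le_mul_of_nonneg_right (le_max_left _ _) (norm_nonneg _))
  · exact (k u v).trans (mul_le_mul_of_nonneg_right (le_max_right _ _) (norm_nonneg _))

theorem isLip_linear (a b : ℝ) : IsLip fun u : Circle => a * (u : ℂ).re + b * (u : ℂ).im :=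
  (isLip_re.const_mul a).add (isLip_im.const_mul b)

/-- A triangle in the plane `z = 0` around the origin is a curve around the vertical axis. -/
theorem exists_radius_triangle {d : Fin 3 → E3} (hd : AffineIndependent ℝ d)
    (hz : ∀ i, d i 2 = 0) {c : Fin 3 → ℝ} (hc : ∀ i, 0 < c i) (hc1 : ∑ i, c i = 1)
    (h0 : comb d c = 0) :
    ∃ ρ : Circle → ℝ, IsLip ρ ∧ (∀ u, 0 < ρ u) ∧ triangle d = range (cyl ρ fun _ => 0) ∧
      (∀ (r : ℝ) (u : Circle), 0 < r → !₂[r * (u : ℂ).re, r * (u : ℂ).im, 0] ∈ openDisk d →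
        r < ρ u) ∧
      ∀ (r : ℝ) (u : Circle), 0 < r → r ≤ ρ u →
        !₂[r * (u : ℂ).re, r * (u : ℂ).im, 0] ∈ disk d := by
  have hind := affineIndependent_iff_comb.1 hd
  -- twice the signed area of the triangle
  set Δ : ℝ := (d 1 0 - d 0 0) * (d 2 1 - d 0 1) - (d 2 0 - d 0 0) * (d 1 1 - d 0 1) with hΔ
  have hΔ0 : Δ ≠ 0 := by
    intro h
    have key : ∀ α β : ℝ, α * (d 1 0 - d 0 0) + β * (d 2 0 - d 0 0) = 0 →
        α * (d 1 1 - d 0 1) + β * (d 2 1 - d 0 1) = 0 → α = 0 ∧ β = 0 := by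
      intro α β h1 h2
      have := hind ![-(α + β), α, β] (by simp [Fin.sum_univ_three]) (by
        ext j
        rw [comb_apply, Fin.sum_univ_three]
        fin_cases j
        · simp; linarith
        · simp; linarith
        · simp [hz])
      exact ⟨by simpa using congrFun this 1, by simpa using congrFun this 2⟩
    obtain ⟨e1, e2⟩ := key (d 2 0 - d 0 0) (-(d 1 0 - d 0 0)) (by ring) (by linarith)
    obtain ⟨e3, e4⟩ := key (d 2 1 - d 0 1) (-(d 1 1 - d 0 1)) (by linarith) (by ring)
    have := (key 1 0 (by linarith) (by linarith)).1
    norm_num at this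
  -- the linear parts of the barycentric coordinates
  set L : Fin 3 → ℝ → ℝ → ℝ := ![
    fun x y => ((d 1 1 - d 2 1) * x + (d 2 0 - d 1 0) * y) / Δ,
    fun x y => ((d 2 1 - d 0 1) * x + (d 0 0 - d 2 0) * y) / Δ,
    fun x y => ((d 0 1 - d 1 1) * x + (d 1 0 - d 0 0) * y) / Δ] with hL
  have hL0 : ∀ x y, ∑ i, L i x y = 0 := by
    intro x y
    simp [hL, Fin.sum_univ_three]
    field_simp
    ring
  have hLx : ∀ x y, comb d (fun i => L i x y) = !₂[x, y, 0] := by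
    intro x y
    ext j
    rw [comb_apply, Fin.sum_univ_three]
    fin_cases j
    · simp [hL]; field_simp; rw [hΔ]; ring
    · simp [hL]; field_simp; rw [hΔ]; ring
    · simp [hz]
  have hLsmul : ∀ i r x y, L i (r * x) (r * y) = r * L i x y := by
    intro i r x y
    fin_cases i <;> simp [hL] <;> ring
  -- the barycentric coordinates of a point of the plane
  have hbary : ∀ x y (b : Fin 3 → ℝ), ∑ i, b i = 1 → comb d b = !₂[x, y, 0] →
      ∀ i, b i = c i + L i x y := by
    intro x y b hb hbx i
    have : b = c + fun i => L i x y := by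
      refine eq_of_comb_eq hd ?_ ?_
      · simp [Finset.sum_add_distrib, hL0, hb, hc1]
      · rw [comb_add, h0, zero_add, hLx, hbx]
    exact congrFun this i
  -- `g i` is the reciprocal of the distance from the origin to the `i`-th side in the direction
  -- `u`, so the radius of the triangle is the reciprocal of the largest `g i`
  set g : Fin 3 → Circle → ℝ := fun i u => -L i (u : ℂ).re (u : ℂ).im / c i with hg
  have hglip : ∀ i, IsLip (g i) := by
    intro i
    have : ∃ a b : ℝ, g i = fun u : Circle => a * (u : ℂ).re + b * (u : ℂ).im := by
      fin_cases i
      · exact ⟨-(d 1 1 - d 2 1) / Δ / c 0, -(d 2 0 - d 1 0) / Δ / c 0, by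
          funext u; simp [hg, hL]; ring⟩
      · exact ⟨-(d 2 1 - d 0 1) / Δ / c 1, -(d 0 0 - d 2 0) / Δ / c 1, by
          funext u; simp [hg, hL]; ring⟩
      · exact ⟨-(d 0 1 - d 1 1) / Δ / c 2, -(d 1 0 - d 0 0) / Δ / c 2, by
          funext u; simp [hg, hL]; ring⟩
    obtain ⟨a, b, h⟩ := this
    rw [h]
    exact isLip_linear a b
  set G : Circle → ℝ := fun u => max (max (g 0 u) (g 1 u)) (g 2 u) with hG
  have hGlip : IsLip G := ((hglip 0).max (hglip 1)).max (hglip 2)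
  have hGle : ∀ i u, g i u ≤ G u := by
    intro i u
    fin_cases i
    · exact (le_max_left _ _).trans (le_max_left _ _)
    · exact (le_max_right _ _).trans (le_max_left _ _)
    · exact le_max_right _ _
  have hGex : ∀ u, ∃ i, g i u = G u := by
    intro u
    rcases max_choice (max (g 0 u) (g 1 u)) (g 2 u) with h | h
    · rcases max_choice (g 0 u) (g 1 u) with h' | h'
      · exact ⟨0, (h.trans h').symm⟩
      · exact ⟨1, (h.trans h').symm⟩
    · exact ⟨2, h.symm⟩
  have hgL : ∀ i r (u : Circle), c i + L i (r * (u : ℂ).re) (r * (u : ℂ).im) = c i * (1 - r * g i u) := by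
    intro i r u
    rw [hLsmul, hg]
    have := (hc i).ne'
    field_simp
    ring
  have hGpos : ∀ u, 0 < G u := by
    intro u
    by_contra! hle
    have h1 : ∀ i, 0 ≤ L i (u : ℂ).re (u : ℂ).im := by
      intro i
      have := (hGle i u).trans hle
      rw [hg] at this
      simp only [div_le_iff₀ (hc i), zero_mul] at this
      linarith
    have h2 : ∀ i, L i (u : ℂ).re (u : ℂ).im = 0 := by
      intro i
      exact (Finset.sum_eq_zero_iff_of_nonneg fun i _ => h1 i).1 (hL0 _ _) i (Finset.mem_univ i)
    have h3 := hLx (u : ℂ).re (u : ℂ).im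
    simp only [h2] at h3
    have h4 : (0 : E3) = !₂[(u : ℂ).re, (u : ℂ).im, 0] := by rw [← h3]; simp [comb]
    have e0 := congrArg (fun p : E3 => p 0) h4
    have e1 := congrArg (fun p : E3 => p 1) h4
    simp at e0 e1
    have := normSq_circle u
    rw [← e0, ← e1] at this
    norm_num at this
  refine ⟨fun u => (G u)⁻¹, hGlip.inv hGpos, fun u => inv_pos.2 (hGpos u), ?_, ?_, ?_⟩
  · ext p
    constructor
    · rintro ⟨b, ⟨hb0, hb1, i, hi⟩, rfl⟩
      set x := comb d b 0
      set y := comb d b 1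
      have hp : comb d b = !₂[x, y, 0] := by
        ext j
        fin_cases j
        · rfl
        · rfl
        · simp [comb_apply, hz]
      have hb := hbary x y b hb1 hp
      have hxy : 0 < x ^ 2 + y ^ 2 := by
        by_contra! hle
        have hx : x = 0 := by nlinarith [sq_nonneg x, sq_nonneg y]
        have hy : y = 0 := by nlinarith [sq_nonneg x, sq_nonneg y]
        have := hb i
        rw [hx, hy, hi] at this
        have h5 := hLsmul i 0 0 0
        simp only [zero_mul] at h5
        linarith [hc i]
      obtain ⟨r, hr, u, hx, hy⟩ := exists_polar hxy
      rw [hx, hy] at hb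
      have hrG : r = (G u)⁻¹ := by
        refine eq_inv_of_mul_eq_one_left ?_
        refine le_antisymm ?_ ?_
        · obtain ⟨j, hj⟩ := hGex u
          have := hb0 j
          rw [hb j, hgL, hj] at this
          linarith [nonneg_of_mul_nonneg_right this (hc j)]
        · have := hb i
          rw [hi, hgL] at this
          have h6 : 1 - r * g i u = 0 := (mul_eq_zero.1 this.symm).resolve_left (hc i).ne'
          nlinarith [mul_le_mul_of_nonneg_left (hGle i u) hr.le]
      refine ⟨u, ?_⟩
      rw [hp, hx, hy, hrG]
      rfl
    · rintro ⟨u, rfl⟩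
      refine ⟨fun i => c i + L i ((G u)⁻¹ * (u : ℂ).re) ((G u)⁻¹ * (u : ℂ).im), ⟨?_, ?_, ?_⟩, ?_⟩
      · intro i
        simp only [hgL]
        refine mul_nonneg (hc i).le (sub_nonneg.2 ?_)
        rw [inv_mul_le_iff₀ (hGpos u), mul_one]
        exact hGle i u
      · simp [Finset.sum_add_distrib, hL0, hc1]
      · obtain ⟨j, hj⟩ := hGex u
        refine ⟨j, ?_⟩
        simp only [hgL]
        rw [hj, inv_mul_cancel₀ (hGpos u).ne']
        ring
      · change comb d (c + fun i => L i ((G u)⁻¹ * (u : ℂ).re) ((G u)⁻¹ * (u : ℂ).im)) = _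
        rw [comb_add, h0, zero_add, hLx]
        rfl
  · rintro r u hr ⟨b, ⟨hb0, hb1⟩, hb⟩
    have hb := hbary _ _ b hb1 hb
    obtain ⟨j, hj⟩ := hGex u
    have := hb0 j
    rw [hb j, hgL, hj] at this
    have h6 := pos_of_mul_pos_right this (hc j).le
    change r < (G u)⁻¹
    rw [← one_div, lt_div_iff₀ (hGpos u)]
    linarith
  · intro r u hr hru
    refine ⟨fun i => c i + L i (r * (u : ℂ).re) (r * (u : ℂ).im), ⟨?_, ?_⟩, ?_⟩
    · intro i
      simp only [hgL]
      refine mul_nonneg (hc i).le (sub_nonneg.2 ?_)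
      change r ≤ (G u)⁻¹ at hru
      rw [← one_div, le_div_iff₀ (hGpos u)] at hru
      nlinarith [mul_le_mul_of_nonneg_left (hGle i u) hr.le]
    · simp [Finset.sum_add_distrib, hL0, hc1]
    · change comb d (c + fun i => L i (r * (u : ℂ).re) (r * (u : ℂ).im)) = _
      rw [comb_add, h0, zero_add, hLx]

/-! ### Quadrilaterals in normal position -/

/-- The positively homogeneous function of `(x, y)` that is linear on the four sectors cut out by
the diagonals, with value `b i` at `(1,1), (-1,1), (-1,-1), (1,-1)`. -/
noncomputable def tent (b : Fin 4 → ℝ) (x y : ℝ) : ℝ :=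
  b 0 * max ((x + y) / 2) 0 + b 1 * max ((y - x) / 2) 0 + b 2 * max (-((x + y) / 2)) 0 +
    b 3 * max (-((y - x) / 2)) 0

/-- The barycentric coordinates of the point in direction `(x, y)` of the quadrilateral in normal
position. -/
noncomputable def quadPoint (b : Fin 4 → ℝ) (x y : ℝ) : Fin 4 → ℝ :=
  (tent b x y)⁻¹ • ![b 0 * max ((x + y) / 2) 0, b 1 * max ((y - x) / 2) 0,
    b 2 * max (-((x + y) / 2)) 0, b 3 * max (-((y - x) / 2)) 0]

theorem tent_mul (b : Fin 4 → ℝ) {r : ℝ} (hr : 0 ≤ r) (x y : ℝ) :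
    tent b (r * x) (r * y) = r * tent b x y := by
  have e : ∀ t, max (r * t) 0 = r * max t 0 := fun t => by
    rw [mul_max_of_nonneg _ _ hr, mul_zero]
  have e1 : (r * x + r * y) / 2 = r * ((x + y) / 2) := by ring
  have e2 : (r * y - r * x) / 2 = r * ((y - x) / 2) := by ring
  rw [tent, tent, e1, e2, ← mul_neg, ← mul_neg, e, e, e, e]
  ring

theorem isLip_tent (b : Fin 4 → ℝ) : IsLip fun u : Circle => tent b (u : ℂ).re (u : ℂ).im := by
  have key : ∀ α β : ℝ, IsLip fun u : Circle => max (α * (u : ℂ).re + β * (u : ℂ).im) 0 :=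
    fun α β => (isLip_linear α β).max (isLip_const 0)
  have := ((((key (1/2) (1/2)).const_mul (b 0)).add ((key (-1/2) (1/2)).const_mul (b 1))).add
    ((key (-1/2) (-1/2)).const_mul (b 2))).add ((key (1/2) (-1/2)).const_mul (b 3))
  convert this using 2 with u
  rw [tent]
  ring_nf

theorem tent_pos {b : Fin 4 → ℝ} (hb : ∀ i, 0 < b i) {x y : ℝ} (h : 0 < x ^ 2 + y ^ 2) :
    0 < tent b x y := by
  have n0 : 0 ≤ b 0 * max ((x + y) / 2) 0 := mul_nonneg (hb 0).le (le_max_right _ _)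
  have n1 : 0 ≤ b 1 * max ((y - x) / 2) 0 := mul_nonneg (hb 1).le (le_max_right _ _)
  have n2 : 0 ≤ b 2 * max (-((x + y) / 2)) 0 := mul_nonneg (hb 2).le (le_max_right _ _)
  have n3 : 0 ≤ b 3 * max (-((y - x) / 2)) 0 := mul_nonneg (hb 3).le (le_max_right _ _)
  rw [tent]
  rcases lt_trichotomy (x + y) 0 with h1 | h1 | h1
  · have := mul_pos (hb 2) (lt_max_of_lt_left (b := -((x + y) / 2)) (c := 0) (by linarith))
    linarith
  · rcases lt_trichotomy (y - x) 0 with h2 | h2 | h2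
    · have := mul_pos (hb 3) (lt_max_of_lt_left (b := -((y - x) / 2)) (c := 0) (by linarith))
      linarith
    · exfalso
      have hx : x = 0 := by linarith
      have hy : y = 0 := by linarith
      rw [hx, hy] at h
      norm_num at h
    · have := mul_pos (hb 1) (lt_max_of_lt_left (b := (y - x) / 2) (c := 0) (by linarith))
      linarith
  · have := mul_pos (hb 0) (lt_max_of_lt_left (b := (x + y) / 2) (c := 0) (by linarith))
    linarith

theorem sum_quadPoint {b : Fin 4 → ℝ} {x y : ℝ} (h : tent b x y ≠ 0) :
    ∑ i, quadPoint b x y i = 1 := by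
  simp only [quadPoint, Fin.sum_univ_four, Pi.smul_apply, smul_eq_mul, ← mul_add]
  exact inv_mul_cancel₀ h

theorem max_mul_max_neg (t : ℝ) : max t 0 * max (-t) 0 = 0 := by
  rcases le_total t 0 with h | h
  · rw [max_eq_right h, zero_mul]
  · rw [max_eq_right (neg_nonpos.2 h), mul_zero]

theorem max_sub_max_neg (t : ℝ) : max t 0 - max (-t) 0 = t := by
  rcases le_total t 0 with h | h
  · rw [max_eq_right h, max_eq_left (neg_nonneg.2 h)]; ring
  · rw [max_eq_left h, max_eq_right (neg_nonpos.2 h)]; ring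

theorem quadPoint_mem {b : Fin 4 → ℝ} (hb : ∀ i, 0 < b i) {x y : ℝ} (h : 0 < x ^ 2 + y ^ 2) :
    quadPoint b x y ∈ quadCoords := by
  have ht := tent_pos hb h
  refine ⟨fun i => ?_, sum_quadPoint ht.ne', ?_, ?_⟩
  · refine mul_nonneg (inv_nonneg.2 ht.le) ?_
    fin_cases i
    · exact mul_nonneg (hb 0).le (le_max_right _ _)
    · exact mul_nonneg (hb 1).le (le_max_right _ _)
    · exact mul_nonneg (hb 2).le (le_max_right _ _)
    · exact mul_nonneg (hb 3).le (le_max_right _ _)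
  · have := max_mul_max_neg ((x + y) / 2)
    simp only [quadPoint, Pi.smul_apply, smul_eq_mul, Matrix.cons_val]
    generalize max ((x + y) / 2) 0 = X at *
    generalize max (-((x + y) / 2)) 0 = Y at *
    linear_combination (tent b x y)⁻¹ * (tent b x y)⁻¹ * b 0 * b 2 * this
  · have := max_mul_max_neg ((y - x) / 2)
    simp only [quadPoint, Pi.smul_apply, smul_eq_mul, Matrix.cons_val]
    generalize max ((y - x) / 2) 0 = X at *
    generalize max (-((y - x) / 2)) 0 = Y at *
    linear_combination (tent b x y)⁻¹ * (tent b x y)⁻¹ * b 1 * b 3 * this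

/-- The vertices of a quadrilateral in normal position. -/
noncomputable def normalVertex (b e : Fin 4 → ℝ) : Fin 4 → E3 :=
  ![!₂[(b 0)⁻¹, (b 0)⁻¹, (b 0)⁻¹ * e 0], !₂[-(b 1)⁻¹, (b 1)⁻¹, (b 1)⁻¹ * e 1],
    !₂[-(b 2)⁻¹, -(b 2)⁻¹, (b 2)⁻¹ * e 2], !₂[(b 3)⁻¹, -(b 3)⁻¹, (b 3)⁻¹ * e 3]]

theorem comb_normalVertex (b e a : Fin 4 → ℝ) : comb (normalVertex b e) a =
    !₂[a 0 / b 0 - a 1 / b 1 - a 2 / b 2 + a 3 / b 3, a 0 / b 0 + a 1 / b 1 - a 2 / b 2 - a 3 / b 3,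
      a 0 / b 0 * e 0 + a 1 / b 1 * e 1 + a 2 / b 2 * e 2 + a 3 / b 3 * e 3] := by
  ext j
  rw [comb_apply, Fin.sum_univ_four]
  fin_cases j <;> simp [normalVertex] <;> ring

/-- In normal position, the point of the quadrilateral over a direction has distance `1 / tent b` to
the axis, and height `tent e / tent b`. -/
theorem comb_normalVertex_quadPoint {b : Fin 4 → ℝ} (e : Fin 4 → ℝ) (hb : ∀ i, b i ≠ 0)
    (x y : ℝ) : comb (normalVertex b e) (quadPoint b x y) =
      !₂[(tent b x y)⁻¹ * x, (tent b x y)⁻¹ * y, tent e x y * (tent b x y)⁻¹] := by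
  have h0 := hb 0
  have h1 := hb 1
  have h2 := hb 2
  have h3 := hb 3
  have m1 := max_sub_max_neg ((x + y) / 2)
  have m2 := max_sub_max_neg ((y - x) / 2)
  rw [comb_normalVertex]
  simp only [quadPoint, tent, Pi.smul_apply, smul_eq_mul, Matrix.cons_val]
  generalize max ((x + y) / 2) 0 = X at *
  generalize max ((y - x) / 2) 0 = Y at *
  generalize max (-((x + y) / 2)) 0 = X' at *
  generalize max (-((y - x) / 2)) 0 = Y' at *
  generalize (b 0 * X + b 1 * Y + b 2 * X' + b 3 * Y')⁻¹ = k at *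
  have c : ∀ i z, b i ≠ 0 → k * (b i * z) / b i = k * z := fun i z hi => by field_simp
  rw [c _ _ h0, c _ _ h1, c _ _ h2, c _ _ h3]
  ext j
  fin_cases j <;> simp
  · linear_combination k * (m1 - m2)
  · linear_combination k * (m1 + m2)
  · ring

theorem affineIndependent_normalVertex {b e : Fin 4 → ℝ} (hb : ∀ i, 0 < b i) (hb1 : ∑ i, b i = 1)
    (he : ∑ i, e i = 0) (he2 : e 0 + e 2 ≠ 0) : AffineIndependent ℝ (normalVertex b e) := by
  rw [affineIndependent_iff_comb]
  intro a ha h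
  rw [comb_normalVertex] at h
  have h0 := congrArg (fun q : E3 => q 0) h
  have h1 := congrArg (fun q : E3 => q 1) h
  have h2 := congrArg (fun q : E3 => q 2) h
  simp at h0 h1 h2
  set v : Fin 4 → ℝ := fun i => a i / b i with hv
  have hav : ∀ i, a i = b i * v i := fun i => by
    have := (hb i).ne'
    simp only [hv]
    field_simp
  change v 0 - v 1 - v 2 + v 3 = 0 at h0
  change v 0 + v 1 - v 2 - v 3 = 0 at h1
  change v 0 * e 0 + v 1 * e 1 + v 2 * e 2 + v 3 * e 3 = 0 at h2
  rw [Fin.sum_univ_four] at ha hb1 he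
  simp only [hav] at ha
  have e2 : v 2 = v 0 := by linarith
  have e3 : v 3 = v 1 := by linarith
  rw [e2, e3] at h2 ha
  have e1 : (v 0 - v 1) * (e 0 + e 2) = 0 := by linear_combination h2 - v 1 * he
  have e1 : v 0 = v 1 := sub_eq_zero.1 ((mul_eq_zero.1 e1).resolve_right he2)
  have e0 : v 1 = 0 := by
    rw [e1] at ha
    linear_combination ha - v 1 * hb1
  funext i
  rw [hav]
  fin_cases i <;> simp [e0, e1, e2, e3]

/-- A quadrilateral in normal position is a curve around the axis with explicit radius and height.
-/
theorem quad_normalVertex {b : Fin 4 → ℝ} (e : Fin 4 → ℝ) (hb : ∀ i, 0 < b i) :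
    quad (normalVertex b e) = range (cyl (fun u => (tent b (u : ℂ).re (u : ℂ).im)⁻¹)
      fun u => tent e (u : ℂ).re (u : ℂ).im * (tent b (u : ℂ).re (u : ℂ).im)⁻¹) := by
  ext q
  constructor
  · rintro ⟨a, ⟨h0, h1, h02, h13⟩, rfl⟩
    rw [comb_normalVertex]
    set v : Fin 4 → ℝ := fun i => a i / b i with hv
    have hav : ∀ i, a i = b i * v i := fun i => by
      have := (hb i).ne'
      simp only [hv]
      field_simp
    have hv0 : ∀ i, 0 ≤ v i := fun i => div_nonneg (h0 i) (hb i).le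
    have key : ∀ s t : ℝ, 0 ≤ s → 0 ≤ t → s * t = 0 →
        max (s - t) 0 = s ∧ max (-(s - t)) 0 = t := by
      intro s t hs ht hst
      rcases mul_eq_zero.1 hst with rfl | rfl
      · simp [ht]
      · simp [hs]
    obtain ⟨k0, k2⟩ := key (v 0) (v 2) (hv0 0) (hv0 2) (by
      rw [hav, hav] at h02
      have : (b 0 * b 2) * (v 0 * v 2) = 0 := by linarith
      exact (mul_eq_zero.1 this).resolve_left (mul_pos (hb 0) (hb 2)).ne')
    obtain ⟨k1, k3⟩ := key (v 1) (v 3) (hv0 1) (hv0 3) (by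
      rw [hav, hav] at h13
      have : (b 1 * b 3) * (v 1 * v 3) = 0 := by linarith
      exact (mul_eq_zero.1 this).resolve_left (mul_pos (hb 1) (hb 3)).ne')
    change !₂[v 0 - v 1 - v 2 + v 3, v 0 + v 1 - v 2 - v 3,
      v 0 * e 0 + v 1 * e 1 + v 2 * e 2 + v 3 * e 3] ∈ _
    set x := v 0 - v 1 - v 2 + v 3 with hx
    set y := v 0 + v 1 - v 2 - v 3 with hy
    have hX : (x + y) / 2 = v 0 - v 2 := by rw [hx, hy]; ring
    have hY : (y - x) / 2 = v 1 - v 3 := by rw [hx, hy]; ring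
    have htent : ∀ c, tent c x y = v 0 * c 0 + v 1 * c 1 + v 2 * c 2 + v 3 * c 3 := by
      intro c
      rw [tent, hX, hY, k0, k1, k2, k3]
      ring
    have htb : tent b x y = 1 := by
      rw [htent, ← h1, Fin.sum_univ_four, hav, hav, hav, hav]
      ring
    have hxy : 0 < x ^ 2 + y ^ 2 := by
      by_contra! hle
      have hx : x = 0 := by nlinarith [sq_nonneg x, sq_nonneg y]
      have hy : y = 0 := by nlinarith [sq_nonneg x, sq_nonneg y]
      rw [hx, hy] at htb
      simp [tent] at htb
    rw [← htent e]
    obtain ⟨r, hr, u, hxu, hyu⟩ := exists_polar hxy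
    rw [hxu, hyu] at htb ⊢
    rw [tent_mul _ hr.le] at htb ⊢
    refine ⟨u, ?_⟩
    have : (tent b (u : ℂ).re (u : ℂ).im)⁻¹ = r := (eq_inv_of_mul_eq_one_left htb).symm
    simp only [cyl, this]
    rw [mul_comm r (tent e _ _)]
  · rintro ⟨u, rfl⟩
    have hu : 0 < (u : ℂ).re ^ 2 + (u : ℂ).im ^ 2 := by rw [normSq_circle]; norm_num
    refine ⟨quadPoint b (u : ℂ).re (u : ℂ).im, quadPoint_mem hb hu, ?_⟩
    rw [comb_normalVertex_quadPoint e fun i => (hb i).ne']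
    rfl

theorem affineMap_image_comb {ι : Type*} [Fintype ι] (Ψ : E3 →ᵃ[ℝ] E3) (p : ι → E3)
    {K : Set (ι → ℝ)} (hK : ∀ a ∈ K, ∑ i, a i = 1) :
    Ψ '' (comb p '' K) = comb (fun i => Ψ (p i)) '' K := by
  rw [← image_comp]
  exact image_congr fun a ha => affineMap_comb Ψ p (hK a ha)

/-- A triangle and a quadrilateral with a common interior point can be moved simultaneously into
cylindrical form by an affine equivalence. The two radii are compared in a direction in which the
quadrilateral meets the plane of the triangle. -/
theorem exists_affineEquiv_cyl {d : Fin 3 → E3} {p : Fin 4 → E3} (hd : AffineIndependent ℝ d)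
    (hp : AffineIndependent ℝ p) {c : Fin 3 → ℝ} {b : Fin 4 → ℝ} (hc : ∀ i, 0 < c i)
    (hc1 : ∑ i, c i = 1) (hb : ∀ i, 0 < b i) (hb1 : ∑ i, b i = 1) (hcb : comb d c = comb p b)
    (h : E3 →ᵃ[ℝ] ℝ) (hh : ∀ i, h (d i) = 0) (he : b 0 * h (p 0) + b 2 * h (p 2) ≠ 0) :
    ∃ (Ψ : E3 ≃ᵃ[ℝ] E3) (ρ : Circle → ℝ), IsLip ρ ∧ (∀ u, 0 < ρ u) ∧
      Ψ '' (triangle d ∪ quad p) = range (cyl ρ fun _ => 0) ∪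
        range (cyl (fun u => (tent b (u : ℂ).re (u : ℂ).im)⁻¹) fun u =>
          tent (fun i => b i * h (p i)) (u : ℂ).re (u : ℂ).im *
            (tent b (u : ℂ).re (u : ℂ).im)⁻¹) ∧
      ∀ u : Circle, tent (fun i => b i * h (p i)) (u : ℂ).re (u : ℂ).im = 0 →
        (comb p (quadPoint b (u : ℂ).re (u : ℂ).im) ∈ openDisk d →
          (tent b (u : ℂ).re (u : ℂ).im)⁻¹ < ρ u) ∧
        ((tent b (u : ℂ).re (u : ℂ).im)⁻¹ ≤ ρ u →
          comb p (quadPoint b (u : ℂ).re (u : ℂ).im) ∈ disk d) := by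
  set e : Fin 4 → ℝ := fun i => b i * h (p i) with he'
  have hesum : ∑ i, e i = 0 := by
    have := affineMap_comb h p hb1
    rw [← hcb, affineMap_comb h d hc1] at this
    simpa [hh] using this.symm
  have hq := affineIndependent_normalVertex hb hb1 hesum he
  obtain ⟨Ψ, hΨ⟩ := exists_affineEquiv_eq hp hq
  have hcomb : ∀ a : Fin 4 → ℝ, ∑ i, a i = 1 → Ψ (comb p a) = comb (normalVertex b e) a := by
    intro a ha
    rw [show Ψ (comb p a) = (Ψ : E3 →ᵃ[ℝ] E3) (comb p a) from rfl, affineMap_comb _ p ha]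
    simp [comb, hΨ]
  have hne : ∀ i, b i ≠ 0 := fun i => (hb i).ne'
  -- `Ψ` is chosen so that `h` becomes the third coordinate, and the common interior point becomes
  -- the origin
  have hΨ2 : ∀ x, Ψ x 2 = h x := by
    intro x
    obtain ⟨co, h1, h2, -⟩ := exists_coord hp
    rw [← h2 x, hcomb _ (h1 x), affineMap_comb h p (h1 x), comb_normalVertex, Fin.sum_univ_four]
    have h0 := hne 0
    have h1 := hne 1
    have h2 := hne 2
    have h3 := hne 3
    simp [he']
    field_simp
  have hΨo : Ψ (comb p b) = 0 := by
    rw [hcomb b hb1, comb_normalVertex]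
    rw [Fin.sum_univ_four] at hesum
    ext j
    fin_cases j <;> simp [hne, hesum]
  have hΨd : ∀ a : Fin 3 → ℝ, ∑ i, a i = 1 → Ψ (comb d a) = comb (fun i => Ψ (d i)) a :=
    fun a ha => affineMap_comb (Ψ : E3 →ᵃ[ℝ] E3) d ha
  obtain ⟨ρ, hρ, hρ0, hT, hin, hout⟩ := exists_radius_triangle (d := fun i => Ψ (d i))
    ((Ψ.affineIndependent_iff).2 hd) (fun i => by rw [hΨ2, hh]) hc hc1
    (by rw [← hΨd c hc1, hcb, hΨo])
  refine ⟨Ψ, ρ, hρ, hρ0, ?_, ?_⟩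
  · rw [image_union, ← hT, ← quad_normalVertex e hb]
    congr 1
    · exact affineMap_image_comb (Ψ : E3 →ᵃ[ℝ] E3) d fun a ha => ha.2.1
    · rw [quad, quad, ← image_comp]
      exact image_congr fun a ha => hcomb a ha.2.1
  · intro u hu
    have hu2 : 0 < (u : ℂ).re ^ 2 + (u : ℂ).im ^ 2 := by rw [normSq_circle]; norm_num
    have htp := tent_pos hb hu2
    have hpt : Ψ (comb p (quadPoint b (u : ℂ).re (u : ℂ).im)) =
        !₂[(tent b (u : ℂ).re (u : ℂ).im)⁻¹ * (u : ℂ).re,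
          (tent b (u : ℂ).re (u : ℂ).im)⁻¹ * (u : ℂ).im, 0] := by
      rw [hcomb _ (sum_quadPoint htp.ne'), comb_normalVertex_quadPoint e hne, hu, zero_mul]
    constructor
    · rintro ⟨a, ⟨ha, ha1⟩, hax⟩
      refine hin _ u (inv_pos.2 htp) ⟨a, ⟨ha, ha1⟩, ?_⟩
      rw [← hpt, ← hΨd a ha1, hax]
    · intro hle
      obtain ⟨a, ⟨ha, ha1⟩, hax⟩ := hout _ u (inv_pos.2 htp) hle
      refine ⟨a, ⟨ha, ha1⟩, Ψ.injective ?_⟩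
      rw [hpt, ← hax, hΨd a ha1]

/-! ### Disks spanned by triangles and the edges crossing them -/

/-- The zero of the affine function `h` on the line through `a` and `b`. -/
noncomputable def crossPoint (h : E3 →ᵃ[ℝ] ℝ) (a b : E3) : E3 :=
  AffineMap.lineMap a b (h a / (h a - h b))

theorem affineMap_lineMap (h : E3 →ᵃ[ℝ] ℝ) (a b : E3) (t : ℝ) :
    h (AffineMap.lineMap a b t) = (1 - t) * h a + t * h b := by
  rw [AffineMap.apply_lineMap, AffineMap.lineMap_apply_ring]

theorem lineMap_eq (a b : E3) (t : ℝ) : AffineMap.lineMap a b t = (1 - t) • a + t • b :=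
  AffineMap.lineMap_apply_module a b t

theorem eq_crossPoint {h : E3 →ᵃ[ℝ] ℝ} {a b : E3} (hab : h a ≠ h b) {t : ℝ}
    (ht : h (AffineMap.lineMap a b t) = 0) : AffineMap.lineMap a b t = crossPoint h a b := by
  rw [crossPoint]
  congr 1
  rw [affineMap_lineMap] at ht
  rw [eq_div_iff (sub_ne_zero.2 hab)]
  linarith

theorem crossPoint_comm {h : E3 →ᵃ[ℝ] ℝ} {a b : E3} (hab : h a ≠ h b) :
    crossPoint h a b = crossPoint h b a := by
  have h1 : h a - h b ≠ 0 := sub_ne_zero.2 hab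
  have h2 : h b - h a ≠ 0 := sub_ne_zero.2 hab.symm
  rw [crossPoint, crossPoint, lineMap_eq, lineMap_eq, add_comm]
  congr 2 <;> field_simp <;> ring

theorem affineMap_crossPoint {h : E3 →ᵃ[ℝ] ℝ} {a b : E3} (hab : h a ≠ h b) :
    h (crossPoint h a b) = 0 := by
  have h1 : h a - h b ≠ 0 := sub_ne_zero.2 hab
  rw [crossPoint, affineMap_lineMap]
  field_simp
  ring

theorem crossPoint_param_mem {x y : ℝ} (h : x * y < 0) : x / (x - y) ∈ Ioo (0 : ℝ) 1 := by
  rcases mul_neg_iff.1 h with ⟨h1, h2⟩ | ⟨h1, h2⟩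
  · exact ⟨div_pos h1 (by linarith), (div_lt_one (by linarith)).2 (by linarith)⟩
  · exact ⟨div_pos_of_neg_of_neg h1 (by linarith), (div_lt_one_of_neg (by linarith)).2 (by linarith)⟩

theorem ne_of_mul_neg {x y : ℝ} (h : x * y < 0) : x ≠ y := by
  rintro rfl
  exact (mul_self_nonneg x).not_gt h

/-- A quadrilateral meets the zero set of an affine function at the crossing points of the edges
along which the function changes sign. -/
theorem exists_eq_crossPoint {p : Fin 4 → E3} {h : E3 →ᵃ[ℝ] ℝ} (hp : ∀ i, h (p i) ≠ 0) {z : E3}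
    (hz : z ∈ quad p) (h0 : h z = 0) :
    ∃ i, h (p i) * h (p (i + 1)) < 0 ∧ z = crossPoint h (p i) (p (i + 1)) := by
  obtain ⟨a, ⟨ha, ha1, h02, h13⟩, rfl⟩ := hz
  rw [Fin.sum_univ_four] at ha1
  have key : ∀ i j : Fin 4, 0 ≤ a i → 0 ≤ a j → a i + a j = 1 →
      comb p a = a i • p i + a j • p j → h (p i) * h (p j) < 0 ∧
        comb p a = crossPoint h (p i) (p j) := by
    intro i j hi hj hij he
    have e1 : comb p a = AffineMap.lineMap (p i) (p j) (a j) := by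
      rw [lineMap_eq, he, ← hij, add_sub_cancel_right]
    have e2 : a i * h (p i) + a j * h (p j) = 0 := by
      rw [e1, affineMap_lineMap, ← hij, add_sub_cancel_right] at h0
      exact h0
    have e3 : h (p i) * h (p j) < 0 := by
      have hs := mul_self_pos.2 (hp i)
      have hs' := mul_self_pos.2 (hp j)
      by_contra! hle
      have f1 : a i * (h (p i) * h (p i)) + a j * (h (p i) * h (p j)) = 0 := by
        linear_combination h (p i) * e2
      have f2 : a i * (h (p i) * h (p j)) + a j * (h (p j) * h (p j)) = 0 := by
        linear_combination h (p j) * e2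
      have g1 : a i * (h (p i) * h (p i)) = 0 := by
        have := mul_nonneg hi hs.le
        have := mul_nonneg hj hle
        linarith
      have g2 : a j * (h (p j) * h (p j)) = 0 := by
        have := mul_nonneg hj hs'.le
        have := mul_nonneg hi hle
        linarith
      have := (mul_eq_zero.1 g1).resolve_right hs.ne'
      have := (mul_eq_zero.1 g2).resolve_right hs'.ne'
      linarith
    refine ⟨e3, ?_⟩
    rw [e1] at h0 ⊢
    exact eq_crossPoint (ne_of_mul_neg e3) h0
  rcases mul_eq_zero.1 h02 with h0' | h2' <;> rcases mul_eq_zero.1 h13 with h1' | h3'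
  · exact ⟨2, key 2 3 (ha 2) (ha 3) (by linarith) (by simp [comb, Fin.sum_univ_four, h0', h1'])⟩
  · exact ⟨1, key 1 2 (ha 1) (ha 2) (by linarith) (by simp [comb, Fin.sum_univ_four, h0', h3'])⟩
  · exact ⟨3, key 3 0 (ha 3) (ha 0) (by linarith)
      (by simp [comb, Fin.sum_univ_four, h2', h1', add_comm])⟩
  · exact ⟨0, key 0 1 (ha 0) (ha 1) (by linarith) (by simp [comb, Fin.sum_univ_four, h2', h3'])⟩

theorem edge_subset_quad (p : Fin 4 → E3) (i : Fin 4) {t : ℝ} (ht : t ∈ Icc (0 : ℝ) 1) :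
    AffineMap.lineMap (p i) (p (i + 1)) t ∈ quad p := by
  obtain ⟨h0, h1⟩ := ht
  rw [lineMap_eq]
  fin_cases i
  · exact ⟨![1 - t, t, 0, 0], ⟨by simp [Fin.forall_fin_succ, h0, h1],
      by simp [Fin.sum_univ_four], by simp, by simp⟩, by simp [comb, Fin.sum_univ_four]⟩
  · exact ⟨![0, 1 - t, t, 0], ⟨by simp [Fin.forall_fin_succ, h0, h1],
      by simp [Fin.sum_univ_four], by simp, by simp⟩, by simp [comb, Fin.sum_univ_four]⟩
  · exact ⟨![0, 0, 1 - t, t], ⟨by simp [Fin.forall_fin_succ, h0, h1],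
      by simp [Fin.sum_univ_four], by simp, by simp⟩, by simp [comb, Fin.sum_univ_four]⟩
  · exact ⟨![t, 0, 0, 1 - t], ⟨by simp [Fin.forall_fin_succ, h0, h1],
      by simp [Fin.sum_univ_four], by simp, by simp⟩,
      by simp [comb, Fin.sum_univ_four, add_comm]⟩

theorem crossPoint_mem_quad {p : Fin 4 → E3} {h : E3 →ᵃ[ℝ] ℝ} {i : Fin 4}
    (hi : h (p i) * h (p (i + 1)) < 0) : crossPoint h (p i) (p (i + 1)) ∈ quad p :=
  edge_subset_quad p i (Ioo_subset_Icc_self (crossPoint_param_mem hi))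

theorem quad_rotate (p : Fin 4 → E3) : quad (fun i => p (i + 1)) = quad p := by
  have key : ∀ p : Fin 4 → E3, quad p ⊆ quad (fun i => p (i + 1)) := by
    rintro p _ ⟨a, ⟨h0, h1, h2, h3⟩, rfl⟩
    refine ⟨fun i => a (i + 1), ⟨fun i => h0 _, ?_, h3, by rw [mul_comm]; exact h2⟩, ?_⟩
    · rw [← h1]; exact Equiv.sum_comp (Equiv.addRight (1 : Fin 4)) a
    · exact Equiv.sum_comp (Equiv.addRight (1 : Fin 4)) fun i => a i • p i
  refine Subset.antisymm ?_ (key p)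
  refine (key _).trans ((key _).trans ((key _).trans (le_of_eq ?_)))
  congr 1
  funext i
  fin_cases i <;> rfl

theorem disk_eq (d : Fin 3 → E3) : disk d = triangle d ∪ openDisk d := by
  ext x
  constructor
  · rintro ⟨c, ⟨h0, h1⟩, rfl⟩
    by_cases h : ∃ i, c i = 0
    · exact Or.inl ⟨c, ⟨h0, h1, h⟩, rfl⟩
    · push Not at h
      exact Or.inr ⟨c, ⟨fun i => (h0 i).lt_of_ne' (h i), h1⟩, rfl⟩
  · rintro (⟨c, ⟨h0, h1, -⟩, rfl⟩ | ⟨c, ⟨h0, h1⟩, rfl⟩)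
    · exact ⟨c, ⟨h0, h1⟩, rfl⟩
    · exact ⟨c, ⟨fun i => (h0 i).le, h1⟩, rfl⟩

theorem disjoint_triangle_openDisk {d : Fin 3 → E3} (hd : AffineIndependent ℝ d) :
    Disjoint (triangle d) (openDisk d) := by
  rw [disjoint_left]
  rintro _ ⟨c, ⟨h0, h1, i, hi⟩, rfl⟩ ⟨c', ⟨h0', h1'⟩, he⟩
  have := eq_of_comb_eq hd (h1'.trans h1.symm) he
  have := h0' i
  simp_all

theorem convex_openDisk (d : Fin 3 → E3) : Convex ℝ (openDisk d) := by
  rintro _ ⟨a, ⟨h0, h1⟩, rfl⟩ _ ⟨b, ⟨k0, k1⟩, rfl⟩ s t hs ht hst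
  refine ⟨s • a + t • b, ⟨fun i => ?_, ?_⟩, by rw [comb_add, comb_smul, comb_smul]⟩
  · have := h0 i
    have := k0 i
    simp only [Pi.add_apply, Pi.smul_apply, smul_eq_mul]
    rcases hs.eq_or_lt with rfl | hs
    · simp_all
    · positivity
  · simp [Finset.sum_add_distrib, ← Finset.mul_sum, h1, k1, hst]

theorem affineMap_disk {d : Fin 3 → E3} {h : E3 →ᵃ[ℝ] ℝ} (hh : ∀ i, h (d i) = 0) {x : E3}
    (hx : x ∈ disk d) : h x = 0 := by
  obtain ⟨c, ⟨-, h1⟩, rfl⟩ := hx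
  rw [affineMap_comb h d h1]
  simp [hh]

theorem affineMap_triangle {d : Fin 3 → E3} {h : E3 →ᵃ[ℝ] ℝ} (hh : ∀ i, h (d i) = 0) {x : E3}
    (hx : x ∈ triangle d) : h x = 0 :=
  affineMap_disk hh (by rw [disk_eq]; exact Or.inl hx)

theorem affineMap_openDisk {d : Fin 3 → E3} {h : E3 →ᵃ[ℝ] ℝ} (hh : ∀ i, h (d i) = 0) {x : E3}
    (hx : x ∈ openDisk d) : h x = 0 :=
  affineMap_disk hh (by rw [disk_eq]; exact Or.inr hx)

theorem isCompact_quad (p : Fin 4 → E3) : IsCompact (quad p) :=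
  isCompact_quadCoords.image (continuous_comb p)

/-- The segment `a b` crosses the disk `d`, which lies in the zero set of `h`. -/
def Hit (d : Fin 3 → E3) (h : E3 →ᵃ[ℝ] ℝ) (a b : E3) : Prop :=
  h a * h b < 0 ∧ crossPoint h a b ∈ openDisk d

theorem hit_comm {d : Fin 3 → E3} {h : E3 →ᵃ[ℝ] ℝ} {a b : E3} : Hit d h a b ↔ Hit d h b a := by
  have key : ∀ a b, Hit d h a b → Hit d h b a := fun a b hab =>
    ⟨by rw [mul_comm]; exact hab.1, by rw [← crossPoint_comm (ne_of_mul_neg hab.1)]; exact hab.2⟩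
  exact ⟨key a b, key b a⟩

/-- A triangle and a disjoint quadrilateral in general position: the vertices of each are affinely
independent and the affine function `h` vanishes on the triangle, but at no vertex of the
quadrilateral. -/
structure GenericPair (d : Fin 3 → E3) (p : Fin 4 → E3) (h : E3 →ᵃ[ℝ] ℝ) : Prop where
  triangle_indep : AffineIndependent ℝ d
  quad_indep : AffineIndependent ℝ p
  vanish : ∀ i, h (d i) = 0
  ne_zero : ∀ i, h (p i) ≠ 0
  disj : Disjoint (triangle d) (quad p)

theorem GenericPair.rotate {d p h} (H : GenericPair d p h) :
    GenericPair d (fun i => p (i + 1)) h :=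
  ⟨H.1, H.2.comp_embedding (Equiv.addRight (1 : Fin 4)).toEmbedding, H.3, fun i => H.4 _,
    by rw [quad_rotate]; exact H.5⟩

theorem GenericPair.exists_hit {d p h} (H : GenericPair d p h) {z : E3} (hz : z ∈ disk d)
    (hq : z ∈ quad p) : ∃ i, Hit d h (p i) (p (i + 1)) ∧ z = crossPoint h (p i) (p (i + 1)) := by
  obtain ⟨i, hi, rfl⟩ := exists_eq_crossPoint H.ne_zero hq (affineMap_disk H.vanish hz)
  rw [disk_eq] at hz
  exact ⟨i, ⟨hi, hz.resolve_left fun ht => disjoint_left.1 H.disj ht hq⟩, rfl⟩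

/-- Moving the triangle alone. -/
theorem ambientIsotopic_move_triangle {d d' : Fin 3 → E3} {p : Fin 4 → E3}
    (hp : AffineIndependent ℝ p)
    (hd : ∀ t ∈ Icc (0 : ℝ) 1, AffineIndependent ℝ fun i => d i + t • (d' i - d i))
    (hdisj : ∀ t ∈ Icc (0 : ℝ) 1, ∀ c ∈ triangleCoords,
      comb (fun i => d i + t • (d' i - d i)) c ∉ quad p) :
    AmbientIsotopic (triangle d ∪ quad p) (triangle d' ∪ quad p) := by
  refine ambientIsotopic_comb isCompact_triangleCoords isCompact_quadCoords (fun a ha => ha.2.1)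
    (fun a ha => ha.2.1) d d' p p hd (fun t _ => by simpa using hp) (fun t ht => ?_)
  simp only [sub_self, smul_zero, add_zero]
  rw [disjoint_left]
  rintro _ ⟨c, hc, rfl⟩
  exact hdisj t ht c hc

/-- Moving the quadrilateral alone, for a triangle in the zero set of `h`. -/
theorem ambientIsotopic_move_quad {d : Fin 3 → E3} {p p' : Fin 4 → E3}
    (hd : AffineIndependent ℝ d)
    (hp : ∀ t ∈ Icc (0 : ℝ) 1, AffineIndependent ℝ fun i => p i + t • (p' i - p i))
    (hdisj : ∀ t ∈ Icc (0 : ℝ) 1, Disjoint (triangle d) (quad fun i => p i + t • (p' i - p i))) :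
    AmbientIsotopic (triangle d ∪ quad p) (triangle d ∪ quad p') := by
  refine ambientIsotopic_comb isCompact_triangleCoords isCompact_quadCoords (fun a ha => ha.2.1)
    (fun a ha => ha.2.1) d d p p' (fun t _ => by simpa using hd) hp (fun t ht => ?_)
  simp only [sub_self, smul_zero, add_zero]
  exact hdisj t ht

theorem AffineIndependent.homothety {d : Fin 3 → E3} (hd : AffineIndependent ℝ d) (x v : E3)
    {s : ℝ} (hs : s ≠ 0) : AffineIndependent ℝ fun i => x + v + s • (d i - x) := by
  rw [affineIndependent_iff_comb] at hd ⊢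
  intro w hw h
  have : comb (fun i => x + v + s • (d i - x)) w = s • comb d w := by
    simp only [comb, smul_add, smul_sub, Finset.sum_add_distrib, Finset.sum_sub_distrib,
      ← Finset.sum_smul, hw, Finset.smul_sum, smul_comm s]
    simp
  rw [this] at h
  exact hd w hw ((smul_eq_zero.1 h).resolve_left hs)

theorem comb_homothety {d : Fin 3 → E3} (x v : E3) (s : ℝ) {c : Fin 3 → ℝ} (hc : ∑ i, c i = 1) :
    comb (fun i => x + v + s • (d i - x)) c = x + v + s • (comb d c - x) := by
  simp only [comb, smul_add, smul_sub, Finset.sum_add_distrib, Finset.sum_sub_distrib,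
      ← Finset.sum_smul, hc, Finset.smul_sum, smul_comm s, one_smul]

/-- Shrinking the triangle towards a point `x` of its disk. -/
theorem ambientIsotopic_shrink {d : Fin 3 → E3} {p : Fin 4 → E3} (hd : AffineIndependent ℝ d)
    (hp : AffineIndependent ℝ p) {x : E3} (hx : x ∈ openDisk d)
    (hq : disk d ∩ quad p ⊆ {x}) {ε : ℝ} (hε : 0 < ε) (hε1 : ε ≤ 1) :
    AmbientIsotopic (triangle d ∪ quad p) (triangle (fun i => x + ε • (d i - x)) ∪ quad p) := by
  have e : ∀ t i, d i + t • ((x + ε • (d i - x)) - d i) = x + 0 + (1 - t + t * ε) • (d i - x) := by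
    intro t i
    module
  have hs : ∀ t ∈ Icc (0 : ℝ) 1, 0 < 1 - t + t * ε := by
    rintro t ⟨h0, h1⟩
    rcases h1.eq_or_lt with rfl | h1
    · simpa using hε
    · have := mul_nonneg h0 hε.le
      linarith
  refine ambientIsotopic_move_triangle hp (fun t ht => ?_) (fun t ht c hc hcq => ?_)
  · simp only [e]
    exact hd.homothety x 0 (hs t ht).ne'
  · simp only [e] at hcq
    rw [comb_homothety x 0 _ hc.2.1, add_zero] at hcq
    have hs0 := hs t ht
    have hs1 : 1 - t + t * ε ≤ 1 := by nlinarith [ht.1]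
    set s := 1 - t + t * ε
    obtain ⟨a, ⟨ha0, ha1⟩, rfl⟩ := hx
    have hmem : comb d a + s • (comb d c - comb d a) ∈ disk d := by
      refine ⟨(1 - s) • a + s • c, ⟨fun i => ?_, ?_⟩, ?_⟩
      · have := (ha0 i).le
        have := hc.1 i
        have : 0 ≤ 1 - s := by linarith
        simp only [Pi.add_apply, Pi.smul_apply, smul_eq_mul]
        positivity
      · simp [Finset.sum_add_distrib, ← Finset.mul_sum, ha1, hc.2.1]
      · rw [comb_add, comb_smul, comb_smul]; module
    have h1 := hq ⟨hmem, hcq⟩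
    have h2 : comb d c = comb d a := by
      have : s • (comb d c - comb d a) = 0 := by simpa using h1
      exact sub_eq_zero.1 ((smul_eq_zero.1 this).resolve_left hs0.ne')
    obtain ⟨-, hc1, i, hi⟩ := hc
    have := congrFun (eq_of_comb_eq hd (hc1.trans ha1.symm) h2) i
    linarith [ha0 i]

theorem norm_comb_le {x : E3} {d : Fin 3 → E3} {r : ℝ} (hr : ∀ i, ‖d i - x‖ ≤ r) {c : Fin 3 → ℝ}
    (h0 : ∀ i, 0 ≤ c i) (h1 : ∑ i, c i = 1) : ‖comb d c - x‖ ≤ r := by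
  have : comb d c - x = ∑ i, c i • (d i - x) := by
    simp [comb, smul_sub, Finset.sum_sub_distrib, ← Finset.sum_smul, h1]
  rw [this]
  refine (norm_sum_le _ _).trans ?_
  calc ∑ i, ‖c i • (d i - x)‖ ≤ ∑ i, c i * r := by
        refine Finset.sum_le_sum fun i _ => ?_
        rw [norm_smul, Real.norm_of_nonneg (h0 i)]
        exact mul_le_mul_of_nonneg_left (hr i) (h0 i)
    _ = r := by rw [← Finset.sum_mul, h1, one_mul]

theorem exists_smul_norm_lt {ι : Type*} [Fintype ι] (v : ι → E3) {δ : ℝ} (hδ : 0 < δ) :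
    ∃ ε : ℝ, 0 < ε ∧ ε ≤ 1 ∧ ∀ i, ‖ε • v i‖ < δ := by
  have hM : ∀ i, ‖v i‖ ≤ ∑ j, ‖v j‖ := fun i =>
    Finset.single_le_sum (f := fun j => ‖v j‖) (fun j _ => norm_nonneg _) (Finset.mem_univ i)
  set M := ∑ j, ‖v j‖
  have hM0 : 0 ≤ M := Finset.sum_nonneg fun _ _ => norm_nonneg _
  refine ⟨min 1 (δ / (M + 1)), by positivity, min_le_left _ _, fun i => ?_⟩
  have hε : 0 < min 1 (δ / (M + 1)) := by positivity
  rw [norm_smul, Real.norm_of_nonneg hε.le]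
  calc min 1 (δ / (M + 1)) * ‖v i‖ ≤ δ / (M + 1) * M :=
        mul_le_mul (min_le_right _ _) (hM i) (norm_nonneg _) (by positivity)
    _ < δ := by
      rw [div_mul_eq_mul_div, div_lt_iff₀ (by positivity)]
      nlinarith

/-- Finitely many nonzero polynomials have a common non-root arbitrarily close to zero. -/
theorem exists_pos_eval_ne_zero {ι : Type*} [Finite ι] (q : ι → Polynomial ℝ) (hq : ∀ i, q i ≠ 0)
    {δ : ℝ} (hδ : 0 < δ) : ∃ t ∈ Ioo 0 δ, ∀ i, (q i).eval t ≠ 0 := by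
  have := Fintype.ofFinite ι
  have hne : ∏ i, q i ≠ 0 := Finset.prod_ne_zero_iff.2 fun i _ => hq i
  obtain ⟨t, ht, ht'⟩ := (Ioo_infinite hδ).exists_notMem_finset (∏ i, q i).roots.toFinset
  refine ⟨t, ht, fun i hi => ht' ?_⟩
  rw [Multiset.mem_toFinset, Polynomial.mem_roots hne, Polynomial.IsRoot, Polynomial.eval_prod]
  exact Finset.prod_eq_zero (Finset.mem_univ i) hi

/-- Finitely many nonzero quadratic polynomials have a common non-root arbitrarily close to zero. -/
theorem exists_quadratic_ne_zero {ι : Type*} [Finite ι] (A B C : ι → ℝ)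
    (h : ∀ i, ¬ (A i = 0 ∧ B i = 0 ∧ C i = 0)) {δ : ℝ} (hδ : 0 < δ) :
    ∃ t ∈ Ioo 0 δ, ∀ i, A i + B i * t + C i * t ^ 2 ≠ 0 := by
  open Polynomial in
  obtain ⟨t, ht, ht'⟩ := exists_pos_eval_ne_zero
    (fun i => Polynomial.C (A i) + Polynomial.C (B i) * X + Polynomial.C (C i) * X ^ 2)
    (fun i hi => h i ⟨by simpa using congrArg (fun q => coeff q 0) hi,
      by simpa [coeff_X, coeff_C, coeff_X_pow] using congrArg (fun q => coeff q 1) hi,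
      by simpa [coeff_X, coeff_C] using congrArg (fun q => coeff q 2) hi⟩) hδ
  exact ⟨t, ht, fun i => by simpa using ht' i⟩

/-! ### Links without crossings -/

theorem affineMap_add_smul (h : E3 →ᵃ[ℝ] ℝ) (x a b : E3) (s : ℝ) :
    h (x + s • (a - b)) = h x + s * (h a - h b) := by
  have := h.map_vadd x (s • (a - b))
  rw [vadd_eq_add, vadd_eq_add, add_comm] at this
  rw [this, map_smul, smul_eq_mul, add_comm]
  congr 2
  simpa using h.linearMap_vsub a b

/-- For a point `c` off the quadrilateral, some interior point of the tetrahedron is visible from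
`c` past the quadrilateral, and is in addition generic for the affine function `h`. -/
theorem exists_visible {p : Fin 4 → E3} (hp : AffineIndependent ℝ p) {c : E3} (hc : c ∉ quad p)
    {h : E3 →ᵃ[ℝ] ℝ} (hh : ∃ i j, h (p i) ≠ h (p j)) :
    ∃ b : Fin 4 → ℝ, (∀ i, 0 < b i) ∧ ∑ i, b i = 1 ∧
      b 0 * (h (p 0) - h (comb p b)) + b 2 * (h (p 2) - h (comb p b)) ≠ 0 ∧
      ∀ t ∈ Icc (0 : ℝ) 1, c + t • (comb p b - c) ∉ quad p := by
  -- the segment from `c` to `comb p b` misses the quadrilateral as soon as `comb p b` avoids the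
  -- planes through `c` and the edges; the curve of weights below lies in none of these planes
  obtain ⟨co, hco1, hco2, hco3⟩ := exists_coord hp
  -- the plane through `c` and the `i`-th edge
  have hplane : ∀ i : Fin 4, ∃ l m : ℝ, ¬ (l = 0 ∧ m = 0) ∧
      l * co (i + 2) c = m * co (i + 3) c := by
    intro i
    by_cases h0 : co (i + 2) c = 0
    · exact ⟨1, 0, by simp, by simp [h0]⟩
    · exact ⟨co (i + 3) c, co (i + 2) c, by simp [h0], by ring⟩
  choose l m hlm hc' using hplane
  -- the conditions on `b = (t, t², 1 - t, 1 - t²) / 2`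
  obtain ⟨t, ⟨ht0, ht1⟩, ht⟩ := exists_quadratic_ne_zero (ι := Fin 5)
    ![l 0 - m 0, l 1, 0, -m 3, h (p 2) - h (p 3)] ![-l 0, -m 1, l 2, m 3, h (p 0) - h (p 2)]
    ![m 0, -l 1, -m 2, l 3, h (p 3) - h (p 1)] (by
      intro i
      fin_cases i <;> simp
      · intro h1 h2; have := hlm 0; simp_all
      · intro h1 h2; have := hlm 1; simp_all
      · intro h1 h2; have := hlm 2; simp_all
      · intro h1 h2; have := hlm 3; simp_all
      · intro h1 h2 h3
        obtain ⟨i, j, hij⟩ := hh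
        refine hij ?_
        have k0 : h (p 0) = h (p 3) := by linarith
        have k1 : h (p 1) = h (p 3) := by linarith
        have k2 : h (p 2) = h (p 3) := by linarith
        have : ∀ i, h (p i) = h (p 3) := by
          intro i; fin_cases i
          · exact k0
          · exact k1
          · exact k2
          · rfl
        rw [this i, this j]) one_pos
  have ht2 : t ^ 2 < 1 := by nlinarith
  set b : Fin 4 → ℝ := ![t / 2, t ^ 2 / 2, (1 - t) / 2, (1 - t ^ 2) / 2] with hb
  have hb1 : ∑ i, b i = 1 := by rw [Fin.sum_univ_four]; simp [hb]; ring
  refine ⟨b, ?_, hb1, ?_, ?_⟩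
  · intro i
    fin_cases i
    · exact half_pos ht0
    · exact half_pos (by positivity)
    · exact half_pos (by linarith)
    · exact half_pos (by linarith)
  · have := ht 4
    rw [affineMap_comb h p hb1, Fin.sum_univ_four]
    intro h0
    apply this
    simp [hb] at h0 ⊢
    linear_combination 4 * h0
  · rintro s ⟨hs0, hs1⟩ hq
    have hs : s ≠ 0 := by
      rintro rfl
      simp [hc] at hq
    have hcoord : ∀ j, co j (c + s • (comb p b - c)) = (1 - s) * co j c + s * b j := by
      intro j
      rw [affineMap_add_smul, hco3 b hb1]
      ring
    obtain ⟨i, hi2, hi3⟩ : ∃ i : Fin 4, co (i + 2) (c + s • (comb p b - c)) = 0 ∧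
        co (i + 3) (c + s • (comb p b - c)) = 0 := by
      obtain ⟨a, ⟨-, ha1, h02, h13⟩, ha⟩ := hq
      rw [← ha]
      simp only [hco3 a ha1]
      rcases mul_eq_zero.1 h02 with h0 | h2 <;> rcases mul_eq_zero.1 h13 with h1 | h3
      · exact ⟨2, h0, h1⟩
      · exact ⟨1, h3, h0⟩
      · exact ⟨3, h1, h2⟩
      · exact ⟨0, h2, h3⟩
    rw [hcoord] at hi2 hi3
    have key : l i * b (i + 2) - m i * b (i + 3) = 0 := by
      have : s * (l i * b (i + 2) - m i * b (i + 3)) = 0 := by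
        linear_combination l i * hi2 - m i * hi3 - (1 - s) * hc' i
      exact (mul_eq_zero.1 this).resolve_left hs
    fin_cases i
    · apply ht 0
      change l 0 * ((1 - t) / 2) - m 0 * ((1 - t ^ 2) / 2) = 0 at key
      simp
      linear_combination 2 * key
    · apply ht 1
      change l 1 * ((1 - t ^ 2) / 2) - m 1 * (t / 2) = 0 at key
      simp
      linear_combination 2 * key
    · apply ht 2
      change l 2 * (t / 2) - m 2 * (t ^ 2 / 2) = 0 at key
      simp
      linear_combination 2 * key
    · apply ht 3
      change l 3 * (t ^ 2 / 2) - m 3 * ((1 - t) / 2) = 0 at key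
      simp
      linear_combination 2 * key

/-- If the quadrilateral misses the disk, the link is trivial: the triangle can be shrunk, moved
to the interior of the tetrahedron spanned by the quadrilateral, and is then a small curve that the
quadrilateral runs around at a distance. -/
theorem GenericPair.isTrivialLink_of_disjoint {d p h} (H : GenericPair d p h)
    (hdisk : Disjoint (disk d) (quad p)) : IsTrivialLink (triangle d ∪ quad p) := by
  obtain ⟨hd, hp, hh, hne, -⟩ := H
  set third : Fin 3 → ℝ := fun _ => 1 / 3 with hthird
  have hthird0 : ∀ i, 0 < third i := fun _ => by norm_num [hthird]
  have hthird1 : ∑ i, third i = 1 := by simp [hthird]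
  set c := comb d third with hcdef
  have hcD : c ∈ openDisk d := ⟨third, ⟨hthird0, hthird1⟩, rfl⟩
  have hcD' : c ∈ disk d := by rw [disk_eq]; exact Or.inr hcD
  have hcq : c ∉ quad p := disjoint_left.1 hdisk hcD'
  have hconst : ∃ i j, h (p i) ≠ h (p j) := by
    by_contra! hall
    obtain ⟨co, h1, h2, -⟩ := exists_coord hp
    have := affineMap_comb h p (h1 (d 0))
    rw [h2, hh] at this
    simp only [hall _ 0, smul_eq_mul, ← Finset.sum_mul, h1] at this
    exact hne 0 (by linarith)
  -- the triangle is first shrunk towards its barycentre `c`, then translated so that its centre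
  -- becomes an interior point `o` of the tetrahedron, visible from `c`; around `o` it is so small
  -- that the quadrilateral passes its plane outside it
  obtain ⟨b, hb, hb1, hgen, hvis⟩ := exists_visible hp hcq hconst
  set o := comb p b with ho
  -- the path of the centre stays at distance `δ` from the quadrilateral
  obtain ⟨δ, hδ, hδ'⟩ : ∃ δ > 0, ∀ t ∈ Icc (0 : ℝ) 1, ∀ z ∈ quad p,
      δ < ‖z - (c + t • (o - c))‖ := by
    have hK : IsCompact ((fun t : ℝ => c + t • (o - c)) '' Icc 0 1) :=
      isCompact_Icc.image (by fun_prop)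
    obtain ⟨δ, hδ, hdis⟩ := Disjoint.exists_thickenings (s := quad p)
      (disjoint_right.2 (by rintro _ ⟨t, ht, rfl⟩; exact hvis t ht)) (isCompact_quad p) hK.isClosed
    refine ⟨δ / 2, half_pos hδ, fun t ht z hz => ?_⟩
    by_contra! hle
    refine disjoint_left.1 hdis (Metric.self_subset_thickening hδ _ hz)
      (Metric.mem_thickening_iff.2 ⟨_, mem_image_of_mem _ ht, ?_⟩)
    rw [dist_eq_norm]
    linarith
  obtain ⟨ε, hε, hε1, hεd⟩ := exists_smul_norm_lt (fun i => d i - c) hδ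
  have hsmall : ∀ a : Fin 3 → ℝ, (∀ i, 0 ≤ a i) → ∑ i, a i = 1 → ∀ t ∈ Icc (0 : ℝ) 1,
      comb (fun i => c + t • (o - c) + ε • (d i - c)) a ∉ quad p := by
    intro a ha ha1 t ht hq
    have := norm_comb_le (x := c + t • (o - c)) (d := fun i => c + t • (o - c) + ε • (d i - c))
      (fun i => by simpa using (hεd i).le) ha ha1
    exact (hδ' t ht _ hq).not_ge this
  have hshrink := ambientIsotopic_shrink hd hp hcD
    (fun z hz => (disjoint_left.1 hdisk hz.1 hz.2).elim) hε hε1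
  have e : ∀ (t : ℝ) i, c + ε • (d i - c) + t • ((c + (o - c) + ε • (d i - c)) - (c + ε • (d i - c))) =
      c + t • (o - c) + ε • (d i - c) := by
    intro t i
    module
  have hmove : AmbientIsotopic (triangle (fun i => c + ε • (d i - c)) ∪ quad p)
      (triangle (fun i => c + (o - c) + ε • (d i - c)) ∪ quad p) := by
    refine ambientIsotopic_move_triangle hp (fun t ht => ?_) (fun t ht a ha => ?_)
    · simp only [e]
      exact hd.homothety c (t • (o - c)) hε.ne'
    · simp only [e]
      exact hsmall a ha.1 ha.2.1 t ht
  refine (hshrink.trans hmove).trans ?_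
  simp only [add_sub_cancel]
  have hoc : comb (fun i => o + ε • (d i - c)) third = o := by
    have := comb_homothety (d := d) c (o - c) ε hthird1
    simpa [← hcdef] using this
  obtain ⟨Ψ, ρ, hρ, hρ0, himg, hu⟩ := exists_affineEquiv_cyl (d := fun i => o + ε • (d i - c))
    (by simpa using hd.homothety c (o - c) hε.ne') hp hthird0 hthird1 hb hb1 hoc
    (h - AffineMap.const ℝ E3 (h o)) (fun i => by
      change h _ - h o = 0
      rw [affineMap_add_smul, hh i,
        affineMap_disk hh hcD']
      ring) hgen
  refine isTrivialLink_of_affine Ψ ?_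
  rw [himg]
  have hu2 : ∀ u : Circle, 0 < (u : ℂ).re ^ 2 + (u : ℂ).im ^ 2 := fun u => by
    rw [normSq_circle]; norm_num
  have htp := fun u : Circle => tent_pos hb (hu2 u)
  refine isTrivialLink_cyl hρ (isLip_const 0) ((isLip_tent b).inv htp)
    ((isLip_tent _).mul ((isLip_tent b).inv htp)) hρ0 (fun u => inv_pos.2 (htp u)) ?_
  intro u hle h0
  have := (hu u ((mul_eq_zero.1 h0).resolve_right (inv_pos.2 (htp u)).ne')).2 hle
  obtain ⟨a, ⟨ha, ha1⟩, hax⟩ := this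
  refine hsmall a ha ha1 1 (right_mem_Icc.2 zero_le_one) ?_
  simp only [one_smul, add_sub_cancel]
  rw [hax]
  exact mem_image_of_mem _ (quadPoint_mem hb (hu2 u))

/-! ### Pulling vertices and edges through the disk -/

/-- If `b` is separated from `a` and `c` by the plane `h = 0`, this plane meets the triangle `a b c`
in the segment between the two crossing points. -/
theorem convex_comb_crossPoint {h : E3 →ᵃ[ℝ] ℝ} {a b c : E3} (hab : h a * h b < 0)
    (hbc : h b * h c < 0) {S : Set E3} (hS : Convex ℝ S) (h1 : crossPoint h a b ∈ S)
    (h2 : crossPoint h b c ∈ S) {α β γ : ℝ} (hα : 0 ≤ α) (hγ : 0 ≤ γ) (hsum : α + β + γ = 1)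
    (h0 : α * h a + β * h b + γ * h c = 0) : α • a + β • b + γ • c ∈ S := by
  have nb : h b ≠ 0 := by intro h0; simp [h0] at hab
  have e1 : h a - h b ≠ 0 := sub_ne_zero.2 (ne_of_mul_neg hab)
  have e2 : h b - h c ≠ 0 := sub_ne_zero.2 (ne_of_mul_neg hbc)
  have r1 : 0 ≤ (h b - h a) / h b := by
    have : (h b - h a) / h b = (h b * h b - h a * h b) / (h b * h b) := by field_simp
    rw [this]
    have := mul_self_pos.2 nb
    exact div_nonneg (by linarith) this.le
  have r2 : 0 ≤ (h b - h c) / h b := by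
    have : (h b - h c) / h b = (h b * h b - h b * h c) / (h b * h b) := by field_simp
    rw [this]
    have := mul_self_pos.2 nb
    exact div_nonneg (by linarith) this.le
  have hb' : β = -(α * h a + γ * h c) / h b := by
    rw [eq_div_iff nb]; linarith
  have key : α • a + β • b + γ • c = (α * ((h b - h a) / h b)) • crossPoint h a b +
      (γ * ((h b - h c) / h b)) • crossPoint h b c := by
    have f1 : (h b - h a) / h b * (1 - h a / (h a - h b)) = 1 := by field_simp; ring
    have f2 : (h b - h a) / h b * (h a / (h a - h b)) = - h a / h b := by field_simp; ring
    have f3 : (h b - h c) / h b * (1 - h b / (h b - h c)) = - h c / h b := by field_simp; ring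
    have f4 : (h b - h c) / h b * (h b / (h b - h c)) = 1 := by field_simp
    rw [crossPoint, crossPoint, lineMap_eq, lineMap_eq, smul_add, smul_add, smul_smul, smul_smul,
      smul_smul, smul_smul, mul_assoc, mul_assoc, mul_assoc, mul_assoc, f1, f2, f3, f4, hb']
    module
  rw [key]
  refine hS h1 h2 (mul_nonneg hα r1) (mul_nonneg hγ r2) ?_
  have : α + γ = 1 - β := by linarith
  field_simp
  linear_combination (h b) * hsum - h0

/-- If both edges at the vertex `p 1` cross the disk, this vertex can be pulled back through the
disk. -/
theorem GenericPair.exists_pull {d p h} (H : GenericPair d p h) (h01 : Hit d h (p 0) (p 1))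
    (h12 : Hit d h (p 1) (p 2)) : ∃ q, GenericPair d ![p 0, q, p 2, p 3] h ∧ 0 < h (p 0) * h q ∧
      AmbientIsotopic (triangle d ∪ quad p) (triangle d ∪ quad ![p 0, q, p 2, p 3]) := by
  -- the vertex moves along the segment to the midpoint of its neighbours, which lies on their side
  -- of the plane; the part of the plane that is swept out stays between the two crossing points,
  -- hence in the disk
  set q : ℝ → Fin 4 → E3 := fun r =>
    ![p 0, (1 / 2 : ℝ) • (p 0 + p 2) + r • (p 1 - (1 / 2 : ℝ) • (p 0 + p 2)), p 2, p 3] with hq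
  have hcomb : ∀ r a, comb (q r) a =
      comb p ![a 0 + a 1 * ((1 - r) / 2), a 1 * r, a 2 + a 1 * ((1 - r) / 2), a 3] := by
    intro r a
    simp only [comb, Fin.sum_univ_four, hq, Matrix.cons_val]
    module
  have hind : ∀ r : ℝ, 0 < r → AffineIndependent ℝ (q r) := by
    intro r hr
    rw [affineIndependent_iff_comb]
    intro w hw h0
    rw [hcomb] at h0
    rw [Fin.sum_univ_four] at hw
    have := affineIndependent_iff_comb.1 H.quad_indep _ (by
      rw [Fin.sum_univ_four]; simp; linarith) h0
    have e0 := congrFun this 0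
    have e1 := congrFun this 1
    have e2 := congrFun this 2
    have e3 := congrFun this 3
    simp [hr.ne'] at e0 e1 e2 e3
    rw [e1] at e0 e2
    funext i
    fin_cases i <;> simp_all
  have hdisj : ∀ r : ℝ, 0 < r → r ≤ 1 → Disjoint (triangle d) (quad (q r)) := by
    intro r hr hr1
    rw [disjoint_left]
    rintro z hz ⟨a, ⟨ha, ha1, h02, h13⟩, rfl⟩
    have h0 := affineMap_triangle H.vanish hz
    rw [Fin.sum_univ_four] at ha1
    rw [hcomb] at hz h0
    rcases mul_eq_zero.1 h13 with h1 | h3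
    · refine disjoint_left.1 H.disj hz ⟨a, ⟨ha, by rw [Fin.sum_univ_four]; exact ha1, h02, h13⟩, ?_⟩
      congr 1
      funext i
      fin_cases i <;> simp [h1]
    · refine disjoint_left.1 (disjoint_triangle_openDisk H.triangle_indep) hz ?_
      have n0 := ha 0
      have n1 := ha 1
      have n2 := ha 2
      have n3 := mul_nonneg n1 (by linarith : 0 ≤ (1 - r) / 2)
      rw [affineMap_comb h p (by rw [Fin.sum_univ_four]; simp; linarith), Fin.sum_univ_four] at h0
      have := convex_comb_crossPoint h01.1 h12.1 (convex_openDisk d) h01.2 h12.2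
        (α := a 0 + a 1 * ((1 - r) / 2)) (β := a 1 * r) (γ := a 2 + a 1 * ((1 - r) / 2))
        (by linarith) (by linarith) (by linarith) (by simpa [h3] using h0)
      convert this using 1
      simp [comb, Fin.sum_univ_four, h3]
  -- the value of `h` at the midpoint of `p 0` and `p 2`
  set μ := (h (p 0) + h (p 2)) / 2 with hμ
  have hval : ∀ r, h (q r 1) = μ + r * (h (p 1) - μ) := by
    intro r
    have e : (1 / 2 : ℝ) • (p 0 + p 2) = AffineMap.lineMap (p 0) (p 2) (1 / 2 : ℝ) := by
      rw [lineMap_eq]; module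
    change h ((1 / 2 : ℝ) • (p 0 + p 2) + r • (p 1 - (1 / 2 : ℝ) • (p 0 + p 2))) = _
    rw [affineMap_add_smul, e, affineMap_lineMap, hμ]
    ring
  have hs1 := h01.1
  have hs2 := h12.1
  obtain ⟨r, hr, hr1, hpos⟩ : ∃ r : ℝ, 0 < r ∧ r ≤ 1 ∧ 0 < h (p 0) * (μ + r * (h (p 1) - μ)) := by
    have hm : 0 < h (p 0) * μ := by
      have : 0 < h (p 0) * h (p 2) := by
        have m1 := mul_self_pos.2 (H.ne_zero 1)
        have : 0 < (h (p 0) * h (p 2)) * (h (p 1) * h (p 1)) := by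
          have := mul_pos_of_neg_of_neg hs1 hs2
          linarith
        exact pos_of_mul_pos_left this m1.le
      have := mul_self_pos.2 (H.ne_zero 0)
      rw [hμ]
      linarith
    refine ⟨min 1 (h (p 0) * μ / (2 * |h (p 0) * (h (p 1) - μ)| + 1)), by positivity,
      min_le_left _ _, ?_⟩
    set k := h (p 0) * (h (p 1) - μ)
    have e : ∀ r, h (p 0) * (μ + r * (h (p 1) - μ)) = h (p 0) * μ + r * k := fun r => by
      simp only [k]; ring
    rw [e]
    set r := min 1 (h (p 0) * μ / (2 * |k| + 1))
    have hr0 : 0 < r := by positivity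
    have hr2 : r * (2 * |k| + 1) ≤ h (p 0) * μ := by
      rw [← le_div_iff₀ (by positivity)]; exact min_le_right _ _
    have := mul_le_mul_of_nonneg_left (neg_abs_le k) hr0.le
    have := mul_nonneg hr0.le (abs_nonneg k)
    nlinarith
  have hq1 : q r = ![p 0, q r 1, p 2, p 3] := rfl
  refine ⟨q r 1, ⟨H.1, hind r hr, H.3, ?_, hdisj r hr hr1⟩, by rw [hval]; exact hpos, ?_⟩
  · intro i
    fin_cases i
    · exact H.4 0
    · change h (q r 1) ≠ 0
      rw [hval]
      exact (mul_ne_zero_iff.1 hpos.ne').2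
    · exact H.4 2
    · exact H.4 3
  · have e : ∀ t : ℝ, (fun i => p i + t • ((![p 0, q r 1, p 2, p 3] : Fin 4 → E3) i - p i)) =
        q (1 - t + t * r) := by
      intro t
      funext i
      fin_cases i <;> simp [hq]
      module
    have hs : ∀ t ∈ Icc (0 : ℝ) 1, 0 < 1 - t + t * r ∧ 1 - t + t * r ≤ 1 := by
      rintro t ⟨h0, h1⟩
      refine ⟨?_, by nlinarith⟩
      rcases h1.eq_or_lt with rfl | h1
      · simpa using hr
      · have := mul_nonneg h0 hr.le
        linarith
    refine ambientIsotopic_move_quad H.1 (fun t ht => ?_) (fun t ht => ?_)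
    · rw [e]; exact hind _ (hs t ht).1
    · rw [e]; exact hdisj _ (hs t ht).1 (hs t ht).2

theorem sum_mul_ne_zero {ι : Type*} [Fintype ι] {a k : ι → ℝ} (ha : ∀ i, 0 ≤ a i)
    (ha1 : ∑ i, a i = 1) {s : ℝ} (hs : ∀ i, 0 < s * k i) : ∑ i, a i * k i ≠ 0 := by
  intro h0
  have h1 : ∑ i, a i * (s * k i) = 0 := by
    have : ∑ i, a i * (s * k i) = s * ∑ i, a i * k i := by
      rw [Finset.mul_sum]; exact Finset.sum_congr rfl fun i _ => by ring
    rw [this, h0, mul_zero]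
  have h2 := (Finset.sum_eq_zero_iff_of_nonneg fun i _ => mul_nonneg (ha i) (hs i).le).1 h1
  have h3 : ∀ i, a i = 0 := fun i =>
    (mul_eq_zero.1 (h2 i (Finset.mem_univ i))).resolve_right (hs i).ne'
  simp [h3] at ha1

/-- A quadrilateral on one side of the plane of the triangle is not linked with it. -/
theorem GenericPair.isTrivialLink_of_same_side {d p h} (H : GenericPair d p h) {s : ℝ}
    (hs : ∀ i, 0 < s * h (p i)) : IsTrivialLink (triangle d ∪ quad p) := by
  refine H.isTrivialLink_of_disjoint (disjoint_left.2 ?_)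
  rintro _ hz ⟨a, ⟨ha, ha1, -⟩, rfl⟩
  have := affineMap_disk H.vanish hz
  rw [affineMap_comb h p ha1] at this
  exact sum_mul_ne_zero ha ha1 hs this

/-- If two opposite edges cross the disk, and the two other edges stay on their sides of its plane,
the edge on one side can be pushed through the disk. -/
theorem GenericPair.isTrivialLink_of_opposite {d p h} (H : GenericPair d p h)
    (h01 : 0 < h (p 0) * h (p 1)) (h12 : Hit d h (p 1) (p 2)) (h30 : Hit d h (p 3) (p 0)) :
    IsTrivialLink (triangle d ∪ quad p) := by
  set τ := h (p 1) / (h (p 1) - h (p 2)) with hτ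
  set υ := h (p 3) / (h (p 3) - h (p 0)) with hυ
  obtain ⟨hτ0, hτ1⟩ : τ ∈ Ioo (0 : ℝ) 1 := crossPoint_param_mem h12.1
  obtain ⟨hυ0, hυ1⟩ : υ ∈ Ioo (0 : ℝ) 1 := crossPoint_param_mem h30.1
  have ex : crossPoint h (p 1) (p 2) = (1 - τ) • p 1 + τ • p 2 := lineMap_eq _ _ _
  have ey : crossPoint h (p 3) (p 0) = (1 - υ) • p 3 + υ • p 0 := lineMap_eq _ _ _
  set x := crossPoint h (p 1) (p 2) with hx
  set y := crossPoint h (p 3) (p 0) with hy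
  have hx0 : h x = 0 := affineMap_openDisk H.vanish h12.2
  have hy0 : h y = 0 := affineMap_openDisk H.vanish h30.2
  have hh23 : 0 < h (p 2) * h (p 3) := by
    have h1 := h12.1
    have h3 := h30.1
    have : 0 < (h (p 0) * h (p 1)) * (h (p 2) * h (p 3)) := by
      have := mul_pos_of_neg_of_neg h1 h3
      linarith
    exact pos_of_mul_pos_right this h01.le
  -- `p 2` and `p 3` move along their edges towards the crossing points `x` and `y` and a little
  -- further; the plane of the triangle is only met between `x` and `y`, inside the disk
  set q : ℝ → Fin 4 → E3 := fun s => ![p 0, p 1, x + s • (p 2 - x), y + s • (p 3 - y)] with hq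
  have hcomb : ∀ s a, comb (q s) a = comb p ![a 0 + a 3 * ((1 - s) * υ),
      a 1 + a 2 * ((1 - s) * (1 - τ)), a 2 * (τ + s * (1 - τ)), a 3 * (1 - υ + s * υ)] := by
    intro s a
    simp only [comb, Fin.sum_univ_four, hq, Matrix.cons_val]
    rw [ex, ey]
    module
  obtain ⟨δ, hδ, hδ1, hδ2⟩ : ∃ δ : ℝ, 0 < δ ∧ 0 < τ - δ * (1 - τ) ∧ 0 < 1 - υ - δ * υ := by
    refine ⟨min τ (1 - υ), lt_min hτ0 (by linarith), ?_, ?_⟩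
    · have := min_le_left τ (1 - υ); nlinarith
    · have := min_le_right τ (1 - υ); nlinarith
  have hind : ∀ s : ℝ, -δ ≤ s → AffineIndependent ℝ (q s) := by
    intro s hs
    have p1 : τ + s * (1 - τ) ≠ 0 := by
      have : 0 < τ + s * (1 - τ) := by nlinarith
      exact this.ne'
    have p2 : 1 - υ + s * υ ≠ 0 := by
      have : 0 < 1 - υ + s * υ := by nlinarith
      exact this.ne'
    rw [affineIndependent_iff_comb]
    intro w hw h0
    rw [hcomb] at h0
    rw [Fin.sum_univ_four] at hw
    have := affineIndependent_iff_comb.1 H.quad_indep _ (by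
      rw [Fin.sum_univ_four]; simp; linarith) h0
    have e0 := congrFun this 0
    have e1 := congrFun this 1
    have e2 := congrFun this 2
    have e3 := congrFun this 3
    simp [p1, p2] at e0 e1 e2 e3
    rw [e3] at e0
    rw [e2] at e1
    funext i
    fin_cases i <;> simp_all
  have hval : ∀ s a, ∑ i, a i = 1 → h (comb (q s) a) =
      a 0 * h (p 0) + a 1 * h (p 1) + s * (a 2 * h (p 2) + a 3 * h (p 3)) := by
    intro s a ha
    rw [affineMap_comb h _ ha, Fin.sum_univ_four]
    simp only [hq, Matrix.cons_val, affineMap_add_smul, hx0, hy0, smul_eq_mul]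
    ring
  have hdisj : ∀ s : ℝ, Disjoint (triangle d) (quad (q s)) := by
    intro s
    rw [disjoint_left]
    rintro z hz ⟨a, ⟨ha, ha1, h02, h13⟩, rfl⟩
    have h0 := affineMap_triangle H.vanish hz
    have hno := fun hD => disjoint_left.1 (disjoint_triangle_openDisk H.triangle_indep) hz hD
    have hval := hval s a ha1
    rw [h0] at hval
    rw [Fin.sum_univ_four] at ha1
    have hline : ∀ i j : Fin 4, h (p i) ≠ h (p j) → (∃ t : ℝ, comb (q s) a = (1 - t) • p i + t • p j) →
        crossPoint h (p i) (p j) ∈ openDisk d → False := by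
      rintro i j hij ⟨t, ht⟩ hD
      rw [← lineMap_eq] at ht
      rw [ht] at h0 hno
      rw [eq_crossPoint hij h0] at hno
      exact hno hD
    have m0 := mul_self_pos.2 (H.ne_zero 0)
    have m2 := mul_self_pos.2 (H.ne_zero 2)
    rcases mul_eq_zero.1 h02 with h0' | h2 <;> rcases mul_eq_zero.1 h13 with h1 | h3
    · -- the edge joining the two moving vertices
      have e : s * (a 2 * h (p 2) + a 3 * h (p 3)) = 0 := by rw [h0', h1] at hval; linarith
      rcases mul_eq_zero.1 e with rfl | e
      · apply hno
        have := convex_openDisk d h12.2 h30.2 (ha 2) (ha 3) (by linarith)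
        convert this using 1
        simp [comb, Fin.sum_univ_four, hq, h0', h1]
        rfl
      · have f : a 2 * (h (p 2) * h (p 2)) + a 3 * (h (p 2) * h (p 3)) = 0 := by
          linear_combination h (p 2) * e
        have := mul_nonneg (ha 2) m2.le
        have := mul_nonneg (ha 3) hh23.le
        have f2 := (mul_eq_zero.1 (by linarith : a 2 * (h (p 2) * h (p 2)) = 0)).resolve_right m2.ne'
        have f3 := (mul_eq_zero.1 (by linarith : a 3 * (h (p 2) * h (p 3)) = 0)).resolve_right hh23.ne'
        linarith
    · refine hline 1 2 (ne_of_mul_neg h12.1) ⟨a 2 * (τ + s * (1 - τ)), ?_⟩ h12.2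
      have : a 1 = 1 - a 2 := by linarith
      rw [hcomb]
      simp only [comb, Fin.sum_univ_four, Matrix.cons_val, h0', h3, this]
      module
    · refine hline 3 0 (ne_of_mul_neg h30.1) ⟨a 0 + a 3 * ((1 - s) * υ), ?_⟩ h30.2
      have : a 0 = 1 - a 3 := by linarith
      rw [hcomb]
      simp only [comb, Fin.sum_univ_four, Matrix.cons_val, h2, h1, this]
      module
    · have e : a 0 * h (p 0) + a 1 * h (p 1) = 0 := by rw [h2, h3] at hval; linarith
      have f : a 0 * (h (p 0) * h (p 0)) + a 1 * (h (p 0) * h (p 1)) = 0 := by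
        linear_combination h (p 0) * e
      have := mul_nonneg (ha 0) m0.le
      have := mul_nonneg (ha 1) h01.le
      have f2 := (mul_eq_zero.1 (by linarith : a 0 * (h (p 0) * h (p 0)) = 0)).resolve_right m0.ne'
      have f3 := (mul_eq_zero.1 (by linarith : a 1 * (h (p 0) * h (p 1)) = 0)).resolve_right h01.ne'
      linarith
  have hside : ∀ i, 0 < h (p 0) * h (q (-δ) i) := by
    have n12 := h12.1
    have n30 := h30.1
    have n02 : h (p 0) * h (p 2) < 0 := by
      have m1 := mul_self_pos.2 (H.ne_zero 1)
      have : (h (p 0) * h (p 2)) * (h (p 1) * h (p 1)) < 0 := by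
        have := mul_neg_of_pos_of_neg h01 n12
        linarith
      exact neg_of_mul_neg_left this m1.le
    intro i
    fin_cases i
    · exact mul_self_pos.2 (H.ne_zero 0)
    · exact h01
    · change 0 < h (p 0) * h (x + (-δ) • (p 2 - x))
      rw [affineMap_add_smul, hx0]
      nlinarith
    · change 0 < h (p 0) * h (y + (-δ) • (p 3 - y))
      rw [affineMap_add_smul, hy0]
      nlinarith
  have H' : GenericPair d (q (-δ)) h := ⟨H.1, hind _ le_rfl, H.3, fun i hi => by
    have := hside i
    rw [hi, mul_zero] at this
    exact this.false, hdisj _⟩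
  refine AmbientIsotopic.trans ?_ (H'.isTrivialLink_of_same_side hside)
  have e : ∀ t : ℝ, (fun i => p i + t • (q (-δ) i - p i)) = q (1 - t * (1 + δ)) := by
    intro t
    funext i
    fin_cases i <;> simp [hq] <;> module
  refine ambientIsotopic_move_quad H.1 (fun t ht => ?_) (fun t ht => ?_)
  · rw [e]; exact hind _ (by nlinarith [ht.2])
  · rw [e]; exact hdisj _

/-! ### One crossing: the Hopf link -/

theorem affineMap_comb_of_sum_eq_zero {ι : Type*} [Fintype ι] (h : E3 →ᵃ[ℝ] ℝ) (p : ι → E3)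
    {w : ι → ℝ} (hw : ∑ i, w i = 0) : ∑ i, w i * h (p i) = h (comb p w) - h 0 := by
  have e : ∀ x, h x = h.linear x + h 0 := by
    intro x
    have := h.map_vadd 0 x
    simpa using this
  rw [e (comb p w), comb, map_sum]
  simp only [map_smul, e (p _), mul_add, Finset.sum_add_distrib, ← Finset.sum_mul, hw, smul_eq_mul]
  ring

/-- Points of the plane of a triangle are affine combinations of its vertices. -/
theorem exists_comb_eq {d : Fin 3 → E3} (hd : AffineIndependent ℝ d) {h : E3 →ᵃ[ℝ] ℝ}
    (hh : ∀ i, h (d i) = 0) {q : E3} (hq : h q ≠ 0) {m : E3} (hm : h m = 0) :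
    ∃ c : Fin 3 → ℝ, ∑ i, c i = 1 ∧ comb d c = m := by
  have hind : AffineIndependent ℝ ![d 0, d 1, d 2, q] := by
    rw [affineIndependent_iff_comb]
    intro w hw h0
    have h3 : w 3 = 0 := by
      have := affineMap_comb_of_sum_eq_zero h ![d 0, d 1, d 2, q] hw
      rw [h0, sub_self, Fin.sum_univ_four] at this
      simpa [hh, hq] using this
    have := affineIndependent_iff_comb.1 hd ![w 0, w 1, w 2] (by
      rw [Fin.sum_univ_four, h3] at hw
      simpa [Fin.sum_univ_three] using hw) (by
      rw [← h0]
      simp [comb, Fin.sum_univ_three, Fin.sum_univ_four, h3])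
    have e0 := congrFun this 0
    have e1 := congrFun this 1
    have e2 := congrFun this 2
    simp at e0 e1 e2
    funext i
    fin_cases i <;> simp [e0, e1, e2, h3]
  obtain ⟨co, h1, h2, -⟩ := exists_coord hind
  have h3 : co 3 m = 0 := by
    have := affineMap_comb h ![d 0, d 1, d 2, q] (h1 m)
    rw [h2, hm, Fin.sum_univ_four] at this
    simpa [hh, hq] using this.symm
  refine ⟨![co 0 m, co 1 m, co 2 m], ?_, ?_⟩
  · have := h1 m
    rw [Fin.sum_univ_four, h3] at this
    simpa [Fin.sum_univ_three] using this
  · conv_rhs => rw [← h2 m]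
    simp [comb, Fin.sum_univ_three, Fin.sum_univ_four, h3]

theorem tent_antisymm {e : Fin 4 → ℝ} (e2 : e 2 = -e 1) (e3 : e 3 = -e 0) (x y : ℝ) :
    tent e x (-y) = -tent e x y := by
  rw [tent, tent, e2, e3]
  have a : (x + -y) / 2 = -((y - x) / 2) := by ring
  have b : (-y - x) / 2 = -((x + y) / 2) := by ring
  rw [a, b, neg_neg, neg_neg]
  ring

theorem tent_pos_of_antisymm {e : Fin 4 → ℝ} (h0 : 0 < e 0) (h1 : 0 < e 1) (e2 : e 2 = -e 1)
    (e3 : e 3 = -e 0) {x y : ℝ} (hy : 0 < y) : 0 < tent e x y := by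
  rw [tent, e2, e3]
  have hXY : -((y - x) / 2) < (x + y) / 2 := by linarith
  have hXY' : -((x + y) / 2) < (y - x) / 2 := by linarith
  have m1 : max (-((y - x) / 2)) 0 ≤ max ((x + y) / 2) 0 := max_le_max hXY.le le_rfl
  have m2 : max (-((x + y) / 2)) 0 ≤ max ((y - x) / 2) 0 := max_le_max hXY'.le le_rfl
  have p1 := mul_nonneg h0.le (sub_nonneg.2 m1)
  have p2 := mul_nonneg h1.le (sub_nonneg.2 m2)
  rcases le_or_gt ((x + y) / 2) 0 with h | h
  · have m3 : max (-((x + y) / 2)) 0 < max ((y - x) / 2) 0 := by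
      rw [max_eq_left (by linarith : (0:ℝ) ≤ -((x + y) / 2)),
        max_eq_left (by linarith : (0:ℝ) ≤ (y - x) / 2)]
      exact hXY'
    have := mul_pos h1 (sub_pos.2 m3)
    linarith
  · have m3 : max (-((y - x) / 2)) 0 < max ((x + y) / 2) 0 := by
      rw [max_eq_left h.le]
      exact max_lt hXY h
    have := mul_pos h0 (sub_pos.2 m3)
    linarith

theorem quadPoint_of_pos {b : Fin 4 → ℝ} {x : ℝ} (hx : 0 < x) (hb : b 0 + b 3 ≠ 0) :
    quadPoint b x 0 = ![b 0 / (b 0 + b 3), 0, 0, b 3 / (b 0 + b 3)] := by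
  have m1 : max ((x + 0) / 2) 0 = x / 2 := by rw [add_zero, max_eq_left (by linarith)]
  have m2 : max ((0 - x) / 2) 0 = 0 := max_eq_right (by linarith)
  have m3 : max (-((x + 0) / 2)) 0 = 0 := max_eq_right (by linarith)
  have m4 : max (-((0 - x) / 2)) 0 = x / 2 := by rw [max_eq_left (by linarith)]; ring
  have ht : tent b x 0 = (b 0 + b 3) * (x / 2) := by rw [tent, m1, m2, m3, m4]; ring
  rw [quadPoint, ht, m1, m2, m3, m4]
  ext i
  fin_cases i <;> simp <;> field_simp

theorem quadPoint_of_neg {b : Fin 4 → ℝ} {x : ℝ} (hx : x < 0) (hb : b 1 + b 2 ≠ 0) :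
    quadPoint b x 0 = ![0, b 1 / (b 1 + b 2), b 2 / (b 1 + b 2), 0] := by
  have m1 : max ((x + 0) / 2) 0 = 0 := max_eq_right (by linarith)
  have m2 : max ((0 - x) / 2) 0 = -x / 2 := by rw [max_eq_left (by linarith)]; ring
  have m3 : max (-((x + 0) / 2)) 0 = -x / 2 := by rw [max_eq_left (by linarith)]; ring
  have m4 : max (-((0 - x) / 2)) 0 = 0 := max_eq_right (by linarith)
  have ht : tent b x 0 = (b 1 + b 2) * (-x / 2) := by rw [tent, m1, m2, m3, m4]; ring
  have hx' := hx.ne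
  rw [quadPoint, ht, m1, m2, m3, m4]
  ext i
  fin_cases i <;> simp <;> field_simp

theorem quadPoint_zero_of_pos {b : Fin 4 → ℝ} {y : ℝ} (hy : 0 < y) (hb : b 0 + b 1 ≠ 0) :
    quadPoint b 0 y = ![b 0 / (b 0 + b 1), b 1 / (b 0 + b 1), 0, 0] := by
  have m1 : max ((0 + y) / 2) 0 = y / 2 := by rw [max_eq_left (by linarith)]; ring
  have m2 : max ((y - 0) / 2) 0 = y / 2 := by rw [max_eq_left (by linarith)]; ring
  have m3 : max (-((0 + y) / 2)) 0 = 0 := max_eq_right (by linarith)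
  have m4 : max (-((y - 0) / 2)) 0 = 0 := max_eq_right (by linarith)
  have ht : tent b 0 y = (b 0 + b 1) * (y / 2) := by rw [tent, m1, m2, m3, m4]; ring
  rw [quadPoint, ht, m1, m2, m3, m4]
  ext i
  fin_cases i <;> simp <;> field_simp

theorem quadPoint_zero_of_neg {b : Fin 4 → ℝ} {y : ℝ} (hy : y < 0) (hb : b 2 + b 3 ≠ 0) :
    quadPoint b 0 y = ![0, 0, b 2 / (b 2 + b 3), b 3 / (b 2 + b 3)] := by
  have m1 : max ((0 + y) / 2) 0 = 0 := max_eq_right (by linarith)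
  have m2 : max ((y - 0) / 2) 0 = 0 := max_eq_right (by linarith)
  have m3 : max (-((0 + y) / 2)) 0 = -y / 2 := by rw [max_eq_left (by linarith)]; ring
  have m4 : max (-((y - 0) / 2)) 0 = -y / 2 := by rw [max_eq_left (by linarith)]; ring
  have ht : tent b 0 y = (b 2 + b 3) * (-y / 2) := by rw [tent, m1, m2, m3, m4]; ring
  have hy' := hy.ne
  rw [quadPoint, ht, m1, m2, m3, m4]
  ext i
  fin_cases i <;> simp <;> field_simp

theorem circle_re_ne_zero {u : Circle} (hu : (u : ℂ).im = 0) : (u : ℂ).re ≠ 0 := by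
  intro h
  have := normSq_circle u
  rw [h, hu] at this
  norm_num at this

/-- If exactly one edge crosses the disk, the link is a Hopf link. The triangle is shrunk to a
small neighbourhood of the crossing point and tilted, along the crossing edge, into a plane that
also contains the midpoint of the opposite edge. -/
theorem GenericPair.isHopfLink_of_hit {d p h} (H : GenericPair d p h)
    (h12 : Hit d h (p 1) (p 2)) (hother : ∀ i, i ≠ 1 → ¬ Hit d h (p i) (p (i + 1))) :
    IsHopfLink (triangle d ∪ quad p) := by
  obtain ⟨hd, hp, hh, hne, hdis⟩ := id H
  set τ := h (p 1) / (h (p 1) - h (p 2)) with hτ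
  obtain ⟨hτ0, hτ1⟩ : τ ∈ Ioo (0 : ℝ) 1 := crossPoint_param_mem h12.1
  have ex : crossPoint h (p 1) (p 2) = (1 - τ) • p 1 + τ • p 2 := lineMap_eq _ _ _
  set x := crossPoint h (p 1) (p 2) with hx
  have hxD : x ∈ openDisk d := h12.2
  have hx0 : h x = 0 := affineMap_openDisk hh hxD
  have hq : disk d ∩ quad p ⊆ {x} := by
    rintro z ⟨hz, hzq⟩
    obtain ⟨i, hi, rfl⟩ := H.exists_hit hz hzq
    by_cases h1 : i = 1
    · rw [h1]; rfl
    · exact (hother i h1 hi).elim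
  obtain ⟨co, hco1, hco2, hco3⟩ := exists_coord hp
  have hxb : x = comb p ![0, 1 - τ, τ, 0] := by simp [comb, Fin.sum_univ_four, ex]
  have hxb1 : ∑ i, (![0, 1 - τ, τ, 0] : Fin 4 → ℝ) i = 1 := by simp [Fin.sum_univ_four]
  have hcx1 : co 1 x = 1 - τ := by rw [hxb, hco3 _ hxb1]; rfl
  have hcx2 : co 2 x = τ := by rw [hxb, hco3 _ hxb1]; rfl
  -- near `x` only the second and third barycentric coordinates matter
  obtain ⟨r, hr, hr'⟩ : ∃ r > 0, ∀ z, ‖z - x‖ < r → 0 < co 1 z ∧ 0 < co 2 z := by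
    have c1 := (co 1).continuous_of_finiteDimensional.tendsto x
    have c2 := (co 2).continuous_of_finiteDimensional.tendsto x
    obtain ⟨r, hr, hr'⟩ := Metric.eventually_nhds_iff.1
      ((c1.eventually (lt_mem_nhds (by rw [hcx1]; linarith : 0 < co 1 x))).and
        (c2.eventually (lt_mem_nhds (by rw [hcx2]; exact hτ0 : 0 < co 2 x))))
    exact ⟨r, hr, fun z hz => hr' (by rwa [dist_eq_norm])⟩
  -- the plane `k = 0` contains `x` and the midpoint of the edge opposite to the crossing edge
  obtain ⟨k, hk⟩ := exists_affineMap_eq hp (V := ℝ) ![1, 2 * τ, -(2 * (1 - τ)), -1]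
  have hk0 : k (p 0) = 1 := hk 0
  have hk1 : k (p 1) = 2 * τ := hk 1
  have hk2 : k (p 2) = -(2 * (1 - τ)) := hk 2
  have hk3 : k (p 3) = -1 := hk 3
  have hkx : k x = 0 := by
    rw [hxb, affineMap_comb k p hxb1, Fin.sum_univ_four]
    simp [hk1, hk2]
    ring
  set w := p 1 - p 2 with hw
  obtain ⟨ε, hε, hε1, hεd⟩ := exists_smul_norm_lt
    (Sum.elim (fun i => d i - x) fun i : Fin 3 => k (d i) • w) (half_pos hr)
  have hεd1 : ∀ i, ‖ε • (d i - x)‖ < r / 2 := fun i => hεd (Sum.inl i)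
  have hεd2 : ∀ i, ‖ε • k (d i) • w‖ < r / 2 := fun i => hεd (Sum.inr i)
  have hshrink := ambientIsotopic_shrink hd hp hxD hq hε hε1
  set d₁ : Fin 3 → E3 := fun i => x + ε • (d i - x) with hd₁
  have hd₁i : AffineIndependent ℝ d₁ := by simpa using hd.homothety x 0 hε.ne'
  have hcd₁ : ∀ c : Fin 3 → ℝ, ∑ i, c i = 1 → comb d₁ c = x + ε • (comb d c - x) := by
    intro c hc
    have := comb_homothety (d := d) x 0 ε hc
    simpa using this
  have hhd₁ : ∀ i, h (d₁ i) = 0 := by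
    intro i
    rw [hd₁]
    simp [affineMap_add_smul, hx0, hh]
  have hkd₁ : ∀ i, k (d₁ i) = ε * k (d i) := by
    intro i
    rw [hd₁]
    simp [affineMap_add_smul, hkx]
  -- the vertices move parallel to the crossing edge into the plane `k = 0`, so that the triangles
  -- can meet the line through this edge only if the original triangle does
  set D : ℝ → Fin 3 → E3 := fun t i => d₁ i - (t / 2 * k (d₁ i)) • w with hD
  have hDcomb : ∀ t (c : Fin 3 → ℝ), ∑ i, c i = 1 →
      comb (D t) c = comb d₁ c - (t / 2 * k (comb d₁ c)) • w := by
    intro t c hc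
    rw [affineMap_comb k d₁ hc]
    simp only [comb, hD, smul_sub, Finset.sum_sub_distrib, Finset.mul_sum, Finset.sum_smul,
      smul_smul, smul_eq_mul]
    congr 1
    exact Finset.sum_congr rfl fun i _ => by congr 1; ring
  have hDind : ∀ t, AffineIndependent ℝ (D t) := by
    intro t
    rw [affineIndependent_iff_comb]
    intro c hc h0
    have e1 : comb (D t) c = comb d₁ c - (t / 2 * ∑ i, c i * k (d₁ i)) • w := by
      simp only [comb, hD, smul_sub, Finset.sum_sub_distrib, Finset.mul_sum, Finset.sum_smul,
        smul_smul]
      congr 1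
      exact Finset.sum_congr rfl fun i _ => by congr 1; ring
    set s := t / 2 * ∑ i, c i * k (d₁ i)
    rw [h0, eq_comm, sub_eq_zero] at e1
    have e2 := affineMap_comb_of_sum_eq_zero h d₁ hc
    simp only [hhd₁, mul_zero, Finset.sum_const_zero] at e2
    have e3 : h (0 + s • (p 1 - p 2)) = h 0 + s * (h (p 1) - h (p 2)) := affineMap_add_smul _ _ _ _ _
    rw [zero_add, ← hw, ← e1] at e3
    have e4 : s = 0 := by
      have : s * (h (p 1) - h (p 2)) = 0 := by linarith
      exact (mul_eq_zero.1 this).resolve_right (sub_ne_zero.2 (ne_of_mul_neg h12.1))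
    rw [e4, zero_smul] at e1
    exact affineIndependent_iff_comb.1 hd₁i c hc e1
  have hDnorm : ∀ t ∈ Icc (0 : ℝ) 1, ∀ c : Fin 3 → ℝ, (∀ i, 0 ≤ c i) → ∑ i, c i = 1 →
      ‖comb (D t) c - x‖ < r := by
    intro t ht c hc hc1
    have key : ∀ i, ‖D t i - x‖ < r := by
      intro i
      have e : D t i - x = ε • (d i - x) - (t / 2) • (ε • k (d i) • w) := by
        simp only [hD, hkd₁]
        simp only [hd₁]
        module
      rw [e]
      have n1 := norm_sub_le (ε • (d i - x)) ((t / 2) • (ε • k (d i) • w))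
      have n2 : ‖(t / 2) • (ε • k (d i) • w)‖ ≤ ‖ε • k (d i) • w‖ := by
        rw [norm_smul, Real.norm_of_nonneg (by linarith [ht.1])]
        have := norm_nonneg (ε • k (d i) • w)
        nlinarith [ht.2]
      linarith [hεd1 i, hεd2 i]
    obtain ⟨i, -, hi⟩ := Finset.exists_max_image Finset.univ (fun i => ‖D t i - x‖) ⟨0, by simp⟩
    exact (norm_comb_le (fun j => hi j (Finset.mem_univ j)) hc hc1).trans_lt (key i)
  have hDdisj : ∀ t ∈ Icc (0 : ℝ) 1, ∀ c ∈ triangleCoords, comb (D t) c ∉ quad p := by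
    rintro t ht c ⟨hc0, hc1, j, hj⟩ ⟨a, ⟨ha0, ha1, h02, h13⟩, ha⟩
    obtain ⟨n1, n2⟩ := hr' _ (hDnorm t ht c hc0 hc1)
    rw [← ha, hco3 a ha1] at n1 n2
    have a0 : a 0 = 0 := (mul_eq_zero.1 h02).resolve_right n2.ne'
    have a3 : a 3 = 0 := (mul_eq_zero.1 h13).resolve_left n1.ne'
    rw [Fin.sum_univ_four, a0, a3] at ha1
    -- the point lies on the line through `p 1` and `p 2`, hence so does its preimage
    have e1 : comb p a = p 2 + a 1 • w := by
      have : a 2 = 1 - a 1 := by linarith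
      simp only [comb, Fin.sum_univ_four, a0, a3, this, hw]
      module
    rw [hDcomb t c hc1] at ha
    set y := comb d₁ c with hy
    set s := t / 2 * k y
    have e2 : y = p 2 + (a 1 + s) • (p 1 - p 2) := by
      rw [e1] at ha
      rw [add_smul, ← add_assoc, ← hw, ha]
      abel
    have e3 : y = AffineMap.lineMap (p 1) (p 2) (1 - (a 1 + s)) := by
      rw [e2, lineMap_eq]; module
    have e4 : h y = 0 := by
      rw [hy, affineMap_comb h d₁ hc1]
      simp [hhd₁]
    have e5 : y = x := by
      rw [e3] at e4 ⊢
      exact eq_crossPoint (ne_of_mul_neg h12.1) e4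
    rw [hy, hcd₁ c hc1, add_eq_left, smul_eq_zero] at e5
    have e6 : comb d c = x := sub_eq_zero.1 (e5.resolve_left hε.ne')
    exact disjoint_left.1 (disjoint_triangle_openDisk hd) ⟨c, ⟨hc0, hc1, j, hj⟩, e6⟩ hxD
  have htilt : AmbientIsotopic (triangle d₁ ∪ quad p) (triangle (D 1) ∪ quad p) := by
    have e : ∀ t : ℝ, (fun i => d₁ i + t • (D 1 i - d₁ i)) = D t := by
      intro t
      funext i
      simp only [hD]
      module
    refine ambientIsotopic_move_triangle hp (fun t ht => ?_) (fun t ht c hc => ?_)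
    · rw [e]; exact hDind t
    · rw [e]; exact hDdisj t ht c hc
  refine (hshrink.trans htilt).trans ?_
  have hkD : ∀ i, k (D 1 i) = 0 := by
    intro i
    have : D 1 i = d₁ i + (-(1 / 2 * k (d₁ i))) • (p 1 - p 2) := by
      simp only [hD]; module
    rw [this, affineMap_add_smul, hk1, hk2]
    ring
  -- the centre of the cylindrical coordinates
  obtain ⟨cx, ⟨hcx0, hcx1⟩, hcx⟩ := hxD
  have hDx : comb (D 1) cx = x := by
    rw [hDcomb 1 cx hcx1, hcd₁ cx hcx1, hcx]
    simp [hkx]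
  set mb : Fin 4 → ℝ := ![1 / 2, 0, 0, 1 / 2] with hmb
  have hmb1 : ∑ i, mb i = 1 := by simp [hmb, Fin.sum_univ_four]; norm_num
  have hkm : k (comb p mb) = 0 := by
    rw [affineMap_comb k p hmb1, Fin.sum_univ_four]
    simp [hmb, hk0, hk3]
  obtain ⟨cm, hcm1, hcm⟩ := exists_comb_eq (hDind 1) hkD (q := p 0) (by rw [hk0]; norm_num) hkm
  obtain ⟨σ, hσ0, hσ1, hσk, hσc⟩ : ∃ σ : ℝ, 0 < σ ∧ σ < 1 ∧
      σ / 2 < (1 - σ) * (2 * τ * (1 - τ)) ∧ ∀ i, 0 < (1 - σ) * cx i + σ * cm i := by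
    have hlim : ∀ φ : ℝ → ℝ, Continuous φ → 0 < φ 0 → ∀ᶠ σ in 𝓝[>] (0 : ℝ), 0 < φ σ :=
      fun φ hφ h0 => (hφ.tendsto 0).mono_left nhdsWithin_le_nhds |>.eventually (lt_mem_nhds h0)
    have h1 := hlim (fun σ => 1 - σ) (by fun_prop) (by norm_num)
    have h2 := hlim (fun σ => (1 - σ) * (2 * τ * (1 - τ)) - σ / 2) (by fun_prop) (by
      have : 0 < 1 - τ := by linarith
      simp only [sub_zero, zero_div, one_mul]
      positivity)
    have h3 : ∀ᶠ σ in 𝓝[>] (0 : ℝ), ∀ i, 0 < (1 - σ) * cx i + σ * cm i :=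
      eventually_all.2 fun i => hlim (fun σ => (1 - σ) * cx i + σ * cm i) (by fun_prop) (by
        simpa using hcx0 i)
    obtain ⟨σ, ⟨⟨k1, k2⟩, k3⟩, k0⟩ := (((h1.and h2).and h3).and self_mem_nhdsWithin).exists
    exact ⟨σ, k0, by linarith, by linarith, k3⟩
  set b : Fin 4 → ℝ := ![σ / 2, (1 - σ) * (1 - τ), (1 - σ) * τ, σ / 2] with hb
  have hb0 : ∀ i, 0 < b i := by
    have q1 : 0 < 1 - σ := by linarith
    have q2 : 0 < 1 - τ := by linarith
    intro i
    fin_cases i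
    · exact half_pos hσ0
    · exact mul_pos q1 q2
    · exact mul_pos q1 hτ0
    · exact half_pos hσ0
  have hb1 : ∑ i, b i = 1 := by simp [hb, Fin.sum_univ_four]; ring
  have hcb : comb (D 1) (fun i => (1 - σ) * cx i + σ * cm i) = comb p b := by
    have e1 : (fun i => (1 - σ) * cx i + σ * cm i) = (1 - σ) • cx + σ • cm := rfl
    rw [e1, comb_add, comb_smul, comb_smul, hDx, hcm, hxb]
    simp only [comb, Fin.sum_univ_four, hb, hmb, Matrix.cons_val]
    module
  have hc1 : ∑ i, ((1 - σ) * cx i + σ * cm i) = 1 := by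
    rw [Finset.sum_add_distrib, ← Finset.mul_sum, ← Finset.mul_sum, hcx1, hcm1]
    ring
  have he : ∀ i, b i * k (p i) = (![σ / 2, (1 - σ) * (2 * τ * (1 - τ)),
      -((1 - σ) * (2 * τ * (1 - τ))), -(σ / 2)] : Fin 4 → ℝ) i := by
    intro i
    fin_cases i
    · simp [hb, hk0]
    · simp [hb, hk1]; ring
    · simp [hb, hk2]; ring
    · simp [hb, hk3]
  obtain ⟨Ψ, ρ, hρ, hρ0, himg, hu⟩ := exists_affineEquiv_cyl (hDind 1) hp hσc hc1 hb0 hb1 hcb k hkD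
    (by rw [he, he]; simp; linarith)
  refine isHopfLink_of_affine Ψ ?_
  rw [himg]
  have hu2 : ∀ u : Circle, 0 < (u : ℂ).re ^ 2 + (u : ℂ).im ^ 2 := fun u => by
    rw [normSq_circle]; norm_num
  have htp := fun u : Circle => tent_pos hb0 (hu2 u)
  have e0 : 0 < b 0 * k (p 0) := by rw [he]; exact half_pos hσ0
  have e1 : 0 < b 1 * k (p 1) := by rw [he]; simp; linarith
  have e2 : b 2 * k (p 2) = -(b 1 * k (p 1)) := by rw [he, he]; simp
  have e3 : b 3 * k (p 3) = -(b 0 * k (p 0)) := by rw [he, he]; simp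
  have htent0 : ∀ u : Circle, (u : ℂ).im = 0 →
      tent (fun i => b i * k (p i)) (u : ℂ).re (u : ℂ).im = 0 := by
    intro u hu0
    have := tent_antisymm (e := fun i => b i * k (p i)) e2 e3 (u : ℂ).re 0
    rw [hu0]
    rw [neg_zero] at this
    linarith
  refine isHopfLink_cyl hρ ((isLip_tent b).inv htp) ((isLip_tent _).mul ((isLip_tent b).inv htp))
    hρ0 (fun u => inv_pos.2 (htp u)) ?_ ?_ ?_ ?_
  · intro u him
    exact mul_pos (tent_pos_of_antisymm e0 e1 e2 e3 him) (inv_pos.2 (htp u))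
  · intro u him
    refine mul_neg_of_neg_of_pos ?_ (inv_pos.2 (htp u))
    have := tent_pos_of_antisymm (e := fun i => b i * k (p i)) e0 e1 e2 e3 (x := (u : ℂ).re)
      (neg_pos.2 him)
    rw [tent_antisymm (e := fun i => b i * k (p i)) e2 e3] at this
    linarith
  · intro u him hre
    by_contra! hle
    obtain ⟨c, ⟨hc0, hc1'⟩, hc⟩ := (hu u (htent0 u him)).2 hle
    have h1 := (hr' _ (hDnorm 1 (right_mem_Icc.2 zero_le_one) c hc0 hc1')).1
    have hs : b 0 + b 3 ≠ 0 := (add_pos (hb0 0) (hb0 3)).ne'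
    rw [hc, him, quadPoint_of_pos hre hs, hco3 _ (by
      rw [Fin.sum_univ_four]; simp; field_simp)] at h1
    exact h1.false
  · intro u him hre
    refine (hu u (htent0 u him)).1 ?_
    refine ⟨cx, ⟨hcx0, hcx1⟩, ?_⟩
    have hs : b 1 + b 2 = 1 - σ := by simp [hb]; ring
    have hs' : 1 - σ ≠ 0 := by linarith
    rw [him, quadPoint_of_neg hre (by rw [hs]; exact hs'), hDx, hxb, hs]
    congr 1
    funext i
    fin_cases i <;> simp [hb, hs']

/-! ### Alternating crossings: the `(2,4)`-torus link -/

theorem tent_alternating (κ x y : ℝ) :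
    tent ![κ, -κ, κ, -κ] x y = κ * (|(x + y) / 2| - |(y - x) / 2|) := by
  have key : ∀ t : ℝ, max t 0 + max (-t) 0 = |t| := by
    intro t
    rcases le_total t 0 with h | h
    · rw [max_eq_right h, max_eq_left (neg_nonneg.2 h), abs_of_nonpos h, zero_add]
    · rw [max_eq_left h, max_eq_right (neg_nonpos.2 h), abs_of_nonneg h, add_zero]
  rw [← key ((x + y) / 2), ← key ((y - x) / 2), tent]
  simp only [Matrix.cons_val]
  ring

theorem abs_lt_abs_of_mul_pos {x y : ℝ} (h : 0 < x * y) : |(y - x) / 2| < |(x + y) / 2| :=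
  sq_lt_sq.1 (by nlinarith)

theorem abs_lt_abs_of_mul_neg {x y : ℝ} (h : x * y < 0) : |(x + y) / 2| < |(y - x) / 2| :=
  sq_lt_sq.1 (by nlinarith)

set_option maxHeartbeats 1000000 in
/-- If the vertices of the quadrilateral alternate between the two sides of the plane of the
triangle and exactly two opposite edges cross the disk, the link is a `(2,4)`-torus link. -/
theorem GenericPair.isTorusLink_of_pos {d p h} (H : GenericPair d p h) (h0 : 0 < h (p 0))
    (h01 : Hit d h (p 0) (p 1)) (h23 : Hit d h (p 2) (p 3)) (h12 : h (p 1) * h (p 2) < 0)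
    (h30 : ¬ Hit d h (p 3) (p 0)) (h12' : ¬ Hit d h (p 1) (p 2)) :
    IsTorusLink 2 4 (triangle d ∪ quad p) := by
  obtain ⟨hd, hp, hh, hne, hdis⟩ := id H
  have k1 : h (p 1) < 0 := (pos_iff_neg_of_mul_neg h01.1).1 h0
  have k2 : 0 < h (p 2) := (neg_iff_pos_of_mul_neg h12).1 k1
  have k3 : h (p 3) < 0 := (pos_iff_neg_of_mul_neg h23.1).1 k2
  have hS : 0 < (h (p 0))⁻¹ + (-h (p 1))⁻¹ + (h (p 2))⁻¹ + (-h (p 3))⁻¹ := by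
    have := inv_pos.2 h0
    have := inv_pos.2 (neg_pos.2 k1)
    have := inv_pos.2 k2
    have := inv_pos.2 (neg_pos.2 k3)
    positivity
  set S := (h (p 0))⁻¹ + (-h (p 1))⁻¹ + (h (p 2))⁻¹ + (-h (p 3))⁻¹ with hSdef
  have hκ := inv_pos.2 hS
  -- weights for which all four products `b i * h (p i)` have the same absolute value
  set b : Fin 4 → ℝ := ![S⁻¹ * (h (p 0))⁻¹, S⁻¹ * (-h (p 1))⁻¹, S⁻¹ * (h (p 2))⁻¹,
    S⁻¹ * (-h (p 3))⁻¹] with hb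
  have hb0 : ∀ i, 0 < b i := by
    intro i
    fin_cases i
    · exact mul_pos hκ (inv_pos.2 h0)
    · exact mul_pos hκ (inv_pos.2 (neg_pos.2 k1))
    · exact mul_pos hκ (inv_pos.2 k2)
    · exact mul_pos hκ (inv_pos.2 (neg_pos.2 k3))
  have hb1 : ∑ i, b i = 1 := by
    rw [Fin.sum_univ_four]
    change S⁻¹ * _ + S⁻¹ * _ + S⁻¹ * _ + S⁻¹ * _ = 1
    rw [← mul_add, ← mul_add, ← mul_add, ← hSdef]
    exact inv_mul_cancel₀ hS.ne'
  have hbe : (fun i => b i * h (p i)) = ![S⁻¹, -S⁻¹, S⁻¹, -S⁻¹] := by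
    have n0 := h0.ne'
    have n1 := k1.ne
    have n2 := k2.ne'
    have n3 := k3.ne
    funext i
    fin_cases i
    · change S⁻¹ * (h (p 0))⁻¹ * h (p 0) = S⁻¹
      field_simp
    · change S⁻¹ * (-h (p 1))⁻¹ * h (p 1) = -S⁻¹
      field_simp
    · change S⁻¹ * (h (p 2))⁻¹ * h (p 2) = S⁻¹
      field_simp
    · change S⁻¹ * (-h (p 3))⁻¹ * h (p 3) = -S⁻¹
      field_simp
  -- with these weights, the weighted mean of two adjacent vertices is the crossing point
  have hcross : ∀ i j, b i * h (p i) + b j * h (p j) = 0 → b i + b j ≠ 0 → h (p i) ≠ h (p j) →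
      (b i / (b i + b j)) • p i + (b j / (b i + b j)) • p j = crossPoint h (p i) (p j) := by
    intro i j hij hb' hn
    have : crossPoint h (p i) (p j) = AffineMap.lineMap (p i) (p j) (b j / (b i + b j)) := by
      symm
      refine eq_crossPoint hn ?_
      rw [affineMap_lineMap]
      field_simp
      linear_combination hij
    rw [this, lineMap_eq]
    congr 2
    field_simp
    ring
  have hbs : ∀ i j, b i + b j ≠ 0 := fun i j => (add_pos (hb0 i) (hb0 j)).ne'
  have be : ∀ i, b i * h (p i) = (![S⁻¹, -S⁻¹, S⁻¹, -S⁻¹] : Fin 4 → ℝ) i := congrFun hbe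
  have c01 := hcross 0 1 (by rw [be, be]; simp) (hbs 0 1) (ne_of_mul_neg h01.1)
  have c23 := hcross 2 3 (by rw [be, be]; simp) (hbs 2 3) (ne_of_mul_neg h23.1)
  have c12 := hcross 1 2 (by rw [be, be]; simp) (hbs 1 2) (ne_of_mul_neg h12)
  have s30 : h (p 3) * h (p 0) < 0 := mul_neg_of_neg_of_pos k3 h0
  have c30 := hcross 3 0 (by rw [be, be]; simp) (hbs 3 0) (ne_of_mul_neg s30)
  have n12 : crossPoint h (p 1) (p 2) ∉ disk d := by
    intro hmem
    rw [disk_eq] at hmem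
    exact hmem.elim (fun ht => disjoint_left.1 hdis ht (crossPoint_mem_quad (i := 1) h12))
      fun ht => h12' ⟨h12, ht⟩
  have n30 : crossPoint h (p 3) (p 0) ∉ disk d := by
    intro hmem
    rw [disk_eq] at hmem
    exact hmem.elim (fun ht => disjoint_left.1 hdis ht (crossPoint_mem_quad (i := 3) s30))
      fun ht => h30 ⟨s30, ht⟩
  have hmem : comb p b ∈ openDisk d := by
    have := convex_openDisk d h01.2 h23.2 (add_pos (hb0 0) (hb0 1)).le
      (add_pos (hb0 2) (hb0 3)).le (by rw [← hb1, Fin.sum_univ_four]; ring)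
    rw [← c01, ← c23, smul_add, smul_add, smul_smul, smul_smul, smul_smul, smul_smul,
      mul_div_cancel₀ _ (hbs 0 1), mul_div_cancel₀ _ (hbs 0 1), mul_div_cancel₀ _ (hbs 2 3),
      mul_div_cancel₀ _ (hbs 2 3)] at this
    rw [comb, Fin.sum_univ_four, add_assoc (b 0 • p 0 + b 1 • p 1)]
    exact this
  obtain ⟨c, ⟨hc0, hc1⟩, hc⟩ := hmem
  obtain ⟨Ψ, ρ, hρ, hρ0, himg, hu⟩ := exists_affineEquiv_cyl hd hp hc0 hc1 hb0 hb1 hc h hh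
    (by rw [be, be]; simp; exact hS.ne')
  refine isTorusLink_of_affine Ψ ?_
  rw [himg]
  left
  have hu2 : ∀ u : Circle, 0 < (u : ℂ).re ^ 2 + (u : ℂ).im ^ 2 := fun u => by
    rw [normSq_circle]; norm_num
  have htp := fun u : Circle => tent_pos hb0 (hu2 u)
  rw [hbe] at hu ⊢
  have hz : ∀ u : Circle, (u : ℂ).re = 0 ∨ (u : ℂ).im = 0 →
      tent ![S⁻¹, -S⁻¹, S⁻¹, -S⁻¹] (u : ℂ).re (u : ℂ).im = 0 := by
    intro u hu0
    rw [tent_alternating]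
    rcases hu0 with h | h
    · rw [h, zero_add, sub_zero, sub_self, mul_zero]
    · rw [h, add_zero, zero_sub, neg_div, abs_neg, sub_self, mul_zero]
  refine isTorusLink_cyl hρ ((isLip_tent b).inv htp) ((isLip_tent _).mul ((isLip_tent b).inv htp))
    hρ0 (fun u => inv_pos.2 (htp u)) ?_ ?_ ?_ ?_
  · intro u hpos
    refine mul_pos ?_ (inv_pos.2 (htp u))
    rw [tent_alternating]
    exact mul_pos hκ (sub_pos.2 (abs_lt_abs_of_mul_pos hpos))
  · intro u hneg
    refine mul_neg_of_neg_of_pos ?_ (inv_pos.2 (htp u))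
    rw [tent_alternating]
    exact mul_neg_of_pos_of_neg hκ (sub_neg.2 (abs_lt_abs_of_mul_neg hneg))
  · intro u him
    by_contra! hle
    have hmem := (hu u (hz u (Or.inr him))).2 hle
    rw [him] at hmem
    rcases (circle_re_ne_zero him).lt_or_gt with hre | hre
    · rw [quadPoint_of_neg hre (hbs 1 2)] at hmem
      apply n12
      rw [← c12]
      convert hmem using 1
      simp [comb, Fin.sum_univ_four]
    · rw [quadPoint_of_pos hre (hbs 0 3)] at hmem
      apply n30
      rw [← c30]
      convert hmem using 1
      simp only [comb, Fin.sum_univ_four, Matrix.cons_val, add_comm (b 3) (b 0)]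
      module
  · intro u hre
    refine (hu u (hz u (Or.inl hre))).1 ?_
    have him : (u : ℂ).im ≠ 0 := fun h => circle_re_ne_zero h hre
    rw [hre]
    rcases him.lt_or_gt with him | him
    · rw [quadPoint_zero_of_neg him (hbs 2 3)]
      convert h23.2 using 1
      rw [← c23]
      simp [comb, Fin.sum_univ_four]
    · rw [quadPoint_zero_of_pos him (hbs 0 1)]
      convert h01.2 using 1
      rw [← c01]
      simp [comb, Fin.sum_univ_four]

theorem hit_neg {d : Fin 3 → E3} {h : E3 →ᵃ[ℝ] ℝ} {a b : E3} : Hit d (-h) a b ↔ Hit d h a b := by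
  have e : ∀ x, (-h) x = -h x := fun x => rfl
  have : crossPoint (-h) a b = crossPoint h a b := by
    rw [crossPoint, crossPoint, e, e, show -h a - -h b = -(h a - h b) by ring, neg_div_neg_eq]
  rw [Hit, Hit, this, e, e, neg_mul_neg]

/-- The link type does not depend on the sign of `h`, which may be chosen such that `p 0` is on the
positive side. -/
theorem GenericPair.isTorusLink_of_alternating {d p h} (H : GenericPair d p h)
    (h01 : Hit d h (p 0) (p 1)) (h23 : Hit d h (p 2) (p 3)) (h12 : h (p 1) * h (p 2) < 0)
    (h30 : ¬ Hit d h (p 3) (p 0)) (h12' : ¬ Hit d h (p 1) (p 2)) :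
    IsTorusLink 2 4 (triangle d ∪ quad p) := by
  rcases (H.ne_zero 0).lt_or_gt with h0 | h0
  · have H' : GenericPair d p (-h) := ⟨H.1, H.2, fun i => by
      change -h (d i) = 0
      rw [H.3, neg_zero], fun i => neg_ne_zero.2 (H.4 i), H.5⟩
    exact H'.isTorusLink_of_pos (neg_pos.2 h0) (hit_neg.2 h01) (hit_neg.2 h23)
      (by change -h (p 1) * -h (p 2) < 0; rwa [neg_mul_neg]) (by rwa [hit_neg]) (by rwa [hit_neg])
  · exact H.isTorusLink_of_pos h0 h01 h23 h12 h30 h12'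

/-! ### The link type determined by the crossings -/

/-- The pattern of crossings that produces a `(2,4)`-torus link: the edges `p 0 p 1` and `p 2 p 3`
cross the disk, the two other edges do not, and the vertices alternate between the two sides of the
plane. The alternation at the crossing edges is part of `Hit`, so one further sign suffices. -/
def IsTorusPattern (d : Fin 3 → E3) (p : Fin 4 → E3) (h : E3 →ᵃ[ℝ] ℝ) : Prop :=
  Hit d h (p 0) (p 1) ∧ Hit d h (p 2) (p 3) ∧ h (p 1) * h (p 2) < 0 ∧
    ¬ Hit d h (p 3) (p 0) ∧ ¬ Hit d h (p 1) (p 2)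

open Classical in
/-- The number of edges of the quadrilateral that cross the disk. -/
noncomputable def numHits (d : Fin 3 → E3) (p : Fin 4 → E3) (h : E3 →ᵃ[ℝ] ℝ) : ℕ :=
  (Finset.univ.filter fun i : Fin 4 => Hit d h (p i) (p (i + 1))).card

open Classical in
theorem numHits_eq (d : Fin 3 → E3) (p : Fin 4 → E3) (h : E3 →ᵃ[ℝ] ℝ) :
    numHits d p h = (if Hit d h (p 0) (p 1) then 1 else 0) +
      (if Hit d h (p 1) (p 2) then 1 else 0) + (if Hit d h (p 2) (p 3) then 1 else 0) +
        (if Hit d h (p 3) (p 0) then 1 else 0) := by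
  rw [numHits, Finset.card_filter, Fin.sum_univ_four]
  rfl

theorem GenericPair.isHopfLink_of_unique {d p h} (H : GenericPair d p h)
    (h0 : ¬ Hit d h (p 0) (p 1)) (h1 : Hit d h (p 1) (p 2)) (h2 : ¬ Hit d h (p 2) (p 3))
    (h3 : ¬ Hit d h (p 3) (p 0)) : IsHopfLink (triangle d ∪ quad p) := by
  refine H.isHopfLink_of_hit h1 fun i hi => ?_
  fin_cases i
  · exact h0
  · exact (hi rfl).elim
  · exact h2
  · exact h3

theorem GenericPair.isTrivialLink_of_none {d p h} (H : GenericPair d p h)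
    (h0 : ¬ Hit d h (p 0) (p 1)) (h1 : ¬ Hit d h (p 1) (p 2)) (h2 : ¬ Hit d h (p 2) (p 3))
    (h3 : ¬ Hit d h (p 3) (p 0)) : IsTrivialLink (triangle d ∪ quad p) := by
  refine H.isTrivialLink_of_disjoint (disjoint_left.2 fun z hz hq => ?_)
  obtain ⟨i, hi, -⟩ := H.exists_hit hz hq
  fin_cases i
  · exact h0 hi
  · exact h1 hi
  · exact h2 hi
  · exact h3 hi

/-- The effect of pulling back a vertex on the crossings. -/
theorem GenericPair.exists_pull_not_hit {d p h} (H : GenericPair d p h) (h01 : Hit d h (p 0) (p 1))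
    (h12 : Hit d h (p 1) (p 2)) : ∃ p' : Fin 4 → E3, GenericPair d p' h ∧
      AmbientIsotopic (triangle d ∪ quad p) (triangle d ∪ quad p') ∧ ¬ Hit d h (p' 0) (p' 1) ∧
      ¬ Hit d h (p' 1) (p' 2) ∧ p' 2 = p 2 ∧ p' 3 = p 3 ∧ p' 0 = p 0 := by
  obtain ⟨q, H', hq, hiso⟩ := H.exists_pull h01 h12
  refine ⟨_, H', hiso, fun hit => ?_, fun hit => ?_, rfl, rfl, rfl⟩
  · exact lt_asymm hq hit.1
  · have h1 := hit.1
    change h q * h (p 2) < 0 at h1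
    have h2 := h01.1
    have h3 := h12.1
    have e1 : 0 < (h (p 0) * h (p 1)) * (h (p 1) * h (p 2)) := mul_pos_of_neg_of_neg h2 h3
    have e2 : (h (p 0) * h q) * (h q * h (p 2)) < 0 := mul_neg_of_pos_of_neg hq h1
    have e3 : 0 < h (p 1) * h (p 1) := mul_self_pos.2 (H.ne_zero 1)
    have e4 : 0 ≤ h q * h q := mul_self_nonneg _
    have e5 : 0 < h (p 0) * h (p 2) := pos_of_mul_pos_left
      (by linarith : 0 < (h (p 0) * h (p 2)) * (h (p 1) * h (p 1))) e3.le
    nlinarith [mul_nonneg e5.le e4]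

/-- If two adjacent edges cross the disk, pulling back their common vertex removes both crossings.
-/
theorem GenericPair.isHopfLink_or {d p h} (H : GenericPair d p h) (h01 : Hit d h (p 0) (p 1))
    (h12 : Hit d h (p 1) (p 2)) :
    (¬ Hit d h (p 2) (p 3) → ¬ Hit d h (p 3) (p 0) → IsTrivialLink (triangle d ∪ quad p)) ∧
    (Hit d h (p 2) (p 3) → ¬ Hit d h (p 3) (p 0) → IsHopfLink (triangle d ∪ quad p)) ∧
    (¬ Hit d h (p 2) (p 3) → Hit d h (p 3) (p 0) → IsHopfLink (triangle d ∪ quad p)) := by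
  obtain ⟨p', H', hiso, n0, n1, e2, e3, e0⟩ := H.exists_pull_not_hit h01 h12
  rw [← e2, ← e3, ← e0]
  refine ⟨fun n2 n3 => hiso.trans (H'.isTrivialLink_of_none n0 n1 n2 n3),
    fun n2 n3 => hiso.trans ?_, fun n2 n3 => hiso.trans ?_⟩
  · have := H'.rotate.isHopfLink_of_unique n1 n2 n3 n0
    rwa [quad_rotate] at this
  · have := H'.rotate.rotate.isHopfLink_of_unique n2 n3 n0 n1
    rwa [(quad_rotate fun i => p' (i + 1)).trans (quad_rotate p')] at this

/-- Four crossings are removed by pulling back two opposite vertices. -/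
theorem GenericPair.isTrivialLink_of_four {d p h} (H : GenericPair d p h)
    (h01 : Hit d h (p 0) (p 1)) (h12 : Hit d h (p 1) (p 2)) (h23 : Hit d h (p 2) (p 3))
    (h30 : Hit d h (p 3) (p 0)) : IsTrivialLink (triangle d ∪ quad p) := by
  obtain ⟨p', H', hiso, n0, n1, e2, e3, e0⟩ := H.exists_pull_not_hit h01 h12
  rw [← e2, ← e3] at h23
  rw [← e3, ← e0] at h30
  have := (H'.rotate.rotate.isHopfLink_or h23 h30).1 n0 n1
  rw [(quad_rotate fun i => p' (i + 1)).trans (quad_rotate p')] at this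
  exact hiso.trans this

/-- Two crossings of opposite edges can be removed unless the vertices alternate. -/
theorem GenericPair.isTrivialLink_of_two {d p h} (H : GenericPair d p h)
    (n0 : ¬ Hit d h (p 0) (p 1)) (h12 : Hit d h (p 1) (p 2)) (n2 : ¬ Hit d h (p 2) (p 3))
    (h30 : Hit d h (p 3) (p 0)) (hT : ¬ IsTorusPattern d (fun i => p (i + 1)) h) :
    IsTrivialLink (triangle d ∪ quad p) := by
  have s0 := H.ne_zero 0
  have s1 := H.ne_zero 1
  rcases (mul_ne_zero s0 s1).lt_or_gt with hs | hs
  · refine (hT ⟨h12, h30, ?_, n0, n2⟩).elim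
    change h (p 2) * h (p 3) < 0
    have e1 := mul_pos_of_neg_of_neg h12.1 h30.1
    have e2 : 0 < (h (p 0) * h (p 1)) * (h (p 2) * h (p 3)) := by linarith
    exact (neg_iff_neg_of_mul_pos e2).1 hs
  · exact H.isTrivialLink_of_opposite hs h12 h30

/-- The classification of links formed by a triangle and a quadrilateral. -/
theorem GenericPair.classification {d p h} (H : GenericPair d p h) :
    (Odd (numHits d p h) → IsHopfLink (triangle d ∪ quad p)) ∧
    (Even (numHits d p h) → ¬ IsTorusPattern d p h → ¬ IsTorusPattern d (fun i => p (i + 1)) h →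
      IsTrivialLink (triangle d ∪ quad p)) := by
  have q1 := quad_rotate p
  have q2 := (quad_rotate fun i => p (i + 1)).trans q1
  have q3 := (quad_rotate fun i => p (i + 1 + 1)).trans q2
  have H1 := H.rotate
  have H2 := H1.rotate
  have H3 := H2.rotate
  rw [numHits_eq]
  by_cases k0 : Hit d h (p 0) (p 1) <;> by_cases k1 : Hit d h (p 1) (p 2) <;>
    by_cases k2 : Hit d h (p 2) (p 3) <;> by_cases k3 : Hit d h (p 3) (p 0) <;>
    simp only [k0, k1, k2, k3, if_true, if_false]
  · exact ⟨fun h => absurd h (by decide), fun _ _ _ => H.isTrivialLink_of_four k0 k1 k2 k3⟩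
  · exact ⟨fun _ => (H.isHopfLink_or k0 k1).2.1 k2 k3, fun h => absurd h (by decide)⟩
  · exact ⟨fun _ => (H.isHopfLink_or k0 k1).2.2 k2 k3, fun h => absurd h (by decide)⟩
  · exact ⟨fun h => absurd h (by decide), fun _ _ _ => (H.isHopfLink_or k0 k1).1 k2 k3⟩
  · exact ⟨fun _ => q3 ▸ (H3.isHopfLink_or k3 k0).2.2 k1 k2, fun h => absurd h (by decide)⟩
  · refine ⟨fun h => absurd h (by decide), fun _ hT _ => q1 ▸ H1.isTrivialLink_of_two k1 k2 k3 k0 ?_⟩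
    rintro ⟨-, -, h30, -, -⟩
    change h (p 3) * h (p 0) < 0 at h30
    refine hT ⟨k0, k2, ?_, k3, k1⟩
    have e1 := mul_pos_of_neg_of_neg k0.1 k2.1
    have e2 : 0 < (h (p 3) * h (p 0)) * (h (p 1) * h (p 2)) := by linarith
    exact (neg_iff_neg_of_mul_pos e2).1 h30
  · exact ⟨fun h => absurd h (by decide), fun _ _ _ => q3 ▸ (H3.isHopfLink_or k3 k0).1 k1 k2⟩
  · exact ⟨fun _ => q3 ▸ H3.isHopfLink_of_unique k3 k0 k1 k2, fun h => absurd h (by decide)⟩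
  · exact ⟨fun _ => q1 ▸ (H1.isHopfLink_or k1 k2).2.1 k3 k0, fun h => absurd h (by decide)⟩
  · exact ⟨fun h => absurd h (by decide), fun _ _ _ => q1 ▸ (H1.isHopfLink_or k1 k2).1 k3 k0⟩
  · exact ⟨fun h => absurd h (by decide), fun _ _ hT => H.isTrivialLink_of_two k0 k1 k2 k3 hT⟩
  · exact ⟨fun _ => H.isHopfLink_of_unique k0 k1 k2 k3, fun h => absurd h (by decide)⟩
  · exact ⟨fun h => absurd h (by decide), fun _ _ _ => q2 ▸ (H2.isHopfLink_or k2 k3).1 k0 k1⟩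
  · exact ⟨fun _ => q1 ▸ H1.isHopfLink_of_unique k1 k2 k3 k0, fun h => absurd h (by decide)⟩
  · exact ⟨fun _ => q2 ▸ H2.isHopfLink_of_unique k2 k3 k0 k1, fun h => absurd h (by decide)⟩
  · exact ⟨fun h => absurd h (by decide), fun _ _ _ => H.isTrivialLink_of_none k0 k1 k2 k3⟩

/-! ### Perturbing a linear embedding into general position -/

/-- Six times the signed volume of the tetrahedron `a b c d`. -/
def vol (a b c d : E3) : ℝ :=
  (b 0 - a 0) * ((c 1 - a 1) * (d 2 - a 2) - (c 2 - a 2) * (d 1 - a 1)) -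
    (b 1 - a 1) * ((c 0 - a 0) * (d 2 - a 2) - (c 2 - a 2) * (d 0 - a 0)) +
      (b 2 - a 2) * ((c 0 - a 0) * (d 1 - a 1) - (c 1 - a 1) * (d 0 - a 0))

/-- An affine dependence has zero coefficients because each of them is annihilated by the volume, as
in the rule of Cramer. -/
theorem affineIndependent_of_vol_ne_zero {p : Fin 4 → E3} (h : vol (p 0) (p 1) (p 2) (p 3) ≠ 0) :
    AffineIndependent ℝ p := by
  rw [affineIndependent_iff_comb]
  intro w hw h0
  have e : ∀ j, w 0 * p 0 j + w 1 * p 1 j + w 2 * p 2 j + w 3 * p 3 j = 0 := by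
    intro j
    have := comb_apply p w j
    rw [h0, Fin.sum_univ_four] at this
    exact this.symm
  have e0 := e 0
  have e1 := e 1
  have e2 := e 2
  rw [Fin.sum_univ_four] at hw
  have hw0 : w 0 = -(w 1 + w 2 + w 3) := by linarith
  rw [hw0] at e0 e1 e2
  have z1 : w 1 * vol (p 0) (p 1) (p 2) (p 3) = 0 := by
    rw [vol]
    linear_combination e0 * ((p 2 1 - p 0 1) * (p 3 2 - p 0 2) - (p 2 2 - p 0 2) * (p 3 1 - p 0 1)) -
      e1 * ((p 2 0 - p 0 0) * (p 3 2 - p 0 2) - (p 2 2 - p 0 2) * (p 3 0 - p 0 0)) +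
      e2 * ((p 2 0 - p 0 0) * (p 3 1 - p 0 1) - (p 2 1 - p 0 1) * (p 3 0 - p 0 0))
  have z2 : w 2 * vol (p 0) (p 1) (p 2) (p 3) = 0 := by
    rw [vol]
    linear_combination e0 * ((p 3 1 - p 0 1) * (p 1 2 - p 0 2) - (p 3 2 - p 0 2) * (p 1 1 - p 0 1)) -
      e1 * ((p 3 0 - p 0 0) * (p 1 2 - p 0 2) - (p 3 2 - p 0 2) * (p 1 0 - p 0 0)) +
      e2 * ((p 3 0 - p 0 0) * (p 1 1 - p 0 1) - (p 3 1 - p 0 1) * (p 1 0 - p 0 0))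
  have z3 : w 3 * vol (p 0) (p 1) (p 2) (p 3) = 0 := by
    rw [vol]
    linear_combination e0 * ((p 1 1 - p 0 1) * (p 2 2 - p 0 2) - (p 1 2 - p 0 2) * (p 2 1 - p 0 1)) -
      e1 * ((p 1 0 - p 0 0) * (p 2 2 - p 0 2) - (p 1 2 - p 0 2) * (p 2 0 - p 0 0)) +
      e2 * ((p 1 0 - p 0 0) * (p 2 1 - p 0 1) - (p 1 1 - p 0 1) * (p 2 0 - p 0 0))
  have y1 := (mul_eq_zero.1 z1).resolve_right h
  have y2 := (mul_eq_zero.1 z2).resolve_right h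
  have y3 := (mul_eq_zero.1 z3).resolve_right h
  funext i
  fin_cases i <;> simp [hw0, y1, y2, y3]

/-- The volume is a cubic polynomial in the size of a displacement, whose leading coefficient is the
volume of the displacement vectors. -/
theorem vol_add_smul (a b c d a' b' c' d' : E3) (s : ℝ) :
    vol (a + s • a') (b + s • b') (c + s • c') (d + s • d') = vol a b c d +
      ((vol (a + a') (b + b') (c + c') (d + d') - vol (a - a') (b - b') (c - c') (d - d')) / 2 -
        vol a' b' c' d') * s +
      ((vol (a + a') (b + b') (c + c') (d + d') + vol (a - a') (b - b') (c - c') (d - d')) / 2 -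
        vol a b c d) * s ^ 2 + vol a' b' c' d' * s ^ 3 := by
  simp only [vol, PiLp.add_apply, PiLp.sub_apply, PiLp.smul_apply, smul_eq_mul]
  ring

/-- The moment curve. -/
noncomputable def moment (x : ℝ) : E3 := !₂[x, x ^ 2, x ^ 3]

theorem vol_moment (a b c d : ℝ) : vol (moment a) (moment b) (moment c) (moment d) =
    (b - a) * (c - a) * (d - a) * (c - b) * (d - b) * (d - c) := by
  simp [vol, moment]
  ring

open Polynomial in
theorem cubic_ne_zero (a b c : ℝ) {d : ℝ} (hd : d ≠ 0) : C a + C b * X + C c * X ^ 2 + C d * X ^ 3 ≠ 0 := by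
  intro h
  have := congrArg (fun r => coeff r 3) h
  simp [coeff_X_pow] at this
  exact hd this

/-- Moving finitely many points along the moment curve makes any four of them affinely
independent. -/
theorem exists_vol_ne_zero {V : Type*} [Finite V] (f : V → E3) {n : V → ℝ}
    (hn : Function.Injective n) {δ : ℝ} (hδ : 0 < δ) :
    ∃ s ∈ Ioo 0 δ, ∀ q : Fin 4 → V, Function.Injective q →
      vol (f (q 0) + s • moment (n (q 0))) (f (q 1) + s • moment (n (q 1)))
        (f (q 2) + s • moment (n (q 2))) (f (q 3) + s • moment (n (q 3))) ≠ 0 := by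
  have hD : ∀ q : {q : Fin 4 → V // Function.Injective q},
      vol (moment (n (q.1 0))) (moment (n (q.1 1))) (moment (n (q.1 2))) (moment (n (q.1 3))) ≠ 0 := by
    rintro ⟨q, hq⟩
    rw [vol_moment]
    have key : ∀ i j, i ≠ j → n (q i) - n (q j) ≠ 0 := fun i j hij =>
      sub_ne_zero.2 ((hn.comp hq).ne hij)
    simp [key]
  set A := fun q : {q : Fin 4 → V // Function.Injective q} => fun i => f (q.1 i)
  set B := fun q : {q : Fin 4 → V // Function.Injective q} => fun i => moment (n (q.1 i))
  open Polynomial in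
  obtain ⟨s, hs, hs'⟩ := exists_pos_eval_ne_zero
    (fun q : {q : Fin 4 → V // Function.Injective q} =>
      Polynomial.C (vol (A q 0) (A q 1) (A q 2) (A q 3)) +
      Polynomial.C ((vol (A q 0 + B q 0) (A q 1 + B q 1) (A q 2 + B q 2) (A q 3 + B q 3) -
        vol (A q 0 - B q 0) (A q 1 - B q 1) (A q 2 - B q 2) (A q 3 - B q 3)) / 2 -
        vol (B q 0) (B q 1) (B q 2) (B q 3)) * X +
      Polynomial.C ((vol (A q 0 + B q 0) (A q 1 + B q 1) (A q 2 + B q 2) (A q 3 + B q 3) +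
        vol (A q 0 - B q 0) (A q 1 - B q 1) (A q 2 - B q 2) (A q 3 - B q 3)) / 2 -
        vol (A q 0) (A q 1) (A q 2) (A q 3)) * X ^ 2 +
      Polynomial.C (vol (B q 0) (B q 1) (B q 2) (B q 3)) * X ^ 3)
    (fun q => cubic_ne_zero _ _ _ (hD q)) hδ
  refine ⟨s, hs, fun q hq => ?_⟩
  rw [vol_add_smul]
  simpa using hs' ⟨q, hq⟩

/-- Two segments from a common point in different directions diverge at a linear rate. -/
theorem exists_pos_mul_add_le {p q : E3}
    (h : ∀ s t : ℝ, 0 ≤ s → 0 ≤ t → s • p = t • q → s = 0 ∧ t = 0) :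
    ∃ m > 0, ∀ s t : ℝ, 0 ≤ s → 0 ≤ t → m * (s + t) ≤ ‖s • p - t • q‖ := by
  obtain ⟨m, hm, hm'⟩ := exists_pos_le (X := Icc (0 : ℝ) 1)
    (φ := fun s => ‖(s : ℝ) • p - (1 - (s : ℝ)) • q‖) (by fun_prop) (fun s => by
      refine norm_pos_iff.2 (sub_ne_zero.2 fun h0 => ?_)
      obtain ⟨h1, h2⟩ := h _ _ s.2.1 (sub_nonneg.2 s.2.2) h0
      linarith)
  refine ⟨m, hm, fun s t hs ht => ?_⟩
  rcases (add_nonneg hs ht).eq_or_lt with h0 | h0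
  · rw [← h0, mul_zero]; exact norm_nonneg _
  · have key := hm' ⟨s / (s + t), div_nonneg hs h0.le, (div_le_one h0).2 (by linarith)⟩
    have e : s • p - t • q = (s + t) • ((s / (s + t)) • p - (1 - s / (s + t)) • q) := by
      rw [smul_sub, smul_smul, smul_smul, mul_div_cancel₀ _ h0.ne', mul_sub,
        mul_div_cancel₀ _ h0.ne']
      congr 2
      ring
    rw [e, norm_smul, Real.norm_of_nonneg h0.le, mul_comm]
    exact mul_le_mul_of_nonneg_left key h0.le

/-- Two edges of a linear embedding at a common vertex point in different directions. -/
theorem IsLinearEmbedding.eq_zero_of_smul_eq {V : Type*} {G : SimpleGraph V} {f : V → E3}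
    (hf : IsLinearEmbedding G f) {z b d : V} (hb : G.Adj z b) (hd : G.Adj z d) (hbd : b ≠ d)
    {s t : ℝ} (hs : 0 ≤ s) (ht : 0 ≤ t) (h : s • (f b - f z) = t • (f d - f z)) :
    s = 0 ∧ t = 0 := by
  have nb : f b - f z ≠ 0 := sub_ne_zero.2 (hf.injective.ne hb.ne')
  have nd : f d - f z ≠ 0 := sub_ne_zero.2 (hf.injective.ne hd.ne')
  rcases hs.eq_or_lt with rfl | hs
  · rw [zero_smul, eq_comm, smul_eq_zero] at h
    exact ⟨rfl, h.resolve_right nd⟩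
  rcases ht.eq_or_lt with rfl | ht
  · rw [zero_smul, smul_eq_zero] at h
    exact ⟨h.resolve_right nb, rfl⟩
  exfalso
  have h1 : f z + (s / (s + t + 1)) • (f b - f z) ∈ openSegment ℝ (f z) (f b) := by
    rw [openSegment_eq_image']
    exact ⟨s / (s + t + 1), ⟨by positivity, (div_lt_one (by positivity)).2 (by linarith)⟩, rfl⟩
  have h2 : f z + (s / (s + t + 1)) • (f b - f z) ∈ openSegment ℝ (f z) (f d) := by
    rw [openSegment_eq_image']
    refine ⟨t / (s + t + 1), ⟨by positivity, (div_lt_one (by positivity)).2 (by linarith)⟩, ?_⟩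
    have : (s + t + 1)⁻¹ • s • (f b - f z) = (s + t + 1)⁻¹ • t • (f d - f z) := by rw [h]
    rw [smul_smul, smul_smul] at this
    simp only [div_eq_inv_mul, this]
  exact disjoint_left.1 (hf.edge_edge z b z d hb hd (by simp [hbd, hd.ne])) h1 h2

/-- Disjoint edges of a linear embedding have disjoint images. -/
theorem IsLinearEmbedding.disjoint_segment {V : Type*} {G : SimpleGraph V} {f : V → E3}
    (hf : IsLinearEmbedding G f) {a b c d : V} (hab : G.Adj a b) (hcd : G.Adj c d) (hac : a ≠ c)
    (had : a ≠ d) (hbc : b ≠ c) (hbd : b ≠ d) :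
    Disjoint (segment ℝ (f a) (f b)) (segment ℝ (f c) (f d)) := by
  rw [← insert_endpoints_openSegment, ← insert_endpoints_openSegment, disjoint_left]
  have inj := hf.injective
  rintro x (rfl | rfl | h1) (h2 | h2 | h2)
  · exact hac (inj h2)
  · exact had (inj h2)
  · exact hf.vertex_edge _ _ _ hcd h2
  · exact hbc (inj h2)
  · exact hbd (inj h2)
  · exact hf.vertex_edge _ _ _ hcd h2
  · exact hf.vertex_edge _ _ _ hab (h2 ▸ h1)
  · exact hf.vertex_edge _ _ _ hab (h2 ▸ h1)
  · exact disjoint_left.1 (hf.edge_edge a b c d hab hcd (by simp [hac, had])) h1 h2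

/-- A piecewise linear displacement of the graph is Lipschitz on each pair of edges. -/
theorem IsLinearEmbedding.exists_lipschitz {V : Type*} {G : SimpleGraph V} {f : V → E3}
    (hf : IsLinearEmbedding G f) (u : V → E3) {a b c d : V} (hab : G.Adj a b) (hcd : G.Adj c d) :
    ∃ M ≥ (0 : ℝ), ∀ s ∈ Icc (0 : ℝ) 1, ∀ t ∈ Icc (0 : ℝ) 1,
      ‖AffineMap.lineMap (u a) (u b) s - AffineMap.lineMap (u c) (u d) t‖ ≤
        M * ‖AffineMap.lineMap (f a) (f b) s - AffineMap.lineMap (f c) (f d) t‖ := by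
  have hdiff : ∀ (g : V → E3) (a b d : V) (s t : ℝ),
      AffineMap.lineMap (g a) (g b) s - AffineMap.lineMap (g a) (g d) t =
        s • (g b - g a) - t • (g d - g a) := by
    intro g a b d s t
    rw [lineMap_eq, lineMap_eq]
    module
  -- two edges starting at the same vertex
  have hshare : ∀ a b d, G.Adj a b → G.Adj a d → ∃ M ≥ (0 : ℝ), ∀ s ∈ Icc (0 : ℝ) 1,
      ∀ t ∈ Icc (0 : ℝ) 1,
      ‖AffineMap.lineMap (u a) (u b) s - AffineMap.lineMap (u a) (u d) t‖ ≤
        M * ‖AffineMap.lineMap (f a) (f b) s - AffineMap.lineMap (f a) (f d) t‖ := by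
    intro a b d hab had
    simp only [hdiff]
    by_cases hbd : b = d
    · subst hbd
      have h0 : 0 < ‖f b - f a‖ := norm_pos_iff.2 (sub_ne_zero.2 (hf.injective.ne hab.ne'))
      refine ⟨‖u b - u a‖ / ‖f b - f a‖, by positivity, fun s _ t _ => le_of_eq ?_⟩
      rw [← sub_smul, ← sub_smul, norm_smul, norm_smul]
      field_simp
    · obtain ⟨m, hm, hm'⟩ := exists_pos_mul_add_le (p := f b - f a) (q := f d - f a)
        fun s t hs ht h => hf.eq_zero_of_smul_eq hab had hbd hs ht h
      refine ⟨(‖u b - u a‖ + ‖u d - u a‖) / m, by positivity, fun s hs t ht => ?_⟩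
      have h1 := hm' s t hs.1 ht.1
      calc ‖s • (u b - u a) - t • (u d - u a)‖ ≤ s * ‖u b - u a‖ + t * ‖u d - u a‖ := by
            refine (norm_sub_le _ _).trans (le_of_eq ?_)
            rw [norm_smul, norm_smul, Real.norm_of_nonneg hs.1, Real.norm_of_nonneg ht.1]
        _ ≤ (‖u b - u a‖ + ‖u d - u a‖) * (s + t) := by
            have := mul_nonneg hs.1 (norm_nonneg (u d - u a))
            have := mul_nonneg ht.1 (norm_nonneg (u b - u a))
            nlinarith
        _ = (‖u b - u a‖ + ‖u d - u a‖) / m * (m * (s + t)) := by field_simp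
        _ ≤ _ := mul_le_mul_of_nonneg_left h1 (by positivity)
  have hrev : ∀ (g : V → E3) a b (s : ℝ), AffineMap.lineMap (g a) (g b) s =
      AffineMap.lineMap (g b) (g a) (1 - s) := fun g a b s =>
    (AffineMap.lineMap_apply_one_sub (g b) (g a) s).symm
  have hI : ∀ {s : ℝ}, s ∈ Icc (0 : ℝ) 1 → 1 - s ∈ Icc (0 : ℝ) 1 := fun hs =>
    ⟨sub_nonneg.2 hs.2, by linarith [hs.1]⟩
  -- a common vertex of the two edges is made their starting point by reversing the parametrizations
  by_cases hac : a = c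
  · subst hac
    exact hshare a b d hab hcd
  by_cases had : a = d
  · subst had
    obtain ⟨M, hM, h⟩ := hshare a b c hab hcd.symm
    refine ⟨M, hM, fun s hs t ht => ?_⟩
    rw [hrev u c, hrev f c]
    exact h s hs _ (hI ht)
  by_cases hbc : b = c
  · subst hbc
    obtain ⟨M, hM, h⟩ := hshare b a d hab.symm hcd
    refine ⟨M, hM, fun s hs t ht => ?_⟩
    rw [hrev u a, hrev f a]
    exact h _ (hI hs) t ht
  by_cases hbd : b = d
  · subst hbd
    obtain ⟨M, hM, h⟩ := hshare b a c hab.symm hcd.symm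
    refine ⟨M, hM, fun s hs t ht => ?_⟩
    rw [hrev u a, hrev f a, hrev u c, hrev f c]
    exact h _ (hI hs) _ (hI ht)
  -- disjoint edges have a positive distance
  have hdis := hf.disjoint_segment hab hcd hac had hbc hbd
  rw [segment_eq_image_lineMap, segment_eq_image_lineMap] at hdis
  obtain ⟨m, hm, hm'⟩ := exists_pos_le_norm_sub (X := Icc (0 : ℝ) 1) (Y := Icc (0 : ℝ) 1)
    (α := fun s => AffineMap.lineMap (f a) (f b) (s : ℝ))
    (β := fun t => AffineMap.lineMap (f c) (f d) (t : ℝ))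
    (AffineMap.lineMap_continuous.comp continuous_subtype_val)
    (AffineMap.lineMap_continuous.comp continuous_subtype_val)
    (fun s t => hdis.ne_of_mem (mem_image_of_mem _ s.2) (mem_image_of_mem _ t.2))
  set B := ‖u a‖ + ‖u b‖ + (‖u c‖ + ‖u d‖)
  have hB : 0 ≤ B := by positivity
  have hle : ∀ a b, ∀ s ∈ Icc (0 : ℝ) 1,
      ‖(AffineMap.lineMap (u a) (u b) s : E3)‖ ≤ ‖u a‖ + ‖u b‖ := by
    intro a b s hs
    rw [lineMap_eq]
    refine (norm_add_le _ _).trans ?_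
    rw [norm_smul, norm_smul, Real.norm_of_nonneg hs.1, Real.norm_of_nonneg (sub_nonneg.2 hs.2)]
    have := mul_nonneg hs.1 (norm_nonneg (u a))
    have := mul_nonneg (sub_nonneg.2 hs.2) (norm_nonneg (u b))
    nlinarith
  refine ⟨B / m, by positivity, fun s hs t ht => ?_⟩
  calc _ ≤ B := (norm_sub_le _ _).trans (add_le_add (hle a b s hs) (hle c d t ht))
    _ = B / m * m := by field_simp
    _ ≤ _ := mul_le_mul_of_nonneg_left (hm' ⟨s, hs⟩ ⟨t, ht⟩) (by positivity)

theorem edgeImage_eq {V : Type*} {G : SimpleGraph V} (f : V → E3) (H : G.Subgraph) :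
    edgeImage f H = {x | ∃ a b, H.Adj a b ∧ ∃ s ∈ Icc (0 : ℝ) 1,
      AffineMap.lineMap (f a) (f b) s = x} := by
  simp only [edgeImage, segment_eq_image_lineMap]
  rfl

/-- Small displacements of the vertices of a linear embedding are realized by ambient isotopies. -/
theorem IsLinearEmbedding.exists_isIsotopyEnd {V : Type*} [Finite V] {G : SimpleGraph V}
    {f : V → E3} (hf : IsLinearEmbedding G f) (u : V → E3) :
    ∃ δ > (0 : ℝ), ∀ s ∈ Ioo 0 δ, ∃ h, IsIsotopyEnd h ∧
      ∀ H : G.Subgraph, h '' edgeImage f H = edgeImage (fun v => f v + s • u v) H := by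
  have := Fintype.ofFinite V
  classical
  have hM : ∀ e : V × V × V × V, ∃ M ≥ (0 : ℝ), G.Adj e.1 e.2.1 → G.Adj e.2.2.1 e.2.2.2 →
      ∀ s ∈ Icc (0 : ℝ) 1, ∀ t ∈ Icc (0 : ℝ) 1,
      ‖AffineMap.lineMap (u e.1) (u e.2.1) s - AffineMap.lineMap (u e.2.2.1) (u e.2.2.2) t‖ ≤
        M * ‖AffineMap.lineMap (f e.1) (f e.2.1) s - AffineMap.lineMap (f e.2.2.1) (f e.2.2.2) t‖ := by
    intro e
    by_cases h1 : G.Adj e.1 e.2.1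
    · by_cases h2 : G.Adj e.2.2.1 e.2.2.2
      · obtain ⟨M, hM, h⟩ := hf.exists_lipschitz u h1 h2
        exact ⟨M, hM, fun _ _ => h⟩
      · exact ⟨0, le_rfl, fun _ h => (h2 h).elim⟩
    · exact ⟨0, le_rfl, fun h => (h1 h).elim⟩
  choose M hM0 hM using hM
  set K := ∑ e, M e
  have hK0 : 0 ≤ K := Finset.sum_nonneg fun e _ => hM0 e
  have hK : ∀ e, M e ≤ K := fun e =>
    Finset.single_le_sum (f := M) (fun e _ => hM0 e) (Finset.mem_univ e)
  -- for `r * K < 1` the displacement by `r • u` is a Lipschitz perturbation with constant less than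
  -- one
  refine ⟨(K + 1)⁻¹, by positivity, fun r hr => ?_⟩
  have hrK : r * K < 1 := by
    have h1 := hr.2
    rw [← one_div, lt_div_iff₀ (by positivity)] at h1
    linarith [hr.1]
  let X := {q : V × V × ℝ // G.Adj q.1 q.2.1 ∧ q.2.2 ∈ Icc (0 : ℝ) 1}
  let γ : (V → E3) → X → E3 := fun g q => AffineMap.lineMap (g q.1.1) (g q.1.2.1) q.1.2.2
  have hγ : ∀ (t : ℝ) x, γ (fun v => f v + t • u v) x = γ f x + t • γ u x := by
    intro t x
    simp only [γ, lineMap_eq]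
    module
  have hlip : ∀ x y : X, ‖γ u x - γ u y‖ ≤ K * ‖γ f x - γ f y‖ := fun x y =>
    (hM (x.1.1, x.1.2.1, y.1.1, y.1.2.1) x.2.1 y.2.1 _ x.2.2 _ y.2.2).trans
      (mul_le_mul_of_nonneg_right (hK _) (norm_nonneg _))
  have hC : ∀ x y, ‖(γ (fun v => f v + r • u v) x - γ f x) -
      (γ (fun v => f v + r • u v) y - γ f y)‖ ≤ r * K * ‖γ f x - γ f y‖ := by
    intro x y
    have e : (γ (fun v => f v + r • u v) x - γ f x) - (γ (fun v => f v + r • u v) y - γ f y) =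
        r • (γ u x - γ u y) := by
      rw [hγ, hγ]; module
    rw [e, norm_smul, Real.norm_of_nonneg hr.1.le, mul_assoc]
    exact mul_le_mul_of_nonneg_left (hlip x y) hr.1.le
  have hc : ∀ t ∈ Icc (0 : ℝ) 1, ∃ c > 0, ∀ x y, c * ‖γ f x - γ f y‖ ≤
      ‖(γ f x + t • (γ (fun v => f v + r • u v) x - γ f x)) -
        (γ f y + t • (γ (fun v => f v + r • u v) y - γ f y))‖ := by
    refine fun t ht => ⟨1 - r * K, by linarith, fun x y => ?_⟩
    have e : (γ f x + t • (γ (fun v => f v + r • u v) x - γ f x)) -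
        (γ f y + t • (γ (fun v => f v + r • u v) y - γ f y)) =
        (γ f x - γ f y) - -((t * r) • (γ u x - γ u y)) := by
      rw [hγ, hγ]; module
    rw [e]
    refine le_trans ?_ (norm_sub_norm_le _ _)
    have h1 : ‖-((t * r) • (γ u x - γ u y))‖ ≤ r * (K * ‖γ f x - γ f y‖) := by
      rw [norm_neg, norm_smul, Real.norm_of_nonneg (mul_nonneg ht.1 hr.1.le)]
      refine mul_le_mul ?_ (hlip x y) (norm_nonneg _) hr.1.le
      nlinarith [ht.2, hr.1]
    linarith
  obtain ⟨h, hh, hγ'⟩ := exists_isIsotopyEnd_of_lineMap (X := X) (fun x y => ‖γ f x - γ f y‖)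
    (γ f) (γ fun v => f v + r • u v) (mul_nonneg hr.1.le hK0) hC hc
  refine ⟨h, hh, fun H => ?_⟩
  rw [edgeImage_eq, edgeImage_eq]
  ext x
  constructor
  · rintro ⟨_, ⟨a, b, hab, s, hs, rfl⟩, rfl⟩
    exact ⟨a, b, hab, s, hs, (hγ' ⟨(a, b, s), H.adj_sub hab, hs⟩).symm⟩
  · rintro ⟨a, b, hab, s, hs, rfl⟩
    exact ⟨_, ⟨a, b, hab, s, hs, rfl⟩, hγ' ⟨(a, b, s), H.adj_sub hab, hs⟩⟩

/-! ### Orientations of points in general position -/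

/-- The properties of the orientations of the tetrahedra spanned by points in general position:
`χ i j k l` tells whether the tetrahedron `i j k l` is positively oriented. The last axiom is the
three-term Grassmann–Plücker relation, read on signs. -/
structure IsChirotope {ι : Type*} (χ : ι → ι → ι → ι → Bool) : Prop where
  swap₁ : ∀ i j k l, [i, j, k, l].Nodup → χ j i k l = !χ i j k l
  swap₂ : ∀ i j k l, [i, j, k, l].Nodup → χ i k j l = !χ i j k l
  swap₃ : ∀ i j k l, [i, j, k, l].Nodup → χ i j l k = !χ i j k l
  gp : ∀ p q a b c d, [p, q, a, b, c, d].Nodup →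
    (χ p q a b == χ p q c d) = (χ p q a d == χ p q b c) →
      (χ p q a b == χ p q c d) = (χ p q a c == χ p q b d)

/-- The three rules `sort₁`, `sort₂`, `sort₃` exchange two adjacent indices that are in decreasing
order; as rewrite rules they bring all indices into increasing order. -/
theorem IsChirotope.sort₁ {ι : Type*} [LT ι] {χ : ι → ι → ι → ι → Bool} (H : IsChirotope χ)
    {i j k l : ι} (h : i < j ∧ [i, j, k, l].Nodup) : χ j i k l = !χ i j k l := H.swap₁ i j k l h.2

theorem IsChirotope.sort₂ {ι : Type*} [LT ι] {χ : ι → ι → ι → ι → Bool} (H : IsChirotope χ)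
    {i j k l : ι} (h : j < k ∧ [i, j, k, l].Nodup) : χ i k j l = !χ i j k l := H.swap₂ i j k l h.2

theorem IsChirotope.sort₃ {ι : Type*} [LT ι] {χ : ι → ι → ι → ι → Bool} (H : IsChirotope χ)
    {i j k l : ι} (h : k < l ∧ [i, j, k, l].Nodup) : χ i j l k = !χ i j k l := H.swap₃ i j k l h.2

theorem IsChirotope.comp {ι κ : Type*} {χ : ι → ι → ι → ι → Bool} (H : IsChirotope χ) {π : κ → ι}
    (hπ : Function.Injective π) : IsChirotope fun i j k l => χ (π i) (π j) (π k) (π l) where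
  swap₁ i j k l h := H.swap₁ _ _ _ _ (by simpa using h.map hπ)
  swap₂ i j k l h := H.swap₂ _ _ _ _ (by simpa using h.map hπ)
  swap₃ i j k l h := H.swap₃ _ _ _ _ (by simpa using h.map hπ)
  gp p q a b c d h := H.gp _ _ _ _ _ _ (by simpa using h.map hπ)

/-- The segment `p q` crosses the triangle `a b c`, in terms of orientations. -/
def ChiHit {ι : Type*} (χ : ι → ι → ι → ι → Bool) (a b c p q : ι) : Prop :=
  χ a b c p ≠ χ a b c q ∧ χ p q a b = χ p q b c ∧ χ p q b c = χ p q c a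

instance {ι : Type*} (χ : ι → ι → ι → ι → Bool) (a b c p q : ι) : Decidable (ChiHit χ a b c p q) :=
  inferInstanceAs (Decidable (_ ∧ _))

/-- The edges `p q` and `r s` of the quadrilateral `p q r s` cross the triangle `a b c`, the two
others do not, and the vertices alternate between the two sides of the triangle. -/
def TorusPattern {ι : Type*} (χ : ι → ι → ι → ι → Bool) (a b c p q r s : ι) : Prop :=
  ChiHit χ a b c p q ∧ ChiHit χ a b c r s ∧ ¬ ChiHit χ a b c p s ∧ ¬ ChiHit χ a b c r q ∧
    χ a b c p = χ a b c r

/-! ### Two torus patterns cannot coexist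

Up to symmetry, there are six pairs of torus patterns. The
first pattern is the one in which the edges `2 5` and `3 6` cross the triangle `0 1 4`. In each of
the six cases, finitely many orientations are treated as independent Boolean variables, and `decide`
runs through their values; the conditions of the two patterns and the Grassmann–Plücker relations
named in the proof exclude all of them. The order in which the variables are introduced only serves
to cut off the search early. -/

set_option synthInstance.maxHeartbeats 0 in
set_option synthInstance.maxSize 100000 in
set_option maxRecDepth 100000 in
set_option maxHeartbeats 0 in
/-- The two triangles share the edge `0 1`, and no edge crosses both of them. No Grassmann–Plücker
relation is needed. -/
theorem not_pattern_same_left_one {χ : Fin 7 → Fin 7 → Fin 7 → Fin 7 → Bool} (H : IsChirotope χ)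
    (h : TorusPattern χ 0 1 4 2 5 3 6) (h' : TorusPattern χ 0 1 5 2 6 3 4) : False := by
  obtain ⟨⟨a1, a2, a3⟩, ⟨a4, a5, a6⟩, a7, a8, a9⟩ := h
  obtain ⟨⟨b1, b2, b3⟩, ⟨b4, b5, b6⟩, b7, b8, b9⟩ := h'
  simp (disch := decide) only [ChiHit, H.sort₁, H.sort₂, H.sort₃] at *
  clear H
  generalize χ 0 1 3 5 = x0135 at *; generalize χ 0 1 4 5 = x0145 at *
  generalize χ 0 1 2 5 = x0125 at *; generalize χ 1 2 4 5 = x1245 at *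
  generalize χ 0 2 4 5 = x0245 at *; generalize χ 0 1 2 4 = x0124 at *
  generalize χ 0 2 5 6 = x0256 at *; generalize χ 1 2 4 6 = x1246 at *
  generalize χ 0 3 4 6 = x0346 at *; generalize χ 1 3 4 5 = x1345 at *
  generalize χ 1 3 5 6 = x1356 at *; generalize χ 0 3 5 6 = x0356 at *
  generalize χ 0 1 2 6 = x0126 at *; generalize χ 0 3 4 5 = x0345 at *
  generalize χ 0 1 4 6 = x0146 at *; generalize χ 0 1 3 6 = x0136 at *
  generalize χ 0 1 3 4 = x0134 at *; generalize χ 0 2 4 6 = x0246 at *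
  generalize χ 0 1 5 6 = x0156 at *; generalize χ 1 3 4 6 = x1346 at *
  generalize χ 1 2 5 6 = x1256 at *
  clear χ
  revert x1256; revert x1346; revert x0156; revert x0246; revert x0134; revert x0136
  revert x0146; revert x0345; revert x0126; revert x0356; revert x1356; revert x1345
  revert x0346; revert x1246; revert x0256; revert x0124; revert x0245; revert x1245
  revert x0125; revert x0145; revert x0135
  decide

set_option synthInstance.maxHeartbeats 0 in
set_option synthInstance.maxSize 100000 in
set_option maxRecDepth 100000 in
set_option maxHeartbeats 0 in
/-- The second triangle contains the edge `2 5`, which crosses the first one. -/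
theorem not_pattern_rotated_one {χ : Fin 7 → Fin 7 → Fin 7 → Fin 7 → Bool} (H : IsChirotope χ)
    (h : TorusPattern χ 0 1 4 2 5 3 6) (h' : TorusPattern χ 0 2 5 1 6 3 4) : False := by
  obtain ⟨⟨a1, a2, a3⟩, ⟨a4, a5, a6⟩, a7, a8, a9⟩ := h
  obtain ⟨⟨b1, b2, b3⟩, ⟨b4, b5, b6⟩, b7, b8, b9⟩ := h'
  have g0 := H.gp 4 5 0 1 2 3 (by decide)
  have g1 := H.gp 1 4 0 3 5 6 (by decide)
  have g2 := H.gp 0 2 1 4 5 6 (by decide)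
  have g3 := H.gp 1 5 0 2 3 4 (by decide)
  have g4 := H.gp 2 5 0 1 3 6 (by decide)
  have g5 := H.gp 3 5 0 1 2 4 (by decide)
  have g6 := H.gp 0 6 1 2 3 5 (by decide)
  have g7 := H.gp 1 2 0 4 5 6 (by decide)
  have g8 := H.gp 4 6 0 1 2 3 (by decide)
  have g9 := H.gp 2 4 0 1 3 6 (by decide)
  have g10 := H.gp 2 4 0 1 3 5 (by decide)
  have g11 := H.gp 0 6 1 2 3 4 (by decide)
  simp (disch := decide) only [ChiHit, H.sort₁, H.sort₂, H.sort₃] at *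
  clear H
  generalize χ 0 1 2 4 = x0124 at *; generalize χ 0 1 4 5 = x0145 at *
  generalize χ 0 1 2 5 = x0125 at *; generalize χ 1 2 4 5 = x1245 at *
  generalize χ 0 2 4 5 = x0245 at *; generalize χ 0 2 5 6 = x0256 at *
  generalize χ 0 1 3 4 = x0134 at *; generalize χ 0 2 3 5 = x0235 at *
  generalize χ 0 1 4 6 = x0146 at *; generalize χ 0 1 2 6 = x0126 at *
  generalize χ 1 2 5 6 = x1256 at *; generalize χ 1 2 4 6 = x1246 at *
  generalize χ 0 2 4 6 = x0246 at *; generalize χ 0 3 4 5 = x0345 at *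
  generalize χ 2 3 4 5 = x2345 at *; generalize χ 1 3 4 5 = x1345 at *
  generalize χ 0 1 3 5 = x0135 at *; generalize χ 1 2 3 5 = x1235 at *
  generalize χ 2 3 5 6 = x2356 at *; generalize χ 0 2 3 4 = x0234 at *
  generalize χ 1 2 3 4 = x1234 at *; generalize χ 2 3 4 6 = x2346 at *
  generalize χ 0 1 5 6 = x0156 at *; generalize χ 1 3 4 6 = x1346 at *
  generalize χ 0 3 4 6 = x0346 at *; generalize χ 0 1 3 6 = x0136 at *
  generalize χ 0 2 3 6 = x0236 at *; generalize χ 0 3 5 6 = x0356 at *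
  generalize χ 1 4 5 6 = x1456 at *
  clear χ
  revert x1456; revert x0356; revert x0236; revert x0136; revert x0346; revert x1346
  revert x0156; revert x2346; revert x1234; revert x0234; revert x2356; revert x1235
  revert x0135; revert x1345; revert x2345; revert x0345; revert x0246; revert x1246
  revert x1256; revert x0126; revert x0146; revert x0235; revert x0134; revert x0256
  revert x0245; revert x1245; revert x0125; revert x0145; revert x0124
  decide

set_option synthInstance.maxHeartbeats 0 in
set_option synthInstance.maxSize 100000 in
set_option maxRecDepth 100000 in
set_option maxHeartbeats 0 in
/-- The edge `1 4` of the first triangle crosses the second one. -/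
theorem not_pattern_rotated_two {χ : Fin 7 → Fin 7 → Fin 7 → Fin 7 → Bool} (H : IsChirotope χ)
    (h : TorusPattern χ 0 1 4 2 5 3 6) (h' : TorusPattern χ 0 2 6 1 4 3 5) : False := by
  obtain ⟨⟨a1, a2, a3⟩, ⟨a4, a5, a6⟩, a7, a8, a9⟩ := h
  obtain ⟨⟨b1, b2, b3⟩, ⟨b4, b5, b6⟩, b7, b8, b9⟩ := h'
  have g0 := H.gp 4 6 0 1 2 3 (by decide)
  have g1 := H.gp 1 2 0 4 5 6 (by decide)
  have g2 := H.gp 0 4 1 2 3 6 (by decide)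
  have g3 := H.gp 0 3 2 4 5 6 (by decide)
  have g4 := H.gp 2 4 0 1 5 6 (by decide)
  have g5 := H.gp 0 2 1 3 5 6 (by decide)
  have g6 := H.gp 0 5 1 2 4 6 (by decide)
  have g7 := H.gp 0 5 1 2 3 6 (by decide)
  have g8 := H.gp 4 6 0 2 3 5 (by decide)
  have g9 := H.gp 1 2 3 4 5 6 (by decide)
  have g10 := H.gp 0 2 1 3 4 5 (by decide)
  have g11 := H.gp 2 4 0 1 3 6 (by decide)
  have g12 := H.gp 2 3 1 4 5 6 (by decide)
  have g13 := H.gp 5 6 1 2 3 4 (by decide)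
  have g14 := H.gp 2 3 0 4 5 6 (by decide)
  have g15 := H.gp 3 5 0 1 2 6 (by decide)
  have g16 := H.gp 1 4 0 2 3 5 (by decide)
  have g17 := H.gp 0 4 1 2 5 6 (by decide)
  have g18 := H.gp 1 4 0 2 5 6 (by decide)
  have g19 := H.gp 0 2 3 4 5 6 (by decide)
  have g20 := H.gp 1 5 0 2 3 4 (by decide)
  simp (disch := decide) only [ChiHit, H.sort₁, H.sort₂, H.sort₃] at *
  clear H
  generalize χ 0 1 3 4 = x0134 at *; generalize χ 0 1 2 4 = x0124 at *
  generalize χ 1 2 4 6 = x1246 at *; generalize χ 0 1 4 6 = x0146 at *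
  generalize χ 0 2 4 6 = x0246 at *; generalize χ 0 1 2 6 = x0126 at *
  generalize χ 0 2 3 6 = x0236 at *; generalize χ 0 2 5 6 = x0256 at *
  generalize χ 1 3 4 6 = x1346 at *; generalize χ 0 3 4 6 = x0346 at *
  generalize χ 2 3 4 6 = x2346 at *; generalize χ 0 2 3 4 = x0234 at *
  generalize χ 1 2 3 4 = x1234 at *; generalize χ 0 1 4 5 = x0145 at *
  generalize χ 0 1 2 5 = x0125 at *; generalize χ 1 2 4 5 = x1245 at *
  generalize χ 1 2 5 6 = x1256 at *; generalize χ 0 1 5 6 = x0156 at *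
  generalize χ 0 2 4 5 = x0245 at *; generalize χ 0 4 5 6 = x0456 at *
  generalize χ 1 3 4 5 = x1345 at *; generalize χ 2 4 5 6 = x2456 at *
  generalize χ 3 4 5 6 = x3456 at *; generalize χ 2 3 5 6 = x2356 at *
  generalize χ 0 3 5 6 = x0356 at *; generalize χ 0 2 3 5 = x0235 at *
  generalize χ 0 3 4 5 = x0345 at *; generalize χ 0 1 3 5 = x0135 at *
  generalize χ 1 4 5 6 = x1456 at *; generalize χ 1 3 5 6 = x1356 at *
  generalize χ 1 2 3 5 = x1235 at *; generalize χ 0 1 2 3 = x0123 at *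
  generalize χ 0 1 3 6 = x0136 at *; generalize χ 1 2 3 6 = x1236 at *
  generalize χ 2 3 4 5 = x2345 at *
  clear χ
  revert x2345; revert x1236; revert x0136; revert x0123; revert x1235; revert x1356
  revert x1456; revert x0135; revert x0345; revert x0235; revert x0356; revert x2356
  revert x3456; revert x2456; revert x1345; revert x0456; revert x0245; revert x0156
  revert x1256; revert x1245; revert x0125; revert x0145; revert x1234; revert x0234
  revert x2346; revert x0346; revert x1346; revert x0256; revert x0236; revert x0126
  revert x0246; revert x0146; revert x1246; revert x0124; revert x0134
  decide

set_option synthInstance.maxHeartbeats 0 in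
set_option synthInstance.maxSize 100000 in
set_option maxRecDepth 100000 in
set_option maxHeartbeats 0 in
/-- The two triangles share only the apex, and neither has an edge that crosses the other one. -/
theorem not_pattern_crossed {χ : Fin 7 → Fin 7 → Fin 7 → Fin 7 → Bool} (H : IsChirotope χ)
    (h : TorusPattern χ 0 1 4 2 5 3 6) (h' : TorusPattern χ 0 2 6 1 5 3 4) : False := by
  obtain ⟨⟨a1, a2, a3⟩, ⟨a4, a5, a6⟩, a7, a8, a9⟩ := h
  obtain ⟨⟨b1, b2, b3⟩, ⟨b4, b5, b6⟩, b7, b8, b9⟩ := h'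
  have g0 := H.gp 1 2 0 4 5 6 (by decide)
  simp (disch := decide) only [ChiHit, H.sort₁, H.sort₂, H.sort₃] at *
  clear H
  generalize χ 0 2 3 6 = x0236 at *; generalize χ 0 2 4 6 = x0246 at *
  generalize χ 0 1 2 6 = x0126 at *; generalize χ 0 1 3 4 = x0134 at *
  generalize χ 0 1 2 4 = x0124 at *; generalize χ 0 1 4 6 = x0146 at *
  generalize χ 1 2 4 6 = x1246 at *; generalize χ 1 2 4 5 = x1245 at *
  generalize χ 0 1 2 5 = x0125 at *; generalize χ 1 2 5 6 = x1256 at *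
  generalize χ 0 3 5 6 = x0356 at *; generalize χ 0 3 4 6 = x0346 at *
  generalize χ 2 3 4 6 = x2346 at *; generalize χ 2 3 5 6 = x2356 at *
  generalize χ 0 2 3 5 = x0235 at *; generalize χ 1 3 4 5 = x1345 at *
  generalize χ 0 1 4 5 = x0145 at *; generalize χ 0 2 4 5 = x0245 at *
  generalize χ 0 2 3 4 = x0234 at *; generalize χ 0 1 3 5 = x0135 at *
  generalize χ 0 1 3 6 = x0136 at *; generalize χ 1 3 4 6 = x1346 at *
  generalize χ 0 1 5 6 = x0156 at *; generalize χ 0 2 5 6 = x0256 at *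
  generalize χ 0 3 4 5 = x0345 at *
  clear χ
  revert x0345; revert x0256; revert x0156; revert x1346; revert x0136; revert x0135
  revert x0234; revert x0245; revert x0145; revert x1345; revert x0235; revert x2356
  revert x2346; revert x0346; revert x0356; revert x1256; revert x0125; revert x1245
  revert x1246; revert x0146; revert x0124; revert x0134; revert x0126; revert x0246
  revert x0236
  decide

set_option synthInstance.maxHeartbeats 0 in
set_option synthInstance.maxSize 100000 in
set_option maxRecDepth 100000 in
set_option maxHeartbeats 0 in
/-- The two triangles share the edge `0 1`, and both are crossed by the edge `3 6`. -/
theorem not_pattern_same_left_two {χ : Fin 7 → Fin 7 → Fin 7 → Fin 7 → Bool} (H : IsChirotope χ)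
    (h : TorusPattern χ 0 1 4 2 5 3 6) (h' : TorusPattern χ 0 1 5 2 4 3 6) : False := by
  obtain ⟨⟨a1, a2, a3⟩, ⟨a4, a5, a6⟩, a7, a8, a9⟩ := h
  obtain ⟨⟨b1, b2, b3⟩, ⟨b4, b5, b6⟩, b7, b8, b9⟩ := h'
  have g0 := H.gp 0 3 1 4 5 6 (by decide)
  have g1 := H.gp 1 3 0 4 5 6 (by decide)
  simp (disch := decide) only [ChiHit, H.sort₁, H.sort₂, H.sort₃] at *
  clear H
  generalize χ 0 1 2 4 = x0124 at *; generalize χ 0 1 4 5 = x0145 at *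
  generalize χ 0 1 3 4 = x0134 at *; generalize χ 0 1 2 5 = x0125 at *
  generalize χ 0 1 3 5 = x0135 at *; generalize χ 1 3 5 6 = x1356 at *
  generalize χ 0 3 5 6 = x0356 at *; generalize χ 0 1 3 6 = x0136 at *
  generalize χ 1 3 4 6 = x1346 at *; generalize χ 0 3 4 6 = x0346 at *
  generalize χ 1 3 4 5 = x1345 at *; generalize χ 0 3 4 5 = x0345 at *
  generalize χ 1 2 4 5 = x1245 at *; generalize χ 0 1 4 6 = x0146 at *
  generalize χ 0 1 5 6 = x0156 at *; generalize χ 1 2 4 6 = x1246 at *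
  generalize χ 1 2 5 6 = x1256 at *; generalize χ 0 2 4 6 = x0246 at *
  generalize χ 0 2 5 6 = x0256 at *; generalize χ 0 1 2 6 = x0126 at *
  generalize χ 0 2 4 5 = x0245 at *
  clear χ
  revert x0245; revert x0126; revert x0256; revert x0246; revert x1256; revert x1246
  revert x0156; revert x0146; revert x1245; revert x0345; revert x1345; revert x0346
  revert x1346; revert x0136; revert x0356; revert x1356; revert x0135; revert x0125
  revert x0134; revert x0145; revert x0124
  decide

set_option synthInstance.maxHeartbeats 0 in
set_option synthInstance.maxSize 100000 in
set_option maxRecDepth 100000 in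
set_option maxHeartbeats 0 in
/-- Each of the two triangles has an edge that crosses the other one, and both are crossed by the
edge `3 6`. -/
theorem not_pattern_mutual {χ : Fin 7 → Fin 7 → Fin 7 → Fin 7 → Bool} (H : IsChirotope χ)
    (h : TorusPattern χ 0 1 4 2 5 3 6) (h' : TorusPattern χ 0 2 5 1 4 3 6) : False := by
  obtain ⟨⟨a1, a2, a3⟩, ⟨a4, a5, a6⟩, a7, a8, a9⟩ := h
  obtain ⟨⟨b1, b2, b3⟩, ⟨b4, b5, b6⟩, b7, b8, b9⟩ := h'
  have g0 := H.gp 1 3 0 2 4 5 (by decide)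
  have g1 := H.gp 1 5 0 2 4 6 (by decide)
  have g2 := H.gp 0 4 1 2 3 5 (by decide)
  have g3 := H.gp 4 5 0 1 2 3 (by decide)
  have g4 := H.gp 1 3 0 2 5 6 (by decide)
  have g5 := H.gp 0 5 2 3 4 6 (by decide)
  have g6 := H.gp 0 2 1 3 4 5 (by decide)
  have g7 := H.gp 5 6 0 1 2 3 (by decide)
  have g8 := H.gp 0 6 1 2 3 4 (by decide)
  have g9 := H.gp 1 4 0 3 5 6 (by decide)
  have g10 := H.gp 2 3 1 4 5 6 (by decide)
  have g11 := H.gp 1 5 2 3 4 6 (by decide)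
  have g12 := H.gp 0 4 2 3 5 6 (by decide)
  have g13 := H.gp 1 2 0 4 5 6 (by decide)
  have g14 := H.gp 2 3 0 1 4 5 (by decide)
  have g15 := H.gp 0 5 1 3 4 6 (by decide)
  have g16 := H.gp 1 2 0 3 4 5 (by decide)
  have g17 := H.gp 2 4 0 3 5 6 (by decide)
  have g18 := H.gp 0 6 1 2 3 5 (by decide)
  have g19 := H.gp 1 3 0 4 5 6 (by decide)
  have g20 := H.gp 0 5 1 2 3 6 (by decide)
  have g21 := H.gp 0 2 1 4 5 6 (by decide)
  have g22 := H.gp 4 5 0 1 2 6 (by decide)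
  simp (disch := decide) only [ChiHit, H.sort₁, H.sort₂, H.sort₃] at *
  clear H
  generalize χ 0 1 2 4 = x0124 at *; generalize χ 1 2 4 5 = x1245 at *
  generalize χ 0 1 2 5 = x0125 at *; generalize χ 0 1 3 4 = x0134 at *
  generalize χ 0 2 4 5 = x0245 at *; generalize χ 0 1 4 6 = x0146 at *
  generalize χ 0 2 3 5 = x0235 at *; generalize χ 0 1 4 5 = x0145 at *
  generalize χ 0 2 5 6 = x0256 at *; generalize χ 2 3 5 6 = x2356 at *
  generalize χ 0 3 5 6 = x0356 at *; generalize χ 0 2 3 6 = x0236 at *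
  generalize χ 1 3 4 6 = x1346 at *; generalize χ 0 1 3 6 = x0136 at *
  generalize χ 0 3 4 6 = x0346 at *; generalize χ 0 1 2 6 = x0126 at *
  generalize χ 0 2 4 6 = x0246 at *; generalize χ 1 2 4 6 = x1246 at *
  generalize χ 1 2 5 6 = x1256 at *; generalize χ 0 1 5 6 = x0156 at *
  generalize χ 1 4 5 6 = x1456 at *; generalize χ 1 3 5 6 = x1356 at *
  generalize χ 1 3 4 5 = x1345 at *; generalize χ 0 1 3 5 = x0135 at *
  generalize χ 0 3 4 5 = x0345 at *; generalize χ 0 4 5 6 = x0456 at *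
  generalize χ 2 3 4 5 = x2345 at *; generalize χ 0 2 3 4 = x0234 at *
  generalize χ 1 2 3 5 = x1235 at *; generalize χ 0 1 2 3 = x0123 at *
  generalize χ 1 2 3 4 = x1234 at *; generalize χ 1 2 3 6 = x1236 at *
  generalize χ 2 3 4 6 = x2346 at *; generalize χ 2 4 5 6 = x2456 at *
  clear χ
  revert x2456; revert x2346; revert x1236; revert x1234; revert x0123; revert x1235
  revert x0234; revert x2345; revert x0456; revert x0345; revert x0135; revert x1345
  revert x1356; revert x1456; revert x0156; revert x1256; revert x1246; revert x0246
  revert x0126; revert x0346; revert x0136; revert x1346; revert x0236; revert x0356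
  revert x2356; revert x0256; revert x0145; revert x0235; revert x0146; revert x0245
  revert x0134; revert x0125; revert x1245; revert x0124
  decide

/-! ### Symmetries of torus patterns -/

/-- Rotating the quadrilateral by two steps. -/
theorem TorusPattern.swap {ι : Type*} {χ : ι → ι → ι → ι → Bool} {a b c p q r s : ι}
    (h : TorusPattern χ a b c p q r s) : TorusPattern χ a b c r s p q :=
  ⟨h.2.1, h.1, h.2.2.2.1, h.2.2.1, h.2.2.2.2.symm⟩

/-- Exchanging the roles of the two large parts, which reverses the triangle and the direction of
the quadrilateral. -/
theorem TorusPattern.flip {χ : Fin 7 → Fin 7 → Fin 7 → Fin 7 → Bool} (H : IsChirotope χ)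
    {a b c p q r s : Fin 7} (hn : [a, b, c, p, q, r, s].Nodup)
    (h : TorusPattern χ a b c p q r s) : TorusPattern χ a c b q p s r := by
  have key : ∀ x y, [a, b, c, x, y].Nodup → (ChiHit χ a c b y x ↔ ChiHit χ a b c x y) := by
    intro x y hxy
    have n1 : [a, b, c, x].Nodup ∧ [a, b, c, y].Nodup ∧ [x, y, a, b].Nodup ∧ [x, y, b, c].Nodup ∧
      [x, y, c, a].Nodup ∧ [x, y, a, c].Nodup ∧ [x, y, c, b].Nodup ∧ [x, y, b, a].Nodup := by
      clear hn h
      grind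
    obtain ⟨n1, n2, n3, n4, n5, n6, n7, n8⟩ := n1
    unfold ChiHit
    rw [H.swap₂ _ _ _ _ n1, H.swap₂ _ _ _ _ n2, H.swap₁ _ _ _ _ n6, H.swap₁ _ _ _ _ n7,
      H.swap₁ _ _ _ _ n8, H.swap₃ _ _ _ _ n3, H.swap₃ _ _ _ _ n4, H.swap₃ _ _ _ _ n5]
    generalize χ a b c x = u1; generalize χ a b c y = u2; generalize χ x y a b = u3
    generalize χ x y b c = u4; generalize χ x y c a = u5
    revert u1 u2 u3 u4 u5
    decide
  obtain ⟨h1, h2, h3, h4, h5⟩ := h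
  have n1 : [a, b, c, p, q].Nodup ∧ [a, b, c, r, s].Nodup ∧ [a, b, c, p, s].Nodup ∧
    [a, b, c, r, q].Nodup ∧ [a, b, c, q].Nodup ∧ [a, b, c, s].Nodup := by grind
  obtain ⟨n1, n2, n3, n4, n5, n6⟩ := n1
  refine ⟨(key _ _ n1).2 h1, (key _ _ n2).2 h2, fun h => h4 ((key _ _ n4).1 h),
    fun h => h3 ((key _ _ n3).1 h), ?_⟩
  rw [H.swap₂ _ _ _ _ n5, H.swap₂ _ _ _ _ n6]
  have h1 := h1.1
  have h2 := h2.1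
  rw [← h5] at h2
  revert h1 h2
  generalize χ a b c p = u1; generalize χ a b c q = u2; generalize χ a b c s = u3
  revert u1 u2 u3
  decide

/-- The label of the `i`-th vertex of the first large part. The label of the apex is `0`. -/
def vA : Fin 3 → Fin 7 := ![1, 2, 3]

/-- The label of the `j`-th vertex of the second large part. -/
def vB : Fin 3 → Fin 7 := ![4, 5, 6]

/-- The triangle through the apex, `vA i` and `vB j`, and the complementary quadrilateral form a
torus pattern. The sign `ε` tells which two opposite edges of the quadrilateral cross the
triangle. -/
def PatternAt (χ : Fin 7 → Fin 7 → Fin 7 → Fin 7 → Bool) (i j ε : Fin 3) : Prop :=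
  TorusPattern χ 0 (vA i) (vB j) (vA (i + 1)) (vB (j + ε)) (vA (i + 2)) (vB (j - ε))

/-- The symmetry of the labels exchanging two vertices in each of the two large parts. -/
def symS : Fin 7 → Fin 7 := ![0, 1, 3, 2, 4, 6, 5]

/-- The symmetry of the labels exchanging the two large parts. -/
def symF : Fin 7 → Fin 7 := ![0, 4, 5, 6, 1, 2, 3]

/-- The symmetries `symS` and `symF` preserve the first pattern, and reduce the sixteen
possibilities for the second pattern to six. -/
theorem not_patternAt_of_zero {χ : Fin 7 → Fin 7 → Fin 7 → Fin 7 → Bool} (H : IsChirotope χ)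
    {i j ε : Fin 3} (hij : (i, j) ≠ (0, 0)) (hε : ε = 1 ∨ ε = 2) (h : PatternAt χ 0 0 1) :
    ¬ PatternAt χ i j ε := by
  intro h'
  have h : TorusPattern χ 0 1 4 2 5 3 6 := h
  have iS : Function.Injective symS := by decide
  have iF : Function.Injective symF := by decide
  have HS := H.comp iS
  have HF := H.comp iF
  have HSF := H.comp (iS.comp iF)
  have hF := h.flip H (by decide)
  have hS := h.swap
  have hSF := hF.swap
  have key : ∀ i j ε : Fin 3, [0, vA i, vB j, vA (i + 1), vB (j + ε), vA (i + 2), vB (j - ε)].Nodup ∨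
    (ε ≠ 1 ∧ ε ≠ 2) := by decide
  have h'S := h'.swap
  have h'F := TorusPattern.flip H ((key i j ε).resolve_right (by tauto)) h'
  have h'SF := h'F.swap
  rcases hε with rfl | rfl <;> fin_cases i <;> fin_cases j
  · exact hij rfl
  · exact not_pattern_same_left_one H h h'
  · exact not_pattern_same_left_one HS hS h'S
  · exact not_pattern_same_left_one HF hF h'F
  · exact not_pattern_mutual HF hF h'SF
  · exact not_pattern_crossed HSF hSF h'F
  · exact not_pattern_same_left_one HSF hSF h'SF
  · exact not_pattern_crossed HF hF h'SF
  · exact not_pattern_mutual HSF hSF h'F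
  · exact hij rfl
  · exact not_pattern_same_left_two H h h'
  · exact not_pattern_same_left_two HS hS h'S
  · exact not_pattern_same_left_two HF hF h'SF
  · exact not_pattern_rotated_one HF hF h'F
  · exact not_pattern_rotated_two HSF hSF h'SF
  · exact not_pattern_same_left_two HSF hSF h'F
  · exact not_pattern_rotated_two HF hF h'F
  · exact not_pattern_rotated_one HSF hSF h'SF

/-- Among the nine pairs of a triangle and a quadrilateral, at most one is a torus pattern. -/
theorem not_patternAt {χ : Fin 7 → Fin 7 → Fin 7 → Fin 7 → Bool} (H : IsChirotope χ)
    {i j ε i' j' ε' : Fin 3} (hij : (i', j') ≠ (i, j)) (hε : ε = 1 ∨ ε = 2) (hε' : ε' = 1 ∨ ε' = 2)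
    (h : PatternAt χ i j ε) : ¬ PatternAt χ i' j' ε' := by
  -- the symmetry of the labels that carries the pattern `0 0 1` to the pattern `i j ε`
  let π : Fin 7 → Fin 7 := ![0, vA i, vA (i + 1), vA (i + 2), vB j, vB (j + ε), vB (j - ε)]
  have hπ : Function.Injective π := by
    have : ∀ i j ε : Fin 3, Function.Injective
        ![0, vA i, vA (i + 1), vA (i + 2), vB j, vB (j + ε), vB (j - ε)] ∨ (ε ≠ 1 ∧ ε ≠ 2) := by
      decide
    exact (this i j ε).resolve_right (by tauto)
  have hA : ∀ k, π (vA k) = vA (i + k) := by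
    intro k
    fin_cases k <;> simp [π, vA]
  have hB : ∀ k, π (vB k) = vB (j + ε * k) := by
    have : ∀ i j ε k : Fin 3, (![0, vA i, vA (i + 1), vA (i + 2), vB j, vB (j + ε), vB (j - ε)] :
        Fin 7 → Fin 7) (vB k) = vB (j + ε * k) ∨ (ε ≠ 1 ∧ ε ≠ 2) := by
      decide
    exact fun k => (this i j ε k).resolve_right (by tauto)
  intro h'
  have e2 : ∀ ε j j' x : Fin 3, (j + ε * 2 = j - ε ∧ j + ε * (ε * (j' - j) + ε * x) = j' + x ∧
      j + ε * (ε * (j' - j)) = j' ∧ j + ε * (ε * (j' - j) - ε * x) = j' - x) ∨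
      (ε ≠ 1 ∧ ε ≠ 2) := by decide
  obtain ⟨e3, e4, e5, e6⟩ := (e2 ε j j' ε').resolve_right (by tauto)
  have e7 : ∀ i i' x : Fin 3, i + (i' - i + x) = i' + x ∧ i + (i' - i) = i' := by decide
  refine not_patternAt_of_zero (H.comp hπ) (i := i' - i) (j := ε * (j' - j)) (ε := ε * ε') ?_ ?_ ?_ ?_
  · rintro e
    rw [Prod.mk.injEq] at e
    have e8 := (e7 i i' 0).2
    rw [e.1, add_zero] at e8
    rw [e.2, mul_zero, add_zero] at e5
    exact hij (Prod.ext e8.symm e5.symm)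
  · rcases hε with rfl | rfl <;> rcases hε' with rfl | rfl <;> decide
  · have : TorusPattern χ (π 0) (π (vA 0)) (π (vB 0)) (π (vA 1)) (π (vB 1)) (π (vA 2))
        (π (vB 2)) := by
      rw [hA, hB, hA, hB, hA, hB]
      rw [e3, add_zero, mul_zero, add_zero, mul_one]
      exact h
    exact this
  · have : TorusPattern χ (π 0) (π (vA (i' - i))) (π (vB (ε * (j' - j)))) (π (vA (i' - i + 1)))
        (π (vB (ε * (j' - j) + ε * ε'))) (π (vA (i' - i + 2)))
        (π (vB (ε * (j' - j) - ε * ε'))) := by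
      rw [hA, hB, hA, hB, hA, hB]
      rw [(e7 _ _ _).1, (e7 _ _ _).1, (e7 i i' 0).2, e4, e5, e6]
      exact h'
    exact this

/-! ### The parity of the number of crossings -/

/-- Five points: the number, modulo two, of the crossings of a triangle through `0`, a vertex in
`{1, 2}` and a vertex in `{3, 4}` with the opposite edge. -/
theorem IsChirotope.five_points {χ : Fin 5 → Fin 5 → Fin 5 → Fin 5 → Bool} (H : IsChirotope χ) :
    ((if ChiHit χ 0 1 3 2 4 then 1 else 0) + (if ChiHit χ 0 1 4 2 3 then 1 else 0) +
      (if ChiHit χ 0 2 3 1 4 then 1 else 0) + (if ChiHit χ 0 2 4 1 3 then 1 else 0)) % 2 =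
    ((χ 0 1 3 4 == χ 0 2 3 4) && (χ 0 1 2 3 == χ 0 1 2 4)).toNat := by
  simp (disch := decide) only [ChiHit, H.sort₁, H.sort₂, H.sort₃] at *
  clear H
  generalize χ 0 1 2 3 = x1; generalize χ 0 1 2 4 = x2; generalize χ 0 1 3 4 = x3
  generalize χ 0 2 3 4 = x4; generalize χ 1 2 3 4 = x5
  revert x1 x2 x3 x4 x5
  decide

/-- The majority among three Boolean values. -/
def majority (x y z : Bool) : Bool := (x && y) || (y && z) || (x && z)

/-- Six points: the twelve crossings of a triangle with apex `0`, a vertex in `{1, 2}` and a vertex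
in `{3, 4, 5}` with an opposite edge are odd in number, up to a correction term for each of the
vertices `1` and `2`. -/
theorem IsChirotope.six_points {χ : Fin 6 → Fin 6 → Fin 6 → Fin 6 → Bool} (H : IsChirotope χ) :
    (((if ChiHit χ 0 1 3 2 4 then 1 else 0) + (if ChiHit χ 0 1 4 2 3 then 1 else 0) +
      (if ChiHit χ 0 2 3 1 4 then 1 else 0) + (if ChiHit χ 0 2 4 1 3 then 1 else 0)) +
    ((if ChiHit χ 0 1 3 2 5 then 1 else 0) + (if ChiHit χ 0 1 5 2 3 then 1 else 0) +
      (if ChiHit χ 0 2 3 1 5 then 1 else 0) + (if ChiHit χ 0 2 5 1 3 then 1 else 0)) +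
    ((if ChiHit χ 0 1 4 2 5 then 1 else 0) + (if ChiHit χ 0 1 5 2 4 then 1 else 0) +
      (if ChiHit χ 0 2 4 1 5 then 1 else 0) + (if ChiHit χ 0 2 5 1 4 then 1 else 0)) +
    (majority (χ 0 1 3 4) (χ 0 1 4 5) (χ 0 1 5 3)).toNat +
    (majority (χ 0 2 3 4) (χ 0 2 4 5) (χ 0 2 5 3)).toNat) % 2 = 1 := by
  have h1 := (H.comp (π := ![0, 1, 2, 3, 4]) (by decide)).five_points
  have h2 := (H.comp (π := ![0, 1, 2, 3, 5]) (by decide)).five_points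
  have h3 := (H.comp (π := ![0, 1, 2, 4, 5]) (by decide)).five_points
  change ((if ChiHit χ 0 1 3 2 4 then 1 else 0) + (if ChiHit χ 0 1 4 2 3 then 1 else 0) +
      (if ChiHit χ 0 2 3 1 4 then 1 else 0) + (if ChiHit χ 0 2 4 1 3 then 1 else 0)) % 2 =
    ((χ 0 1 3 4 == χ 0 2 3 4) && (χ 0 1 2 3 == χ 0 1 2 4)).toNat at h1
  change ((if ChiHit χ 0 1 3 2 5 then 1 else 0) + (if ChiHit χ 0 1 5 2 3 then 1 else 0) +
      (if ChiHit χ 0 2 3 1 5 then 1 else 0) + (if ChiHit χ 0 2 5 1 3 then 1 else 0)) % 2 =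
    ((χ 0 1 3 5 == χ 0 2 3 5) && (χ 0 1 2 3 == χ 0 1 2 5)).toNat at h2
  change ((if ChiHit χ 0 1 4 2 5 then 1 else 0) + (if ChiHit χ 0 1 5 2 4 then 1 else 0) +
      (if ChiHit χ 0 2 4 1 5 then 1 else 0) + (if ChiHit χ 0 2 5 1 4 then 1 else 0)) % 2 =
    ((χ 0 1 4 5 == χ 0 2 4 5) && (χ 0 1 2 4 == χ 0 1 2 5)).toNat at h3
  have key : (((χ 0 1 3 4 == χ 0 2 3 4) && (χ 0 1 2 3 == χ 0 1 2 4)).toNat +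
      ((χ 0 1 3 5 == χ 0 2 3 5) && (χ 0 1 2 3 == χ 0 1 2 5)).toNat +
      ((χ 0 1 4 5 == χ 0 2 4 5) && (χ 0 1 2 4 == χ 0 1 2 5)).toNat +
      (majority (χ 0 1 3 4) (χ 0 1 4 5) (χ 0 1 5 3)).toNat +
      (majority (χ 0 2 3 4) (χ 0 2 4 5) (χ 0 2 5 3)).toNat) % 2 = 1 := by
    clear h1 h2 h3
    have g1 := H.gp 0 1 2 3 4 5 (by decide)
    have g2 := H.gp 0 2 1 3 4 5 (by decide)
    have g3 := H.gp 0 3 1 2 4 5 (by decide)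
    have g4 := H.gp 0 4 1 2 3 5 (by decide)
    have g5 := H.gp 0 5 1 2 3 4 (by decide)
    simp (disch := decide) only [H.sort₂, H.sort₃] at *
    clear H
    generalize χ 0 1 2 3 = x1 at *; generalize χ 0 1 2 4 = x2 at *
    generalize χ 0 1 2 5 = x3 at *; generalize χ 0 1 3 4 = x4 at *
    generalize χ 0 1 3 5 = x5 at *; generalize χ 0 1 4 5 = x6 at *
    generalize χ 0 2 3 4 = x7 at *; generalize χ 0 2 3 5 = x8 at *
    generalize χ 0 2 4 5 = x9 at *; generalize χ 0 3 4 5 = x10 at *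
    clear χ
    revert x1 x2 x3 x4 x5 x6 x7 x8 x9 x10
    decide
  omega

/-- The number of edges of the quadrilateral complementary to the triangle through the apex, `vA i`
and `vB j` that cross this triangle. -/
def crossings (χ : Fin 7 → Fin 7 → Fin 7 → Fin 7 → Bool) (i j : Fin 3) : ℕ :=
  (if ChiHit χ 0 (vA i) (vB j) (vA (i + 1)) (vB (j + 1)) then 1 else 0) +
  (if ChiHit χ 0 (vA i) (vB j) (vA (i + 2)) (vB (j + 1)) then 1 else 0) +
  (if ChiHit χ 0 (vA i) (vB j) (vA (i + 2)) (vB (j + 2)) then 1 else 0) +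
  (if ChiHit χ 0 (vA i) (vB j) (vA (i + 1)) (vB (j + 2)) then 1 else 0)

/-- The total number of crossings is odd. A crossing involves exactly two vertices of the first
large part, so the count for six points applies to each pair of these vertices; the correction terms of
the three pairs cancel modulo two. -/
theorem IsChirotope.odd_sum_crossings {χ : Fin 7 → Fin 7 → Fin 7 → Fin 7 → Bool}
    (H : IsChirotope χ) : Odd (∑ i, ∑ j, crossings χ i j) := by
  have h1 := (H.comp (π := ![0, 1, 2, 4, 5, 6]) (by decide)).six_points
  have h2 := (H.comp (π := ![0, 1, 3, 4, 5, 6]) (by decide)).six_points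
  have h3 := (H.comp (π := ![0, 2, 3, 4, 5, 6]) (by decide)).six_points
  let N : Fin 7 → Fin 7 → Fin 7 → Fin 7 → ℕ := fun a b p q => if ChiHit χ 0 a b p q then 1 else 0
  let m : Fin 7 → ℕ := fun a => (majority (χ 0 a 4 5) (χ 0 a 5 6) (χ 0 a 6 4)).toNat
  change ((N 1 4 2 5 + N 1 5 2 4 + N 2 4 1 5 + N 2 5 1 4) + (N 1 4 2 6 + N 1 6 2 4 + N 2 4 1 6 +
    N 2 6 1 4) + (N 1 5 2 6 + N 1 6 2 5 + N 2 5 1 6 + N 2 6 1 5) + m 1 + m 2) % 2 = 1 at h1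
  change ((N 1 4 3 5 + N 1 5 3 4 + N 3 4 1 5 + N 3 5 1 4) + (N 1 4 3 6 + N 1 6 3 4 + N 3 4 1 6 +
    N 3 6 1 4) + (N 1 5 3 6 + N 1 6 3 5 + N 3 5 1 6 + N 3 6 1 5) + m 1 + m 3) % 2 = 1 at h2
  change ((N 2 4 3 5 + N 2 5 3 4 + N 3 4 2 5 + N 3 5 2 4) + (N 2 4 3 6 + N 2 6 3 4 + N 3 4 2 6 +
    N 3 6 2 4) + (N 2 5 3 6 + N 2 6 3 5 + N 3 5 2 6 + N 3 6 2 5) + m 2 + m 3) % 2 = 1 at h3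
  rw [Nat.odd_iff]
  simp only [Fin.sum_univ_three]
  change (((N 1 4 2 5 + N 1 4 3 5 + N 1 4 3 6 + N 1 4 2 6) +
    (N 1 5 2 6 + N 1 5 3 6 + N 1 5 3 4 + N 1 5 2 4) +
    (N 1 6 2 4 + N 1 6 3 4 + N 1 6 3 5 + N 1 6 2 5)) +
    ((N 2 4 3 5 + N 2 4 1 5 + N 2 4 1 6 + N 2 4 3 6) +
    (N 2 5 3 6 + N 2 5 1 6 + N 2 5 1 4 + N 2 5 3 4) +
    (N 2 6 3 4 + N 2 6 1 4 + N 2 6 1 5 + N 2 6 3 5)) +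
    ((N 3 4 1 5 + N 3 4 2 5 + N 3 4 2 6 + N 3 4 1 6) +
    (N 3 5 1 6 + N 3 5 2 6 + N 3 5 2 4 + N 3 5 1 4) +
    (N 3 6 1 4 + N 3 6 2 4 + N 3 6 2 5 + N 3 6 1 5))) % 2 = 1
  omega

/-! ### Crossings in terms of orientations -/

theorem mem_triangle {d : Fin 3 → E3} {x : E3} :
    x ∈ triangle d ↔ ∃ i, x ∈ segment ℝ (d i) (d (i + 1)) := by
  constructor
  · rintro ⟨c, ⟨h0, h1, i, hi⟩, rfl⟩
    rw [Fin.sum_univ_three] at h1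
    have e : comb d c = c 0 • d 0 + c 1 • d 1 + c 2 • d 2 := by rw [comb, Fin.sum_univ_three]
    fin_cases i
    · refine ⟨1, c 1, c 2, h0 1, h0 2, ?_, ?_⟩ <;> simp_all
    · refine ⟨2, c 2, c 0, h0 2, h0 0, ?_, ?_⟩ <;> simp_all [add_comm]
    · refine ⟨0, c 0, c 1, h0 0, h0 1, ?_, ?_⟩ <;> simp_all
  · rintro ⟨i, s, t, hs, ht, hst, rfl⟩
    refine ⟨Pi.single i s + Pi.single (i + 1) t, ⟨fun j => ?_, ?_, ?_⟩, ?_⟩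
    · have h1 : 0 ≤ (Pi.single i s : Fin 3 → ℝ) := Pi.single_nonneg.2 hs
      have h2 : 0 ≤ (Pi.single (i + 1) t : Fin 3 → ℝ) := Pi.single_nonneg.2 ht
      exact add_nonneg (h1 j) (h2 j)
    · simp [Finset.sum_add_distrib, hst]
    · exact ⟨i + 2, by fin_cases i <;> simp⟩
    · rw [comb_add]
      simp [comb, Pi.single_apply, ite_smul]

theorem mem_quad {p : Fin 4 → E3} {x : E3} :
    x ∈ quad p ↔ ∃ i, x ∈ segment ℝ (p i) (p (i + 1)) := by
  constructor
  · rintro ⟨c, ⟨h0, h1, h2, h3⟩, rfl⟩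
    rw [Fin.sum_univ_four] at h1
    have e : comb p c = c 0 • p 0 + c 1 • p 1 + c 2 • p 2 + c 3 • p 3 := by
      rw [comb, Fin.sum_univ_four]
    rcases mul_eq_zero.1 h2 with h2 | h2 <;> rcases mul_eq_zero.1 h3 with h3 | h3
    · refine ⟨2, c 2, c 3, h0 2, h0 3, ?_, ?_⟩ <;> simp_all
    · refine ⟨1, c 1, c 2, h0 1, h0 2, ?_, ?_⟩ <;> simp_all
    · refine ⟨3, c 3, c 0, h0 3, h0 0, ?_, ?_⟩ <;> simp_all [add_comm]
    · refine ⟨0, c 0, c 1, h0 0, h0 1, ?_, ?_⟩ <;> simp_all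
  · rintro ⟨i, hx⟩
    rw [segment_eq_image_lineMap] at hx
    obtain ⟨t, ht, rfl⟩ := hx
    exact edge_subset_quad p i ht

/-- The affine function `x ↦ vol a b c x`. -/
def volMap (a b c : E3) : E3 →ᵃ[ℝ] ℝ where
  toFun x := vol a b c x
  linear :=
    { toFun := fun v =>
        (b 0 - a 0) * ((c 1 - a 1) * v 2 - (c 2 - a 2) * v 1) -
          (b 1 - a 1) * ((c 0 - a 0) * v 2 - (c 2 - a 2) * v 0) +
            (b 2 - a 2) * ((c 0 - a 0) * v 1 - (c 1 - a 1) * v 0)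
      map_add' := fun v w => by simp only [PiLp.add_apply]; ring
      map_smul' := fun t v => by simp only [PiLp.smul_apply, smul_eq_mul, RingHom.id_apply]; ring }
  map_vadd' := fun x v => by
    simp only [vol, vadd_eq_add, PiLp.add_apply, LinearMap.coe_mk, AddHom.coe_mk]
    ring

@[simp] theorem volMap_apply (a b c x : E3) : volMap a b c x = vol a b c x := rfl

theorem vol_comb (a b x : E3) (d : Fin 3 → E3) {c : Fin 3 → ℝ} (hc : ∑ i, c i = 1) :
    vol a b (comb d c) x = c 0 * vol a b (d 0) x + c 1 * vol a b (d 1) x + c 2 * vol a b (d 2) x := by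
  rw [Fin.sum_univ_three] at hc
  have hc : c 2 = 1 - c 0 - c 1 := by linarith
  simp only [vol, comb_apply, Fin.sum_univ_three, hc]
  ring

theorem vol_lineMap (a b x : E3) (t : ℝ) : vol a b (AffineMap.lineMap a b t) x = 0 := by
  simp only [vol, lineMap_eq, PiLp.add_apply, PiLp.smul_apply, smul_eq_mul]
  ring

theorem vol_swap₁ (a b c d : E3) : vol b a c d = -vol a b c d := by simp only [vol]; ring
theorem vol_swap₂ (a b c d : E3) : vol a c b d = -vol a b c d := by simp only [vol]; ring
theorem vol_swap₃ (a b c d : E3) : vol a b d c = -vol a b c d := by simp only [vol]; ring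

/-- Two disjoint edges of a nondegenerate tetrahedron. -/
theorem disjoint_segment_of_vol_ne_zero {a b c d : E3} (h : vol a b c d ≠ 0) :
    Disjoint (segment ℝ a b) (segment ℝ c d) := by
  rw [Set.disjoint_left]
  intro x hx hy
  rw [segment_eq_image_lineMap] at hx hy
  obtain ⟨s, -, rfl⟩ := hx
  obtain ⟨t, -, ht⟩ := hy
  have h1 := vol_lineMap a b d s
  have h2 := vol_lineMap a b c s
  rw [← ht] at h1 h2
  have e1 : vol a b (AffineMap.lineMap c d t) d = (1 - t) * vol a b c d := by
    simp only [vol, lineMap_eq, PiLp.add_apply, PiLp.smul_apply, smul_eq_mul]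
    ring
  have e2 : vol a b (AffineMap.lineMap c d t) c = -t * vol a b c d := by
    simp only [vol, lineMap_eq, PiLp.add_apply, PiLp.smul_apply, smul_eq_mul]
    ring
  rw [h1] at e1
  rw [h2] at e2
  rcases mul_eq_zero.1 e1.symm with e | e
  · rcases mul_eq_zero.1 e2.symm with e' | e'
    · linarith
    · exact h e'
  · exact h e

/-- The orientations of the tetrahedra spanned by the points `P i`. -/
noncomputable def orient {ι : Type*} (P : ι → E3) (i j k l : ι) : Bool :=
  decide (0 < vol (P i) (P j) (P k) (P l))

theorem orient_eq_iff {ι : Type*} {P : ι → E3} {i j k l i' j' k' l' : ι}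
    (h : vol (P i) (P j) (P k) (P l) ≠ 0) (h' : vol (P i') (P j') (P k') (P l') ≠ 0) :
    orient P i j k l = orient P i' j' k' l' ↔
      0 < vol (P i) (P j) (P k) (P l) * vol (P i') (P j') (P k') (P l') := by
  simp only [orient, decide_eq_decide]
  rcases h.lt_or_gt with h | h <;> rcases h'.lt_or_gt with h' | h'
  · simp [h.not_gt, h'.not_gt, mul_pos_of_neg_of_neg h h']
  · simp [h.not_gt, h', (mul_neg_of_neg_of_pos h h').not_gt]
  · simp [h, h'.not_gt, (mul_neg_of_pos_of_neg h h').not_gt]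
  · simp [h, h', mul_pos h h']

/-- The three products in the Grassmann–Plücker relation for volumes have sum zero, so they do not
all have the same sign. -/
theorem isChirotope_orient {ι : Type*} {P : ι → E3}
    (hP : ∀ i j k l, [i, j, k, l].Nodup → vol (P i) (P j) (P k) (P l) ≠ 0) :
    IsChirotope (orient P) := by
  have key : ∀ x : ℝ, x ≠ 0 → decide (0 < -x) = !decide (0 < x) := by
    intro x hx
    rcases hx.lt_or_gt with h | h
    · simp [h, h.not_gt]
    · simp [h, h.not_gt]
  refine ⟨fun i j k l h => ?_, fun i j k l h => ?_, fun i j k l h => ?_,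
    fun p q a b c d h => ?_⟩
  · rw [orient, vol_swap₁, key _ (hP i j k l h), orient]
  · rw [orient, vol_swap₂, key _ (hP i j k l h), orient]
  · rw [orient, vol_swap₃, key _ (hP i j k l h), orient]
  · have n : [p, q, a, b].Nodup ∧ [p, q, c, d].Nodup ∧ [p, q, a, d].Nodup ∧ [p, q, b, c].Nodup ∧
      [p, q, a, c].Nodup ∧ [p, q, b, d].Nodup := by grind
    obtain ⟨n1, n2, n3, n4, n5, n6⟩ := n
    replace n1 := hP _ _ _ _ n1
    replace n2 := hP _ _ _ _ n2
    replace n3 := hP _ _ _ _ n3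
    replace n4 := hP _ _ _ _ n4
    replace n5 := hP _ _ _ _ n5
    replace n6 := hP _ _ _ _ n6
    have e : ∀ x y z w : Bool, ((x == y) = (z == w)) ↔ ((x = y) ↔ (z = w)) := by decide
    rw [e, e, orient_eq_iff n1 n2, orient_eq_iff n3 n4, orient_eq_iff n5 n6]
    have gp : vol (P p) (P q) (P a) (P b) * vol (P p) (P q) (P c) (P d) +
        vol (P p) (P q) (P a) (P d) * vol (P p) (P q) (P b) (P c) =
        vol (P p) (P q) (P a) (P c) * vol (P p) (P q) (P b) (P d) := by
      simp only [vol]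
      ring
    intro hh
    have m1 := mul_ne_zero n1 n2
    have m2 := mul_ne_zero n3 n4
    rw [← gp]
    constructor
    · intro h1
      have := hh.1 h1
      linarith
    · intro h1
      by_contra h2
      have h3 := fun h => h2 (hh.2 h)
      have := lt_of_le_of_ne (not_lt.1 h2) m1
      have := lt_of_le_of_ne (not_lt.1 h3) m2
      linarith

/-- The endpoints of the segment are on different sides of the triangle, and the line through them
passes the three edges of the triangle on the same side. -/
theorem hit_iff {ι : Type*} {P : ι → E3}
    (hP : ∀ i j k l, [i, j, k, l].Nodup → vol (P i) (P j) (P k) (P l) ≠ 0) {a b c p q : ι}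
    (hn : [a, b, c, p, q].Nodup) :
    Hit ![P a, P b, P c] (volMap (P a) (P b) (P c)) (P p) (P q) ↔ ChiHit (orient P) a b c p q := by
  have n : [a, b, c, p].Nodup ∧ [a, b, c, q].Nodup ∧ [p, q, a, b].Nodup ∧ [p, q, b, c].Nodup ∧
    [p, q, c, a].Nodup := by grind
  obtain ⟨n1, n2, n3, n4, n5⟩ := n
  replace n1 := hP _ _ _ _ n1
  replace n2 := hP _ _ _ _ n2
  replace n3 := hP _ _ _ _ n3
  replace n4 := hP _ _ _ _ n4
  replace n5 := hP _ _ _ _ n5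
  rw [Hit, ChiHit, ne_eq, orient_eq_iff n1 n2, orient_eq_iff n3 n4, orient_eq_iff n4 n5,
    not_lt, volMap_apply, volMap_apply, le_iff_lt_or_eq, or_iff_left (mul_ne_zero n1 n2)]
  refine and_congr_right fun hneg => ?_
  set m := crossPoint (volMap (P a) (P b) (P c)) (P p) (P q) with hm
  -- the barycentric coordinates of the crossing point are proportional to the volumes spanned by
  -- the segment and the edges of the triangle
  have prop : ∀ x : Fin 3 → ℝ, ∑ i, x i = 1 → comb ![P a, P b, P c] x = m →
      x 1 * vol (P p) (P q) (P a) (P b) = x 2 * vol (P p) (P q) (P c) (P a) ∧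
      x 2 * vol (P p) (P q) (P b) (P c) = x 0 * vol (P p) (P q) (P a) (P b) := by
    intro x hx he
    have e1 := vol_comb (P p) (P q) (P a) ![P a, P b, P c] hx
    have e2 := vol_comb (P p) (P q) (P b) ![P a, P b, P c] hx
    rw [he, hm, crossPoint, vol_lineMap] at e1 e2
    simp only [Matrix.cons_val_zero, Matrix.cons_val_one, Matrix.cons_val] at e1 e2
    have z1 : vol (P p) (P q) (P a) (P a) = 0 := by simp only [vol]; ring
    have z2 : vol (P p) (P q) (P b) (P b) = 0 := by simp only [vol]; ring
    rw [z1, vol_swap₃ _ _ (P a) (P b)] at e1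
    rw [z2, vol_swap₃ _ _ (P b) (P c)] at e2
    constructor <;> linarith
  have hd : AffineIndependent ℝ ![P a, P b, P c] := by
    have := (affineIndependent_of_vol_ne_zero (p := ![P a, P b, P c, P p]) n1).comp_embedding
      (Fin.castSuccEmb (n := 3))
    convert this using 1
    ext i
    fin_cases i <;> rfl
  have hh : ∀ i, volMap (P a) (P b) (P c) (![P a, P b, P c] i) = 0 := by
    intro i
    fin_cases i <;> simp [vol] <;> ring
  constructor
  · rintro ⟨x, ⟨hx0, hx1⟩, hx2⟩
    obtain ⟨p1, p2⟩ := prop x hx1 hx2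
    have h0 := hx0 0
    have h1 := hx0 1
    have h2 := hx0 2
    have s1 : 0 < x 0 * vol (P p) (P q) (P a) (P b) ^ 2 := by positivity
    have s2 : 0 < vol (P p) (P q) (P a) (P b) * vol (P p) (P q) (P b) (P c) := by
      refine pos_of_mul_pos_right (a := x 2) ?_ h2.le
      linear_combination s1 - vol (P p) (P q) (P a) (P b) * p2
    refine ⟨s2, pos_of_mul_pos_right (a := x 2) ?_ h2.le⟩
    have := mul_pos h1 s2
    linear_combination this + vol (P p) (P q) (P b) (P c) * p1
  · rintro ⟨hv1, hv2⟩
    obtain ⟨x, hx1, hx2⟩ := exists_comb_eq hd hh (q := P p) n1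
      (affineMap_crossPoint (h := volMap (P a) (P b) (P c)) (ne_of_mul_neg hneg))
    obtain ⟨p1, p2⟩ := prop x hx1 hx2
    refine ⟨x, ⟨?_, hx1⟩, hx2⟩
    rw [Fin.sum_univ_three] at hx1
    generalize vol (P p) (P q) (P b) (P c) = v0 at *
    generalize vol (P p) (P q) (P c) (P a) = v1 at *
    generalize vol (P p) (P q) (P a) (P b) = v2 at *
    have s0 : 0 < v2 ^ 2 := by positivity
    have s1 : 0 < v1 * v2 := by
      have : 0 < v0 ^ 2 := by positivity
      refine pos_of_mul_pos_right (a := v0 ^ 2) ?_ this.le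
      linear_combination mul_pos hv1 hv2
    have t2 : 0 < x 2 := by
      refine pos_of_mul_pos_left (b := v0 * v2 + v1 * v2 + v2 ^ 2) ?_ (by linarith)
      linear_combination s0 + v2 * p1 - v2 * p2 - v2 ^ 2 * hx1
    have t0 : 0 < x 0 := by
      refine pos_of_mul_pos_left (b := v2 ^ 2) ?_ s0.le
      linear_combination mul_pos t2 hv1 + v2 * p2
    have t1 : 0 < x 1 := by
      refine pos_of_mul_pos_left (b := v2 ^ 2) ?_ s0.le
      linear_combination mul_pos t2 s1 - v2 * p1
    intro i
    fin_cases i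
    exacts [t0, t1, t2]

/-- A triangle and a quadrilateral whose vertices are in general position. -/
theorem genericPair_of_vol_ne_zero {P : Fin 7 → E3}
    (hP : ∀ i j k l, [i, j, k, l].Nodup → vol (P i) (P j) (P k) (P l) ≠ 0) {a b c p q r s : Fin 7}
    (hn : [a, b, c, p, q, r, s].Nodup) :
    GenericPair ![P a, P b, P c] ![P p, P q, P r, P s] (volMap (P a) (P b) (P c)) where
  triangle_indep := by
    have := (affineIndependent_of_vol_ne_zero (p := ![P a, P b, P c, P p])
      (hP _ _ _ _ (by grind))).comp_embedding (Fin.castSuccEmb (n := 3))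
    convert this using 1
    ext i
    fin_cases i <;> rfl
  quad_indep := affineIndependent_of_vol_ne_zero (p := ![P p, P q, P r, P s])
    (hP _ _ _ _ (by grind))
  vanish i := by fin_cases i <;> simp [vol] <;> ring
  ne_zero i := by
    fin_cases i
    · exact hP _ _ _ _ (by grind)
    · exact hP _ _ _ _ (by grind)
    · exact hP _ _ _ _ (by grind)
    · exact hP _ _ _ _ (by grind)
  disj := by
    rw [Set.disjoint_left]
    intro x hx hy
    obtain ⟨i, hi⟩ := mem_triangle.1 hx
    obtain ⟨j, hj⟩ := mem_quad.1 hy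
    refine Set.disjoint_left.1 (disjoint_segment_of_vol_ne_zero ?_) hi hj
    fin_cases i <;> fin_cases j <;> exact hP _ _ _ _ (by grind)

/-- The alternation of the vertices is expressed by different pairs of vertices on the two sides;
both determine it, since the endpoints of a crossing edge have opposite orientations. -/
theorem isTorusPattern_iff {P : Fin 7 → E3}
    (hP : ∀ i j k l, [i, j, k, l].Nodup → vol (P i) (P j) (P k) (P l) ≠ 0) {a b c p q r s : Fin 7}
    (hn : [a, b, c, p, q, r, s].Nodup) :
    IsTorusPattern ![P a, P b, P c] ![P p, P q, P r, P s] (volMap (P a) (P b) (P c)) ↔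
      TorusPattern (orient P) a b c p q r s := by
  have n1 : [a, b, c, p, q].Nodup ∧ [a, b, c, r, s].Nodup ∧ [a, b, c, p, s].Nodup ∧
    [a, b, c, r, q].Nodup ∧ [a, b, c, p].Nodup ∧ [a, b, c, q].Nodup ∧ [a, b, c, r].Nodup := by grind
  obtain ⟨n1, n2, n3, n4, n5, n6, n7⟩ := n1
  have h1 := hit_iff hP n1
  have h2 := hit_iff hP n2
  have h3 := hit_comm.trans (hit_iff hP n3)
  have h4 := hit_comm.trans (hit_iff hP n4)
  have h5 : volMap (P a) (P b) (P c) (P q) * volMap (P a) (P b) (P c) (P r) < 0 ↔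
      orient P a b c q ≠ orient P a b c r := by
    rw [ne_eq, orient_eq_iff (hP _ _ _ _ n6) (hP _ _ _ _ n7), not_lt, volMap_apply, volMap_apply,
      le_iff_lt_or_eq, or_iff_left (mul_ne_zero (hP _ _ _ _ n6) (hP _ _ _ _ n7))]
  have e : orient P a b c p ≠ orient P a b c q → (orient P a b c q ≠ orient P a b c r ↔
      orient P a b c p = orient P a b c r) := by
    generalize orient P a b c p = x; generalize orient P a b c q = y
    generalize orient P a b c r = z
    revert x y z
    decide
  change (Hit _ _ (P p) (P q) ∧ Hit _ _ (P r) (P s) ∧ _ ∧ ¬ Hit _ _ (P s) (P p) ∧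
    ¬ Hit _ _ (P q) (P r)) ↔ _
  have h5 : volMap (P a) (P b) (P c) (![P p, P q, P r, P s] 1) *
    volMap (P a) (P b) (P c) (![P p, P q, P r, P s] 2) < 0 ↔ _ := h5
  rw [h1, h2, h3, h4, h5]
  constructor
  · rintro ⟨a1, a2, a3, a4, a5⟩
    exact ⟨a1, a2, a4, a5, (e a1.1).1 a3⟩
  · rintro ⟨a1, a2, a3, a4, a5⟩
    exact ⟨a1, a2, (e a1.1).2 a5, a3, a4⟩

/-- Traversing the quadrilateral in the opposite direction. -/
theorem TorusPattern.reverse {χ : Fin 7 → Fin 7 → Fin 7 → Fin 7 → Bool} (H : IsChirotope χ)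
    {a b c p q r s : Fin 7} (hn : [a, b, c, p, q, r, s].Nodup)
    (h : TorusPattern χ a b c p q r s) : TorusPattern χ a b c s r q p := by
  have key : ∀ x y, [a, b, c, x, y].Nodup → (ChiHit χ a b c y x ↔ ChiHit χ a b c x y) := by
    intro x y hxy
    have n1 : [x, y, a, b].Nodup ∧ [x, y, b, c].Nodup ∧ [x, y, c, a].Nodup := by
      clear hn h
      grind
    obtain ⟨n1, n2, n3⟩ := n1
    unfold ChiHit
    rw [H.swap₁ _ _ _ _ n1, H.swap₁ _ _ _ _ n2, H.swap₁ _ _ _ _ n3, ne_comm]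
    simp only [Bool.not_inj_iff]
  obtain ⟨h1, h2, h3, h4, h5⟩ := h
  have n1 : [a, b, c, p, q].Nodup ∧ [a, b, c, r, s].Nodup ∧ [a, b, c, p, s].Nodup ∧
    [a, b, c, r, q].Nodup := by grind
  obtain ⟨n1, n2, n3, n4⟩ := n1
  refine ⟨(key _ _ n2).2 h2, (key _ _ n1).2 h1, fun h => h3 ((key _ _ n3).1 h),
    fun h => h4 ((key _ _ n4).1 h), ?_⟩
  have h1 := h1.1
  have h2 := h2.1
  rw [← h5] at h2
  revert h1 h2
  generalize χ a b c p = u1; generalize χ a b c q = u2; generalize χ a b c s = u3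
  revert u1 u2 u3
  decide

/-- The triangle through the apex, `vA i` and `vB j`. -/
def starTriangle (P : Fin 7 → E3) (i j : Fin 3) : Fin 3 → E3 := ![P 0, P (vA i), P (vB j)]

/-- The vertices of the quadrilateral complementary to `starTriangle P i j`. -/
def coQuad (P : Fin 7 → E3) (i j : Fin 3) : Fin 4 → E3 :=
  ![P (vA (i + 1)), P (vB (j + 1)), P (vA (i + 2)), P (vB (j + 2))]

/-- The nine links of seven points in general position: the links that a triangle meets in an odd
number of points are Hopf links, their number is odd, and with at most one exception, which is a
`(2, 4)`-torus link, the others are trivial. -/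
theorem link_classification {P : Fin 7 → E3}
    (hP : ∀ i j k l, [i, j, k, l].Nodup → vol (P i) (P j) (P k) (P l) ≠ 0) :
    ∃ O T : Set (Fin 3 × Fin 3), Odd O.ncard ∧ T.Subsingleton ∧ Disjoint O T ∧
      (∀ x ∈ O, IsHopfLink (triangle (starTriangle P x.1 x.2) ∪ quad (coQuad P x.1 x.2))) ∧
      (∀ x ∈ T, IsTorusLink 2 4 (triangle (starTriangle P x.1 x.2) ∪ quad (coQuad P x.1 x.2))) ∧
      ∀ x, x ∉ O → x ∉ T →
        IsTrivialLink (triangle (starTriangle P x.1 x.2) ∪ quad (coQuad P x.1 x.2)) := by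
  have hχ := isChirotope_orient hP
  have key : ∀ i j : Fin 3, [0, vA i, vB j, vA (i + 1), vB (j + 1), vA (i + 2), vB (j + 2)].Nodup ∧
      [0, vA i, vB j, vB (j + 1), vA (i + 2), vB (j + 2), vA (i + 1)].Nodup ∧
      j - 1 = j + 2 ∧ j - 2 = j + 1 ∧ [0, vA i, vB j, vA (i + 1), vB (j + 1)].Nodup ∧
      [0, vA i, vB j, vA (i + 2), vB (j + 1)].Nodup ∧
      [0, vA i, vB j, vA (i + 2), vB (j + 2)].Nodup ∧
      [0, vA i, vB j, vA (i + 1), vB (j + 2)].Nodup := by decide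
  let h := fun x : Fin 3 × Fin 3 => volMap (P 0) (P (vA x.1)) (P (vB x.2))
  have hG : ∀ x, GenericPair (starTriangle P x.1 x.2) (coQuad P x.1 x.2) (h x) :=
    fun x => genericPair_of_vol_ne_zero hP (key x.1 x.2).1
  have hN : ∀ x, numHits (starTriangle P x.1 x.2) (coQuad P x.1 x.2) (h x) =
      crossings (orient P) x.1 x.2 := by
    intro x
    obtain ⟨-, -, -, -, n1, n2, n3, n4⟩ := key x.1 x.2
    classical
    rw [numHits_eq, crossings]
    congr 1
    · congr 1
      · congr 1
        · exact if_congr (hit_iff hP n1) rfl rfl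
        · exact if_congr (hit_comm.trans (hit_iff hP n2)) rfl rfl
      · exact if_congr (hit_iff hP n3) rfl rfl
    · exact if_congr (hit_comm.trans (hit_iff hP n4)) rfl rfl
  have hT : ∀ x, IsTorusPattern (starTriangle P x.1 x.2) (coQuad P x.1 x.2) (h x) →
      PatternAt (orient P) x.1 x.2 1 := by
    intro x hx
    have := (isTorusPattern_iff hP (key x.1 x.2).1).1 hx
    rw [PatternAt, (key x.1 x.2).2.2.1]
    exact this
  have hT' : ∀ x, IsTorusPattern (starTriangle P x.1 x.2) (fun i => coQuad P x.1 x.2 (i + 1))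
      (h x) → PatternAt (orient P) x.1 x.2 2 := by
    intro x hx
    have e : (fun i => coQuad P x.1 x.2 (i + 1)) =
        ![P (vB (x.2 + 1)), P (vA (x.1 + 2)), P (vB (x.2 + 2)), P (vA (x.1 + 1))] := by
      funext i
      fin_cases i <;> rfl
    rw [e] at hx
    have := ((isTorusPattern_iff hP (key x.1 x.2).2.1).1 hx).reverse hχ (key x.1 x.2).2.1
    rw [PatternAt, (key x.1 x.2).2.2.2.1]
    exact this
  refine ⟨{x | Odd (crossings (orient P) x.1 x.2)}, {x | ¬ Odd (crossings (orient P) x.1 x.2) ∧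
    (IsTorusPattern (starTriangle P x.1 x.2) (coQuad P x.1 x.2) (h x) ∨
      IsTorusPattern (starTriangle P x.1 x.2) (fun i => coQuad P x.1 x.2 (i + 1)) (h x))},
    ?_, ?_, ?_, ?_, ?_, ?_⟩
  · have := hχ.odd_sum_crossings
    rw [← Finset.sum_product', Finset.odd_sum_iff_odd_card_odd] at this
    convert this
    rw [← Set.ncard_coe_finset]
    congr 1
    ext x
    simp
  · rintro x ⟨-, hx⟩ y ⟨-, hy⟩
    have key : ∀ x, (IsTorusPattern (starTriangle P x.1 x.2) (coQuad P x.1 x.2) (h x) ∨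
      IsTorusPattern (starTriangle P x.1 x.2) (fun i => coQuad P x.1 x.2 (i + 1)) (h x)) →
      ∃ ε, (ε = 1 ∨ ε = 2) ∧ PatternAt (orient P) x.1 x.2 ε := fun x hx =>
      hx.elim (fun hx => ⟨1, Or.inl rfl, hT x hx⟩) fun hx => ⟨2, Or.inr rfl, hT' x hx⟩
    obtain ⟨ε, hε, h1⟩ := key x hx
    obtain ⟨ε', hε', h2⟩ := key y hy
    by_contra hxy
    exact not_patternAt hχ (fun e => hxy e.symm) hε hε' h1 h2
  · rw [Set.disjoint_left]
    exact fun x hx hx' => hx'.1 hx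
  · intro x hx
    exact (hG x).classification.1 (by rw [hN]; exact hx)
  · rintro x ⟨-, ⟨h1, h2, h3, h4, h5⟩ | ⟨h1, h2, h3, h4, h5⟩⟩
    · exact (hG x).isTorusLink_of_alternating h1 h2 h3 h4 h5
    · rw [← quad_rotate]
      exact (hG x).rotate.isTorusLink_of_alternating h1 h2 h3 h4 h5
  · intro x hO hT
    have hO : ¬ Odd (crossings (orient P) x.1 x.2) := hO
    exact (hG x).classification.2 (by rw [hN]; exact Nat.not_odd_iff_even.1 hO)
      (fun h => hT ⟨hO, Or.inl h⟩) fun h => hT ⟨hO, Or.inr h⟩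

/-! ### Roots of functions on link complements -/

/-- Every continuous function without zeros on the complement of `B` has a continuous `n`-th root
on `A`. For two disjoint knots this says that `n` divides their linking number. -/
def RootsOff (n : ℕ) (A B : Set E3) : Prop :=
  ∀ g : E3 → ℂ, ContinuousOn g Bᶜ → (∀ x ∈ Bᶜ, g x ≠ 0) →
    ∃ s : E3 → ℂ, ContinuousOn s A ∧ ∀ x ∈ A, s x ^ n = g x

/-- The set `L` is the union of two disjoint connected closed sets `A` and `B` that satisfy
`RootsOff n A B`. -/
def HasRoots (n : ℕ) (L : Set E3) : Prop :=
  ∃ A B : Set E3, IsClosed A ∧ IsClosed B ∧ IsConnected A ∧ IsConnected B ∧ Disjoint A B ∧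
    A ∪ B = L ∧ RootsOff n A B

theorem RootsOff.image {n : ℕ} {A B : Set E3} (H : RootsOff n A B) (e : E3 ≃ₜ E3) :
    RootsOff n (e '' A) (e '' B) := by
  intro g hg h0
  have hm : MapsTo e Bᶜ (e '' B)ᶜ := fun x hx => by
    rintro ⟨y, hy, hxy⟩
    exact hx (e.injective hxy ▸ hy)
  obtain ⟨s, hs, hs'⟩ := H (g ∘ e) (hg.comp e.continuous.continuousOn hm) fun x hx => h0 _ (hm hx)
  refine ⟨s ∘ e.symm, hs.comp e.symm.continuous.continuousOn ?_, ?_⟩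
  · rintro _ ⟨y, hy, rfl⟩
    simpa using hy
  · rintro _ ⟨y, hy, rfl⟩
    simpa using hs' y hy

theorem HasRoots.image {n : ℕ} {L : Set E3} (H : HasRoots n L) (e : E3 ≃ₜ E3) :
    HasRoots n (e '' L) := by
  obtain ⟨A, B, hA, hB, cA, cB, hd, rfl, hr⟩ := H
  exact ⟨e '' A, e '' B, e.isClosedMap _ hA, e.isClosedMap _ hB,
    cA.image _ e.continuous.continuousOn, cB.image _ e.continuous.continuousOn,
    (disjoint_image_iff e.injective).2 hd, (image_union _ _ _).symm, hr.image e⟩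

theorem hasRoots_image_iff {n : ℕ} {L : Set E3} (e : E3 ≃ₜ E3) :
    HasRoots n (e '' L) ↔ HasRoots n L := by
  refine ⟨fun h => ?_, fun h => h.image e⟩
  simpa [image_image] using h.image e.symm

theorem AmbientIsotopic.hasRoots_iff {n : ℕ} {K L : Set E3} (h : AmbientIsotopic K L) :
    HasRoots n K ↔ HasRoots n L := by
  obtain ⟨e, -, rfl⟩ := ambientIsotopic_iff.1 h
  exact (hasRoots_image_iff e).symm

/-- The components of a two-component link are determined up to order. -/
theorem not_hasRoots {n : ℕ} {A B : Set E3} (hA : IsClosed A) (hB : IsClosed B)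
    (cA : A.Nonempty) (cB : B.Nonempty) (hd : Disjoint A B) (h1 : ¬ RootsOff n A B)
    (h2 : ¬ RootsOff n B A) : ¬ HasRoots n (A ∪ B) := by
  rintro ⟨C, D, hC, hD, cC, cD, hd', he, hr⟩
  have key : ∀ E : Set E3, IsConnected E → E ⊆ A ∪ B → E ⊆ A ∨ E ⊆ B := by
    intro E hE hsub
    exact isPreconnected_iff_subset_of_disjoint_closed.1 hE.isPreconnected A B hA hB hsub
      (by rw [hd.inter_eq, inter_empty])
  have hC' := key C cC (he ▸ subset_union_left)
  have hD' := key D cD (he ▸ subset_union_right)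
  have eq_of : ∀ {X Y : Set E3}, Disjoint X Y → C ⊆ X → D ⊆ Y → X ∪ Y = C ∪ D → C = X ∧ D = Y := by
    intro X Y hXY h1 h2 h3
    refine ⟨h1.antisymm fun x hx => ?_, h2.antisymm fun x hx => ?_⟩
    · rcases h3.subset (Or.inl hx) with h | h
      · exact h
      · exact (Set.disjoint_left.1 hXY hx (h2 h)).elim
    · rcases h3.subset (Or.inr hx) with h | h
      · exact (Set.disjoint_left.1 hXY (h1 h) hx).elim
      · exact h
  rcases hC' with hC' | hC' <;> rcases hD' with hD' | hD'
  · obtain ⟨x, hx⟩ := cB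
    have : x ∈ C ∪ D := he ▸ Or.inr hx
    exact Set.disjoint_left.1 hd (union_subset hC' hD' this) hx
  · obtain ⟨rfl, rfl⟩ := eq_of hd hC' hD' he.symm
    exact h1 hr
  · obtain ⟨rfl, rfl⟩ := eq_of hd.symm hC' hD' (by rw [he, union_comm])
    exact h2 hr
  · obtain ⟨x, hx⟩ := cA
    have : x ∈ C ∪ D := he ▸ Or.inl hx
    exact Set.disjoint_left.1 hd hx (union_subset hC' hD' this)

/-- A continuous function with finitely many possible values is constant. -/
theorem eq_of_pow_eq {X : Type*} [TopologicalSpace X] [PreconnectedSpace X] {n : ℕ} (hn : n ≠ 0)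
    {v : X → ℂ} (hv : Continuous v) {c : ℂ} (h : ∀ x, v x ^ n = c) (x y : X) : v x = v y := by
  have hfin : {z : ℂ | z ^ n = c}.Finite := by
    have hp : (Polynomial.X ^ n - Polynomial.C c : Polynomial ℂ) ≠ 0 :=
      Polynomial.X_pow_sub_C_ne_zero (Nat.pos_of_ne_zero hn) c
    refine (Polynomial.finite_setOfPred_isRoot hp).subset fun z hz => ?_
    simpa [Polynomial.IsRoot, sub_eq_zero] using hz
  exact hfin.countable.isTotallyDisconnected _ (range_subset_iff.2 h) (isPreconnected_range hv) ⟨x, rfl⟩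
    ⟨y, rfl⟩

/-- The function `a + b exp (m i θ)` winds `m` times around the origin if `|a| < |b|`, so it has
no continuous periodic `n`-th root unless `n` divides `m`. -/
theorem not_exists_root {n : ℕ} (hn : n ≠ 0) {m : ℤ} (hnm : ¬ (n : ℤ) ∣ m) {a b : ℂ}
    (hab : ‖a‖ < ‖b‖) {w : ℝ → ℂ} (hw : Continuous w) (hper : w (2 * Real.pi) = w 0)
    (h : ∀ θ : ℝ, w θ ^ n = a + b * Complex.exp (m * θ * Complex.I)) : False := by
  have hb : b ≠ 0 := norm_pos_iff.1 ((norm_nonneg a).trans_lt hab)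
  have hn' : (n : ℂ) ≠ 0 := Nat.cast_ne_zero.2 hn
  -- the factor `1 + (a / b) exp (-m i θ)` stays in the right half plane
  let z : ℝ → ℂ := fun θ => 1 + a / b * Complex.exp (-(m * θ * Complex.I))
  have hz : ∀ θ, z θ ∈ Complex.slitPlane := by
    intro θ
    left
    have h1 : ‖a / b * Complex.exp (-(m * θ * Complex.I))‖ < 1 := by
      have : -((m : ℂ) * θ * Complex.I) = ((-(m * θ) : ℝ) : ℂ) * Complex.I := by push_cast; ring
      rw [norm_mul, this, Complex.norm_exp_ofReal_mul_I, mul_one, norm_div, div_lt_one]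
      · exact hab
      · exact norm_pos_iff.2 hb
    have h2 := (Complex.abs_re_le_norm _).trans_lt h1
    have h3 := (abs_lt.1 h2).1
    simp only [z, Complex.add_re, Complex.one_re]
    linarith
  have hz0 : ∀ θ, z θ ≠ 0 := fun θ => Complex.slitPlane_ne_zero (hz θ)
  have hzc : Continuous z := by fun_prop
  let r : ℝ → ℂ := fun θ => z θ ^ (1 / n : ℂ)
  have hr : Continuous r := hzc.cpow continuous_const hz
  have hrn : ∀ θ, r θ ^ n = z θ := fun θ => by simp [r, ← Complex.cpow_mul_nat, hn]
  have hr0 : ∀ θ, r θ ≠ 0 := fun θ h0 => hz0 θ (by rw [← hrn, h0, zero_pow hn])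
  let v : ℝ → ℂ := fun θ => w θ / r θ * Complex.exp (-(m * θ * Complex.I / n))
  have hv : Continuous v := (hw.div hr hr0).mul (by fun_prop)
  have hvn : ∀ θ, v θ ^ n = b := by
    intro θ
    have e1 : (n : ℂ) * -(m * θ * Complex.I / n) = -(m * θ * Complex.I) := by field_simp
    rw [mul_pow, div_pow, h, hrn, ← Complex.exp_nat_mul, e1, div_mul_eq_mul_div,
      div_eq_iff (hz0 θ)]
    simp only [z, Complex.exp_neg]
    have := Complex.exp_ne_zero (m * θ * Complex.I)
    field_simp
    ring
  have e := eq_of_pow_eq hn hv hvn (2 * Real.pi) 0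
  have er : r (2 * Real.pi) = r 0 := by
    simp only [r, z]
    congr 3
    rw [Complex.exp_eq_exp_iff_exists_int]
    exact ⟨-m, by push_cast; ring⟩
  have hw0 : w 0 ≠ 0 := by
    intro h0
    have := hvn 0
    rw [show v 0 = 0 by simp [v, h0], zero_pow hn] at this
    exact hb this.symm
  simp only [v, er, hper] at e
  have e2 := mul_left_cancel₀ (div_ne_zero hw0 (hr0 0)) e
  rw [Complex.exp_eq_exp_iff_exists_int] at e2
  obtain ⟨k, hk⟩ := e2
  refine hnm ⟨-k, ?_⟩
  push_cast at hk
  have hpi : (2 * Real.pi * Complex.I : ℂ) ≠ 0 := Complex.two_pi_I_ne_zero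
  have : (m : ℂ) = n * (-k : ℤ) := by
    field_simp at hk
    push_cast
    apply mul_left_cancel₀ hpi
    linear_combination -Complex.I * hk
  exact_mod_cast this

/-- A curve along which a function vanishing only on `B` winds around the origin. -/
theorem not_rootsOff {n : ℕ} (hn : n ≠ 0) {m : ℤ} (hnm : ¬ (n : ℤ) ∣ m) {a b : ℂ}
    (hab : ‖a‖ < ‖b‖) {γ : Circle → E3} (hγ : Continuous γ) {B : Set E3} {g : E3 → ℂ}
    (hg : Continuous g) (hB : ∀ x, g x = 0 → x ∈ B)
    (h : ∀ u : Circle, g (γ u) = a + b * (u : ℂ) ^ m) : ¬ RootsOff n (range γ) B := by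
  intro H
  obtain ⟨s, hs, hs'⟩ := H g hg.continuousOn fun x hx h0 => hx (hB x h0)
  refine not_exists_root hn hnm hab (w := fun θ => s (γ (Circle.exp θ)))
    (hs.comp_continuous (hγ.comp Circle.exp.continuous) fun θ => mem_range_self _) ?_ fun θ => ?_
  · simp
  · rw [hs' _ (mem_range_self _), h, Circle.coe_exp, ← Complex.exp_int_mul]
    ring_nf

theorem isClosed_range_of_circle {γ : Circle → E3} (hγ : Continuous γ) : IsClosed (range γ) :=
  (isCompact_range hγ).isClosed

theorem isConnected_range_of_circle {γ : Circle → E3} (hγ : Continuous γ) :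
    IsConnected (range γ) := isConnected_range hγ

/-! ### Roots distinguish the three standard links -/

/-- A convex open set is simply connected, so functions without zeros on it have roots. -/
theorem rootsOff_of_convex {n : ℕ} (hn : n ≠ 0) {A B U : Set E3} (hU : Convex ℝ U)
    (hUo : IsOpen U) (hUn : U.Nonempty) (hA : A ⊆ U) (hB : Disjoint U B) : RootsOff n A B := by
  intro g hg h0
  have hs : IsSimplyConnected U := by
    have := hU.contractibleSpace hUn
    exact SimplyConnectedSpace.ofContractible U
  have hUB : U ⊆ Bᶜ := hB.subset_compl_right
  obtain ⟨s, hs1, hs2⟩ := Complex.exists_continuousOn_pow_eq hs hUo (hg.mono hUB)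
    (by rintro ⟨x, hx, hx0⟩; exact h0 x (hUB hx) hx0) hn
  exact ⟨s, hs1.mono hA, fun x _ => hs2 x⟩

theorem unitCircle_eq : {x : E3 | x 2 = 0 ∧ x 0 ^ 2 + x 1 ^ 2 = 1} =
    range fun u : Circle => (!₂[(u : ℂ).re, (u : ℂ).im, 0] : E3) := by
  ext x
  constructor
  · rintro ⟨h1, h2⟩
    obtain ⟨u, hu1, hu2⟩ := exists_circle h2
    exact ⟨u, by ext i; fin_cases i <;> simp [hu1, hu2, h1]⟩
  · rintro ⟨u, rfl⟩
    exact ⟨rfl, normSq_circle u⟩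

theorem continuous_mk {X : Type*} [TopologicalSpace X] {f g : X → ℝ} (hf : Continuous f)
    (hg : Continuous g) : Continuous fun x => (⟨f x, g x⟩ : ℂ) :=
  Complex.equivRealProdCLM.symm.continuous.comp (hf.prodMk hg)

/-- The half-space `x < 3/2` contains the first circle and misses the second one. -/
theorem hasRoots_standardUnlink {n : ℕ} (hn : n ≠ 0) : HasRoots n standardUnlink := by
  have c1 : Continuous fun u : Circle => (!₂[(u : ℂ).re, (u : ℂ).im, 0] : E3) := by fun_prop
  have c2 : Continuous fun u : Circle => (!₂[3 + (u : ℂ).re, (u : ℂ).im, 0] : E3) := by fun_prop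
  have e1 := unitCircle_eq
  have e2 : {x : E3 | x 2 = 0 ∧ (x 0 - 3) ^ 2 + x 1 ^ 2 = 1} =
      range fun u : Circle => (!₂[3 + (u : ℂ).re, (u : ℂ).im, 0] : E3) := by
    ext x
    constructor
    · rintro ⟨h1, h2⟩
      obtain ⟨u, hu1, hu2⟩ := exists_circle h2
      exact ⟨u, by ext i; fin_cases i <;> simp [hu1, hu2, h1]⟩
    · rintro ⟨u, rfl⟩
      exact ⟨rfl, by simpa using normSq_circle u⟩
  have hsub : {x : E3 | x 2 = 0 ∧ x 0 ^ 2 + x 1 ^ 2 = 1} ⊆ {x : E3 | x 0 < 3 / 2} := by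
    rintro x ⟨-, hx⟩
    change x 0 < 3 / 2
    nlinarith [sq_nonneg (x 1)]
  have hdis : Disjoint {x : E3 | x 0 < 3 / 2} {x : E3 | x 2 = 0 ∧ (x 0 - 3) ^ 2 + x 1 ^ 2 = 1} := by
    rw [Set.disjoint_left]
    rintro x hx ⟨-, hx'⟩
    change x 0 < 3 / 2 at hx
    nlinarith [sq_nonneg (x 1)]
  refine ⟨_, _, ?_, ?_, ?_, ?_, hdis.mono_left hsub, rfl,
    rootsOff_of_convex (U := {x : E3 | x 0 < 3 / 2}) hn ?_ ?_ ⟨0, ?_⟩ hsub hdis⟩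
  · exact e1 ▸ isClosed_range_of_circle c1
  · exact e2 ▸ isClosed_range_of_circle c2
  · exact e1 ▸ isConnected_range_of_circle c1
  · exact e2 ▸ isConnected_range_of_circle c2
  · intro x hx y hy a b ha hb hab
    simp only [mem_ofPred_eq, PiLp.add_apply, PiLp.smul_apply, smul_eq_mul] at *
    have h1 : a = 1 - b := by linarith
    rcases ha.eq_or_lt with rfl | ha
    · have : b = 1 := by linarith
      simpa [this] using hy
    · have := mul_lt_mul_of_pos_left hx ha
      have := mul_le_mul_of_nonneg_left hy.le hb
      subst h1
      linarith
  · exact isOpen_lt (by fun_prop) continuous_const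
  · simp

/-- The components of the Hopf link have linking number one. -/
theorem not_hasRoots_standardHopfLink : ¬ HasRoots 2 standardHopfLink := by
  have c1 : Continuous fun u : Circle => (!₂[(u : ℂ).re, (u : ℂ).im, 0] : E3) := by fun_prop
  have c2 : Continuous fun u : Circle => (!₂[1 - (u : ℂ).re, 0, (u : ℂ).im] : E3) := by fun_prop
  have e1 := unitCircle_eq
  have e2 : {x : E3 | x 1 = 0 ∧ (x 0 - 1) ^ 2 + x 2 ^ 2 = 1} =
      range fun u : Circle => (!₂[1 - (u : ℂ).re, 0, (u : ℂ).im] : E3) := by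
    ext x
    constructor
    · rintro ⟨h1, h2⟩
      obtain ⟨u, hu1, hu2⟩ := exists_circle (x := 1 - x 0) (y := x 2) (by linarith)
      exact ⟨u, by ext i; fin_cases i <;> simp [hu1, hu2, h1]⟩
    · rintro ⟨u, rfl⟩
      exact ⟨rfl, by simpa using normSq_circle u⟩
  have hinv : ∀ u : Circle, (u : ℂ) ^ (-1 : ℤ) = ⟨(u : ℂ).re, -(u : ℂ).im⟩ := by
    intro u
    rw [zpow_neg_one, ← Circle.coe_inv, Circle.coe_inv_eq_conj]
    rfl
  refine not_hasRoots (e1 ▸ isClosed_range_of_circle c1) (e2 ▸ isClosed_range_of_circle c2)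
    (e1 ▸ range_nonempty _) (e2 ▸ range_nonempty _) ?_ ?_ ?_
  · rw [Set.disjoint_left]
    rintro x ⟨h1, h2⟩ ⟨h3, h4⟩
    rw [h1] at h4
    rw [h3] at h2
    nlinarith
  -- for each circle, a function that vanishes only there: the real part measures the distance to a
  -- sphere through the circle, the imaginary part the height over its plane
  · rw [e1]
    refine not_rootsOff (m := -1) (a := 1) (b := -2)
      (g := fun x => ⟨(x 0 - 1) ^ 2 + x 1 ^ 2 + x 2 ^ 2 - 1, 2 * x 1⟩) two_ne_zero (by decide)
      (by simp) c1 ?_ ?_ ?_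
    · exact continuous_mk (by fun_prop) (by fun_prop)
    · intro x hx
      rw [Complex.ext_iff] at hx
      obtain ⟨h1, h2⟩ := hx
      have h2 : 2 * x 1 = 0 := h2
      have h1 : (x 0 - 1) ^ 2 + x 1 ^ 2 + x 2 ^ 2 - 1 = 0 := h1
      have h3 : x 1 = 0 := by linarith
      rw [h3] at h1
      exact ⟨h3, by linarith⟩
    · intro u
      rw [hinv]
      have := normSq_circle u
      apply Complex.ext
      · simp
        linarith
      · simp
  · rw [e2]
    refine not_rootsOff (m := -1) (a := 1) (b := -2)
      (g := fun x => ⟨x 0 ^ 2 + x 1 ^ 2 + x 2 ^ 2 - 1, 2 * x 2⟩) two_ne_zero (by decide)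
      (by simp) c2 ?_ ?_ ?_
    · exact continuous_mk (by fun_prop) (by fun_prop)
    · intro x hx
      rw [Complex.ext_iff] at hx
      obtain ⟨h1, h2⟩ := hx
      have h2 : 2 * x 2 = 0 := h2
      have h1 : x 0 ^ 2 + x 1 ^ 2 + x 2 ^ 2 - 1 = 0 := h1
      have h3 : x 2 = 0 := by linarith
      rw [h3] at h1
      exact ⟨h3, by linarith⟩
    · intro u
      rw [hinv]
      have := normSq_circle u
      apply Complex.ext
      · simp
        linarith
      · simp

/-- The core of the standard torus. -/
noncomputable def coreCircle : Set E3 := range (cyl (fun _ => 2) fun _ => 0)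

/-- The component of the standard `(2, 4)`-torus link on the inner side of the torus
at longitude zero. -/
noncomputable def torusKnotIn : Circle → E3 :=
  cyl (fun u => 2 - ((u : ℂ).re ^ 2 - (u : ℂ).im ^ 2)) fun u => -(2 * ((u : ℂ).re * (u : ℂ).im))

/-- The component of the standard `(2, 4)`-torus link on the outer side of the torus
at longitude zero. -/
noncomputable def torusKnotOut : Circle → E3 :=
  cyl (fun u => 2 + ((u : ℂ).re ^ 2 - (u : ℂ).im ^ 2)) fun u => 2 * ((u : ℂ).re * (u : ℂ).im)

theorem torus_sq (u : Circle) : ((u : ℂ).re ^ 2 - (u : ℂ).im ^ 2) ^ 2 +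
    (2 * ((u : ℂ).re * (u : ℂ).im)) ^ 2 = 1 := by
  linear_combination ((u : ℂ).re ^ 2 + (u : ℂ).im ^ 2 + 1) * normSq_circle u

theorem isLip_in : IsLip (fun u : Circle => 2 - ((u : ℂ).re ^ 2 - (u : ℂ).im ^ 2)) ∧
    IsLip (fun u : Circle => -(2 * ((u : ℂ).re * (u : ℂ).im))) :=
  ⟨(isLip_const 2).sub isLip_torus.1, by simpa using isLip_torus.2.const_mul (-1)⟩

theorem isLip_out : IsLip (fun u : Circle => 2 + ((u : ℂ).re ^ 2 - (u : ℂ).im ^ 2)) ∧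
    IsLip (fun u : Circle => 2 * ((u : ℂ).re * (u : ℂ).im)) :=
  ⟨(isLip_const 2).add isLip_torus.1, isLip_torus.2⟩

theorem mem_coreCircle {x : E3} (h2 : x 2 = 0) (h : x 0 ^ 2 + x 1 ^ 2 = 4) : x ∈ coreCircle := by
  obtain ⟨u, h3, h4⟩ := exists_circle (x := x 0 / 2) (y := x 1 / 2) (by linarith)
  exact ⟨u, by ext i; fin_cases i <;> simp [cyl, h2, h3, h4] <;> ring⟩

/-- Pushing one component of the torus link to the core of the torus. -/
theorem exists_image_eq_coreCircle :
    (∃ h : E3 ≃ₜ E3, h '' range torusKnotIn = range torusKnotIn ∧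
      h '' range torusKnotOut = coreCircle) ∧
    ∃ h : E3 ≃ₜ E3, h '' range torusKnotIn = coreCircle ∧
      h '' range torusKnotOut = range torusKnotOut := by
  obtain ⟨a1, a2⟩ := isLip_in
  obtain ⟨b1, b2⟩ := isLip_out
  have p1 : ∀ u : Circle, 0 < 2 - ((u : ℂ).re ^ 2 - (u : ℂ).im ^ 2) := fun u => by
    linarith [(abs_le.1 (torus_abs_le u)).2]
  have p2 : ∀ u : Circle, 0 < 2 + ((u : ℂ).re ^ 2 - (u : ℂ).im ^ 2) := fun u => by
    linarith [(abs_le.1 (torus_abs_le u)).1]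
  have key : ∀ c s t : ℝ, c ^ 2 + s ^ 2 = 1 → t ∈ Icc (0 : ℝ) 1 → (2 - t) * c = 0 →
      (2 - t) * s ≠ 0 := by
    intro c s t h ht h1 h2
    have h3 : 2 - t ≠ 0 := by linarith [ht.2]
    have h1 := (mul_eq_zero.1 h1).resolve_left h3
    have h2 := (mul_eq_zero.1 h2).resolve_left h3
    rw [h1, h2] at h
    norm_num at h
  constructor
  · obtain ⟨h, -, h1, h2⟩ := exists_isIsotopyEnd_cyl a1 a2 a1 a2 b1 b2 (isLip_const 2)
      (isLip_const 0) p1 p1 p2 (fun _ => two_pos) (fun t ht u e1 e2 =>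
        key _ _ t (torus_sq u) ht (by linear_combination e1) (by linear_combination e2))
    exact ⟨h, by rw [← range_comp]; exact congrArg range (funext h1),
      by rw [← range_comp]; exact congrArg range (funext h2)⟩
  · obtain ⟨h, -, h1, h2⟩ := exists_isIsotopyEnd_cyl a1 a2 (isLip_const 2) (isLip_const 0) b1 b2 b1
      b2 p1 (fun _ => two_pos) p2 p2 (fun t ht u e1 e2 =>
        key _ _ t (torus_sq u) ht (by linear_combination e1) (by linear_combination e2))
    exact ⟨h, by rw [← range_comp]; exact congrArg range (funext h1),
      by rw [← range_comp]; exact congrArg range (funext h2)⟩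

theorem sq_circle (u : Circle) : (u : ℂ) ^ (2 : ℤ) =
    ⟨(u : ℂ).re ^ 2 - (u : ℂ).im ^ 2, 2 * ((u : ℂ).re * (u : ℂ).im)⟩ := by
  have : (u : ℂ) ^ (2 : ℤ) = u * u := by rw [zpow_two]
  rw [this]
  apply Complex.ext
  · simp [sq]
  · simp
    ring

/-- Both components wind twice around the core. -/
theorem not_rootsOff_coreCircle : ¬ RootsOff 4 (range torusKnotIn) coreCircle ∧
    ¬ RootsOff 4 (range torusKnotOut) coreCircle := by
  have hz : ∀ x : E3, (⟨x 0 ^ 2 + x 1 ^ 2 + x 2 ^ 2 - 4, 4 * x 2⟩ : ℂ) = 0 → x ∈ coreCircle := by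
    intro x hx
    rw [Complex.ext_iff] at hx
    obtain ⟨h1, h2⟩ := hx
    have h2 : 4 * x 2 = 0 := h2
    have h1 : x 0 ^ 2 + x 1 ^ 2 + x 2 ^ 2 - 4 = 0 := h1
    have h3 : x 2 = 0 := by linarith
    rw [h3] at h1
    exact mem_coreCircle h3 (by linarith)
  constructor
  · refine not_rootsOff (m := 2) (a := 1) (b := -4)
      (g := fun x => ⟨x 0 ^ 2 + x 1 ^ 2 + x 2 ^ 2 - 4, 4 * x 2⟩) four_ne_zero (by decide)
      (by simp) (continuous_cyl isLip_in.1 isLip_in.2)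
      (continuous_mk (by fun_prop) (by fun_prop)) hz fun u => ?_
    rw [sq_circle]
    have h1 := normSq_circle u
    have h2 := torus_sq u
    apply Complex.ext
    · simp [cyl]
      linear_combination h2 + (2 - ((u : ℂ).re ^ 2 - (u : ℂ).im ^ 2)) ^ 2 * h1
    · simp [cyl]
  · refine not_rootsOff (m := 2) (a := 1) (b := 4)
      (g := fun x => ⟨x 0 ^ 2 + x 1 ^ 2 + x 2 ^ 2 - 4, 4 * x 2⟩) four_ne_zero (by decide)
      (by simp) (continuous_cyl isLip_out.1 isLip_out.2)
      (continuous_mk (by fun_prop) (by fun_prop)) hz fun u => ?_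
    rw [sq_circle]
    have h1 := normSq_circle u
    have h2 := torus_sq u
    apply Complex.ext
    · simp [cyl]
      linear_combination h2 + (2 + ((u : ℂ).re ^ 2 - (u : ℂ).im ^ 2)) ^ 2 * h1
    · simp [cyl]

/-- A periodic root along an embedded circle is a root on that circle. -/
theorem exists_root_on_range {n : ℕ} {γ : Circle → E3} (hγ : Continuous γ)
    (hi : Function.Injective γ) {g : E3 → ℂ} {S : ℝ → ℂ} (hS : Continuous S)
    (hper : Function.Periodic S (2 * Real.pi)) (h : ∀ θ, S θ ^ n = g (γ (Circle.exp θ))) :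
    ∃ s : E3 → ℂ, ContinuousOn s (range γ) ∧ ∀ x ∈ range γ, s x ^ n = g x := by
  have hq : IsOpenQuotientMap Circle.exp :=
    ⟨Circle.exp_surjective, Circle.exp.continuous, isLocalHomeomorph_circleExp.isOpenMap⟩
  let T : Circle → ℂ := fun u => S (Complex.arg u)
  have hT : ∀ θ, T (Circle.exp θ) = S θ := by
    intro θ
    obtain ⟨m, hm⟩ := Circle.exp_eq_exp.1 (Circle.exp_arg (Circle.exp θ))
    have := hper.int_mul m θ
    rw [← this, ← hm]
  have hTc : Continuous T := hq.isQuotientMap.continuous_iff.2 (hS.congr fun θ => (hT θ).symm)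
  have hemb := (hγ.isClosedEmbedding hi).isEmbedding
  refine ⟨fun x => T (Function.invFun γ x), ?_, ?_⟩
  · rw [continuousOn_iff_continuous_domRestrict]
    refine (hTc.comp hemb.toHomeomorph.symm.continuous).congr ?_
    rintro ⟨_, u, rfl⟩
    have : hemb.toHomeomorph.symm ⟨γ u, mem_range_self u⟩ = u := by
      rw [Homeomorph.symm_apply_eq]
      rfl
    simp [this, Function.leftInverse_invFun hi u]
  · rintro _ ⟨u, rfl⟩
    obtain ⟨θ, rfl⟩ := Circle.exp_surjective u
    simp only [Function.leftInverse_invFun hi (Circle.exp θ), hT, h]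

/-- In the complement of the core, the curve `torusKnotOut` is homotopic to a loop that is run
through twice. -/
noncomputable def doubling (q : ℝ × ℝ) : E3 :=
  !₂[(1 - q.2) * ((2 + Real.cos (2 * q.1)) * Real.cos q.1),
    (1 - q.2) * ((2 + Real.cos (2 * q.1)) * Real.sin q.1) + q.2 * (10 * Real.cos q.1 ^ 2),
    Real.sin (2 * q.1)]

theorem doubling_notMem {q : ℝ × ℝ} (hq : q.2 ∈ Icc (0 : ℝ) 1) : doubling q ∉ coreCircle := by
  rintro ⟨u, hu⟩
  have h1 : doubling q 2 = 0 := by rw [← hu]; simp [cyl]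
  have h2 : doubling q 0 ^ 2 + doubling q 1 ^ 2 = 4 := by
    rw [← hu]
    simp [cyl]
    linear_combination 4 * normSq_circle u
  obtain ⟨θ, t⟩ := q
  obtain ⟨ht0, ht1⟩ := hq
  simp only [doubling, Real.sin_two_mul, Real.cos_two_mul] at h1 h2 ht0 ht1
  simp at h1 h2
  have h3 := Real.sin_sq_add_cos_sq θ
  rcases h1 with h1 | h1
  · rw [h1] at h2 h3
    have h4 : Real.cos θ ^ 2 = 1 := by linarith
    rw [h4] at h2
    have h5 : (1 - t) ^ 2 * 9 + (t * 10) ^ 2 = 4 := by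
      linear_combination h2 - ((1 - t) ^ 2 * 9) * h4
    nlinarith [sq_nonneg (109 * t - 9)]
  · rw [h1] at h2 h3
    have h4 : Real.sin θ ^ 2 = 1 := by linarith
    have h5 : (1 - t) ^ 2 = 4 := by
      linear_combination h2 - (1 - t) ^ 2 * h4
    nlinarith

/-- A root exists on a homotopy from the component to a loop run through twice; there it is periodic
because its change over half a period is a sign, which occurs twice. -/
theorem rootsOff_coreCircle : RootsOff 2 (range torusKnotOut) coreCircle := by
  intro g hg h0
  let τ : ℝ × ℝ → ℝ × ℝ := fun q => (q.1, max 0 (min 1 q.2))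
  have hτ : ∀ q, (τ q).2 ∈ Icc (0 : ℝ) 1 := fun q =>
    ⟨le_max_left _ _, max_le zero_le_one (min_le_left _ _)⟩
  have hF : Continuous fun q => doubling (τ q) := by
    unfold doubling
    fun_prop
  obtain ⟨S, hS, hS2⟩ := Complex.exists_continuousOn_pow_eq (U := (univ : Set (ℝ × ℝ)))
    (g := fun q => g (doubling (τ q))) (n := 2) (by
      have := (convex_univ (𝕜 := ℝ) (E := ℝ × ℝ)).contractibleSpace univ_nonempty
      exact SimplyConnectedSpace.ofContractible _) isOpen_univ
    (hg.comp_continuous hF fun q => doubling_notMem (hτ q)).continuousOn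
    (by rintro ⟨q, -, hq⟩; exact h0 _ (doubling_notMem (hτ q)) hq) two_ne_zero
  rw [continuousOn_univ] at hS
  have hS0 : ∀ q, S q ≠ 0 := fun q hq => h0 _ (doubling_notMem (hτ q)) (by
    have := hS2 q
    rw [hq] at this
    simpa using this.symm)
  -- at time `1` the root changes by a sign over half a period, hence not at all over a period
  have hhalf : ∀ θ : ℝ, S (θ + Real.pi, 1) / S (θ, 1) = S (0 + Real.pi, 1) / S (0, 1) := by
    intro θ
    refine eq_of_pow_eq (n := 2) (c := 1) two_ne_zero
      (v := fun θ : ℝ => S (θ + Real.pi, 1) / S (θ, 1)) ?_ (fun θ => ?_) θ 0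
    · exact (hS.comp (by fun_prop)).div (hS.comp (by fun_prop)) fun θ => hS0 _
    · have : doubling (τ (θ + Real.pi, 1)) = doubling (τ (θ, 1)) := by
        simp [doubling, τ, mul_add, Real.sin_add_two_pi]
      simp only [div_pow, hS2, this]
      rw [← hS2]
      exact div_self (pow_ne_zero 2 (hS0 _))
  have hfull : ∀ q : ℝ × ℝ, S (q.1 + 2 * Real.pi, q.2) / S q = S (0 + 2 * Real.pi, 1) / S (0, 1) := by
    intro q
    refine eq_of_pow_eq (n := 2) (c := 1) two_ne_zero
      (v := fun q : ℝ × ℝ => S (q.1 + 2 * Real.pi, q.2) / S q) ?_ (fun q => ?_) q (0, 1)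
    · exact (hS.comp (by fun_prop)).div hS hS0
    · have : doubling (τ (q.1 + 2 * Real.pi, q.2)) = doubling (τ q) := by
        have e : 2 * (q.1 + 2 * Real.pi) = 2 * q.1 + 2 * Real.pi + 2 * Real.pi := by ring
        simp [doubling, τ, e]
      simp only [div_pow, hS2, this]
      rw [← hS2]
      exact div_self (pow_ne_zero 2 (hS0 _))
  have hone : S (0 + 2 * Real.pi, 1) / S (0, 1) = 1 := by
    have h1 := hhalf Real.pi
    have h2 : (S (0 + Real.pi, 1) / S (0, 1)) ^ 2 = 1 := by
      have : doubling (τ (0 + Real.pi, 1)) = doubling (τ (0, 1)) := by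
        simp [doubling, τ]
      rw [div_pow, hS2, this, ← hS2]
      exact div_self (pow_ne_zero 2 (hS0 _))
    have e : 0 + 2 * Real.pi = Real.pi + Real.pi := by ring
    have h3 := hS0 (Real.pi, 1)
    have h4 := hS0 (0, 1)
    rw [zero_add] at h1 h2
    rw [e, ← h2, sq]
    nth_rewrite 1 [← h1]
    field_simp
  refine exists_root_on_range (S := fun θ => S (θ, 0)) (continuous_cyl isLip_out.1 isLip_out.2) ?_
    (hS.comp (by fun_prop)) (fun θ => ?_) fun θ => ?_
  · intro u v huv
    have := cyl_antilipschitz (ρ := fun u : Circle => 2 + ((u : ℂ).re ^ 2 - (u : ℂ).im ^ 2))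
      (ζ := fun u => 2 * ((u : ℂ).re * (u : ℂ).im)) one_pos
      (fun u => by linarith [(abs_le.1 (torus_abs_le u)).1]) u v
    have huv' : cyl _ _ u = cyl _ _ v := huv
    rw [huv', sub_self, norm_zero, one_mul] at this
    exact Subtype.ext (sub_eq_zero.1 (norm_le_zero_iff.1 this))
  · have := hfull (θ, 0)
    rw [hone, div_eq_one_iff_eq (hS0 _)] at this
    exact this
  · have : doubling (τ (θ, 0)) = torusKnotOut (Circle.exp θ) := by
      ext i
      fin_cases i <;> simp [doubling, τ, torusKnotOut, cyl, Circle.coe_exp, Complex.exp_re,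
        Complex.exp_im, Real.cos_two_mul', Real.sin_two_mul]
      ring
    rw [hS2, this]
    rfl

/-- Pushing either component to the core of the torus reduces both claims to the core. -/
theorem hasRoots_standardTorusLink : HasRoots 2 (standardTorusLink 2 4) ∧
    ¬ HasRoots 4 (standardTorusLink 2 4) := by
  have hin : Continuous torusKnotIn := continuous_cyl isLip_in.1 isLip_in.2
  have hout : Continuous torusKnotOut := continuous_cyl isLip_out.1 isLip_out.2
  obtain ⟨⟨h, h1, h2⟩, k, k1, k2⟩ := exists_image_eq_coreCircle
  have e : standardTorusLink 2 4 = range torusKnotIn ∪ range torusKnotOut := standardTorusLink_eq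
  have hd : Disjoint (range torusKnotIn) (range torusKnotOut) := by
    rw [Set.disjoint_left]
    rintro _ ⟨u, rfl⟩ ⟨v, hv⟩
    have e0 : (2 + ((v : ℂ).re ^ 2 - (v : ℂ).im ^ 2)) * (v : ℂ).re =
      (2 - ((u : ℂ).re ^ 2 - (u : ℂ).im ^ 2)) * (u : ℂ).re := congrArg (fun x : E3 => x 0) hv
    have e1 : (2 + ((v : ℂ).re ^ 2 - (v : ℂ).im ^ 2)) * (v : ℂ).im =
      (2 - ((u : ℂ).re ^ 2 - (u : ℂ).im ^ 2)) * (u : ℂ).im := congrArg (fun x : E3 => x 1) hv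
    have e2 : 2 * ((v : ℂ).re * (v : ℂ).im) = -(2 * ((u : ℂ).re * (u : ℂ).im)) :=
      congrArg (fun x : E3 => x 2) hv
    have hu := normSq_circle u
    have hv := normSq_circle v
    have hs := torus_sq u
    have p1 := (abs_le.1 (torus_abs_le u)).2
    have p2 := (abs_le.1 (torus_abs_le v)).1
    generalize hcu : (u : ℂ).re ^ 2 - (u : ℂ).im ^ 2 = cu at *
    generalize hcv : (v : ℂ).re ^ 2 - (v : ℂ).im ^ 2 = cv at *
    -- both points have the same distance to the axis, hence the same longitude
    have hr : 2 + cv = 2 - cu := by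
      have h1 : (2 + cv) ^ 2 = (2 - cu) ^ 2 := by
        linear_combination ((2 + cv) * (v : ℂ).re + (2 - cu) * (u : ℂ).re) * e0 +
          ((2 + cv) * (v : ℂ).im + (2 - cu) * (u : ℂ).im) * e1 - (2 + cv) ^ 2 * hv +
          (2 - cu) ^ 2 * hu
      exact (pow_left_inj₀ (by linarith) (by linarith) two_ne_zero).1 h1
    rw [hr] at e0 e1
    have hne : 2 - cu ≠ 0 := by linarith
    have f0 := mul_left_cancel₀ hne e0
    have f1 := mul_left_cancel₀ hne e1
    rw [f0, f1] at hcv e2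
    have h0 : cu = 0 := by linarith
    have h1 : 2 * ((u : ℂ).re * (u : ℂ).im) = 0 := by linarith
    rw [h0, h1] at hs
    norm_num at hs
  rw [e]
  constructor
  · refine ⟨_, _, isClosed_range_of_circle hout, isClosed_range_of_circle hin,
      isConnected_range_of_circle hout, isConnected_range_of_circle hin, hd.symm,
      union_comm _ _, ?_⟩
    have := rootsOff_coreCircle.image k.symm
    rw [← k1] at this
    nth_rewrite 1 [← k2] at this
    simpa [image_image] using this
  · refine not_hasRoots (isClosed_range_of_circle hin) (isClosed_range_of_circle hout)
      (range_nonempty _) (range_nonempty _) hd (fun H => ?_) fun H => ?_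
    · have := H.image h
      rw [h1, h2] at this
      exact not_rootsOff_coreCircle.1 this
    · have := H.image k
      rw [k1, k2] at this
      exact not_rootsOff_coreCircle.2 this

theorem IsTrivialLink.hasRoots {L : Set E3} (h : IsTrivialLink L) {n : ℕ} (hn : n ≠ 0) :
    HasRoots n L := (AmbientIsotopic.hasRoots_iff h).2 (hasRoots_standardUnlink hn)

theorem IsHopfLink.not_hasRoots {L : Set E3} (h : IsHopfLink L) : ¬ HasRoots 2 L := fun H =>
  not_hasRoots_standardHopfLink ((AmbientIsotopic.hasRoots_iff h).1 H)

theorem IsTorusLink.hasRoots {L : Set E3} (h : IsTorusLink 2 4 L) :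
    HasRoots 2 L ∧ ¬ HasRoots 4 L := by
  rcases h with h | h
  · rw [h.hasRoots_iff, h.hasRoots_iff]
    exact hasRoots_standardTorusLink
  · rw [h.hasRoots_iff, h.hasRoots_iff, ← reflectZ_standardTorusLink]
    have e : reflectZ '' standardTorusLink 2 4 = reflectZHomeo '' standardTorusLink 2 4 := rfl
    rw [e, hasRoots_image_iff, hasRoots_image_iff]
    exact hasRoots_standardTorusLink

theorem IsHopfLink.not_isTrivialLink {L : Set E3} (h : IsHopfLink L) : ¬ IsTrivialLink L :=
  fun h' => h.not_hasRoots (h'.hasRoots two_ne_zero)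

theorem IsTorusLink.not_isTrivialLink {L : Set E3} (h : IsTorusLink 2 4 L) : ¬ IsTrivialLink L :=
  fun h' => h.hasRoots.2 (h'.hasRoots four_ne_zero)

theorem IsHopfLink.not_isTorusLink {L : Set E3} (h : IsHopfLink L) : ¬ IsTorusLink 2 4 L :=
  fun h' => h.not_hasRoots h'.hasRoots.1

/-! ### The disjoint pairs of cycles of `K_{3,3,1}` -/

/-- The vertex of `K_{3,3,1}` with a given label: the apex, `vA i` or `vB j`. -/
def vertexOf : Fin 7 → K331Vertex :=
  ![⟨2, (0 : Fin 1)⟩, ⟨0, (0 : Fin 3)⟩, ⟨0, (1 : Fin 3)⟩, ⟨0, (2 : Fin 3)⟩, ⟨1, (0 : Fin 3)⟩,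
    ⟨1, (1 : Fin 3)⟩, ⟨1, (2 : Fin 3)⟩]

theorem vertexOf_bijective : Function.Bijective vertexOf := by decide

theorem exists_vertexOf (v : K331Vertex) : v = vertexOf 0 ∨ (∃ i, v = vertexOf (vA i)) ∨
    ∃ j, v = vertexOf (vB j) := by
  revert v
  decide

theorem not_adj_vA (i i' : Fin 3) : ¬ K331.Adj (vertexOf (vA i)) (vertexOf (vA i')) := by
  revert i i'
  decide

theorem not_adj_vB (i i' : Fin 3) : ¬ K331.Adj (vertexOf (vB i)) (vertexOf (vB i')) := by
  revert i i'
  decide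

theorem adj_zero_vA (i : Fin 3) : K331.Adj (vertexOf 0) (vertexOf (vA i)) := by
  revert i
  decide

theorem adj_zero_vB (j : Fin 3) : K331.Adj (vertexOf 0) (vertexOf (vB j)) := by
  revert j
  decide

theorem adj_vA_vB (i j : Fin 3) : K331.Adj (vertexOf (vA i)) (vertexOf (vB j)) := by
  revert i j
  decide

/-- The vertices of the triangle through the apex, `vA i` and `vB j`. -/
def starVerts (i j : Fin 3) : Set K331Vertex :=
  {vertexOf 0, vertexOf (vA i), vertexOf (vB j)}

/-- The union of the triangle through the apex, `vA i` and `vB j` and of the complementary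
quadrilateral. -/
def pairSubgraph (i j : Fin 3) : K331.Subgraph where
  verts := univ
  Adj p q := K331.Adj p q ∧ (p ∈ starVerts i j ↔ q ∈ starVerts i j)
  adj_sub h := h.1
  edge_vert _ := mem_univ _
  symm := ⟨fun _ _ h => ⟨h.1.symm, h.2.symm⟩⟩

theorem zero_mem_starVerts (i j : Fin 3) : vertexOf 0 ∈ starVerts i j := Or.inl rfl

theorem vA_mem_starVerts {i j k : Fin 3} : vertexOf (vA k) ∈ starVerts i j ↔ k = i := by
  have : ∀ i j k : Fin 3, (vertexOf (vA k) = vertexOf 0 ∨ vertexOf (vA k) = vertexOf (vA i) ∨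
    vertexOf (vA k) = vertexOf (vB j)) ↔ k = i := by decide
  exact this i j k

theorem vB_mem_starVerts {i j k : Fin 3} : vertexOf (vB k) ∈ starVerts i j ↔ k = j := by
  have : ∀ i j k : Fin 3, (vertexOf (vB k) = vertexOf 0 ∨ vertexOf (vB k) = vertexOf (vA i) ∨
    vertexOf (vB k) = vertexOf (vB j)) ↔ k = j := by decide
  exact this i j k

/-- Every vertex of a cycle has two distinct neighbours on it. -/
theorem IsCycleSubgraph.exists_neighbors {V : Type*} {G : SimpleGraph V} {C : G.Subgraph}
    (h : IsCycleSubgraph C) {v : V} (hv : v ∈ C.verts) :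
    ∃ x y, x ≠ y ∧ C.Adj v x ∧ C.Adj v y := by
  obtain ⟨u, w, hw, rfl⟩ := h
  have := hw.ncard_neighborSet_toSubgraph_eq_two (by simpa using hv)
  obtain ⟨x, y, hxy, he⟩ := Set.ncard_eq_two.1 this
  have hx : x ∈ w.toSubgraph.neighborSet v := he ▸ Or.inl rfl
  have hy : y ∈ w.toSubgraph.neighborSet v := he ▸ Or.inr rfl
  exact ⟨x, y, hxy, hx, hy⟩

theorem IsCycleSubgraph.nonempty {V : Type*} {G : SimpleGraph V} {C : G.Subgraph}
    (h : IsCycleSubgraph C) : C.verts.Nonempty := by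
  obtain ⟨u, w, hw, rfl⟩ := h
  exact ⟨u, by simp⟩

theorem exists_vB_adj {C : K331.Subgraph} (hC : IsCycleSubgraph C) (h0 : vertexOf 0 ∉ C.verts)
    {i : Fin 3} (hi : vertexOf (vA i) ∈ C.verts) :
    ∃ j j', j ≠ j' ∧ C.Adj (vertexOf (vA i)) (vertexOf (vB j)) ∧
      C.Adj (vertexOf (vA i)) (vertexOf (vB j')) := by
  have key : ∀ x, C.Adj (vertexOf (vA i)) x → ∃ j, x = vertexOf (vB j) := by
    intro x hx
    rcases exists_vertexOf x with rfl | ⟨k, rfl⟩ | h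
    · exact (h0 hx.snd_mem).elim
    · exact (not_adj_vA _ _ hx.adj_sub).elim
    · exact h
  obtain ⟨x, y, hxy, hx, hy⟩ := hC.exists_neighbors hi
  obtain ⟨j, rfl⟩ := key x hx
  obtain ⟨j', rfl⟩ := key y hy
  exact ⟨j, j', fun h => hxy (by rw [h]), hx, hy⟩

theorem exists_vA_adj {C : K331.Subgraph} (hC : IsCycleSubgraph C) (h0 : vertexOf 0 ∉ C.verts)
    {j : Fin 3} (hj : vertexOf (vB j) ∈ C.verts) :
    ∃ i i', i ≠ i' ∧ C.Adj (vertexOf (vB j)) (vertexOf (vA i)) ∧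
      C.Adj (vertexOf (vB j)) (vertexOf (vA i')) := by
  have key : ∀ x, C.Adj (vertexOf (vB j)) x → ∃ j, x = vertexOf (vA j) := by
    intro x hx
    rcases exists_vertexOf x with rfl | h | ⟨k, rfl⟩
    · exact (h0 hx.snd_mem).elim
    · exact h
    · exact (not_adj_vB _ _ hx.adj_sub).elim
  obtain ⟨x, y, hxy, hx, hy⟩ := hC.exists_neighbors hj
  obtain ⟨i, rfl⟩ := key x hx
  obtain ⟨i', rfl⟩ := key y hy
  exact ⟨i, i', fun h => hxy (by rw [h]), hx, hy⟩

/-- A cycle that avoids the apex has at least two vertices in each large part. -/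
theorem exists_mem_verts {C : K331.Subgraph} (hC : IsCycleSubgraph C)
    (h0 : vertexOf 0 ∉ C.verts) :
    ∃ i j, vertexOf (vA (i + 1)) ∈ C.verts ∧ vertexOf (vA (i + 2)) ∈ C.verts ∧
      vertexOf (vB (j + 1)) ∈ C.verts ∧ vertexOf (vB (j + 2)) ∈ C.verts := by
  have hA : ∃ i, vertexOf (vA i) ∈ C.verts := by
    obtain ⟨v, hv⟩ := hC.nonempty
    rcases exists_vertexOf v with rfl | ⟨k, rfl⟩ | ⟨k, rfl⟩
    · exact (h0 hv).elim
    · exact ⟨k, hv⟩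
    · obtain ⟨i, -, -, h, -⟩ := exists_vA_adj hC h0 hv
      exact ⟨i, h.snd_mem⟩
  obtain ⟨i, hi⟩ := hA
  obtain ⟨j, j', hj, hj1, hj2⟩ := exists_vB_adj hC h0 hi
  obtain ⟨i, i', hi, hi1, hi2⟩ := exists_vA_adj hC h0 hj1.snd_mem
  have key : ∀ i i' : Fin 3, i ≠ i' → ∃ k, (i = k + 1 ∧ i' = k + 2) ∨ (i' = k + 1 ∧ i = k + 2) := by
    decide
  obtain ⟨k, hk⟩ := key i i' hi
  obtain ⟨l, hl⟩ := key j j' hj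
  refine ⟨k, l, ?_⟩
  rcases hk with ⟨rfl, rfl⟩ | ⟨rfl, rfl⟩ <;> rcases hl with ⟨rfl, rfl⟩ | ⟨rfl, rfl⟩
  · exact ⟨hi1.snd_mem, hi2.snd_mem, hj1.snd_mem, hj2.snd_mem⟩
  · exact ⟨hi1.snd_mem, hi2.snd_mem, hj2.snd_mem, hj1.snd_mem⟩
  · exact ⟨hi2.snd_mem, hi1.snd_mem, hj1.snd_mem, hj2.snd_mem⟩
  · exact ⟨hi2.snd_mem, hi1.snd_mem, hj2.snd_mem, hj1.snd_mem⟩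

/-- The cycle that avoids the apex alternates between the large parts, so it has two vertices in
each; only three vertices are left for the other cycle. -/
theorem sup_eq_pairSubgraph {C D : K331.Subgraph} (hC : IsCycleSubgraph C)
    (hD : IsCycleSubgraph D) (hd : Disjoint C.verts D.verts) (h0 : vertexOf 0 ∈ C.verts) :
    ∃ i j, C ⊔ D = pairSubgraph i j := by
  have h0D : vertexOf 0 ∉ D.verts := Set.disjoint_left.1 hd h0
  obtain ⟨i, j, hi1, hi2, hj1, hj2⟩ := exists_mem_verts hD h0D
  have key : ∀ i k : Fin 3, k = i ∨ k = i + 1 ∨ k = i + 2 := by decide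
  have hCA : ∀ k, vertexOf (vA k) ∈ C.verts → k = i := by
    intro k hk
    rcases key i k with h | rfl | rfl
    · exact h
    · exact (Set.disjoint_left.1 hd hk hi1).elim
    · exact (Set.disjoint_left.1 hd hk hi2).elim
  have hCB : ∀ k, vertexOf (vB k) ∈ C.verts → k = j := by
    intro k hk
    rcases key j k with h | rfl | rfl
    · exact h
    · exact (Set.disjoint_left.1 hd hk hj1).elim
    · exact (Set.disjoint_left.1 hd hk hj2).elim
  -- the neighbours of the apex are the two other vertices of the cycle through it
  obtain ⟨c1, c2⟩ : C.Adj (vertexOf 0) (vertexOf (vA i)) ∧ C.Adj (vertexOf 0) (vertexOf (vB j)) := by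
    have key : ∀ x, C.Adj (vertexOf 0) x → x = vertexOf (vA i) ∨ x = vertexOf (vB j) := by
      intro x hx
      rcases exists_vertexOf x with rfl | ⟨k, rfl⟩ | ⟨k, rfl⟩
      · exact (hx.adj_sub.ne rfl).elim
      · exact Or.inl (by rw [hCA k hx.snd_mem])
      · exact Or.inr (by rw [hCB k hx.snd_mem])
    obtain ⟨x, y, hxy, hx, hy⟩ := hC.exists_neighbors h0
    rcases key x hx with rfl | rfl <;> rcases key y hy with rfl | rfl
    · exact (hxy rfl).elim
    · exact ⟨hx, hy⟩
    · exact ⟨hy, hx⟩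
    · exact (hxy rfl).elim
  have c3 : C.Adj (vertexOf (vA i)) (vertexOf (vB j)) := by
    have key : ∀ x, C.Adj (vertexOf (vA i)) x → x = vertexOf 0 ∨ x = vertexOf (vB j) := by
      intro x hx
      rcases exists_vertexOf x with rfl | ⟨k, rfl⟩ | ⟨k, rfl⟩
      · exact Or.inl rfl
      · exact (not_adj_vA _ _ hx.adj_sub).elim
      · exact Or.inr (by rw [hCB k hx.snd_mem])
    obtain ⟨x, y, hxy, hx, hy⟩ := hC.exists_neighbors c1.snd_mem
    rcases key x hx with rfl | rfl
    · rcases key y hy with rfl | rfl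
      · exact (hxy rfl).elim
      · exact hy
    · exact hx
  have hDA : ∀ k, vertexOf (vA k) ∈ D.verts ↔ k ≠ i := by
    intro k
    refine ⟨?_, fun h => ?_⟩
    · rintro hk rfl
      exact Set.disjoint_left.1 hd c1.snd_mem hk
    · rcases key i k with h' | rfl | rfl
      · exact (h h').elim
      · exact hi1
      · exact hi2
  have hDB : ∀ k, vertexOf (vB k) ∈ D.verts ↔ k ≠ j := by
    intro k
    refine ⟨?_, fun h => ?_⟩
    · rintro hk rfl
      exact Set.disjoint_left.1 hd c2.snd_mem hk
    · rcases key j k with h' | rfl | rfl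
      · exact (h h').elim
      · exact hj1
      · exact hj2
  have hDadj : ∀ k l, k ≠ i → l ≠ j → D.Adj (vertexOf (vA k)) (vertexOf (vB l)) := by
    intro k l hk hl
    obtain ⟨l1, l2, hne, h1, h2⟩ := exists_vB_adj hD h0D ((hDA k).2 hk)
    have n1 := (hDB l1).1 h1.snd_mem
    have n2 := (hDB l2).1 h2.snd_mem
    have : ∀ j l l1 l2 : Fin 3, l ≠ j → l1 ≠ j → l2 ≠ j → l1 ≠ l2 → l = l1 ∨ l = l2 := by decide
    rcases this j l l1 l2 hl n1 n2 hne with rfl | rfl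
    · exact h1
    · exact h2
  refine ⟨i, j, SimpleGraph.Subgraph.ext ?_ ?_⟩
  · refine eq_univ_of_forall fun v => ?_
    rcases exists_vertexOf v with rfl | ⟨k, rfl⟩ | ⟨k, rfl⟩
    · exact Or.inl h0
    · rcases eq_or_ne k i with rfl | hk
      · exact Or.inl c1.snd_mem
      · exact Or.inr ((hDA k).2 hk)
    · rcases eq_or_ne k j with rfl | hk
      · exact Or.inl c2.snd_mem
      · exact Or.inr ((hDB k).2 hk)
  · have mem : ∀ v, (v ∈ C.verts → v ∈ starVerts i j) ∧ (v ∈ D.verts → v ∉ starVerts i j) := by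
      intro v
      rcases exists_vertexOf v with rfl | ⟨k, rfl⟩ | ⟨k, rfl⟩
      · exact ⟨fun _ => zero_mem_starVerts i j, fun h => (h0D h).elim⟩
      · rw [vA_mem_starVerts]
        exact ⟨hCA k, (hDA k).1⟩
      · rw [vB_mem_starVerts]
        exact ⟨hCB k, (hDB k).1⟩
    funext p q
    apply propext
    constructor
    · rintro (h | h)
      · exact ⟨h.adj_sub, iff_of_true ((mem p).1 h.fst_mem) ((mem q).1 h.snd_mem)⟩
      · exact ⟨h.adj_sub, iff_of_false ((mem p).2 h.fst_mem) ((mem q).2 h.snd_mem)⟩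
    · rintro ⟨h, hpq⟩
      have main : ∀ k l, K331.Adj (vertexOf (vA k)) (vertexOf (vB l)) →
          (vertexOf (vA k) ∈ starVerts i j ↔ vertexOf (vB l) ∈ starVerts i j) →
          (C ⊔ D).Adj (vertexOf (vA k)) (vertexOf (vB l)) := by
        intro k l _ h
        rw [vA_mem_starVerts, vB_mem_starVerts] at h
        by_cases hk : k = i
        · obtain rfl := hk
          obtain rfl := h.1 rfl
          exact Or.inl c3
        · exact Or.inr (hDadj k l hk fun hl => hk (h.2 hl))
      have main0 : ∀ v, K331.Adj (vertexOf 0) v → v ∈ starVerts i j →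
          (C ⊔ D).Adj (vertexOf 0) v := by
        rintro v hv (rfl | rfl | rfl)
        · exact (hv.ne rfl).elim
        · exact Or.inl c1
        · exact Or.inl c2
      rcases exists_vertexOf p with rfl | ⟨k, rfl⟩ | ⟨k, rfl⟩
      · exact main0 q h (hpq.1 (zero_mem_starVerts i j))
      · rcases exists_vertexOf q with rfl | ⟨l, rfl⟩ | ⟨l, rfl⟩
        · exact (main0 _ h.symm (hpq.2 (zero_mem_starVerts i j))).symm
        · exact (not_adj_vA _ _ h).elim
        · exact main k l h hpq
      · rcases exists_vertexOf q with rfl | ⟨l, rfl⟩ | ⟨l, rfl⟩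
        · exact (main0 _ h.symm (hpq.2 (zero_mem_starVerts i j))).symm
        · exact (main l k h.symm hpq.symm).symm
        · exact (not_adj_vB _ _ h).elim

theorem IsDisjointCyclePair.exists_eq {H : K331.Subgraph} (h : IsDisjointCyclePair H) :
    ∃ i j, H = pairSubgraph i j := by
  obtain ⟨C, D, hC, hD, hd, rfl⟩ := h
  by_cases h0 : vertexOf 0 ∈ C.verts
  · exact sup_eq_pairSubgraph hC hD hd h0
  · by_cases h0' : vertexOf 0 ∈ D.verts
    · rw [sup_comm]
      exact sup_eq_pairSubgraph hD hC hd.symm h0'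
    · -- two cycles avoiding the apex would need four vertices in each large part
      obtain ⟨i, _, h1, h2, -, -⟩ := exists_mem_verts hC h0
      obtain ⟨i', _, h3, h4, -, -⟩ := exists_mem_verts hD h0'
      have key : ∀ i i' : Fin 3, i + 1 = i' + 1 ∨ i + 1 = i' + 2 ∨ i + 2 = i' + 1 ∨
        i + 2 = i' + 2 := by decide
      rcases key i i' with h | h | h | h
      · exact (Set.disjoint_left.1 hd h1 (h ▸ h3)).elim
      · exact (Set.disjoint_left.1 hd h1 (h ▸ h4)).elim
      · exact (Set.disjoint_left.1 hd h2 (h ▸ h3)).elim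
      · exact (Set.disjoint_left.1 hd h2 (h ▸ h4)).elim

theorem pairSubgraph_injective {i j i' j' : Fin 3} (h : pairSubgraph i j = pairSubgraph i' j') :
    i = i' ∧ j = j' := by
  have h1 : (pairSubgraph i j).Adj (vertexOf 0) (vertexOf (vA i)) :=
    ⟨adj_zero_vA i, iff_of_true (zero_mem_starVerts i j) (vA_mem_starVerts.2 rfl)⟩
  have h2 : (pairSubgraph i j).Adj (vertexOf 0) (vertexOf (vB j)) :=
    ⟨adj_zero_vB j, iff_of_true (zero_mem_starVerts i j) (vB_mem_starVerts.2 rfl)⟩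
  rw [h] at h1 h2
  exact ⟨vA_mem_starVerts.1 (h1.2.1 (zero_mem_starVerts i' j')),
    vB_mem_starVerts.1 (h2.2.1 (zero_mem_starVerts i' j'))⟩

theorem isDisjointCyclePair_pairSubgraph (i j : Fin 3) :
    IsDisjointCyclePair (pairSubgraph i j) := by
  let w : K331.Walk (vertexOf 0) (vertexOf 0) :=
    .cons (adj_zero_vA i) (.cons (adj_vA_vB i j) (.cons (adj_zero_vB j).symm .nil))
  let w' : K331.Walk (vertexOf (vA (i + 1))) (vertexOf (vA (i + 1))) :=
    .cons (adj_vA_vB (i + 1) (j + 1)) (.cons (adj_vA_vB (i + 2) (j + 1)).symm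
      (.cons (adj_vA_vB (i + 2) (j + 2)) (.cons (adj_vA_vB (i + 1) (j + 2)).symm .nil)))
  have hne : ∀ i j : Fin 3, [0, vA i, vB j, vA (i + 1), vB (j + 1), vA (i + 2), vB (j + 2)].Nodup := by
    decide
  have hne := (hne i j).map vertexOf_bijective.1
  simp only [List.map_cons, List.map_nil, List.nodup_cons, List.mem_cons, List.not_mem_nil, or_false,
    not_or, List.nodup_nil, and_true, not_false_eq_true] at hne
  obtain ⟨⟨a1, a2, a3, a4, a5, a6⟩, ⟨b1, b2, b3, b4, b5⟩, ⟨c1, c2, c3, c4⟩, ⟨d1, d2, d3⟩, ⟨e1, e2⟩,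
    f1⟩ := hne
  have hw : IsCycleSubgraph w.toSubgraph := by
    refine ⟨_, w, ?_, rfl⟩
    simp only [w, SimpleGraph.Walk.cons_isCycle_iff]
    simp
    grind
  have hw' : IsCycleSubgraph w'.toSubgraph := by
    refine ⟨_, w', ?_, rfl⟩
    simp only [w', SimpleGraph.Walk.cons_isCycle_iff]
    simp
    grind
  have hd : Disjoint w.toSubgraph.verts w'.toSubgraph.verts := by
    rw [Set.disjoint_left]
    simp [w, w']
    grind
  have h0 : vertexOf 0 ∈ w.toSubgraph.verts := by simp [w]
  obtain ⟨i', j', h⟩ := sup_eq_pairSubgraph hw hw' hd h0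
  have h1 : (pairSubgraph i' j').Adj (vertexOf 0) (vertexOf (vA i)) := by
    rw [← h]
    exact Or.inl (by simp [w])
  have h2 : (pairSubgraph i' j').Adj (vertexOf 0) (vertexOf (vB j)) := by
    rw [← h]
    exact Or.inl (by simp [w])
  obtain rfl := vA_mem_starVerts.1 (h1.2.1 (zero_mem_starVerts _ _))
  obtain rfl := vB_mem_starVerts.1 (h2.2.1 (zero_mem_starVerts _ _))
  exact ⟨_, _, hw, hw', hd, h.symm⟩

theorem edgeImage_pairSubgraph (f : K331Vertex → E3) (i j : Fin 3) :
    edgeImage f (pairSubgraph i j) =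
      triangle (starTriangle (f ∘ vertexOf) i j) ∪ quad (coQuad (f ∘ vertexOf) i j) := by
  have third : ∀ i k : Fin 3, k ≠ i → k = i + 1 ∨ k = i + 2 := by decide
  have other : ∀ i : Fin 3, i + 1 ≠ i ∧ i + 2 ≠ i := by decide
  ext x
  constructor
  · rintro ⟨p, q, ⟨h, hpq⟩, hx⟩
    have main : ∀ k l, (vertexOf (vA k) ∈ starVerts i j ↔ vertexOf (vB l) ∈ starVerts i j) →
        x ∈ segment ℝ (f (vertexOf (vA k))) (f (vertexOf (vB l))) →
        x ∈ triangle (starTriangle (f ∘ vertexOf) i j) ∪ quad (coQuad (f ∘ vertexOf) i j) := by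
      intro k l h hx
      rw [vA_mem_starVerts, vB_mem_starVerts] at h
      by_cases hk : k = i
      · obtain rfl := hk
        obtain rfl := h.1 rfl
        exact Or.inl (mem_triangle.2 ⟨1, hx⟩)
      · refine Or.inr (mem_quad.2 ?_)
        have hl : l ≠ j := fun hl => hk (h.2 hl)
        rcases third i k hk with rfl | rfl <;> rcases third j l hl with rfl | rfl
        · exact ⟨0, hx⟩
        · exact ⟨3, by rw [segment_symm]; exact hx⟩
        · exact ⟨1, by rw [segment_symm]; exact hx⟩
        · exact ⟨2, hx⟩
    have main0 : ∀ v, K331.Adj (vertexOf 0) v → v ∈ starVerts i j →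
        x ∈ segment ℝ (f (vertexOf 0)) (f v) →
        x ∈ triangle (starTriangle (f ∘ vertexOf) i j) ∪ quad (coQuad (f ∘ vertexOf) i j) := by
      rintro v hv (rfl | rfl | rfl) hx
      · exact (hv.ne rfl).elim
      · exact Or.inl (mem_triangle.2 ⟨0, hx⟩)
      · exact Or.inl (mem_triangle.2 ⟨2, by rw [segment_symm]; exact hx⟩)
    have hx' := hx
    rw [segment_symm] at hx'
    rcases exists_vertexOf p with rfl | ⟨k, rfl⟩ | ⟨k, rfl⟩
    · exact main0 q h (hpq.1 (zero_mem_starVerts i j)) hx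
    · rcases exists_vertexOf q with rfl | ⟨l, rfl⟩ | ⟨l, rfl⟩
      · exact main0 _ h.symm (hpq.2 (zero_mem_starVerts i j)) hx'
      · exact (not_adj_vA _ _ h).elim
      · exact main k l hpq hx
    · rcases exists_vertexOf q with rfl | ⟨l, rfl⟩ | ⟨l, rfl⟩
      · exact main0 _ h.symm (hpq.2 (zero_mem_starVerts i j)) hx'
      · exact main l k hpq.symm hx'
      · exact (not_adj_vB _ _ h).elim
  · have hAB : ∀ k l, k ≠ i → l ≠ j →
        (pairSubgraph i j).Adj (vertexOf (vA k)) (vertexOf (vB l)) := fun k l hk hl =>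
      ⟨adj_vA_vB k l, iff_of_false (fun h => hk (vA_mem_starVerts.1 h))
        fun h => hl (vB_mem_starVerts.1 h)⟩
    rintro (hx | hx)
    · obtain ⟨k, hk⟩ := mem_triangle.1 hx
      fin_cases k
      · exact ⟨_, _, ⟨adj_zero_vA i, iff_of_true (zero_mem_starVerts i j)
          (vA_mem_starVerts.2 rfl)⟩, hk⟩
      · exact ⟨_, _, ⟨adj_vA_vB i j, iff_of_true (vA_mem_starVerts.2 rfl)
          (vB_mem_starVerts.2 rfl)⟩, hk⟩
      · exact ⟨_, _, ⟨(adj_zero_vB j).symm, iff_of_true (vB_mem_starVerts.2 rfl)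
          (zero_mem_starVerts i j)⟩, hk⟩
    · obtain ⟨k, hk⟩ := mem_quad.1 hx
      fin_cases k
      · exact ⟨_, _, hAB _ _ (other i).1 (other j).1, hk⟩
      · exact ⟨_, _, (hAB _ _ (other i).2 (other j).1).symm, hk⟩
      · exact ⟨_, _, hAB _ _ (other i).2 (other j).2, hk⟩
      · exact ⟨_, _, (hAB _ _ (other i).1 (other j).2).symm, hk⟩

/-- The nine links of a linear embedding, sorted by their types. -/
theorem IsLinearEmbedding.link_types {f : K331Vertex → E3} (hf : IsLinearEmbedding K331 f) :
    ∃ O T : Set (Fin 3 × Fin 3), Odd O.ncard ∧ T.Subsingleton ∧ Disjoint O T ∧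
      (∀ x ∈ O, IsHopfLink (edgeImage f (pairSubgraph x.1 x.2))) ∧
      (∀ x ∈ T, IsTorusLink 2 4 (edgeImage f (pairSubgraph x.1 x.2))) ∧
      ∀ x, x ∉ O → x ∉ T → IsTrivialLink (edgeImage f (pairSubgraph x.1 x.2)) := by
  let n : K331Vertex → ℝ := fun v => (Fintype.equivFin K331Vertex v : ℕ)
  have hn : Function.Injective n := fun v w h =>
    (Fintype.equivFin K331Vertex).injective (Fin.ext (Nat.cast_injective h))
  obtain ⟨δ, hδ, H⟩ := hf.exists_isIsotopyEnd fun v => moment (n v)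
  obtain ⟨s, hs, hvol⟩ := exists_vol_ne_zero f hn hδ
  obtain ⟨h, hh, hH⟩ := H s hs
  set f' : K331Vertex → E3 := fun v => f v + s • moment (n v)
  have iso : ∀ H : K331.Subgraph, AmbientIsotopic (edgeImage f H) (edgeImage f' H) :=
    fun H => ambientIsotopic_iff.2 ⟨h, hh, hH H⟩
  have hP : ∀ i j k l : Fin 7, [i, j, k, l].Nodup → vol ((f' ∘ vertexOf) i) ((f' ∘ vertexOf) j)
      ((f' ∘ vertexOf) k) ((f' ∘ vertexOf) l) ≠ 0 := by
    intro i j k l hn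
    refine hvol (vertexOf ∘ ![i, j, k, l]) (vertexOf_bijective.1.comp ?_)
    exact List.nodup_ofFn.1 (show (List.ofFn ![i, j, k, l]).Nodup by simpa using hn)
  obtain ⟨O, T, h1, h2, h3, h4, h5, h6⟩ := link_classification hP
  simp only [← edgeImage_pairSubgraph] at h4 h5 h6
  exact ⟨O, T, h1, h2, h3, fun x hx => (iso _).trans (h4 x hx),
    fun x hx => (h5 x hx).imp (iso _).trans (iso _).trans, fun x hO hT => (iso _).trans (h6 x hO hT)⟩

theorem mainTheorem2 (f : K331Vertex → E3) (hf : IsLinearEmbedding K331 f) :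
    (Odd (nontrivialLinks K331 f).ncard →
      ∀ L ∈ nontrivialLinks K331 f, IsHopfLink (edgeImage f L)) ∧
    (Even (nontrivialLinks K331 f).ncard →
      ∃ L ∈ nontrivialLinks K331 f, IsTorusLink 2 4 (edgeImage f L) ∧
        ∀ L' ∈ nontrivialLinks K331 f, L' ≠ L →
          IsHopfLink (edgeImage f L') ∧ ¬ IsTorusLink 2 4 (edgeImage f L')) := by
  obtain ⟨O, T, hO, hT, hd, tO, tT, tt⟩ := hf.link_types
  have heq : nontrivialLinks K331 f = (fun x : Fin 3 × Fin 3 => pairSubgraph x.1 x.2) '' (O ∪ T) := by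
    ext H
    constructor
    · rintro ⟨hH, hnt⟩
      obtain ⟨i, j, rfl⟩ := hH.exists_eq
      refine ⟨(i, j), ?_, rfl⟩
      by_contra hx
      rw [mem_union, not_or] at hx
      exact hnt (tt (i, j) hx.1 hx.2)
    · rintro ⟨x, hx, rfl⟩
      exact ⟨isDisjointCyclePair_pairSubgraph _ _,
        hx.elim (fun hx => (tO x hx).not_isTrivialLink) fun hx => (tT x hx).not_isTrivialLink⟩
  have hinj : Function.Injective fun x : Fin 3 × Fin 3 => pairSubgraph x.1 x.2 := fun x y h =>
    Prod.ext_iff.2 (pairSubgraph_injective h)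
  have hcard : (nontrivialLinks K331 f).ncard = O.ncard + T.ncard := by
    rw [heq, ncard_image_of_injective _ hinj, ncard_union_eq hd]
  rw [hcard]
  rcases hT.eq_empty_or_singleton with rfl | ⟨x, rfl⟩
  · rw [ncard_empty, add_zero]
    refine ⟨fun _ L hL => ?_, fun h => (Nat.not_even_iff_odd.2 hO h).elim⟩
    rw [heq, union_empty] at hL
    obtain ⟨x, hx, rfl⟩ := hL
    exact tO x hx
  · rw [ncard_singleton]
    refine ⟨fun h => (Nat.not_odd_iff_even.2 hO.add_one h).elim, fun _ =>
      ⟨pairSubgraph x.1 x.2, heq ▸ ⟨x, Or.inr rfl, rfl⟩, tT x rfl, fun L' hL' hne => ?_⟩⟩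
    rw [heq] at hL'
    obtain ⟨y, hy | rfl, rfl⟩ := hL'
    · exact ⟨tO y hy, (tO y hy).not_isTorusLink⟩
    · exact (hne rfl).elim
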